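/- Let $S^2$ be the round unit sphere with Laplace--Beltrami operator $\Delta_{S^2}$, gradient $\nabla_\omega$ and surface measure $d\omega$, and let $V(x)=\frac{1}{x^2+1}$. There is $N_0>0$ such that for every real $N\ge N_0$ and every smooth, compactly supported $W:\mathbb R\times S^2\to\mathbb R$ with $|W|\le 1$ everywhere and $W(0,\omega)\neq 0$ for all $\omega\in S^2$, there are $\epsilon_0>0$ and $C>0$ such that the following holds for every $\epsilon\in(0,\epsilon_0)$. Let $u:\mathbb R\times\mathbb R\times S^2\to\mathbb C$ be a smooth solution, in the variables $(t,x,\omega)$, of the Cauchy problem $$\bigl(-\partial_t^2+\partial_x^2+V(\Delta_{S^2}-N)+i\epsilon W\bigr)u=0,\qquad u(0,x,\omega)=u_0(x,\omega),\quad \partial_tu(0,x,\omega)=u_1(x,\omega),$$ and let $$E(t)=\frac12\int_{\{t\}\times\mathbb R\times S^2}|\partial_tu|^2+|\partial_xu|^2+V\bigl(|\nabla_\omega u|^2+N|u|^2\bigr)\,d\omega\,dx .$$ If the initial data are such that $E(0)$ is finite (for instance, if they are compactly supported), then $$E(t)\le C\,E(0)\quad\text{for all }t\in\mathbb R,$$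 $$\int_{\mathbb R\times\mathbb R\times S^2}\frac{|\partial_xu|^2}{x^2+1}+\frac{x^2}{1+x^2}\left(\frac{|\nabla_\omega u|^2}{1+|x|^3}+\frac{|\partial_tu|^2}{x^2+1}\right)+\frac{|u|^2}{1+|x|^3}\,d\omega\,dx\,dt\le C\,E(0),$$ $$\int_{\mathbb R\times\mathbb R\times S^2}\frac{|u|\,|\partial_tu|}{1+|x|^3}\,d\omega\,dx\,dt\le C\,E(0).$$ -/

import Mathlib

open MeasureTheory
open scoped Manifold ContDiff ENNReal NNReal

noncomputable section

namespace TrappedWave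

/-- Euclidean three-space. -/
abbrev E3 : Type := EuclideanSpace ℝ (Fin 3)

/-- The unit sphere in Euclidean three-space. -/
abbrev S2 : Type := Metric.sphere (0 : E3) 1

/-- The standard surface measure on the unit sphere (total mass `4 π`). -/
def sphereMeasure : Measure S2 := (volume : Measure E3).toSphere

/-- The extension of a function on the sphere to a function on three-space that is constant along
rays from the origin (with the irrelevant value `0` at the origin). -/
def radialExt (f : S2 → ℂ) (y : E3) : ℂ :=
  if h : y = 0 then 0
  else f ⟨‖y‖⁻¹ • y, by
    rw [mem_sphere_zero_iff_norm, norm_smul, norm_inv, norm_norm,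
      inv_mul_cancel₀ (norm_ne_zero_iff.mpr h)]⟩

/-- The Laplace-Beltrami operator of the round unit sphere: the Euclidean Laplacian of the
extension that is constant along rays, evaluated on the sphere. -/
def sphereLaplacian (f : S2 → ℂ) (θ : S2) : ℂ :=
  Laplacian.laplacian (radialExt f) (θ : E3)

/-- The squared length of the gradient on the round unit sphere of a complex-valued function
(the sum of those of its real and imaginary parts): the sum of the squared moduli of the partial
derivatives of the extension that is constant along rays, whose radial derivative vanishes. -/
def sphereGradSq (f : S2 → ℂ) (θ : S2) : ℝ :=
  ∑ i : Fin 3, ‖fderiv ℝ (radialExt f) (θ : E3) (EuclideanSpace.single i 1)‖ ^ 2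

/-- The potential `V(x) = 1 / (x² + 1)`. -/
def potV (x : ℝ) : ℝ := 1 / (x ^ 2 + 1)

/-- The time derivative `∂ₜ u`. -/
def dt (u : ℝ → ℝ → S2 → ℂ) (t x : ℝ) (θ : S2) : ℂ := deriv (fun s => u s x θ) t

/-- The spatial derivative `∂ₓ u`. -/
def dx (u : ℝ → ℝ → S2 → ℂ) (t x : ℝ) (θ : S2) : ℂ := deriv (fun y => u t y θ) x

/-- `(-∂ₜ² + ∂ₓ² + V (Δ_{S²} - N) + i ε W) u` at the point `(t, x, θ)`. -/
def waveOp (N ε : ℝ) (W : ℝ × S2 → ℝ) (u : ℝ → ℝ → S2 → ℂ) (t x : ℝ) (θ : S2) : ℂ :=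
  -(dt (dt u) t x θ) + dx (dx u) t x θ
    + (potV x : ℂ) * (sphereLaplacian (u t x) θ - (N : ℂ) * u t x θ)
    + Complex.I * (ε : ℂ) * (W (x, θ) : ℂ) * u t x θ

/-- `u` is a smooth solution on `ℝ × ℝ × S²` of the Cauchy problem for the model wave equation
with initial data `u(0) = u₀`, `∂ₜ u(0) = u₁`. -/
structure IsCauchySolution (N ε : ℝ) (W : ℝ × S2 → ℝ) (u₀ u₁ : ℝ → S2 → ℂ)
    (u : ℝ → ℝ → S2 → ℂ) : Prop where
  smooth : ContMDiff (𝓘(ℝ, ℝ).prod (𝓘(ℝ, ℝ).prod (𝓡 2))) 𝓘(ℝ, ℂ) ∞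
    (fun p : ℝ × ℝ × S2 => u p.1 p.2.1 p.2.2)
  equation : ∀ t x θ, waveOp N ε W u t x θ = 0
  init : ∀ x θ, u 0 x θ = u₀ x θ
  init_dt : ∀ x θ, dt u 0 x θ = u₁ x θ

/-- The energy `E(t)`, with value `∞` if the integral diverges. -/
def energy (N : ℝ) (u : ℝ → ℝ → S2 → ℂ) (t : ℝ) : ℝ≥0∞ :=
  (1 / 2) * ∫⁻ x : ℝ, ∫⁻ θ : S2, ENNReal.ofReal
    (‖dt u t x θ‖ ^ 2 + ‖dx u t x θ‖ ^ 2
      + potV x * (sphereGradSq (u t x) θ + N * ‖u t x θ‖ ^ 2)) ∂sphereMeasure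

/-- The space-time integral of the classical Morawetz estimate, degenerate at `x = 0`. -/
def morawetzIntegral (u : ℝ → ℝ → S2 → ℂ) : ℝ≥0∞ :=
  ∫⁻ t : ℝ, ∫⁻ x : ℝ, ∫⁻ θ : S2, ENNReal.ofReal
    (‖dx u t x θ‖ ^ 2 / (x ^ 2 + 1)
      + x ^ 2 / (1 + x ^ 2) *
          (sphereGradSq (u t x) θ / (1 + |x| ^ 3) + ‖dt u t x θ‖ ^ 2 / (x ^ 2 + 1))
      + ‖u t x θ‖ ^ 2 / (1 + |x| ^ 3)) ∂sphereMeasure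

/-- The space-time integral of the refined Morawetz estimate. -/
def refinedIntegral (u : ℝ → ℝ → S2 → ℂ) : ℝ≥0∞ :=
  ∫⁻ t : ℝ, ∫⁻ x : ℝ, ∫⁻ θ : S2, ENNReal.ofReal
    (‖u t x θ‖ * ‖dt u t x θ‖ / (1 + |x| ^ 3)) ∂sphereMeasure

end TrappedWave

end

noncomputable section

namespace TrappedWave

open Set Filter Topology

/-! ### Radial extension -/

/-! The obstruction is the source: the time derivative of E is the pairing of iεWu with ∂ₜu, so E
stays bounded once the integral of |W||u||∂ₜu| over space-time is bounded by a constant times the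
largest energy; smallness of ε then closes the argument. The classical Morawetz estimate does not
give this. The multiplier arctan x ∂ₓ with its lower order correction (`rectInt_m0_le`,
`rectInt_m_le`) controls u and ∂ₓu up to x = 0, but ∂ₜu and the spherical gradient only with a
factor x², because rays along x = 0 are trapped at the maximum of V.

It suffices to improve the weight of |∂ₜu|² near x = 0 from x² to √|x|
(`IsSolution.rectInt_sqrt_abs_le`). Indeed 2|u||∂ₜu| ≤ |x|^(-1/2)|u|² + |x|^(1/2)|∂ₜu|², the
function |x|^(-1/2) is integrable at 0, and the supremum in x of the spherical norm of u is
controlled by u and ∂ₓu through a one-dimensional Sobolev inequality (`alpha_le`). This gives the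
bound for the product (`rectInt_w_near_le`, `rectInt_wgt_w_le`).

The improved weight is obtained on each spherical harmonic. With L² the eigenvalue plus N, a
coefficient w solves w_tt = w_xx - L²Vw + g. Since V = 1 - (j')² for j(x) = √(1+x²), the operator
is, up to a constant, ∂ₓ² + L²(j')², and Lj is an exact solution of its eikonal equation. One pairs
w_t with Aw, where A (`opA`) has the antisymmetric kernel φ(x-y) sin(L(j(x)-j(y))) with φ(d) = √L
(d²+L⁻²)^(-3/4). In the commutator (`comQ_eq`) the terms of order L² cancel and L times a kernel B
remains, integrated against |e^(iLj(x))w(x) - e^(iLj(y))w(y)|². Because φ decays like |d|^(-3/2), B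
is positive up to a small error (`kerB_ge`), and its marginals are small because B is almost a
derivative (`abs_jI_kerB_le`). The main term is thus a regularized Sobolev seminorm of order 1/4 of
e^(iLj)w. The phase turns by an angle of order one over a distance 1/(Ls), where s² = y² + 1/L, and
this yields the lower bound L²√s |w|² (`diffForm_ge`). As √s ≥ L^(-1/4), this beats the remaining
errors of order L^(3/2) for large L (`comQ_ge`); taking N large makes L large on every harmonic,
including the constants. The multiplier √s w then exchanges L²√s |w|² for √s |w_t|²
(`rectInt_rho_wt_le`).

All these bounds are uniform in L, so they can be summed over harmonics: Green's identity and the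
spectral theorem on spaces of polynomials supply the harmonics (`exists_eigenbasis`), Bessel's
inequality bounds the right-hand sides, and Stone-Weierstrass gives completeness on the left
(`tendsto_sum_sq_coeff_harm`). Every integration by parts happens on a bounded box: a smoothed light
cone localizes the energy inequality (`energy_le`), and the flux through the sides of a box is made
small by choosing its width (`exists_bdry_le`), so finiteness of the energy is the only decay
needed. In `uniform_bounds` the work done by the source is at most half of the initial energy plus
the work, hence at most the initial energy. Negative times follow by reflection. -/

/-- The radial projection to the sphere (with an arbitrary value at the origin). -/
def radialProj (y : E3) : S2 :=
  if h : y = 0 then ⟨EuclideanSpace.single 0 1, by simp⟩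
  else ⟨‖y‖⁻¹ • y, by
    rw [mem_sphere_zero_iff_norm, norm_smul, norm_inv, norm_norm,
      inv_mul_cancel₀ (norm_ne_zero_iff.mpr h)]⟩

lemma radialProj_coe {y : E3} (h : y ≠ 0) : (radialProj y : E3) = ‖y‖⁻¹ • y := by
  simp [radialProj, h]

lemma radialExt_eq (f : S2 → ℂ) {y : E3} (h : y ≠ 0) : radialExt f y = f (radialProj y) := by
  simp [radialExt, radialProj, h]

lemma sphere_ne_zero (θ : S2) : (θ : E3) ≠ 0 := by
  intro h
  have := θ.2
  simp [h] at this

lemma sphere_norm (θ : S2) : ‖(θ : E3)‖ = 1 := by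
  simp

lemma radialProj_sphere (θ : S2) : radialProj (θ : E3) = θ := by
  apply Subtype.ext
  rw [radialProj_coe (sphere_ne_zero θ)]
  simp

lemma radialExt_sphere (f : S2 → ℂ) (θ : S2) : radialExt f (θ : E3) = f θ := by
  rw [radialExt_eq f (sphere_ne_zero θ), radialProj_sphere]

lemma radialProj_smul {c : ℝ} (hc : 0 < c) (y : E3) : radialProj (c • y) = radialProj y := by
  by_cases h : y = 0
  · simp [h]
  · apply Subtype.ext
    rw [radialProj_coe h, radialProj_coe (smul_ne_zero hc.ne' h), norm_smul, Real.norm_of_nonneg hc.le,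
      smul_smul]
    congr 1
    field_simp

lemma radialExt_smul (f : S2 → ℂ) {c : ℝ} (hc : 0 < c) (y : E3) :
    radialExt f (c • y) = radialExt f y := by
  by_cases h : y = 0
  · simp [h]
  · rw [radialExt_eq f h, radialExt_eq f (smul_ne_zero hc.ne' h), radialProj_smul hc]

instance finrank_E3_fact : Fact (Module.finrank ℝ E3 = 2 + 1) := ⟨by simp⟩

lemma contMDiffAt_radialProj {y : E3} (h : y ≠ 0) :
    ContMDiffAt 𝓘(ℝ, E3) (𝓡 2) ∞ radialProj y := by
  -- The formula for the projection lands on the sphere only off the origin, so smoothness is proved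
  -- on this open subtype and then transferred.
  let U : TopologicalSpace.Opens E3 := ⟨{0}ᶜ, isOpen_compl_singleton⟩
  have key : ContMDiff 𝓘(ℝ, E3) (𝓡 2) ∞ (fun z : U => radialProj (z : E3)) := by
    have h1 : ContMDiff 𝓘(ℝ, E3) 𝓘(ℝ, E3) ∞ (fun z : U => ‖(z : E3)‖⁻¹ • (z : E3)) := by
      intro z
      have hz : (z : E3) ≠ 0 := z.2
      have h2 : ContMDiffAt 𝓘(ℝ, E3) 𝓘(ℝ, E3) ∞ (fun z : E3 => ‖z‖⁻¹ • z) (z : E3) := by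
        apply ContDiffAt.contMDiffAt
        exact ((contDiffAt_norm ℝ hz).inv (norm_ne_zero_iff.mpr hz)).smul contDiffAt_id
      exact (contMDiffAt_subtype_iff (U := U) (f := fun z : E3 => ‖z‖⁻¹ • z)).2 h2
    have h3 : ∀ z : U, (fun z : U => ‖(z : E3)‖⁻¹ • (z : E3)) z ∈ Metric.sphere (0 : E3) 1 := by
      intro z
      have hz : (z : E3) ≠ 0 := z.2
      rw [mem_sphere_zero_iff_norm, norm_smul, norm_inv, norm_norm,
        inv_mul_cancel₀ (norm_ne_zero_iff.mpr hz)]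
    have h4 := ContMDiff.codRestrict_sphere (n := 2) h1 h3
    have h5 : (fun z : U => radialProj (z : E3)) = Set.codRestrict _ _ h3 := by
      funext z
      apply Subtype.ext
      have hz : (z : E3) ≠ 0 := z.2
      rw [radialProj_coe hz]
      rfl
    rw [h5]
    exact h4
  exact (contMDiffAt_subtype_iff (U := U) (f := radialProj) (x := ⟨y, h⟩)).1 (key ⟨y, h⟩)

/-! ### Smoothness of functions on `ℝ × ℝ × S²` through extensions -/

/-- The extension, constant along rays, in the spherical variable. -/
def ext (u : ℝ → ℝ → S2 → ℂ) (p : ℝ × ℝ × E3) : ℂ := radialExt (u p.1 p.2.1) p.2.2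

/-- Smoothness of a function on `ℝ × ℝ × S²`, expressed through its extension. -/
def SmoothFun (u : ℝ → ℝ → S2 → ℂ) : Prop :=
  ∀ p : ℝ × ℝ × E3, p.2.2 ≠ 0 → ContDiffAt ℝ ∞ (ext u) p

/-- Smoothness of a function on the sphere, expressed through its extension. -/
def SmoothSph (f : S2 → ℂ) : Prop := ∀ y : E3, y ≠ 0 → ContDiffAt ℝ ∞ (radialExt f) y

lemma isOpen_offZero : IsOpen {p : ℝ × ℝ × E3 | p.2.2 ≠ 0} :=
  isOpen_ne_fun (by fun_prop) continuous_const

/-- This turns smoothness on the manifold into smoothness on an open subset of a normed space, where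
symmetry of second derivatives and the chain rule are directly available. -/
lemma smoothFun_of_contMDiff {u : ℝ → ℝ → S2 → ℂ}
    (hu : ContMDiff (𝓘(ℝ, ℝ).prod (𝓘(ℝ, ℝ).prod (𝓡 2))) 𝓘(ℝ, ℂ) ∞
      (fun p : ℝ × ℝ × S2 => u p.1 p.2.1 p.2.2)) : SmoothFun u := by
  intro p hp
  rw [← contMDiffAt_iff_contDiffAt]
  have h1 : ContMDiffAt 𝓘(ℝ, ℝ × ℝ × E3) (𝓘(ℝ, ℝ).prod (𝓘(ℝ, ℝ).prod (𝓡 2))) ∞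
      (fun q : ℝ × ℝ × E3 => ((q.1, q.2.1, radialProj q.2.2) : ℝ × ℝ × S2)) p := by
    have a1 : ContMDiffAt 𝓘(ℝ, ℝ × ℝ × E3) 𝓘(ℝ, ℝ) ∞ (fun q : ℝ × ℝ × E3 => q.1) p :=
      contDiffAt_fst.contMDiffAt
    have a2 : ContMDiffAt 𝓘(ℝ, ℝ × ℝ × E3) 𝓘(ℝ, ℝ) ∞ (fun q : ℝ × ℝ × E3 => q.2.1) p :=
      (contDiff_fst.comp contDiff_snd).contDiffAt.contMDiffAt
    have a3 : ContMDiffAt 𝓘(ℝ, ℝ × ℝ × E3) 𝓘(ℝ, E3) ∞ (fun q : ℝ × ℝ × E3 => q.2.2) p :=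
      (contDiff_snd.comp contDiff_snd).contDiffAt.contMDiffAt
    have a4 := ContMDiffAt.comp p (contMDiffAt_radialProj hp) a3
    exact a1.prodMk (a2.prodMk a4)
  have h2 := ContMDiffAt.comp p hu.contMDiffAt h1
  refine h2.congr_of_eventuallyEq ?_
  filter_upwards [isOpen_offZero.mem_nhds hp] with q hq
  simp [ext, radialExt_eq _ hq]

variable {u : ℝ → ℝ → S2 → ℂ}

lemma ext_sphere (u : ℝ → ℝ → S2 → ℂ) (t x : ℝ) (θ : S2) : ext u (t, x, (θ : E3)) = u t x θ :=
  radialExt_sphere _ _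

lemma continuous_inclSphere :
    Continuous (fun p : ℝ × ℝ × S2 => ((p.1, p.2.1, (p.2.2 : E3)) : ℝ × ℝ × E3)) := by
  fun_prop

lemma continuous_comp_inclSphere {F : Type*} [TopologicalSpace F] {g : ℝ × ℝ × E3 → F}
    (hg : ∀ p : ℝ × ℝ × E3, p.2.2 ≠ 0 → ContinuousAt g p) :
    Continuous (fun p : ℝ × ℝ × S2 => g (p.1, p.2.1, (p.2.2 : E3))) := by
  rw [continuous_iff_continuousAt]
  intro p
  have := hg (p.1, p.2.1, (p.2.2 : E3)) (sphere_ne_zero _)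
  exact ContinuousAt.comp (f := fun p : ℝ × ℝ × S2 => ((p.1, p.2.1, (p.2.2 : E3)) : ℝ × ℝ × E3))
    this continuous_inclSphere.continuousAt

lemma SmoothFun.continuous (hu : SmoothFun u) :
    Continuous (fun p : ℝ × ℝ × S2 => u p.1 p.2.1 p.2.2) := by
  have := continuous_comp_inclSphere (g := ext u) (fun p hp => (hu p hp).continuousAt)
  simpa [ext_sphere] using this

lemma hasDerivAt_slice_fst {F : Type*} [NormedAddCommGroup F] [NormedSpace ℝ F]
    {g : ℝ × ℝ × E3 → F} {t x : ℝ} {y : E3}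
    (hg : DifferentiableAt ℝ g (t, x, y)) :
    HasDerivAt (fun s => g (s, x, y)) (fderiv ℝ g (t, x, y) (1, 0, 0)) t := by
  have h1 : HasDerivAt (fun s : ℝ => ((s, x, y) : ℝ × ℝ × E3)) (1, 0, 0) t :=
    (hasDerivAt_id t).prodMk ((hasDerivAt_const t x).prodMk (hasDerivAt_const t y))
  exact HasFDerivAt.comp_hasDerivAt t hg.hasFDerivAt h1

lemma hasDerivAt_slice_snd {F : Type*} [NormedAddCommGroup F] [NormedSpace ℝ F]
    {g : ℝ × ℝ × E3 → F} {t x : ℝ} {y : E3}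
    (hg : DifferentiableAt ℝ g (t, x, y)) :
    HasDerivAt (fun s => g (t, s, y)) (fderiv ℝ g (t, x, y) (0, 1, 0)) x := by
  have h1 : HasDerivAt (fun s : ℝ => ((t, s, y) : ℝ × ℝ × E3)) (0, 1, 0) x :=
    (hasDerivAt_const x t).prodMk ((hasDerivAt_id x).prodMk (hasDerivAt_const x y))
  exact HasFDerivAt.comp_hasDerivAt x hg.hasFDerivAt h1

lemma hasFDerivAt_slice_trd {F : Type*} [NormedAddCommGroup F] [NormedSpace ℝ F]
    {g : ℝ × ℝ × E3 → F} {t x : ℝ} {y : E3}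
    (hg : DifferentiableAt ℝ g (t, x, y)) (e : E3) :
    fderiv ℝ (fun z => g (t, x, z)) y e = fderiv ℝ g (t, x, y) (0, 0, e) := by
  have h1 : HasFDerivAt (fun s : E3 => ((t, x, s) : ℝ × ℝ × E3))
      ((0 : E3 →L[ℝ] ℝ).prod ((0 : E3 →L[ℝ] ℝ).prod (ContinuousLinearMap.id ℝ E3))) y :=
    (hasFDerivAt_const t y).prodMk ((hasFDerivAt_const x y).prodMk (hasFDerivAt_id y))
  have := HasFDerivAt.comp y hg.hasFDerivAt h1
  have h2 := this.fderiv
  change fderiv ℝ (g ∘ fun s => (t, x, s)) y e = _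
  rw [h2]
  simp

lemma SmoothFun.differentiableAt (hu : SmoothFun u) {p : ℝ × ℝ × E3} (hp : p.2.2 ≠ 0) :
    DifferentiableAt ℝ (ext u) p := (hu p hp).differentiableAt (by simp)

lemma ext_dt (hu : SmoothFun u) {p : ℝ × ℝ × E3} (hp : p.2.2 ≠ 0) :
    ext (dt u) p = fderiv ℝ (ext u) p (1, 0, 0) := by
  obtain ⟨t, x, y⟩ := p
  have h := (hasDerivAt_slice_fst (hu.differentiableAt hp)).deriv
  simp only [ext] at *
  rw [← h, radialExt_eq _ hp]
  simp only [radialExt_eq _ hp]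
  rfl

lemma ext_dx (hu : SmoothFun u) {p : ℝ × ℝ × E3} (hp : p.2.2 ≠ 0) :
    ext (dx u) p = fderiv ℝ (ext u) p (0, 1, 0) := by
  obtain ⟨t, x, y⟩ := p
  have h := (hasDerivAt_slice_snd (hu.differentiableAt hp)).deriv
  simp only [ext] at *
  rw [← h, radialExt_eq _ hp]
  simp only [radialExt_eq _ hp]
  rfl

lemma contDiffAt_fderiv_ext (hu : SmoothFun u) {p : ℝ × ℝ × E3} (hp : p.2.2 ≠ 0) :
    ContDiffAt ℝ ∞ (fderiv ℝ (ext u)) p :=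
  (hu p hp).fderiv_right (by simp)

lemma contDiffAt_fderiv_ext_apply (hu : SmoothFun u) {p : ℝ × ℝ × E3} (hp : p.2.2 ≠ 0)
    (v : ℝ × ℝ × E3) : ContDiffAt ℝ ∞ (fun q => fderiv ℝ (ext u) q v) p :=
  (contDiffAt_fderiv_ext hu hp).clm_apply contDiffAt_const

lemma ext_dt_eventuallyEq (hu : SmoothFun u) {p : ℝ × ℝ × E3} (hp : p.2.2 ≠ 0) :
    ext (dt u) =ᶠ[𝓝 p] fun q => fderiv ℝ (ext u) q (1, 0, 0) := by
  filter_upwards [isOpen_offZero.mem_nhds hp] with q hq using ext_dt hu hq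

lemma ext_dx_eventuallyEq (hu : SmoothFun u) {p : ℝ × ℝ × E3} (hp : p.2.2 ≠ 0) :
    ext (dx u) =ᶠ[𝓝 p] fun q => fderiv ℝ (ext u) q (0, 1, 0) := by
  filter_upwards [isOpen_offZero.mem_nhds hp] with q hq using ext_dx hu hq

lemma SmoothFun.dt (hu : SmoothFun u) : SmoothFun (dt u) := fun _ hp =>
  (contDiffAt_fderiv_ext_apply hu hp (1, 0, 0)).congr_of_eventuallyEq (ext_dt_eventuallyEq hu hp)

lemma SmoothFun.dx (hu : SmoothFun u) : SmoothFun (dx u) := fun _ hp =>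
  (contDiffAt_fderiv_ext_apply hu hp (0, 1, 0)).congr_of_eventuallyEq (ext_dx_eventuallyEq hu hp)

lemma SmoothFun.hasDerivAt_dt (hu : SmoothFun u) (t x : ℝ) (θ : S2) :
    HasDerivAt (fun s => u s x θ) (TrappedWave.dt u t x θ) t := by
  have hp : ((t, x, (θ : E3)) : ℝ × ℝ × E3).2.2 ≠ 0 := sphere_ne_zero θ
  have h := hasDerivAt_slice_fst (hu.differentiableAt hp)
  rw [← ext_dt hu hp] at h
  simpa [ext_sphere] using h

lemma SmoothFun.hasDerivAt_dx (hu : SmoothFun u) (t x : ℝ) (θ : S2) :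
    HasDerivAt (fun s => u t s θ) (TrappedWave.dx u t x θ) x := by
  have hp : ((t, x, (θ : E3)) : ℝ × ℝ × E3).2.2 ≠ 0 := sphere_ne_zero θ
  have h := hasDerivAt_slice_snd (hu.differentiableAt hp)
  rw [← ext_dx hu hp] at h
  simpa [ext_sphere] using h

/-- Partial derivatives of the extension commute. -/
lemma fderiv_fderiv_ext_comm (hu : SmoothFun u) {p : ℝ × ℝ × E3} (hp : p.2.2 ≠ 0)
    (v w : ℝ × ℝ × E3) :
    fderiv ℝ (fun q => fderiv ℝ (ext u) q v) p w = fderiv ℝ (fun q => fderiv ℝ (ext u) q w) p v := by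
  have hd : DifferentiableAt ℝ (fderiv ℝ (ext u)) p :=
    (contDiffAt_fderiv_ext hu hp).differentiableAt (by simp)
  have hs : IsSymmSndFDerivAt ℝ (ext u) p := (hu p hp).isSymmSndFDerivAt
    (by simp only [minSmoothness_of_isRCLikeNormedField]; exact WithTop.coe_le_coe.2 (le_top (a := (2 : ℕ∞))))
  rw [fderiv_clm_apply hd (differentiableAt_const _), fderiv_clm_apply hd (differentiableAt_const _)]
  simpa using hs.eq w v

lemma dt_dx_comm (hu : SmoothFun u) (t x : ℝ) (θ : S2) :
    TrappedWave.dt (TrappedWave.dx u) t x θ = TrappedWave.dx (TrappedWave.dt u) t x θ := by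
  have hp : ((t, x, (θ : E3)) : ℝ × ℝ × E3).2.2 ≠ 0 := sphere_ne_zero θ
  rw [← ext_sphere (TrappedWave.dt (TrappedWave.dx u)), ← ext_sphere (TrappedWave.dx (TrappedWave.dt u)),
    ext_dt hu.dx hp, ext_dx hu.dt hp, (ext_dt_eventuallyEq hu hp).fderiv_eq,
    (ext_dx_eventuallyEq hu hp).fderiv_eq, fderiv_fderiv_ext_comm hu hp]

lemma SmoothFun.smoothSph (hu : SmoothFun u) (t x : ℝ) : SmoothSph (u t x) := by
  intro y hy
  have h1 : ContDiffAt ℝ ∞ (fun z : E3 => ((t, x, z) : ℝ × ℝ × E3)) y := by fun_prop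
  exact ContDiffAt.comp (g := ext u) y (hu (t, x, y) hy) h1

/-- The partial derivatives of the extension of a function on the sphere, at points of the
sphere. -/
def gradComp (i : Fin 3) (f : S2 → ℂ) (θ : S2) : ℂ :=
  fderiv ℝ (radialExt f) (θ : E3) (EuclideanSpace.single i 1)

lemma sphereGradSq_eq (f : S2 → ℂ) (θ : S2) :
    sphereGradSq f θ = ∑ i : Fin 3, ‖gradComp i f θ‖ ^ 2 := rfl

lemma gradComp_eq (hu : SmoothFun u) (i : Fin 3) (t x : ℝ) (θ : S2) :
    gradComp i (u t x) θ
      = fderiv ℝ (ext u) (t, x, (θ : E3)) (0, 0, EuclideanSpace.single i 1) := by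
  have hp : ((t, x, (θ : E3)) : ℝ × ℝ × E3).2.2 ≠ 0 := sphere_ne_zero θ
  rw [← hasFDerivAt_slice_trd (hu.differentiableAt hp)]
  rfl

lemma continuous_gradComp (hu : SmoothFun u) (i : Fin 3) :
    Continuous (fun p : ℝ × ℝ × S2 => gradComp i (u p.1 p.2.1) p.2.2) := by
  have := continuous_comp_inclSphere
    (g := fun q => fderiv ℝ (ext u) q (0, 0, EuclideanSpace.single i 1))
    (fun p hp => (contDiffAt_fderiv_ext_apply hu hp _).continuousAt)
  simpa [gradComp_eq hu] using this

lemma hasDerivAt_gradComp_dt (hu : SmoothFun u) (i : Fin 3) (t x : ℝ) (θ : S2) :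
    HasDerivAt (fun s => gradComp i (u s x) θ) (gradComp i (TrappedWave.dt u t x) θ) t := by
  have hp : ((t, x, (θ : E3)) : ℝ × ℝ × E3).2.2 ≠ 0 := sphere_ne_zero θ
  simp only [gradComp_eq hu, gradComp_eq hu.dt]
  rw [(ext_dt_eventuallyEq hu hp).fderiv_eq, fderiv_fderiv_ext_comm hu hp]
  exact hasDerivAt_slice_fst
    ((contDiffAt_fderiv_ext_apply hu hp (0, 0, EuclideanSpace.single i 1)).differentiableAt
      (by simp))

lemma hasDerivAt_gradComp_dx (hu : SmoothFun u) (i : Fin 3) (t x : ℝ) (θ : S2) :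
    HasDerivAt (fun s => gradComp i (u t s) θ) (gradComp i (TrappedWave.dx u t x) θ) x := by
  have hp : ((t, x, (θ : E3)) : ℝ × ℝ × E3).2.2 ≠ 0 := sphere_ne_zero θ
  simp only [gradComp_eq hu, gradComp_eq hu.dx]
  rw [(ext_dx_eventuallyEq hu hp).fderiv_eq, fderiv_fderiv_ext_comm hu hp]
  exact hasDerivAt_slice_snd
    ((contDiffAt_fderiv_ext_apply hu hp (0, 0, EuclideanSpace.single i 1)).differentiableAt
      (by simp))

end TrappedWave

namespace TrappedWave

open Set Filter Topology

/-! ### Calculus on the sphere -/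

instance : IsFiniteMeasure sphereMeasure := by unfold sphereMeasure; infer_instance
instance : sphereMeasure.IsOpenPosMeasure := by unfold sphereMeasure; infer_instance

/-- The partial derivatives of a function on three-space. -/
def pd (i : Fin 3) (F : E3 → ℂ) (y : E3) : ℂ := fderiv ℝ F y (EuclideanSpace.single i 1)

variable {f g : S2 → ℂ}

lemma gradComp_eq_pd (i : Fin 3) (f : S2 → ℂ) (θ : S2) :
    gradComp i f θ = pd i (radialExt f) θ := rfl

lemma SmoothSph.contDiffAt_pd (hf : SmoothSph f) (i : Fin 3) {y : E3} (hy : y ≠ 0) :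
    ContDiffAt ℝ ∞ (pd i (radialExt f)) y :=
  ((hf y hy).fderiv_right (m := ∞) (by simp)).clm_apply contDiffAt_const

lemma SmoothSph.differentiableAt (hf : SmoothSph f) {y : E3} (hy : y ≠ 0) :
    DifferentiableAt ℝ (radialExt f) y := (hf y hy).differentiableAt (by simp)

lemma SmoothSph.differentiableAt_pd (hf : SmoothSph f) (i : Fin 3) {y : E3} (hy : y ≠ 0) :
    DifferentiableAt ℝ (pd i (radialExt f)) y := (hf.contDiffAt_pd i hy).differentiableAt (by simp)

lemma laplacian_eq_sum_pd {F : E3 → ℂ} {y : E3} (hF : ContDiffAt ℝ ∞ F y) :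
    Laplacian.laplacian F y = ∑ i, pd i (pd i F) y := by
  rw [InnerProductSpace.laplacian_eq_iteratedFDeriv_orthonormalBasis F
    (EuclideanSpace.basisFun (Fin 3) ℝ)]
  refine Finset.sum_congr rfl fun i _ => ?_
  have hd : DifferentiableAt ℝ (fderiv ℝ F) y :=
    (hF.fderiv_right (m := ∞) (by simp)).differentiableAt (by simp)
  rw [iteratedFDeriv_two_apply]
  unfold pd
  rw [fderiv_clm_apply hd (differentiableAt_const _)]
  simp

lemma sphereLaplacian_eq (hf : SmoothSph f) (θ : S2) :
    sphereLaplacian f θ = ∑ i, pd i (pd i (radialExt f)) θ :=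
  laplacian_eq_sum_pd (hf _ (sphere_ne_zero θ))

/-- The derivatives of a function homogeneous of degree zero are homogeneous of degree `-1`. -/
lemma pd_radialExt_smul (i : Fin 3) (f : S2 → ℂ) {c : ℝ} (hc : 0 < c) (y : E3) :
    pd i (radialExt f) (c • y) = (c⁻¹ : ℝ) * pd i (radialExt f) y := by
  have h1 : (fun z => radialExt f (c • z)) = radialExt f := funext fun z => radialExt_smul f hc z
  have h2 := fderiv_comp_smul (𝕜 := ℝ) (f := radialExt f) (x := y) c
  rw [h1] at h2
  unfold pd
  rw [h2]
  have : (c : ℂ) ≠ 0 := by exact_mod_cast hc.ne'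
  simp [this]

lemma pd_pd_radialExt_smul (i j : Fin 3) (f : S2 → ℂ) {c : ℝ} (hc : 0 < c) (y : E3) :
    pd j (pd i (radialExt f)) (c • y) = ((c⁻¹) ^ 2 : ℝ) * pd j (pd i (radialExt f)) y := by
  have h1 : (fun z => pd i (radialExt f) (c • z)) = fun z => (c⁻¹ : ℝ) • pd i (radialExt f) z :=
    funext fun z => by rw [pd_radialExt_smul i f hc z]; simp
  have h2 := fderiv_comp_smul (𝕜 := ℝ) (f := pd i (radialExt f)) (x := y) c
  have h0 : fderiv ℝ (fun z => (c⁻¹ : ℝ) • pd i (radialExt f) z) y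
      = (c⁻¹ : ℝ) • fderiv ℝ (pd i (radialExt f)) y :=
    congrFun (fderiv_const_smul_field (𝕜 := ℝ) (f := pd i (radialExt f)) (c⁻¹ : ℝ)) y
  rw [h1, h0] at h2
  have h3 := congrArg (fun L : E3 →L[ℝ] ℂ => L (EuclideanSpace.single j 1)) h2
  have hc' : (c : ℂ) ≠ 0 := by exact_mod_cast hc.ne'
  simp only [_root_.smul_apply, Complex.real_smul] at h3
  change _ * pd j (pd i (radialExt f)) y = _ * pd j (pd i (radialExt f)) (c • y) at h3
  push_cast at h3 ⊢
  have h4 : pd j (pd i (radialExt f)) (c • y) = (c : ℂ)⁻¹ * ((c : ℂ) * pd j (pd i (radialExt f)) (c • y)) := by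
    field_simp
  rw [h4, ← h3]
  ring

/-- Euler's relation: the radial derivative of the extension vanishes. -/
lemma sum_coord_mul_pd (hf : SmoothSph f) {y : E3} (hy : y ≠ 0) :
    ∑ i, (y i : ℂ) * pd i (radialExt f) y = 0 := by
  have h0 : HasDerivAt (fun c : ℝ => radialExt f (c • y)) (fderiv ℝ (radialExt f) y y) 1 := by
    have h1 : HasDerivAt (fun c : ℝ => c • y) y 1 := by
      simpa using (hasDerivAt_id (1 : ℝ)).smul_const y
    have h2 : HasFDerivAt (radialExt f) (fderiv ℝ (radialExt f) y) ((1 : ℝ) • y) := by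
      rw [one_smul]
      exact (hf.differentiableAt hy).hasFDerivAt
    exact h2.comp_hasDerivAt (1 : ℝ) h1
  have h3 : HasDerivAt (fun c : ℝ => radialExt f (c • y)) 0 1 := by
    refine (hasDerivAt_const (1 : ℝ) (radialExt f y)).congr_of_eventuallyEq ?_
    filter_upwards [lt_mem_nhds (zero_lt_one' ℝ)] with c hc using radialExt_smul f hc y
  have h4 := h0.unique h3
  have h5 : y = ∑ i, y i • (EuclideanSpace.single i (1 : ℝ) : E3) := by
    ext j
    simp [Finset.sum_apply, Pi.single_apply]
  unfold pd
  have h6 := congrArg (fun z => fderiv ℝ (radialExt f) y z) h5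
  simp only [map_sum, map_smul, Complex.real_smul] at h6
  rw [← h6, h4]

lemma eq_norm_smul_radialProj {y : E3} (hy : y ≠ 0) :
    y = ‖y‖ • (radialProj y : E3) := by
  rw [radialProj_coe hy, smul_smul, mul_inv_cancel₀ (norm_ne_zero_iff.mpr hy), one_smul]

/-- Integration in polar coordinates of a product of a radial and an angular function. -/
lemma integral_radial_mul (η : ℝ → ℂ) (H : S2 → ℂ) :
    ∫ y : E3, η ‖y‖ * H (radialProj y)
      = (∫ r : Ioi (0 : ℝ), η r ∂(Measure.volumeIoiPow 2)) * ∫ θ, H θ ∂sphereMeasure := by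
  have h1 : ∫ y : E3, η ‖y‖ * H (radialProj y)
      = ∫ y : ({(0 : E3)}ᶜ : Set E3), η ‖(y : E3)‖ * H (radialProj y)
          ∂((volume : Measure E3).comap (↑)) := by
    rw [integral_subtype_comap (measurableSet_singleton _).compl
      (fun y : E3 => η ‖y‖ * H (radialProj y)), restrict_compl_singleton]
  have h2 := (volume : Measure E3).measurePreserving_homeomorphUnitSphereProd.integral_comp
    (Homeomorph.measurableEmbedding _) (fun z : S2 × Ioi (0 : ℝ) => H z.1 * η z.2)
  have hfin : Module.finrank ℝ E3 - 1 = 2 := by simp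
  rw [hfin, integral_prod_mul (f := H) (g := fun r : Ioi (0 : ℝ) => η r)] at h2
  rw [h1, mul_comm]
  unfold sphereMeasure
  rw [← h2]
  refine integral_congr_ae (Eventually.of_forall fun y => ?_)
  have hy : (y : E3) ≠ 0 := y.2
  have h3 : (homeomorphUnitSphereProd E3 y).1 = radialProj (y : E3) := by
    apply Subtype.ext
    rw [radialProj_coe hy]
    simp
  simp only [h3, homeomorphUnitSphereProd_apply_snd_coe]
  ring

/-- A radial cutoff supported in an annulus around the unit sphere. -/
def annBump : ContDiffBump (1 : ℝ) := ⟨1 / 4, 1 / 2, by norm_num, by norm_num⟩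

/-- Using the square of the norm keeps the cutoff smooth at the origin, with no separate argument
there. -/
def annFun (y : E3) : ℝ := annBump (‖y‖ ^ 2)

lemma contDiff_annFun : ContDiff ℝ ∞ annFun :=
  annBump.contDiff.comp (contDiff_norm_sq ℝ)

lemma tsupport_annFun : tsupport annFun ⊆ {y : E3 | ‖y‖ ^ 2 ∈ Icc (1 / 2 : ℝ) (3 / 2)} := by
  refine closure_minimal ?_ (isClosed_Icc.preimage (by fun_prop))
  intro y hy
  have h : annBump (‖y‖ ^ 2) ≠ 0 := hy
  have h2 : ‖y‖ ^ 2 ∈ Function.support (annBump : ℝ → ℝ) := h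
  rw [annBump.support_eq, Real.ball_eq_Ioo] at h2
  constructor
  · have := h2.1; simp only [annBump] at this; linarith
  · have := h2.2; simp only [annBump] at this; linarith

lemma ne_zero_of_mem_tsupport_annFun {y : E3} (hy : y ∈ tsupport annFun) : y ≠ 0 := by
  rintro rfl
  have := (tsupport_annFun hy).1
  norm_num at this

lemma hasCompactSupport_annFun : HasCompactSupport annFun := by
  refine HasCompactSupport.of_support_subset_isCompact (isCompact_closedBall (0 : E3) 2) ?_
  intro y hy
  have := (tsupport_annFun (subset_tsupport _ hy)).2
  rw [mem_closedBall_zero_iff]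
  nlinarith [norm_nonneg y]

/-- A function continuous off the origin, multiplied by the cutoff, is continuous with compact
support. -/
lemma continuous_annFun_mul {G : E3 → ℂ} (hG : ∀ y ≠ 0, ContinuousAt G y) :
    Continuous (fun y => (annFun y : ℂ) * G y) := by
  rw [continuous_iff_continuousAt]
  intro y
  by_cases hy : y ∈ tsupport annFun
  · exact ContinuousAt.mul (Complex.continuous_ofReal.comp contDiff_annFun.continuous).continuousAt
      (hG y (ne_zero_of_mem_tsupport_annFun hy))
  · have h : (fun y => (annFun y : ℂ) * G y) =ᶠ[𝓝 y] fun _ => 0 := by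
      filter_upwards [(isClosed_tsupport annFun).isOpen_compl.mem_nhds hy] with z hz
      simp [image_eq_zero_of_notMem_tsupport hz]
    exact h.continuousAt

lemma integrable_annFun_mul {G : E3 → ℂ} (hG : ∀ y ≠ 0, ContinuousAt G y) :
    Integrable (fun y => (annFun y : ℂ) * G y) := by
  refine (continuous_annFun_mul hG).integrable_of_hasCompactSupport ?_
  refine hasCompactSupport_annFun.mono ?_
  intro y hy
  simp only [Function.mem_support, ne_eq, mul_eq_zero, not_or, Complex.ofReal_eq_zero] at hy ⊢
  exact hy.1

/-- The radial factor in the polar-coordinate computations. -/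
def annConst : ℂ := ∫ r : Ioi (0 : ℝ), (annBump ((r : ℝ) ^ 2) * (((r : ℝ))⁻¹ ^ 2) : ℂ)
  ∂(Measure.volumeIoiPow 2)

/-- Integration over the annulus of a function homogeneous of degree `-2`. -/
lemma integral_annFun_mul_homog {G : E3 → ℂ} (hG : ∀ y ≠ 0, G y = ((‖y‖⁻¹) ^ 2 : ℝ) * G (radialProj y)) :
    ∫ y, (annFun y : ℂ) * G y = annConst * ∫ θ : S2, G θ ∂sphereMeasure := by
  have h := integral_radial_mul (fun r => (annBump (r ^ 2) * (r⁻¹ ^ 2) : ℂ)) (fun θ => G θ)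
  rw [annConst, ← h]
  refine integral_congr_ae (Eventually.of_forall fun y => ?_)
  by_cases hy : y = 0
  · have : annFun (0 : E3) = 0 := by
      by_contra h0
      exact ne_zero_of_mem_tsupport_annFun (subset_tsupport _ h0) rfl
    simp only [annFun] at this
    simp only [hy, annFun, this]
    simp
  · simp only
    rw [hG y hy]
    simp only [annFun]
    push_cast
    ring

/-- The polar formula applied to ‖y‖⁻² itself would force the integral of a continuous, nonnegative,
not identically zero function to vanish. -/
lemma annConst_ne_zero : annConst ≠ 0 := by
  intro h0
  have h := integral_annFun_mul_homog (G := fun y => ((‖y‖⁻¹) ^ 2 : ℝ)) (by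
    intro y hy
    simp)
  rw [h0, zero_mul] at h
  have h1 : Continuous fun y : E3 => annFun y * (‖y‖⁻¹) ^ 2 := by
    have := continuous_annFun_mul (G := fun y => ((‖y‖⁻¹) ^ 2 : ℝ)) (by
      intro y hy
      have : ‖y‖ ≠ 0 := norm_ne_zero_iff.mpr hy
      fun_prop (disch := assumption))
    have h2 := Complex.continuous_re.comp this
    convert h2 using 2
    rw [Function.comp_apply, ← Complex.ofReal_mul, Complex.ofReal_re]
  have h2 : 0 < ∫ y : E3, annFun y * (‖y‖⁻¹) ^ 2 := by
    refine h1.integral_pos_of_hasCompactSupport_nonneg_nonzero (x := EuclideanSpace.single 0 1) ?_ ?_ ?_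
    · exact hasCompactSupport_annFun.mul_right
    · intro y
      have : 0 ≤ annFun y := annBump.nonneg
      positivity
    · have : annFun (EuclideanSpace.single 0 1 : E3) = 1 := by
        unfold annFun
        apply annBump.one_of_mem_closedBall
        simp [annBump]
      simp [this]
  have h3 : ((∫ y : E3, annFun y * (‖y‖⁻¹) ^ 2 : ℝ) : ℂ) = 0 := by
    rw [← h, ← integral_complex_ofReal]
    simp
  rw [Complex.ofReal_eq_zero] at h3
  exact h2.ne' h3

/-- The gradient of a radial function points along y. Paired with the gradient of a function
homogeneous of degree zero it therefore gives zero by Euler's relation, which removes the cutoff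
error in Green's identity. -/
lemma fderiv_annFun (y : E3) :
    ∃ c : ℝ, ∀ i : Fin 3, fderiv ℝ annFun y (EuclideanSpace.single i 1) = c * y i := by
  have h1 : HasFDerivAt (fun y : E3 => ‖y‖ ^ 2) (2 • (innerSL ℝ y)) y :=
    (hasStrictFDerivAt_norm_sq y).hasFDerivAt
  have h2 : HasDerivAt (annBump : ℝ → ℝ) (deriv annBump (‖y‖ ^ 2)) (‖y‖ ^ 2) :=
    ((annBump.contDiff (n := 1)).differentiable (by simp) _).hasDerivAt
  have h3 := HasDerivAt.comp_hasFDerivAt y h2 h1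
  refine ⟨2 * deriv annBump (‖y‖ ^ 2), fun i => ?_⟩
  have h4 : fderiv ℝ annFun y = _ := h3.fderiv
  rw [h4]
  simp [PiLp.inner_apply]
  ring

/-- **Green's identity** on the sphere. -/
theorem integral_sphereLaplacian_mul (hf : SmoothSph f) (hg : SmoothSph g) :
    ∫ θ, sphereLaplacian f θ * g θ ∂sphereMeasure
      = -∫ θ, ∑ i, gradComp i f θ * gradComp i g θ ∂sphereMeasure := by
  set F := radialExt f with hF
  set G := radialExt g with hG
  have cG : ∀ y ≠ 0, ContinuousAt G y := fun y hy => (hg y hy).continuousAt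
  have cF1 : ∀ i, ∀ y ≠ 0, ContinuousAt (pd i F) y := fun i y hy => (hf.contDiffAt_pd i hy).continuousAt
  have cG1 : ∀ i, ∀ y ≠ 0, ContinuousAt (pd i G) y := fun i y hy => (hg.contDiffAt_pd i hy).continuousAt
  have cF2 : ∀ i, ∀ y ≠ 0, ContinuousAt (pd i (pd i F)) y := fun i y hy =>
    (((hf.contDiffAt_pd i hy).fderiv_right (m := ∞) (by simp)).clm_apply contDiffAt_const).continuousAt
  have dA : ∀ y, DifferentiableAt ℝ (fun y => (annFun y : ℂ)) y := fun y =>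
    (Complex.ofRealCLM.differentiableAt).comp y (contDiff_annFun.differentiable (by simp) y)
  have pdA : ∀ i y, fderiv ℝ (fun y => (annFun y : ℂ)) y (EuclideanSpace.single i 1)
      = (fderiv ℝ annFun y (EuclideanSpace.single i 1) : ℂ) := fun i y => by
    have := (Complex.ofRealCLM.hasFDerivAt).comp y
      (contDiff_annFun.differentiable (by simp) y).hasFDerivAt
    have h := this.fderiv
    change fderiv ℝ (Complex.ofRealCLM ∘ annFun) y _ = _
    rw [h]
    simp
  have cA : ∀ i, Continuous fun y => fderiv ℝ annFun y (EuclideanSpace.single i 1) := fun i =>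
    (contDiff_annFun.continuous_fderiv (by simp)).clm_apply continuous_const
  -- support of the product
  have tsub : ∀ y, y ∈ tsupport (fun y => (annFun y : ℂ) * G y) → y ≠ 0 := by
    intro y hy
    apply ne_zero_of_mem_tsupport_annFun
    refine closure_mono ?_ hy
    intro z hz
    simp only [Function.mem_support, ne_eq, mul_eq_zero, not_or, Complex.ofReal_eq_zero] at hz ⊢
    exact hz.1
  have dAG : ∀ y, DifferentiableAt ℝ (fun y => (annFun y : ℂ) * G y) y := by
    intro y
    by_cases hy : y ∈ tsupport annFun
    · exact (dA y).mul (hg.differentiableAt (ne_zero_of_mem_tsupport_annFun hy))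
    · have h : (fun y => (annFun y : ℂ) * G y) =ᶠ[𝓝 y] fun _ => 0 := by
        filter_upwards [(isClosed_tsupport annFun).isOpen_compl.mem_nhds hy] with z hz
        simp [image_eq_zero_of_notMem_tsupport hz]
      exact (differentiableAt_const _).congr_of_eventuallyEq h
  have annz : ∀ y, y ∉ tsupport annFun → fderiv ℝ annFun y = 0 := by
    intro y hy
    have h : annFun =ᶠ[𝓝 y] fun _ => 0 := by
      filter_upwards [(isClosed_tsupport annFun).isOpen_compl.mem_nhds hy] with z hz
      simp [image_eq_zero_of_notMem_tsupport hz]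
    rw [h.fderiv_eq]; simp
  have fAG : ∀ i y, fderiv ℝ (fun y => (annFun y : ℂ) * G y) y (EuclideanSpace.single i 1)
      = (annFun y : ℂ) * pd i G y
        + (fderiv ℝ annFun y (EuclideanSpace.single i 1) : ℂ) * G y := by
    intro i y
    by_cases hy : y ∈ tsupport annFun
    · rw [fderiv_fun_mul (dA y) (hg.differentiableAt (ne_zero_of_mem_tsupport_annFun hy))]
      simp only [_root_.add_apply, _root_.smul_apply, pdA]
      simp only [pd, smul_eq_mul]
      ring
    · have h : (fun y => (annFun y : ℂ) * G y) =ᶠ[𝓝 y] fun _ => 0 := by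
        filter_upwards [(isClosed_tsupport annFun).isOpen_compl.mem_nhds hy] with z hz
        simp [image_eq_zero_of_notMem_tsupport hz]
      rw [h.fderiv_eq, annz y hy, image_eq_zero_of_notMem_tsupport hy]
      simp
  -- products with the derivative of the cutoff
  have cB : ∀ i, ∀ H : E3 → ℂ, (∀ y ≠ 0, ContinuousAt H y) →
      Integrable fun y => (fderiv ℝ annFun y (EuclideanSpace.single i 1) : ℂ) * H y := by
    intro i H hH
    have hc : Continuous fun y => (fderiv ℝ annFun y (EuclideanSpace.single i 1) : ℂ) * H y := by
      rw [continuous_iff_continuousAt]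
      intro y
      by_cases hy : y ∈ tsupport annFun
      · exact ContinuousAt.mul (Complex.continuous_ofReal.comp (cA i)).continuousAt
          (hH y (ne_zero_of_mem_tsupport_annFun hy))
      · have h : (fun y => (fderiv ℝ annFun y (EuclideanSpace.single i 1) : ℂ) * H y)
            =ᶠ[𝓝 y] fun _ => 0 := by
          filter_upwards [(isClosed_tsupport annFun).isOpen_compl.mem_nhds hy] with z hz
          simp [annz z hz]
        exact h.continuousAt
    refine hc.integrable_of_hasCompactSupport (hasCompactSupport_annFun.mono' ?_)
    intro y hy
    by_contra hn
    apply hy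
    simp [annz y hn]
  -- Integration by parts in three-space, with the cutoff attached to `G`; the derivative falling on
  -- the cutoff is kept for now and disappears only after summation over the coordinates.
  have step : ∀ i, ∫ y, (annFun y : ℂ) * (pd i (pd i F) y * G y)
      = -∫ y, ((annFun y : ℂ) * (pd i F y * pd i G y)
        + (fderiv ℝ annFun y (EuclideanSpace.single i 1) : ℂ) * (G y * pd i F y)) := by
    intro i
    have e1 : ∀ y, (fderiv ℝ (fun y => (annFun y : ℂ) * G y) y (EuclideanSpace.single i 1)) * pd i F y
        = (annFun y : ℂ) * (pd i F y * pd i G y)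
        + (fderiv ℝ annFun y (EuclideanSpace.single i 1) : ℂ) * (G y * pd i F y) := by
      intro y; rw [fAG]; ring
    have e2 : ∀ y, (fun y => (annFun y : ℂ) * G y) y
          * fderiv ℝ (pd i F) y (EuclideanSpace.single i 1)
        = (annFun y : ℂ) * (pd i (pd i F) y * G y) := by
      intro y; simp only [pd]; ring
    have := integral_mul_fderiv_eq_neg_fderiv_mul_of_integrable (μ := (volume : Measure E3))
      (f := fun y => (annFun y : ℂ) * G y) (g := pd i F) (v := EuclideanSpace.single i 1)
      (by
        simp only [e1]
        exact (integrable_annFun_mul fun y hy => (cF1 i y hy).mul (cG1 i y hy)).add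
          (cB i _ fun y hy => (cG y hy).mul (cF1 i y hy)))
      (by
        have : (fun y => (annFun y : ℂ) * G y * fderiv ℝ (pd i F) y (EuclideanSpace.single i 1))
            = fun y => (annFun y : ℂ) * (pd i (pd i F) y * G y) := funext e2
        rw [this]
        exact integrable_annFun_mul fun y hy => (cF2 i y hy).mul (cG y hy))
      (by
        have : (fun y => (annFun y : ℂ) * G y * pd i F y)
            = fun y => (annFun y : ℂ) * (G y * pd i F y) := funext fun y => by ring
        rw [this]
        exact integrable_annFun_mul fun y hy => (cG y hy).mul (cF1 i y hy))
      (fun y _ => dAG y) (fun y hy => hf.differentiableAt_pd i (tsub y hy))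
    simp only [e1] at this
    rw [← this]
    exact integral_congr_ae (Eventually.of_forall fun y => (e2 y).symm)
  have sum1 : ∫ y, (annFun y : ℂ) * ((∑ i, pd i (pd i F) y) * G y)
      = -∫ y, (annFun y : ℂ) * (∑ i, pd i F y * pd i G y) := by
    have a1 : ∫ y, (annFun y : ℂ) * ((∑ i, pd i (pd i F) y) * G y)
        = ∑ i, ∫ y, (annFun y : ℂ) * (pd i (pd i F) y * G y) := by
      have I : ∀ i ∈ Finset.univ, Integrable (fun y => (annFun y : ℂ) * (pd i (pd i F) y * G y)) :=
        fun i _ => integrable_annFun_mul fun y hy => (cF2 i y hy).mul (cG y hy)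
      rw [← integral_finsetSum _ I]
      refine integral_congr_ae (Eventually.of_forall fun y => ?_)
      simp only [Finset.sum_mul, Finset.mul_sum]
    rw [a1]
    simp only [step]
    have I : ∀ i ∈ Finset.univ, Integrable (fun y => (annFun y : ℂ) * (pd i F y * pd i G y)
        + (fderiv ℝ annFun y (EuclideanSpace.single i 1) : ℂ) * (G y * pd i F y)) := fun i _ =>
      (integrable_annFun_mul fun y hy => (cF1 i y hy).mul (cG1 i y hy)).add
          (cB i _ fun y hy => (cG y hy).mul (cF1 i y hy))
    rw [Finset.sum_neg_distrib, ← integral_finsetSum _ I]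
    congr 1
    refine integral_congr_ae (Eventually.of_forall fun y => ?_)
    simp only [Finset.sum_add_distrib, Finset.mul_sum, add_eq_left]
    obtain ⟨c, hc⟩ := fderiv_annFun y
    simp only [hc]
    by_cases hy : y = 0
    · simp [hy]
    · have := sum_coord_mul_pd hf hy
      calc _ = (c : ℂ) * G y * ∑ i, (y i : ℂ) * pd i F y := by
            rw [Finset.mul_sum]
            refine Finset.sum_congr rfl fun i _ => ?_
            push_cast; ring
        _ = 0 := by rw [this, mul_zero]
  -- Both integrands are homogeneous of degree -2, so each integral over the annulus is the same
  -- nonzero constant times an integral over the sphere, and the constant cancels.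
  have hom1 : ∀ y : E3, y ≠ 0 → (∑ i, pd i (pd i F) y) * G y
      = ((‖y‖⁻¹) ^ 2 : ℝ) * ((∑ i, pd i (pd i F) (radialProj y)) * G (radialProj y)) := by
    intro y hy
    have hn : 0 < ‖y‖ := norm_pos_iff.mpr hy
    conv_lhs => rw [eq_norm_smul_radialProj hy]
    simp only [hF, hG, pd_pd_radialExt_smul _ _ f hn, radialExt_smul g hn]
    rw [← Finset.mul_sum]
    ring
  have hom2 : ∀ y : E3, y ≠ 0 → (∑ i, pd i F y * pd i G y)
      = ((‖y‖⁻¹) ^ 2 : ℝ) * (∑ i, pd i F (radialProj y) * pd i G (radialProj y)) := by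
    intro y hy
    have hn : 0 < ‖y‖ := norm_pos_iff.mpr hy
    conv_lhs => rw [eq_norm_smul_radialProj hy]
    simp only [hF, hG, pd_radialExt_smul _ _ hn]
    rw [Finset.mul_sum]
    refine Finset.sum_congr rfl fun i _ => ?_
    push_cast; ring
  rw [integral_annFun_mul_homog hom1, integral_annFun_mul_homog hom2, ← mul_neg] at sum1
  have := mul_left_cancel₀ annConst_ne_zero sum1
  simp only [hF, hG, radialExt_sphere] at this
  simp only [gradComp_eq_pd, ← this, sphereLaplacian_eq hf]

end TrappedWave

namespace TrappedWave

open Set Filter Topology ComplexConjugate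

/-! ### Algebra of smooth functions on the sphere -/

variable {f g : S2 → ℂ}

lemma eventually_ne_zero {y : E3} (hy : y ≠ 0) : ∀ᶠ z in 𝓝 y, z ≠ (0 : E3) :=
  isOpen_ne.mem_nhds hy

lemma radialExt_comp₂ (φ : ℂ → ℂ → ℂ) (f g : S2 → ℂ) {y : E3} (hy : y ≠ 0) :
    radialExt (fun θ => φ (f θ) (g θ)) =ᶠ[𝓝 y] fun z => φ (radialExt f z) (radialExt g z) := by
  filter_upwards [eventually_ne_zero hy] with z hz
  simp only [radialExt_eq _ hz]

lemma radialExt_comp (φ : ℂ → ℂ) (f : S2 → ℂ) {y : E3} (hy : y ≠ 0) :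
    radialExt (fun θ => φ (f θ)) =ᶠ[𝓝 y] fun z => φ (radialExt f z) := by
  filter_upwards [eventually_ne_zero hy] with z hz
  simp only [radialExt_eq _ hz]

lemma smoothSph_const (c : ℂ) : SmoothSph (fun _ => c) := fun _ hy =>
  contDiffAt_const.congr_of_eventuallyEq (radialExt_comp (fun _ => c) (fun _ => 0) hy)

lemma SmoothSph.add (hf : SmoothSph f) (hg : SmoothSph g) : SmoothSph (fun θ => f θ + g θ) :=
  fun y hy => ((hf y hy).add (hg y hy)).congr_of_eventuallyEq (radialExt_comp₂ (· + ·) f g hy)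

lemma SmoothSph.mul (hf : SmoothSph f) (hg : SmoothSph g) : SmoothSph (fun θ => f θ * g θ) :=
  fun y hy => ((hf y hy).mul (hg y hy)).congr_of_eventuallyEq (radialExt_comp₂ (· * ·) f g hy)

lemma SmoothSph.conj (hf : SmoothSph f) : SmoothSph (fun θ => conj (f θ)) :=
  fun y hy => (Complex.conjCLE.contDiff.contDiffAt.comp y (hf y hy)).congr_of_eventuallyEq
    (radialExt_comp conj f hy)

lemma SmoothSph.const_mul (hf : SmoothSph f) (c : ℂ) : SmoothSph (fun θ => c * f θ) :=
  (smoothSph_const c).mul hf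

lemma SmoothSph.sum {ι : Type*} (s : Finset ι) {F : ι → S2 → ℂ} (h : ∀ i ∈ s, SmoothSph (F i)) :
    SmoothSph (fun θ => ∑ i ∈ s, F i θ) := by
  classical
  induction s using Finset.induction_on with
  | empty => simpa using smoothSph_const 0
  | insert a s ha ih =>
    simp only [Finset.sum_insert ha]
    exact (h a (by simp)).add (ih fun i hi => h i (by simp [hi]))

lemma SmoothSph.continuous (hf : SmoothSph f) : Continuous f := by
  have h : Continuous fun θ : S2 => radialExt f (θ : E3) := by
    rw [continuous_iff_continuousAt]
    intro θ
    exact ContinuousAt.comp (f := fun θ : S2 => (θ : E3)) (hf _ (sphere_ne_zero θ)).continuousAt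
      continuous_subtype_val.continuousAt
  simpa [radialExt_sphere] using h

lemma SmoothSph.continuous_gradComp (hf : SmoothSph f) (i : Fin 3) : Continuous (gradComp i f) := by
  rw [continuous_iff_continuousAt]
  intro θ
  exact ContinuousAt.comp (f := fun θ : S2 => (θ : E3))
    (hf.contDiffAt_pd i (sphere_ne_zero θ)).continuousAt continuous_subtype_val.continuousAt

lemma SmoothSph.continuous_laplacian (hf : SmoothSph f) : Continuous (sphereLaplacian f) := by
  have : sphereLaplacian f = fun θ : S2 => ∑ i, pd i (pd i (radialExt f)) θ :=
    funext fun θ => sphereLaplacian_eq hf θ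
  rw [this]
  refine continuous_finsetSum _ fun i _ => ?_
  rw [continuous_iff_continuousAt]
  intro θ
  have h : ContDiffAt ℝ ∞ (pd i (pd i (radialExt f))) (θ : E3) :=
    ((hf.contDiffAt_pd i (sphere_ne_zero θ)).fderiv_right (m := ∞) (by simp)).clm_apply
      contDiffAt_const
  exact ContinuousAt.comp (f := fun θ : S2 => (θ : E3)) h.continuousAt
    continuous_subtype_val.continuousAt

lemma pd_add {F G : E3 → ℂ} {y : E3} (i : Fin 3) (hF : DifferentiableAt ℝ F y)
    (hG : DifferentiableAt ℝ G y) : pd i (fun z => F z + G z) y = pd i F y + pd i G y := by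
  simp [pd, fderiv_fun_add hF hG]

lemma pd_mul {F G : E3 → ℂ} {y : E3} (i : Fin 3) (hF : DifferentiableAt ℝ F y)
    (hG : DifferentiableAt ℝ G y) :
    pd i (fun z => F z * G z) y = F y * pd i G y + G y * pd i F y := by
  simp [pd, fderiv_fun_mul hF hG]

lemma pd_congr {F G : E3 → ℂ} {y : E3} (i : Fin 3) (h : F =ᶠ[𝓝 y] G) : pd i F y = pd i G y := by
  simp [pd, h.fderiv_eq]

lemma pd_congr_nhds {F G : E3 → ℂ} {y : E3} (i : Fin 3) (h : F =ᶠ[𝓝 y] G) :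
    pd i F =ᶠ[𝓝 y] pd i G := by
  filter_upwards [h.fderiv (𝕜 := ℝ)] with z hz
  simp [pd, hz]

lemma pd_conj {F : E3 → ℂ} {y : E3} (i : Fin 3) (hF : DifferentiableAt ℝ F y) :
    pd i (fun z => conj (F z)) y = conj (pd i F y) := by
  have h := (Complex.conjCLE : ℂ ≃L[ℝ] ℂ).hasFDerivAt.comp y hF.hasFDerivAt
  have h2 := h.fderiv
  unfold pd
  change fderiv ℝ (Complex.conjCLE ∘ F) y _ = _
  rw [h2]
  simp

lemma gradComp_add (hf : SmoothSph f) (hg : SmoothSph g) (i : Fin 3) (θ : S2) :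
    gradComp i (fun θ => f θ + g θ) θ = gradComp i f θ + gradComp i g θ := by
  have hy := sphere_ne_zero θ
  rw [gradComp_eq_pd, pd_congr i (radialExt_comp₂ (· + ·) f g hy),
    pd_add i (hf.differentiableAt hy) (hg.differentiableAt hy)]
  rfl

lemma gradComp_mul (hf : SmoothSph f) (hg : SmoothSph g) (i : Fin 3) (θ : S2) :
    gradComp i (fun θ => f θ * g θ) θ = f θ * gradComp i g θ + g θ * gradComp i f θ := by
  have hy := sphere_ne_zero θ
  rw [gradComp_eq_pd, pd_congr i (radialExt_comp₂ (· * ·) f g hy),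
    pd_mul i (hf.differentiableAt hy) (hg.differentiableAt hy), radialExt_sphere, radialExt_sphere]
  rfl

lemma gradComp_conj (hf : SmoothSph f) (i : Fin 3) (θ : S2) :
    gradComp i (fun θ => conj (f θ)) θ = conj (gradComp i f θ) := by
  have hy := sphere_ne_zero θ
  rw [gradComp_eq_pd, pd_congr i (radialExt_comp conj f hy), pd_conj i (hf.differentiableAt hy)]
  rfl

lemma gradComp_const (c : ℂ) (i : Fin 3) (θ : S2) : gradComp i (fun _ => c) θ = 0 := by
  have hy := sphere_ne_zero θ
  rw [gradComp_eq_pd, pd_congr i (radialExt_comp (fun _ => c) (fun _ => 0) hy)]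
  simp [pd]

lemma gradComp_const_mul (hf : SmoothSph f) (c : ℂ) (i : Fin 3) (θ : S2) :
    gradComp i (fun θ => c * f θ) θ = c * gradComp i f θ := by
  rw [gradComp_mul (smoothSph_const c) hf, gradComp_const]; ring

lemma sphereLaplacian_add (hf : SmoothSph f) (hg : SmoothSph g) (θ : S2) :
    sphereLaplacian (fun θ => f θ + g θ) θ = sphereLaplacian f θ + sphereLaplacian g θ := by
  have hy := sphere_ne_zero θ
  rw [sphereLaplacian_eq (hf.add hg), sphereLaplacian_eq hf, sphereLaplacian_eq hg,
    ← Finset.sum_add_distrib]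
  refine Finset.sum_congr rfl fun i _ => ?_
  rw [pd_congr i (pd_congr_nhds i (radialExt_comp₂ (· + ·) f g hy))]
  rw [← pd_add i (hf.differentiableAt_pd i hy) (hg.differentiableAt_pd i hy)]
  apply pd_congr
  filter_upwards [eventually_ne_zero hy] with z hz
  exact pd_add i (hf.differentiableAt hz) (hg.differentiableAt hz)

lemma sphereLaplacian_mul (hf : SmoothSph f) (hg : SmoothSph g) (θ : S2) :
    sphereLaplacian (fun θ => f θ * g θ) θ
      = f θ * sphereLaplacian g θ + g θ * sphereLaplacian f θ
        + 2 * ∑ i, gradComp i f θ * gradComp i g θ := by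
  have hy := sphere_ne_zero θ
  rw [sphereLaplacian_eq (hf.mul hg), sphereLaplacian_eq hf, sphereLaplacian_eq hg,
    Finset.mul_sum, Finset.mul_sum, Finset.mul_sum, ← Finset.sum_add_distrib,
    ← Finset.sum_add_distrib]
  refine Finset.sum_congr rfl fun i _ => ?_
  have dF := hf.differentiableAt hy
  have dG := hg.differentiableAt hy
  have dF1 := hf.differentiableAt_pd i hy
  have dG1 := hg.differentiableAt_pd i hy
  rw [pd_congr i (pd_congr_nhds i (radialExt_comp₂ (· * ·) f g hy))]
  have h1 : pd i (fun z => radialExt f z * radialExt g z) =ᶠ[𝓝 (θ : E3)]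
      fun z => radialExt f z * pd i (radialExt g) z + radialExt g z * pd i (radialExt f) z := by
    filter_upwards [eventually_ne_zero hy] with z hz
    exact pd_mul i (hf.differentiableAt hz) (hg.differentiableAt hz)
  rw [pd_congr i h1, pd_add i (dF.fun_mul dG1) (dG.fun_mul dF1), pd_mul i dF dG1, pd_mul i dG dF1,
    radialExt_sphere, radialExt_sphere, gradComp_eq_pd, gradComp_eq_pd]
  ring

lemma sphereLaplacian_const (c : ℂ) (θ : S2) : sphereLaplacian (fun _ => c) θ = 0 := by
  have hy := sphere_ne_zero θ
  rw [sphereLaplacian_eq (smoothSph_const c)]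
  refine Finset.sum_eq_zero fun i _ => ?_
  rw [pd_congr i (pd_congr_nhds i (radialExt_comp (fun _ => c) (fun _ => 0) hy))]
  have : pd i (fun _ : E3 => c) = fun _ => 0 := by funext z; simp [pd]
  rw [this]
  simp [pd]

lemma sphereLaplacian_const_mul (hf : SmoothSph f) (c : ℂ) (θ : S2) :
    sphereLaplacian (fun θ => c * f θ) θ = c * sphereLaplacian f θ := by
  rw [sphereLaplacian_mul (smoothSph_const c) hf, sphereLaplacian_const]
  simp [gradComp_const]

lemma sphereLaplacian_conj (hf : SmoothSph f) (θ : S2) :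
    sphereLaplacian (fun θ => conj (f θ)) θ = conj (sphereLaplacian f θ) := by
  have hy := sphere_ne_zero θ
  rw [sphereLaplacian_eq hf.conj, sphereLaplacian_eq hf, map_sum]
  refine Finset.sum_congr rfl fun i _ => ?_
  rw [pd_congr i (pd_congr_nhds i (radialExt_comp conj f hy)),
    ← pd_conj i (hf.differentiableAt_pd i hy)]
  apply pd_congr
  filter_upwards [eventually_ne_zero hy] with z hz
  exact pd_conj i (hf.differentiableAt hz)

/-! ### Coordinate functions -/

/-- The coordinate functions on the sphere. -/
def coordFun (i : Fin 3) (θ : S2) : ℂ := ((θ : E3) i : ℂ)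

/-- The inverse of the norm, as a complex-valued function. -/
def invNorm (y : E3) : ℂ := ((‖y‖⁻¹ : ℝ) : ℂ)

/-- The coordinates, as complex-valued functions on three-space. -/
def coordE (i : Fin 3) (y : E3) : ℂ := ((y i : ℝ) : ℂ)

lemma contDiff_coordE (i : Fin 3) : ContDiff ℝ ∞ (coordE i) := by
  have : ContDiff ℝ ∞ fun y : E3 => y i := by fun_prop
  exact Complex.ofRealCLM.contDiff.comp this

lemma contDiffAt_invNorm {y : E3} (hy : y ≠ 0) : ContDiffAt ℝ ∞ invNorm y :=
  Complex.ofRealCLM.contDiff.contDiffAt.comp y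
    ((contDiffAt_norm ℝ hy).inv (norm_ne_zero_iff.mpr hy))

lemma pd_coordE (i j : Fin 3) (y : E3) : pd j (coordE i) y = if i = j then 1 else 0 := by
  have h1 : HasFDerivAt (fun y : E3 => y i) (EuclideanSpace.proj i : E3 →L[ℝ] ℝ) y :=
    (EuclideanSpace.proj i : E3 →L[ℝ] ℝ).hasFDerivAt
  have h2 := (Complex.ofRealCLM.hasFDerivAt).comp y h1
  unfold pd
  change fderiv ℝ (Complex.ofRealCLM ∘ fun y : E3 => y i) y _ = _
  rw [h2.fderiv]
  by_cases h : i = j <;> simp [h]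

lemma pd_invNorm (j : Fin 3) {y : E3} (hy : y ≠ 0) :
    pd j invNorm y = -(coordE j y * invNorm y ^ 3) := by
  have hn : ‖y‖ ≠ 0 := norm_ne_zero_iff.mpr hy
  have h1 : HasFDerivAt (fun y : E3 => ‖y‖ ^ 2) (2 • (innerSL ℝ y)) y :=
    (hasStrictFDerivAt_norm_sq y).hasFDerivAt
  have h2 := h1.sqrt (by positivity)
  simp only [Real.sqrt_sq (norm_nonneg _)] at h2
  have h3 := (hasDerivAt_inv hn).comp_hasFDerivAt y h2
  have h4 := (Complex.ofRealCLM.hasFDerivAt).comp y h3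
  unfold pd
  change fderiv ℝ (Complex.ofRealCLM ∘ ((fun y => y⁻¹) ∘ fun y : E3 => ‖y‖)) y _ = _
  rw [h4.fderiv]
  have hn' : (‖y‖ : ℂ) ≠ 0 := by exact_mod_cast hn
  simp [coordE, invNorm, PiLp.inner_apply]
  field_simp

lemma radialExt_coordFun {y : E3} (hy : y ≠ 0) (i : Fin 3) :
    radialExt (coordFun i) y = coordE i y * invNorm y := by
  rw [radialExt_eq _ hy, coordFun, radialProj_coe hy]
  simp [coordE, invNorm]
  ring

lemma radialExt_coordFun_nhds {y : E3} (hy : y ≠ 0) (i : Fin 3) :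
    radialExt (coordFun i) =ᶠ[𝓝 y] fun z => coordE i z * invNorm z := by
  filter_upwards [eventually_ne_zero hy] with z hz using radialExt_coordFun hz i

lemma smoothSph_coordFun (i : Fin 3) : SmoothSph (coordFun i) := fun _ hy =>
  ((contDiff_coordE i).contDiffAt.mul (contDiffAt_invNorm hy)).congr_of_eventuallyEq
    (radialExt_coordFun_nhds hy i)

lemma pd_coordE_mul_invNorm (i j : Fin 3) {y : E3} (hy : y ≠ 0) :
    pd j (fun z => coordE i z * invNorm z) y
      = (if i = j then 1 else 0) * invNorm y - coordE i y * coordE j y * invNorm y ^ 3 := by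
  rw [pd_mul j ((contDiff_coordE i).differentiable (by simp) y)
    ((contDiffAt_invNorm hy).differentiableAt (by simp)), pd_coordE, pd_invNorm j hy]
  ring

lemma invNorm_sphere (θ : S2) : invNorm (θ : E3) = 1 := by simp [invNorm]

lemma gradComp_coordFun (i j : Fin 3) (θ : S2) :
    gradComp j (coordFun i) θ = (if i = j then 1 else 0) - coordFun i θ * coordFun j θ := by
  have hy := sphere_ne_zero θ
  rw [gradComp_eq_pd, pd_congr j (radialExt_coordFun_nhds hy i), pd_coordE_mul_invNorm i j hy,
    invNorm_sphere]
  simp [coordE, coordFun]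

lemma sum_coordFun_sq (θ : S2) : ∑ i, coordFun i θ * coordFun i θ = 1 := by
  have h := sphere_norm θ
  have h2 : ‖(θ : E3)‖ ^ 2 = 1 := by rw [h]; norm_num
  rw [EuclideanSpace.norm_sq_eq] at h2
  simp only [Real.norm_eq_abs, sq_abs] at h2
  simp only [coordFun]
  have h3 := congrArg (fun r : ℝ => (r : ℂ)) h2
  push_cast at h3
  rw [← h3]
  exact Finset.sum_congr rfl fun i _ => by ring

lemma sphereLaplacian_coordFun (i : Fin 3) (θ : S2) :
    sphereLaplacian (coordFun i) θ = -2 * coordFun i θ := by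
  have hy := sphere_ne_zero θ
  rw [sphereLaplacian_eq (smoothSph_coordFun i)]
  have key : ∀ j, pd j (pd j (radialExt (coordFun i))) θ
      = (if i = j then 1 else 0) * (-coordFun j θ)
        + (-((if i = j then 1 else 0) * coordFun j θ + coordFun i θ)
          + 3 * coordFun i θ * (coordFun j θ * coordFun j θ)) := by
    intro j
    have h1 : pd j (radialExt (coordFun i)) =ᶠ[𝓝 (θ : E3)] fun z =>
        (if i = j then 1 else 0) * invNorm z
          + (-1 : ℂ) * ((coordE i z * coordE j z) * (invNorm z * (invNorm z * invNorm z))) := by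
      filter_upwards [eventually_ne_zero hy, pd_congr_nhds j (radialExt_coordFun_nhds hy i)]
        with z hz h
      rw [h, pd_coordE_mul_invNorm i j hz]
      ring
    have dN : DifferentiableAt ℝ invNorm (θ : E3) :=
      (contDiffAt_invNorm hy).differentiableAt (by simp)
    have dC : ∀ k, DifferentiableAt ℝ (coordE k) (θ : E3) := fun k =>
      (contDiff_coordE k).differentiable (by simp) _
    have dc : ∀ c : ℂ, DifferentiableAt ℝ (fun _ : E3 => c) (θ : E3) := fun c =>
      differentiableAt_const c
    have pc : ∀ c : ℂ, pd j (fun _ : E3 => c) (θ : E3) = 0 := fun c => by simp [pd]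
    have dN2 := dN.fun_mul dN
    have dN3 := dN.fun_mul dN2
    have dC2 := (dC i).fun_mul (dC j)
    rw [pd_congr j h1, pd_add j ((dc _).fun_mul dN) ((dc _).fun_mul (dC2.fun_mul dN3)),
      pd_mul j (dc _) dN, pd_mul j (dc _) (dC2.fun_mul dN3), pd_mul j dC2 dN3, pd_mul j (dC i) (dC j),
      pd_mul j dN dN2, pd_mul j dN dN, pc, pc, pd_coordE, pd_coordE, pd_invNorm j hy,
      invNorm_sphere]
    have hc : ∀ k, coordE k (θ : E3) = coordFun k θ := fun k => rfl
    simp only [hc]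
    simp only [if_true]
    ring
  simp only [key]
  rw [Finset.sum_add_distrib, Finset.sum_add_distrib, Finset.sum_neg_distrib,
    Finset.sum_add_distrib, ← Finset.mul_sum, sum_coordFun_sq]
  simp
  ring

end TrappedWave

namespace TrappedWave

open Set Filter Topology ComplexConjugate

/-! ### Polynomial functions on the sphere -/

variable {f g : S2 → ℂ}

/-- Multiplication by a coordinate. -/
def mulCoord (i : Fin 3) : (S2 → ℂ) →ₗ[ℂ] (S2 → ℂ) where
  toFun f θ := coordFun i θ * f θ
  map_add' f g := by funext θ; simp [mul_add]
  map_smul' c f := by funext θ; simp; ring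

/-- The restrictions to the sphere of the polynomials of degree at most `n`. -/
def polySph : ℕ → Submodule ℂ (S2 → ℂ)
  | 0 => Submodule.span ℂ {fun _ => 1}
  | n + 1 => polySph n ⊔ ⨆ i : Fin 3, (polySph n).map (mulCoord i)

lemma polySph_le_succ (n : ℕ) : polySph n ≤ polySph (n + 1) := le_sup_left

lemma polySph_mono : Monotone polySph := monotone_nat_of_le_succ polySph_le_succ

lemma mul_coord_mem {n : ℕ} (hf : f ∈ polySph n) (i : Fin 3) :
    (fun θ => coordFun i θ * f θ) ∈ polySph (n + 1) :=
  (le_sup_right : _ ≤ polySph (n + 1)) (Submodule.mem_iSup_of_mem i ⟨f, hf, rfl⟩)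

instance finiteDimensional_polySph (n : ℕ) : FiniteDimensional ℂ (polySph n) := by
  induction n with
  | zero =>
    exact (inferInstance : FiniteDimensional ℂ (Submodule.span ℂ {fun _ : S2 => (1 : ℂ)}))
  | succ n ih =>
    exact (inferInstance : FiniteDimensional ℂ
      ↥(polySph n ⊔ ⨆ i : Fin 3, (polySph n).map (mulCoord i)))

lemma smul_fun_eq (c : ℂ) (f : S2 → ℂ) : (c • f) = fun θ => c * f θ := rfl

lemma add_fun_eq (f g : S2 → ℂ) : (f + g) = fun θ => f θ + g θ := rfl

/-- The property used in the induction on the degree. -/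
def polyGood (n : ℕ) : Submodule ℂ (S2 → ℂ) where
  -- The Laplacian of a coordinate times p contains the pairing of their gradients, so the induction
  -- must carry that pairing too, one degree higher.
  carrier := {p | SmoothSph p ∧ sphereLaplacian p ∈ polySph n ∧
    ∀ i, (fun θ => ∑ j, gradComp j (coordFun i) θ * gradComp j p θ) ∈ polySph (n + 1)}
  zero_mem' := by
    have h0 : (0 : S2 → ℂ) = fun _ => 0 := rfl
    refine ⟨smoothSph_const 0, ?_, fun i => ?_⟩
    · have : sphereLaplacian (0 : S2 → ℂ) = 0 := by
        funext θ; rw [h0, sphereLaplacian_const]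
      rw [this]; exact Submodule.zero_mem _
    · have : (fun θ => ∑ j, gradComp j (coordFun i) θ * gradComp j (0 : S2 → ℂ) θ) = 0 := by
        funext θ
        rw [h0]
        simp [gradComp_const]
      rw [this]; exact Submodule.zero_mem _
  add_mem' := by
    rintro p q ⟨hp1, hp2, hp3⟩ ⟨hq1, hq2, hq3⟩
    refine ⟨hp1.add hq1, ?_, fun i => ?_⟩
    · have : sphereLaplacian (p + q) = sphereLaplacian p + sphereLaplacian q := by
        funext θ; rw [add_fun_eq, sphereLaplacian_add hp1 hq1]; rfl
      rw [this]; exact Submodule.add_mem _ hp2 hq2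
    · convert Submodule.add_mem _ (hp3 i) (hq3 i) using 1
      funext θ
      rw [add_fun_eq]
      simp only [gradComp_add hp1 hq1, Pi.add_apply, ← Finset.sum_add_distrib, mul_add]
  smul_mem' := by
    rintro c p ⟨hp1, hp2, hp3⟩
    refine ⟨hp1.const_mul c, ?_, fun i => ?_⟩
    · have : sphereLaplacian (c • p) = c • sphereLaplacian p := by
        funext θ; rw [smul_fun_eq, sphereLaplacian_const_mul hp1]; rfl
      rw [this]; exact Submodule.smul_mem _ _ hp2
    · convert Submodule.smul_mem _ c (hp3 i) using 1
      funext θ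
      rw [smul_fun_eq]
      simp only [gradComp_const_mul hp1, Pi.smul_apply, smul_eq_mul, Finset.mul_sum]
      exact Finset.sum_congr rfl fun j _ => by ring

lemma polyGood_le_succ (n : ℕ) : polyGood n ≤ polyGood (n + 1) := fun _ hp =>
  ⟨hp.1, polySph_le_succ n hp.2.1, fun i => polySph_le_succ _ (hp.2.2 i)⟩

/-- On the sphere Δx_k = -2x_k and ∇x_i·∇x_k = δ_ik - x_i x_k. With the product rule, multiplication
by one more coordinate therefore stays within polynomials of the expected degree. -/
lemma polySph_le_polyGood (n : ℕ) : polySph n ≤ polyGood n := by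
  induction n with
  | zero =>
    unfold polySph
    rw [Submodule.span_le, Set.singleton_subset_iff]
    refine ⟨smoothSph_const 1, ?_, fun i => ?_⟩
    · have : sphereLaplacian (fun _ : S2 => (1 : ℂ)) = 0 := by
        funext θ; rw [sphereLaplacian_const]; rfl
      rw [this]; exact Submodule.zero_mem _
    · have : (fun θ : S2 => ∑ j, gradComp j (coordFun i) θ * gradComp j (fun _ : S2 => (1 : ℂ)) θ)
          = 0 := by
        funext θ
        simp [gradComp_const]
      rw [this]; exact Submodule.zero_mem _
  | succ n ih =>
    refine sup_le (ih.trans (polyGood_le_succ n)) (iSup_le fun k => ?_)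
    rw [Submodule.map_le_iff_le_comap]
    intro q hq
    obtain ⟨hq1, hq2, hq3⟩ := ih hq
    have hX := smoothSph_coordFun k
    refine ⟨hX.mul hq1, ?_, fun i => ?_⟩
    · have h1 : sphereLaplacian (mulCoord k q) = (fun θ => coordFun k θ * sphereLaplacian q θ)
          + ((-2 : ℂ) • (fun θ => coordFun k θ * q θ)
            + (2 : ℂ) • (fun θ => ∑ j, gradComp j (coordFun k) θ * gradComp j q θ)) := by
        funext θ
        change sphereLaplacian (fun θ => coordFun k θ * q θ) θ = _
        rw [sphereLaplacian_mul hX hq1, sphereLaplacian_coordFun]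
        simp only [Pi.add_apply, Pi.smul_apply, smul_eq_mul]
        ring
      rw [h1]
      exact Submodule.add_mem _ (mul_coord_mem hq2 k) (Submodule.add_mem _
        (Submodule.smul_mem _ _ (mul_coord_mem hq k)) (Submodule.smul_mem _ _ (hq3 k)))
    · have h1 : (fun θ => ∑ j, gradComp j (coordFun i) θ * gradComp j (mulCoord k q) θ)
          = ((if i = k then (1 : ℂ) else 0) • q + (-1 : ℂ) • (fun θ => coordFun i θ * (coordFun k θ * q θ)))
            + (fun θ => coordFun k θ * (∑ j, gradComp j (coordFun i) θ * gradComp j q θ)) := by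
        funext θ
        have h2 : ∀ j, gradComp j (mulCoord k q) θ
            = coordFun k θ * gradComp j q θ + q θ * gradComp j (coordFun k) θ :=
          fun j => gradComp_mul hX hq1 j θ
        have h3 : ∑ j, gradComp j (coordFun i) θ * gradComp j (coordFun k) θ
            = (if i = k then 1 else 0) - coordFun i θ * coordFun k θ := by
          simp only [gradComp_coordFun, sub_mul, mul_sub, Finset.sum_sub_distrib]
          have e1 : ∑ j, coordFun i θ * coordFun j θ * (coordFun k θ * coordFun j θ)
              = coordFun i θ * coordFun k θ := by
            calc _ = coordFun i θ * coordFun k θ * ∑ j, coordFun j θ * coordFun j θ := by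
                  rw [Finset.mul_sum]; exact Finset.sum_congr rfl fun j _ => by ring
              _ = _ := by rw [sum_coordFun_sq, mul_one]
          rw [e1]
          simp [eq_comm, mul_comm]
        simp only [h2, mul_add, Finset.sum_add_distrib, Pi.add_apply, Pi.smul_apply, smul_eq_mul]
        have e2 : ∑ j, gradComp j (coordFun i) θ * (q θ * gradComp j (coordFun k) θ)
            = q θ * ((if i = k then 1 else 0) - coordFun i θ * coordFun k θ) := by
          rw [← h3, Finset.mul_sum]; exact Finset.sum_congr rfl fun j _ => by ring
        rw [e2, Finset.mul_sum]
        have e3 : ∑ j, gradComp j (coordFun i) θ * (coordFun k θ * gradComp j q θ)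
            = ∑ j, coordFun k θ * (gradComp j (coordFun i) θ * gradComp j q θ) :=
          Finset.sum_congr rfl fun j _ => by ring
        rw [e3]
        ring
      rw [h1]
      refine Submodule.add_mem _ (Submodule.add_mem _ (Submodule.smul_mem _ _ ?_)
        (Submodule.smul_mem _ _ ?_)) ?_
      · exact polySph_mono (by omega : n ≤ n + 1 + 1) hq
      · exact mul_coord_mem (mul_coord_mem hq k) i
      · exact mul_coord_mem (hq3 i) k

lemma smoothSph_of_mem {n : ℕ} (hf : f ∈ polySph n) : SmoothSph f := (polySph_le_polyGood n hf).1

lemma sphereLaplacian_mem {n : ℕ} (hf : f ∈ polySph n) : sphereLaplacian f ∈ polySph n :=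
  (polySph_le_polyGood n hf).2.1

/-! ### The Hilbert space of square-integrable functions -/

/-- The class of a continuous function in `L²`. -/
def toL2 (f : S2 → ℂ) : Lp ℂ 2 sphereMeasure :=
  open Classical in
  if h : Continuous f then ContinuousMap.toLp 2 sphereMeasure ℂ ⟨f, h⟩ else 0

lemma toL2_eq (hf : Continuous f) : toL2 f = ContinuousMap.toLp 2 sphereMeasure ℂ ⟨f, hf⟩ := by
  simp [toL2, hf]

lemma toL2_add (hf : Continuous f) (hg : Continuous g) :
    toL2 (fun θ => f θ + g θ) = toL2 f + toL2 g := by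
  rw [toL2_eq hf, toL2_eq hg, toL2_eq (f := fun θ => f θ + g θ) (by fun_prop), ← map_add]
  rfl

lemma toL2_const_mul (hf : Continuous f) (c : ℂ) : toL2 (fun θ => c * f θ) = c • toL2 f := by
  rw [toL2_eq hf, toL2_eq (f := fun θ => c * f θ) (by fun_prop), ← map_smul]
  rfl

lemma toL2_sub (hf : Continuous f) (hg : Continuous g) :
    toL2 (fun θ => f θ - g θ) = toL2 f - toL2 g := by
  rw [toL2_eq hf, toL2_eq hg, toL2_eq (f := fun θ => f θ - g θ) (by fun_prop), ← map_sub]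
  rfl

lemma toL2_sum {ι : Type*} (s : Finset ι) {F : ι → S2 → ℂ} (h : ∀ i, Continuous (F i)) :
    toL2 (fun θ => ∑ i ∈ s, F i θ) = ∑ i ∈ s, toL2 (F i) := by
  classical
  induction s using Finset.induction_on with
  | empty =>
    simp only [Finset.sum_empty]
    rw [toL2_eq continuous_const]
    exact map_zero _
  | insert a s ha ih =>
    simp only [Finset.sum_insert ha]
    rw [toL2_add (h a) (continuous_finsetSum _ fun i _ => h i), ih]

lemma inner_toL2 (hf : Continuous f) (hg : Continuous g) :
    inner ℂ (toL2 f) (toL2 g) = ∫ θ, conj (f θ) * g θ ∂sphereMeasure := by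
  rw [toL2_eq hf, toL2_eq hg, ContinuousMap.inner_toLp]
  exact integral_congr_ae (Eventually.of_forall fun θ => by simp [mul_comm])

lemma integrable_sphere {F : Type*} [NormedAddCommGroup F] {h : S2 → F} (hf : Continuous h) :
    Integrable h sphereMeasure :=
  hf.integrable_of_hasCompactSupport (HasCompactSupport.of_compactSpace h)

lemma norm_toL2_sq (hf : Continuous f) :
    ‖toL2 f‖ ^ 2 = ∫ θ, ‖f θ‖ ^ 2 ∂sphereMeasure := by
  have h := inner_self_eq_norm_sq_to_K (𝕜 := ℂ) (toL2 f)
  rw [inner_toL2 hf hf] at h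
  have h2 : ∫ θ, conj (f θ) * f θ ∂sphereMeasure = ((∫ θ, ‖f θ‖ ^ 2 ∂sphereMeasure : ℝ) : ℂ) := by
    rw [← integral_complex_ofReal]
    refine integral_congr_ae (Eventually.of_forall fun θ => ?_)
    simp only [Complex.conj_mul']
    push_cast; rfl
  rw [h2] at h
  have h3 : ((∫ θ, ‖f θ‖ ^ 2 ∂sphereMeasure : ℝ) : ℂ) = ((‖toL2 f‖ ^ 2 : ℝ) : ℂ) := by
    rw [h]; push_cast; rfl
  exact (Complex.ofReal_injective h3).symm

/-- The surface measure charges every nonempty open set, so a continuous function that vanishes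
almost everywhere vanishes. -/
lemma toL2_injective (hf : Continuous f) (h : toL2 f = 0) : f = 0 := by
  rw [toL2_eq hf] at h
  have h2 := ContinuousMap.toLp_injective (p := 2) (𝕜 := ℂ) (E := ℂ) sphereMeasure
    (a₁ := ⟨f, hf⟩) (a₂ := 0) (by rw [h, map_zero])
  exact congrArg (fun F : C(S2, ℂ) => (F : S2 → ℂ)) h2

/-! ### Spherical harmonics -/

/-- Coefficients of a function with respect to a family of functions. -/
def coeff (Y f : S2 → ℂ) : ℂ := ∫ θ, conj (Y θ) * f θ ∂sphereMeasure

lemma laplacian_symm (hf : SmoothSph f) (hg : SmoothSph g) :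
    ∫ θ, conj (f θ) * sphereLaplacian g θ ∂sphereMeasure
      = ∫ θ, conj (sphereLaplacian f θ) * g θ ∂sphereMeasure := by
  have h1 := integral_sphereLaplacian_mul hg hf.conj
  have h2 := integral_sphereLaplacian_mul hf.conj hg
  calc _ = ∫ θ, sphereLaplacian g θ * conj (f θ) ∂sphereMeasure :=
        integral_congr_ae (Eventually.of_forall fun θ => mul_comm _ _)
    _ = ∫ θ, sphereLaplacian (fun θ => conj (f θ)) θ * g θ ∂sphereMeasure := by
        rw [h1, h2]
        congr 1
        refine integral_congr_ae (Eventually.of_forall fun θ => ?_)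
        exact Finset.sum_congr rfl fun i _ => mul_comm _ _
    _ = _ := integral_congr_ae (Eventually.of_forall fun θ => by
        simp only [sphereLaplacian_conj hf])

lemma integral_laplacian_self (hf : SmoothSph f) :
    ∫ θ, conj (f θ) * sphereLaplacian f θ ∂sphereMeasure
      = -((∫ θ, sphereGradSq f θ ∂sphereMeasure : ℝ) : ℂ) := by
  have h1 := integral_sphereLaplacian_mul hf hf.conj
  calc _ = ∫ θ, sphereLaplacian f θ * conj (f θ) ∂sphereMeasure :=
        integral_congr_ae (Eventually.of_forall fun θ => mul_comm _ _)
    _ = _ := by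
        rw [h1, ← integral_complex_ofReal]
        congr 1
        refine integral_congr_ae (Eventually.of_forall fun θ => ?_)
        simp only [sphereGradSq_eq]
        push_cast
        refine Finset.sum_congr rfl fun i _ => ?_
        rw [gradComp_conj hf, Complex.mul_conj']

/-- An orthonormal eigenbasis of a space of polynomials on the sphere. -/
theorem exists_eigenbasis (n : ℕ) : ∃ (m : ℕ) (Y : Fin m → S2 → ℂ) (l : Fin m → ℝ),
    (∀ k, SmoothSph (Y k)) ∧ (∀ k θ, sphereLaplacian (Y k) θ = -(l k : ℂ) * Y k θ) ∧
    Orthonormal ℂ (fun k => toL2 (Y k)) ∧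
    (∀ p ∈ polySph n, ∃ a : Fin m → ℂ, p = fun θ => ∑ k, a k * Y k θ) := by
  have cont : ∀ p : polySph n, Continuous (p : S2 → ℂ) := fun p =>
    (smoothSph_of_mem p.2).continuous
  -- The L² product is pulled back to the space of polynomials; it is definite there because
  -- polynomials are continuous.
  let core : InnerProductSpace.Core ℂ (polySph n) :=
    { inner := fun p q => inner ℂ (toL2 (p : S2 → ℂ)) (toL2 (q : S2 → ℂ))
      conj_inner_symm := fun p q => inner_conj_symm _ _
      re_inner_nonneg := fun p => inner_self_nonneg
      add_left := fun p q r => by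
        have : toL2 ((p + q : polySph n) : S2 → ℂ) = toL2 p + toL2 q := toL2_add (cont p) (cont q)
        simp only [this, inner_add_left]
      smul_left := fun p q c => by
        have : toL2 ((c • p : polySph n) : S2 → ℂ) = c • toL2 p := toL2_const_mul (cont p) c
        simp only [this, inner_smul_left]
      definite := fun p hp => by
        have h1 : toL2 (p : S2 → ℂ) = 0 := inner_self_eq_zero.1 hp
        exact Subtype.ext (toL2_injective (cont p) h1) }
  let _ : NormedAddCommGroup (polySph n) := core.toNormedAddCommGroup
  let _ : InnerProductSpace ℂ (polySph n) := InnerProductSpace.ofCore core.toCore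
  have inner_def : ∀ p q : polySph n, inner ℂ p q = inner ℂ (toL2 (p : S2 → ℂ)) (toL2 (q : S2 → ℂ)) :=
    fun p q => rfl
  -- The Laplacian preserves this finite-dimensional space and is symmetric by Green's identity, so
  -- the spectral theorem provides the basis without any explicit harmonics.
  let T : polySph n →ₗ[ℂ] polySph n :=
    { toFun := fun p => ⟨sphereLaplacian p, sphereLaplacian_mem p.2⟩
      map_add' := fun p q => Subtype.ext (funext fun θ =>
        sphereLaplacian_add (smoothSph_of_mem p.2) (smoothSph_of_mem q.2) θ)
      map_smul' := fun c p => Subtype.ext (funext fun θ =>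
        sphereLaplacian_const_mul (smoothSph_of_mem p.2) c θ) }
  have hT : T.IsSymmetric := by
    intro p q
    rw [inner_def, inner_def, inner_toL2 (cont _) (cont _), inner_toL2 (cont _) (cont _)]
    exact (laplacian_symm (smoothSph_of_mem p.2) (smoothSph_of_mem q.2)).symm
  let b := hT.eigenvectorBasis rfl
  refine ⟨Module.finrank ℂ (polySph n), fun k => (b k : S2 → ℂ), fun k => -hT.eigenvalues rfl k,
    fun k => smoothSph_of_mem (b k).2, fun k θ => ?_, ?_, fun p hp => ?_⟩
  · have h := hT.apply_eigenvectorBasis rfl k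
    have h2 := congrArg (fun p : polySph n => (p : S2 → ℂ) θ) h
    push_cast
    rw [neg_neg]
    exact h2
  · have h := b.orthonormal
    rw [orthonormal_iff_ite] at h ⊢
    intro i j
    rw [← h i j]
    rfl
  · have h := b.sum_repr ⟨p, hp⟩
    refine ⟨fun k => b.repr ⟨p, hp⟩ k, ?_⟩
    have h2 := congrArg (fun p : polySph n => (p : S2 → ℂ)) h
    simp only at h2
    conv_lhs => rw [← h2]
    funext θ
    simp [Finset.sum_apply]

end TrappedWave

/-! ### Bessel inequalities for spherical harmonics. -/

namespace TrappedWave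

open Set Filter Topology ComplexConjugate

variable {f g : S2 → ℂ}

lemma coeff_eq_inner {Y : S2 → ℂ} (hY : Continuous Y) (hf : Continuous f) :
    coeff Y f = inner ℂ (toL2 Y) (toL2 f) := (inner_toL2 hY hf).symm

/-- A finite orthonormal family of eigenfunctions of the Laplacian on the sphere. -/
structure IsEigenFamily {m : ℕ} (Y : Fin m → S2 → ℂ) (l : Fin m → ℝ) : Prop where
  smooth : ∀ k, SmoothSph (Y k)
  eigen : ∀ k θ, sphereLaplacian (Y k) θ = -(l k : ℂ) * Y k θ
  orthonormal : Orthonormal ℂ (fun k => toL2 (Y k))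

namespace IsEigenFamily

variable {m : ℕ} {Y : Fin m → S2 → ℂ} {l : Fin m → ℝ}

lemma cont (h : IsEigenFamily Y l) (k : Fin m) : Continuous (Y k) := (h.smooth k).continuous

lemma sum_sq_coeff_le (h : IsEigenFamily Y l) (hf : Continuous f) :
    ∑ k, ‖coeff (Y k) f‖ ^ 2 ≤ ∫ θ, ‖f θ‖ ^ 2 ∂sphereMeasure := by
  rw [← norm_toL2_sq hf]
  simp only [coeff_eq_inner (h.cont _) hf]
  exact h.orthonormal.sum_inner_products_le (toL2 f)

lemma coeff_laplacian (h : IsEigenFamily Y l) (hf : SmoothSph f) (k : Fin m) :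
    coeff (Y k) (sphereLaplacian f) = -(l k : ℂ) * coeff (Y k) f := by
  rw [coeff, laplacian_symm (h.smooth k) hf, coeff, ← integral_const_mul]
  refine integral_congr_ae (Eventually.of_forall fun θ => ?_)
  simp only [h.eigen, map_mul, map_neg, Complex.conj_ofReal, mul_assoc]

lemma eigenvalue_nonneg (h : IsEigenFamily Y l) (k : Fin m) : 0 ≤ l k := by
  have h1 := integral_laplacian_self (h.smooth k)
  have h2 := h.coeff_laplacian (h.smooth k) k
  rw [coeff] at h2
  rw [h2, coeff_eq_inner (h.cont k) (h.cont k),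
    inner_self_eq_norm_sq_to_K, h.orthonormal.1 k] at h1
  have h3 : (l k : ℂ) = ((∫ θ, sphereGradSq (Y k) θ ∂sphereMeasure : ℝ) : ℂ) := by
    simpa using h1
  rw [Complex.ofReal_injective h3]
  exact integral_nonneg fun θ => Finset.sum_nonneg fun i _ => by positivity

/-- Complete the square in each coefficient: the orthogonal projection is the best approximation in
the span. -/
lemma norm_sub_sq (h : IsEigenFamily Y l) (v : Lp ℂ 2 sphereMeasure) (a : Fin m → ℂ) :
    ‖v‖ ^ 2 - ∑ k, ‖inner ℂ (toL2 (Y k)) v‖ ^ 2 ≤ ‖v - ∑ k, a k • toL2 (Y k)‖ ^ 2 := by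
  set s : Lp ℂ 2 sphereMeasure := ∑ k, a k • toL2 (Y k) with hs
  have h1 : ‖v - s‖ ^ 2 = ‖v‖ ^ 2 - 2 * RCLike.re (inner ℂ v s) + ‖s‖ ^ 2 := by
    rw [@_root_.norm_sub_sq ℂ]
  have h2 : inner ℂ v s = ∑ k, a k * conj (inner ℂ (toL2 (Y k)) v) := by
    rw [hs, inner_sum]
    exact Finset.sum_congr rfl fun k _ => by rw [inner_smul_right, inner_conj_symm]
  have h3 : ‖s‖ ^ 2 = ∑ k, ‖a k‖ ^ 2 := by
    have h4 : inner ℂ s s = ∑ k, conj (a k) * a k := by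
      rw [hs]; exact h.orthonormal.inner_sum a a Finset.univ
    have h5 := inner_self_eq_norm_sq (𝕜 := ℂ) s
    rw [h4] at h5
    rw [← h5, map_sum]
    exact Finset.sum_congr rfl fun k _ => by
      rw [Complex.conj_mul', ← Complex.ofReal_pow]; exact (Complex.ofReal_re _).symm
  rw [h1, h2, h3, map_sum]
  have h6 : ∀ k, 2 * RCLike.re (a k * conj (inner ℂ (toL2 (Y k)) v)) - ‖a k‖ ^ 2
      ≤ ‖inner ℂ (toL2 (Y k)) v‖ ^ 2 := by
    intro k
    have := sq_nonneg ‖inner ℂ (toL2 (Y k)) v - a k‖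
    rw [@norm_sub_sq_real ℂ] at this
    have h7 : inner ℝ (inner ℂ (toL2 (Y k)) v) (a k)
        = RCLike.re (a k * conj (inner ℂ (toL2 (Y k)) v)) := by
      rw [Complex.inner]; simp
    rw [h7] at this
    linarith
  have := Finset.sum_le_sum fun k (_ : k ∈ Finset.univ) => h6 k
  rw [Finset.sum_sub_distrib, ← Finset.mul_sum] at this
  linarith

/-- The Dirichlet energy of the remainder f - Σ c_k Y_k is nonnegative, and expanding it with the
symmetry of the Laplacian gives exactly the difference of the two sides. -/
lemma sum_eigenvalue_mul_sq_coeff_le (h : IsEigenFamily Y l) (hf : SmoothSph f) :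
    ∑ k, l k * ‖coeff (Y k) f‖ ^ 2 ≤ ∫ θ, sphereGradSq f θ ∂sphereMeasure := by
  set c : Fin m → ℂ := fun k => coeff (Y k) f with hc
  set g : S2 → ℂ := fun θ => f θ + ∑ k, -c k * Y k θ with hg
  have hS : SmoothSph (fun θ => ∑ k, -c k * Y k θ) :=
    SmoothSph.sum _ fun k _ => (h.smooth k).const_mul _
  have hgS : SmoothSph g := hf.add hS
  have hLsum : ∀ θ, sphereLaplacian (fun θ => ∑ k, -c k * Y k θ) θ
      = ∑ k, (c k * l k) * Y k θ := by
    have key : ∀ (s : Finset (Fin m)) θ, sphereLaplacian (fun θ => ∑ k ∈ s, -c k * Y k θ) θ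
        = ∑ k ∈ s, (c k * l k) * Y k θ := by
      intro s θ
      classical
      induction s using Finset.induction_on with
      | empty => simpa using sphereLaplacian_const 0 θ
      | insert a s ha ih =>
        simp only [Finset.sum_insert ha]
        rw [sphereLaplacian_add ((h.smooth a).const_mul _)
          (SmoothSph.sum _ fun k _ => (h.smooth k).const_mul _), ih,
          sphereLaplacian_const_mul (h.smooth a), h.eigen]
        ring
    exact key Finset.univ
  have hLg : sphereLaplacian g = fun θ => sphereLaplacian f θ + ∑ k, (c k * l k) * Y k θ := by
    funext θ; rw [hg, sphereLaplacian_add hf hS, hLsum]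
  have e1 : ∀ d : Fin m → ℂ, toL2 (fun θ => ∑ k, d k * Y k θ) = ∑ k, d k • toL2 (Y k) := by
    intro d
    rw [toL2_sum (F := fun k θ => d k * Y k θ) Finset.univ
      (fun k => continuous_const.mul (h.cont k))]
    exact Finset.sum_congr rfl fun k _ => toL2_const_mul (h.cont k) _
  have contsum : ∀ d : Fin m → ℂ, Continuous (fun θ => ∑ k, d k * Y k θ) := fun d =>
    continuous_finsetSum _ fun k _ => continuous_const.mul (h.cont k)
  have h1 := integral_laplacian_self hgS
  have h2 := integral_laplacian_self hf
  rw [← inner_toL2 hgS.continuous hgS.continuous_laplacian, hLg,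
    toL2_add hf.continuous_laplacian (contsum _), hg, toL2_add hf.continuous (contsum _), e1, e1,
    inner_add_left, inner_add_right, inner_add_right, h.orthonormal.inner_sum,
    inner_toL2 hf.continuous hf.continuous_laplacian, h2, inner_sum, sum_inner] at h1
  have e2 : ∀ k, inner ℂ (toL2 f) ((c k * l k) • toL2 (Y k)) = ((l k * ‖c k‖ ^ 2 : ℝ) : ℂ) := by
    intro k
    rw [inner_smul_right, ← inner_conj_symm, ← coeff_eq_inner (h.cont k) hf.continuous]
    have := Complex.mul_conj' (c k)
    push_cast
    rw [← this]; ring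
  have e3 : ∀ k, inner ℂ (-c k • toL2 (Y k)) (toL2 (sphereLaplacian f))
      = ((l k * ‖c k‖ ^ 2 : ℝ) : ℂ) := by
    intro k
    rw [inner_smul_left, ← coeff_eq_inner (h.cont k) hf.continuous_laplacian,
      h.coeff_laplacian hf]
    have := Complex.mul_conj' (c k)
    push_cast
    rw [← this, map_neg]; ring
  have e4 : ∀ k, conj (-c k) * (c k * l k) = -((l k * ‖c k‖ ^ 2 : ℝ) : ℂ) := by
    intro k
    have := Complex.mul_conj' (c k)
    push_cast
    rw [← this, map_neg]; ring
  simp only [e2, e3, e4, Finset.sum_neg_distrib, ← Complex.ofReal_sum] at h1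
  have h3 : 0 ≤ ∫ θ, sphereGradSq g θ ∂sphereMeasure :=
    integral_nonneg fun θ => Finset.sum_nonneg fun i _ => by positivity
  have h4 : -(∫ θ, sphereGradSq f θ ∂sphereMeasure) + ∑ k, l k * ‖c k‖ ^ 2
      = -∫ θ, sphereGradSq g θ ∂sphereMeasure := by
    have := congrArg Complex.re h1
    simp only [Complex.add_re, Complex.neg_re, Complex.ofReal_re] at this
    linarith
  linarith

end IsEigenFamily

/-! ### Completeness -/

lemma one_mem_polySph : (fun _ : S2 => (1 : ℂ)) ∈ polySph 0 :=
  (Submodule.subset_span rfl : _ ∈ Submodule.span ℂ {fun _ : S2 => (1 : ℂ)})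

lemma mul_mem_polySph {m n : ℕ} {p q : S2 → ℂ} (hp : p ∈ polySph m) (hq : q ∈ polySph n) :
    (fun θ => p θ * q θ) ∈ polySph (m + n) := by
  let M : (S2 → ℂ) →ₗ[ℂ] (S2 → ℂ) :=
    { toFun := fun p θ => p θ * q θ
      map_add' := fun a b => by funext θ; simp [add_mul]
      map_smul' := fun c a => by funext θ; simp [mul_assoc] }
  have key : ∀ m, polySph m ≤ (polySph (m + n)).comap M := by
    intro m
    induction m with
    | zero =>
      refine Submodule.span_le.2 (Set.singleton_subset_iff.2 ?_)
      change (fun θ => 1 * q θ) ∈ polySph (0 + n)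
      simpa using hq
    | succ m ih =>
      refine sup_le (ih.trans (Submodule.comap_mono (polySph_mono (by omega)))) (iSup_le fun i => ?_)
      rw [Submodule.map_le_iff_le_comap]
      intro r hr
      have h1 : M (mulCoord i r) = fun θ => coordFun i θ * M r θ := by
        funext θ; exact mul_assoc _ _ _
      change M (mulCoord i r) ∈ polySph (m + 1 + n)
      rw [h1, add_right_comm]
      exact mul_coord_mem (ih hr) i
  exact key m hp

lemma conj_mem_polySph {n : ℕ} {p : S2 → ℂ} (hp : p ∈ polySph n) :
    (fun θ => conj (p θ)) ∈ polySph n := by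
  let M : (S2 → ℂ) →ₛₗ[starRingEnd ℂ] (S2 → ℂ) :=
    { toFun := fun p θ => conj (p θ)
      map_add' := fun a b => by funext θ; simp
      map_smul' := fun c a => by funext θ; simp }
  have key : ∀ n, polySph n ≤ (polySph n).comap M := by
    intro n
    induction n with
    | zero =>
      refine Submodule.span_le.2 (Set.singleton_subset_iff.2 ?_)
      change (fun _ : S2 => conj (1 : ℂ)) ∈ polySph 0
      simp only [map_one]
      exact one_mem_polySph
    | succ n ih =>
      refine sup_le (ih.trans (Submodule.comap_mono (polySph_le_succ n))) (iSup_le fun i => ?_)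
      rw [Submodule.map_le_iff_le_comap]
      intro r hr
      have h1 : M (mulCoord i r) = fun θ => coordFun i θ * M r θ := by
        funext θ
        change conj (coordFun i θ * r θ) = coordFun i θ * conj (r θ)
        simp [coordFun]
      change M (mulCoord i r) ∈ polySph (n + 1)
      rw [h1]
      exact mul_coord_mem (ih hr) i
  exact key n hp

/-- The polynomial functions as a star subalgebra of the continuous functions. -/
def polyStar : StarSubalgebra ℂ C(S2, ℂ) where
  carrier := {F | ∃ n, (F : S2 → ℂ) ∈ polySph n}
  mul_mem' := by
    rintro F G ⟨m, hF⟩ ⟨n, hG⟩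
    exact ⟨m + n, mul_mem_polySph hF hG⟩
  add_mem' := by
    rintro F G ⟨m, hF⟩ ⟨n, hG⟩
    exact ⟨m + n, Submodule.add_mem _ (polySph_mono (by omega : m ≤ m + n) hF)
      (polySph_mono (by omega : n ≤ m + n) hG)⟩
  algebraMap_mem' c := by
    refine ⟨0, ?_⟩
    have : (algebraMap ℂ C(S2, ℂ) c : S2 → ℂ) = c • fun _ => (1 : ℂ) := by
      funext θ; simp [algebraMap_apply]
    rw [this]
    exact Submodule.smul_mem _ _ (Submodule.subset_span rfl)
  star_mem' := by
    rintro F ⟨n, hF⟩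
    exact ⟨n, conj_mem_polySph hF⟩

/-- Stone-Weierstrass: the polynomials form a star subalgebra, and the coordinates separate points.
-/
lemma exists_polySph_near (hf : Continuous f) {δ : ℝ} (hδ : 0 < δ) :
    ∃ n, ∃ p ∈ polySph n, ∀ θ, ‖f θ - p θ‖ ≤ δ := by
  have hsep : polyStar.SeparatesPoints := by
    intro θ₁ θ₂ hne
    have : ∃ i : Fin 3, (θ₁ : E3) i ≠ (θ₂ : E3) i := by
      by_contra! hcon
      exact hne (Subtype.ext (by ext i; exact hcon i))
    obtain ⟨i, hi⟩ := this
    refine ⟨coordFun i, ⟨⟨coordFun i, (smoothSph_coordFun i).continuous⟩, ⟨1, ?_⟩, rfl⟩, ?_⟩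
    · have := mul_coord_mem one_mem_polySph i
      simpa using this
    · simpa [coordFun] using hi
  have htop := ContinuousMap.starSubalgebra_topologicalClosure_eq_top_of_separatesPoints polyStar hsep
  have hmem : (⟨f, hf⟩ : C(S2, ℂ)) ∈ polyStar.topologicalClosure := by rw [htop]; trivial
  have hcl : (⟨f, hf⟩ : C(S2, ℂ)) ∈ closure (polyStar : Set C(S2, ℂ)) := hmem
  obtain ⟨P, ⟨n, hP⟩, hd⟩ := Metric.mem_closure_iff.1 hcl δ hδ
  refine ⟨n, P, hP, fun θ => ?_⟩
  rw [← dist_eq_norm]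
  exact (ContinuousMap.dist_apply_le_dist θ).trans hd.le

/-- The number of harmonics of degree at most `n`. -/
def harmDim (n : ℕ) : ℕ := (exists_eigenbasis n).choose

/-- An orthonormal system of harmonics of degree at most `n`. -/
def harm (n : ℕ) : Fin (harmDim n) → S2 → ℂ := (exists_eigenbasis n).choose_spec.choose

/-- The corresponding eigenvalues. -/
def harmEig (n : ℕ) : Fin (harmDim n) → ℝ := (exists_eigenbasis n).choose_spec.choose_spec.choose

lemma isEigenFamily_harm (n : ℕ) : IsEigenFamily (harm n) (harmEig n) :=
  have h := (exists_eigenbasis n).choose_spec.choose_spec.choose_spec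
  ⟨h.1, h.2.1, h.2.2.1⟩

lemma exists_eq_sum_harm {n : ℕ} {p : S2 → ℂ} (hp : p ∈ polySph n) :
    ∃ a : Fin (harmDim n) → ℂ, p = fun θ => ∑ k, a k * harm n k θ :=
  (exists_eigenbasis n).choose_spec.choose_spec.choose_spec.2.2.2 p hp

/-- The families for different n are chosen independently and need not be nested, so completeness is
phrased as convergence of the finite sums. Bessel bounds them from above; best approximation,
compared with a uniformly close polynomial, bounds them from below. -/
lemma tendsto_sum_sq_coeff_harm (hf : Continuous f) :
    Tendsto (fun n => ∑ k, ‖coeff (harm n k) f‖ ^ 2) atTop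
      (𝓝 (∫ θ, ‖f θ‖ ^ 2 ∂sphereMeasure)) := by
  set μ := sphereMeasure.real univ with hμ
  rw [Metric.tendsto_atTop]
  intro η hη
  obtain ⟨δ, hδ, hδη⟩ : ∃ δ : ℝ, 0 < δ ∧ δ ^ 2 * μ < η := by
    have : Tendsto (fun δ : ℝ => δ ^ 2 * μ) (𝓝[>] 0) (𝓝 0) := by
      have h : Continuous fun δ : ℝ => δ ^ 2 * μ := by fun_prop
      have := (h.tendsto 0).mono_left (nhdsWithin_le_nhds (s := Ioi 0))
      simpa using this
    obtain ⟨δ, h1, h2⟩ := ((this.eventually_lt_const hη).and self_mem_nhdsWithin).exists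
    exact ⟨δ, h2, h1⟩
  obtain ⟨n₀, p, hp, hfp⟩ := exists_polySph_near hf hδ
  refine ⟨n₀, fun n hn => ?_⟩
  have h := isEigenFamily_harm n
  have hle := h.sum_sq_coeff_le hf
  obtain ⟨a, ha⟩ := exists_eq_sum_harm (polySph_mono hn hp)
  have hpc : Continuous p := (smoothSph_of_mem hp).continuous
  have h1 := h.norm_sub_sq (toL2 f) a
  have h2 : ∑ k, a k • toL2 (harm n k) = toL2 p := by
    rw [ha, toL2_sum (F := fun k θ => a k * harm n k θ) Finset.univ
      (fun k => continuous_const.mul (h.cont k))]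
    exact Finset.sum_congr rfl fun k _ => (toL2_const_mul (h.cont k) _).symm
  rw [h2, ← toL2_sub hf hpc, norm_toL2_sq hf, norm_toL2_sq (hf.fun_sub hpc)] at h1
  have h3 : ∫ θ, ‖f θ - p θ‖ ^ 2 ∂sphereMeasure ≤ δ ^ 2 * μ := by
    calc _ ≤ ∫ _, δ ^ 2 ∂sphereMeasure := by
          refine integral_mono (integrable_sphere (by fun_prop)) (integrable_const _) fun θ => ?_
          exact pow_le_pow_left₀ (norm_nonneg _) (hfp θ) 2
      _ = _ := by rw [integral_const, smul_eq_mul, mul_comm]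
  simp only [← coeff_eq_inner (h.cont _) hf] at h1
  rw [Real.dist_eq, abs_sub_comm, abs_of_nonneg (by linarith)]
  linarith

end TrappedWave

namespace TrappedWave

open Set Filter Topology ComplexConjugate

/-! ### Integrals over the sphere depending on parameters -/

lemma continuous_integral_sphere {P F : Type*} [TopologicalSpace P] [FirstCountableTopology P]
    [LocallyCompactSpace P] [NormedAddCommGroup F] [NormedSpace ℝ F] {φ : P → S2 → F}
    (h : Continuous fun p : P × S2 => φ p.1 p.2) :
    Continuous fun p => ∫ θ, φ p θ ∂sphereMeasure := by
  have := continuous_parametric_integral_of_continuous (μ := sphereMeasure) (f := φ) h isCompact_univ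
  simpa using this

lemma hasDerivAt_integral_sphere {F : Type*} [NormedAddCommGroup F] [NormedSpace ℝ F]
    {φ φ' : ℝ → S2 → F} (h : ∀ s, Continuous (φ s))
    (h' : Continuous fun p : ℝ × S2 => φ' p.1 p.2)
    (hd : ∀ s θ, HasDerivAt (fun r => φ r θ) (φ' s θ) s) (s : ℝ) :
    HasDerivAt (fun r => ∫ θ, φ r θ ∂sphereMeasure) (∫ θ, φ' s θ ∂sphereMeasure) s := by
  obtain ⟨B, hB⟩ := ((isCompact_Icc (a := s - 1) (b := s + 1)).prod
    (isCompact_univ (X := S2))).exists_bound_of_continuousOn h'.continuousOn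
  refine (hasDerivAt_integral_of_dominated_loc_of_deriv_le (F := φ) (F' := φ')
    (Icc_mem_nhds (by linarith : s - 1 < s) (by linarith : s < s + 1))
    (Eventually.of_forall fun r => (integrable_sphere (h r)).aestronglyMeasurable)
    (integrable_sphere (h s)) ?_ (bound := fun _ => B) ?_ (integrable_const _) ?_).2
  · exact (integrable_sphere (h := φ' s)
      (h'.comp (by fun_prop : Continuous fun θ : S2 => (s, θ)))).aestronglyMeasurable
  · exact Eventually.of_forall fun θ r hr => hB (r, θ) ⟨hr, trivial⟩
  · exact Eventually.of_forall fun θ r _ => hd r θ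

/-- The real `L²` product over the sphere of two functions. -/
def ip (A B : ℝ → ℝ → S2 → ℂ) (t x : ℝ) : ℝ := ∫ θ, inner ℝ (A t x θ) (B t x θ) ∂sphereMeasure

/-- Joint continuity of a function on `ℝ × ℝ × S²`. -/
def ContFun (A : ℝ → ℝ → S2 → ℂ) : Prop := Continuous fun p : ℝ × ℝ × S2 => A p.1 p.2.1 p.2.2

variable {A B D : ℝ → ℝ → S2 → ℂ} {u : ℝ → ℝ → S2 → ℂ}

lemma SmoothFun.contFun (h : SmoothFun A) : ContFun A := h.continuous

lemma ContFun.slice (h : ContFun A) (t x : ℝ) : Continuous (A t x) :=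
  Continuous.comp (g := fun p : ℝ × ℝ × S2 => A p.1 p.2.1 p.2.2) h
    (by fun_prop : Continuous fun θ : S2 => (t, x, θ))

lemma ContFun.slice_t (h : ContFun A) (x : ℝ) : Continuous fun p : ℝ × S2 => A p.1 x p.2 :=
  Continuous.comp (g := fun p : ℝ × ℝ × S2 => A p.1 p.2.1 p.2.2) h
    (by fun_prop : Continuous fun p : ℝ × S2 => (p.1, x, p.2))

lemma ContFun.slice_x (h : ContFun A) (t : ℝ) : Continuous fun p : ℝ × S2 => A t p.1 p.2 :=
  Continuous.comp (g := fun p : ℝ × ℝ × S2 => A p.1 p.2.1 p.2.2) h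
    (by fun_prop : Continuous fun p : ℝ × S2 => (t, p.1, p.2))

lemma ContFun.assoc (h : ContFun A) : Continuous fun p : (ℝ × ℝ) × S2 => A p.1.1 p.1.2 p.2 :=
  Continuous.comp (g := fun p : ℝ × ℝ × S2 => A p.1 p.2.1 p.2.2) h
    (by fun_prop : Continuous fun p : (ℝ × ℝ) × S2 => (p.1.1, p.1.2, p.2))

lemma ip_comm (A B : ℝ → ℝ → S2 → ℂ) (t x : ℝ) : ip A B t x = ip B A t x := by
  simp only [ip, real_inner_comm]

lemma continuous_ip (hA : ContFun A) (hB : ContFun B) :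
    Continuous fun p : ℝ × ℝ => ip A B p.1 p.2 :=
  continuous_integral_sphere (φ := fun p : ℝ × ℝ => fun θ => inner ℝ (A p.1 p.2 θ) (B p.1 p.2 θ))
    (hA.assoc.inner hB.assoc)

lemma integrable_ip (hA : ContFun A) (hB : ContFun B) (t x : ℝ) :
    Integrable (fun θ => inner ℝ (A t x θ) (B t x θ)) sphereMeasure :=
  integrable_sphere ((hA.slice t x).inner (hB.slice t x))

lemma hasDerivAt_ip_t (hA : SmoothFun A) (hB : SmoothFun B) (t x : ℝ) :
    HasDerivAt (fun s => ip A B s x) (ip (dt A) B t x + ip A (dt B) t x) t := by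
  have h := hasDerivAt_integral_sphere
    (φ := fun s θ => inner ℝ (A s x θ) (B s x θ))
    (φ' := fun s θ => inner ℝ (A s x θ) (dt B s x θ) + inner ℝ (dt A s x θ) (B s x θ))
    (fun s => (hA.contFun.slice s x).inner (hB.contFun.slice s x))
    (((hA.contFun.slice_t x).inner (hB.dt.contFun.slice_t x)).add
      ((hA.dt.contFun.slice_t x).inner (hB.contFun.slice_t x)))
    (fun s θ => (hA.hasDerivAt_dt s x θ).inner ℝ (hB.hasDerivAt_dt s x θ)) t
  rw [integral_add (integrable_ip hA.contFun hB.dt.contFun t x)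
    (integrable_ip hA.dt.contFun hB.contFun t x), add_comm] at h
  exact h

lemma hasDerivAt_ip_x (hA : SmoothFun A) (hB : SmoothFun B) (t x : ℝ) :
    HasDerivAt (fun s => ip A B t s) (ip (dx A) B t x + ip A (dx B) t x) x := by
  have h := hasDerivAt_integral_sphere
    (φ := fun s θ => inner ℝ (A t s θ) (B t s θ))
    (φ' := fun s θ => inner ℝ (A t s θ) (dx B t s θ) + inner ℝ (dx A t s θ) (B t s θ))
    (fun s => (hA.contFun.slice t s).inner (hB.contFun.slice t s))
    (((hA.contFun.slice_x t).inner (hB.dx.contFun.slice_x t)).add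
      ((hA.dx.contFun.slice_x t).inner (hB.contFun.slice_x t)))
    (fun s θ => (hA.hasDerivAt_dx t s θ).inner ℝ (hB.hasDerivAt_dx t s θ)) x
  rw [integral_add (integrable_ip hA.contFun hB.dx.contFun t x)
    (integrable_ip hA.dx.contFun hB.contFun t x), add_comm] at h
  exact h

lemma ip_self (A : ℝ → ℝ → S2 → ℂ) (t x : ℝ) :
    ip A A t x = ∫ θ, ‖A t x θ‖ ^ 2 ∂sphereMeasure := by
  simp only [ip, real_inner_self_eq_norm_sq]

lemma ip_self_nonneg (A : ℝ → ℝ → S2 → ℂ) (t x : ℝ) : 0 ≤ ip A A t x := by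
  rw [ip_self]; exact integral_nonneg fun θ => by positivity

lemma abs_ip_le (hA : ContFun A) (hB : ContFun B) (t x : ℝ) :
    |ip A B t x| ≤ √(ip A A t x) * √(ip B B t x) := by
  have h1 : ip A B t x = (inner ℂ (toL2 (A t x)) (toL2 (B t x))).re := by
    rw [inner_toL2 (hA.slice t x) (hB.slice t x), ip]
    have hi : Integrable (fun θ => conj (A t x θ) * B t x θ) sphereMeasure := by
      have := hA.slice t x
      have := hB.slice t x
      exact integrable_sphere (by fun_prop)
    have := integral_re hi
    simp only [RCLike.re_eq_complex_re] at this
    rw [← this]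
    refine integral_congr_ae (Eventually.of_forall fun θ => ?_)
    simp [Complex.inner, mul_comm]
  rw [h1, ip_self, ip_self, ← norm_toL2_sq (hA.slice t x), ← norm_toL2_sq (hB.slice t x),
    Real.sqrt_sq (norm_nonneg _), Real.sqrt_sq (norm_nonneg _)]
  exact (Complex.abs_re_le_norm _).trans (norm_inner_le_norm _ _)

/-- The squared `L²` norm over the sphere of the spherical gradient. -/
def gradInt (u : ℝ → ℝ → S2 → ℂ) (t x : ℝ) : ℝ := ∫ θ, sphereGradSq (u t x) θ ∂sphereMeasure

lemma continuous_gradInt (hu : SmoothFun u) : Continuous fun p : ℝ × ℝ => gradInt u p.1 p.2 := by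
  refine continuous_integral_sphere (φ := fun p : ℝ × ℝ => fun θ => sphereGradSq (u p.1 p.2) θ) ?_
  simp only [sphereGradSq_eq]
  refine continuous_finsetSum _ fun i _ => ?_
  have := (continuous_gradComp hu i).comp
    (by fun_prop : Continuous fun p : (ℝ × ℝ) × S2 => (p.1.1, p.1.2, p.2))
  exact this.norm.pow 2

lemma gradInt_nonneg (u : ℝ → ℝ → S2 → ℂ) (t x : ℝ) : 0 ≤ gradInt u t x :=
  integral_nonneg fun θ => Finset.sum_nonneg fun i _ => by positivity

lemma integral_inner_laplacian {f g : S2 → ℂ} (hf : SmoothSph f) (hg : SmoothSph g) :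
    ∫ θ, inner ℝ (sphereLaplacian f θ) (g θ) ∂sphereMeasure
      = -∫ θ, ∑ i, inner ℝ (gradComp i f θ) (gradComp i g θ) ∂sphereMeasure := by
  have h := integral_sphereLaplacian_mul hf hg.conj
  have c1 := hf.continuous_laplacian
  have c2 := hg.continuous
  have c3 := fun i => hf.continuous_gradComp i
  have c4 := fun i => hg.continuous_gradComp i
  simp only [gradComp_conj hg] at h
  have h2 := congrArg Complex.re h
  rw [Complex.neg_re, ← RCLike.re_eq_complex_re, ← integral_re (integrable_sphere (by fun_prop)),
    ← integral_re (integrable_sphere (by fun_prop))] at h2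
  calc _ = ∫ θ, RCLike.re (sphereLaplacian f θ * conj (g θ)) ∂sphereMeasure := by
        refine integral_congr_ae (Eventually.of_forall fun θ => ?_)
        simp [Complex.inner, mul_comm]
    _ = _ := by
        rw [h2]
        congr 1
        refine integral_congr_ae (Eventually.of_forall fun θ => ?_)
        simp [Complex.inner, mul_comm]

/-- The spherical Laplacian of a function on `ℝ × ℝ × S²`. -/
def lap (u : ℝ → ℝ → S2 → ℂ) (t x : ℝ) (θ : S2) : ℂ := sphereLaplacian (u t x) θ

lemma ip_lap_self (hu : SmoothFun u) (t x : ℝ) : ip (lap u) u t x = -gradInt u t x := by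
  rw [ip, gradInt]
  refine (integral_inner_laplacian (hu.smoothSph t x) (hu.smoothSph t x)).trans ?_
  simp only [real_inner_self_eq_norm_sq, sphereGradSq_eq]

lemma hasDerivAt_gradInt_t (hu : SmoothFun u) (t x : ℝ) :
    HasDerivAt (fun s => gradInt u s x) (-2 * ip (lap u) (dt u) t x) t := by
  have c1 := fun i => (continuous_gradComp hu i).comp
    (by fun_prop : Continuous fun p : ℝ × S2 => (p.1, x, p.2))
  have c2 := fun i => (continuous_gradComp hu.dt i).comp
    (by fun_prop : Continuous fun p : ℝ × S2 => (p.1, x, p.2))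
  have h := hasDerivAt_integral_sphere
    (φ := fun s θ => sphereGradSq (u s x) θ)
    (φ' := fun s θ => ∑ i, 2 * inner ℝ (gradComp i (u s x) θ) (gradComp i (dt u s x) θ))
    (fun s => by
      simp only [sphereGradSq_eq]
      exact continuous_finsetSum _ fun i _ => ((hu.smoothSph s x).continuous_gradComp i).norm.pow 2)
    (continuous_finsetSum _ fun i _ => continuous_const.mul ((c1 i).inner (c2 i)))
    (fun s θ => by
      simp only [sphereGradSq_eq]
      exact HasDerivAt.fun_sum fun i _ => (hasDerivAt_gradComp_dt hu i s x θ).norm_sq) t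
  refine h.congr_deriv ?_
  have : ip (lap u) (dt u) t x = _ :=
    integral_inner_laplacian (hu.smoothSph t x) (hu.dt.smoothSph t x)
  simp only [← Finset.mul_sum]
  rw [integral_const_mul, this]
  ring

lemma hasDerivAt_gradInt_x (hu : SmoothFun u) (t x : ℝ) :
    HasDerivAt (fun s => gradInt u t s) (-2 * ip (lap u) (dx u) t x) x := by
  have c1 := fun i => (continuous_gradComp hu i).comp
    (by fun_prop : Continuous fun p : ℝ × S2 => (t, p.1, p.2))
  have c2 := fun i => (continuous_gradComp hu.dx i).comp
    (by fun_prop : Continuous fun p : ℝ × S2 => (t, p.1, p.2))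
  have h := hasDerivAt_integral_sphere
    (φ := fun s θ => sphereGradSq (u t s) θ)
    (φ' := fun s θ => ∑ i, 2 * inner ℝ (gradComp i (u t s) θ) (gradComp i (dx u t s) θ))
    (fun s => by
      simp only [sphereGradSq_eq]
      exact continuous_finsetSum _ fun i _ => ((hu.smoothSph t s).continuous_gradComp i).norm.pow 2)
    (continuous_finsetSum _ fun i _ => continuous_const.mul ((c1 i).inner (c2 i)))
    (fun s θ => by
      simp only [sphereGradSq_eq]
      exact HasDerivAt.fun_sum fun i _ => (hasDerivAt_gradComp_dx hu i t s θ).norm_sq) x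
  refine h.congr_deriv ?_
  have : ip (lap u) (dx u) t x = _ :=
    integral_inner_laplacian (hu.smoothSph t x) (hu.dx.smoothSph t x)
  simp only [← Finset.mul_sum]
  rw [integral_const_mul, this]
  ring

end TrappedWave

/-! ### Balance laws integrated over the sphere. -/

namespace TrappedWave

open Set Filter Topology ComplexConjugate

/-- The quadratic quantities of a solution, integrated over the sphere, with their balance laws.
Here `α`, `β`, `γ`, `δ` stand for the squared norms of the function, its time derivative, its space
derivative and its spherical gradient; `p`, `q`, `r` for the products of the derivatives with each
other and with the function; and `σt`, `σx`, `σ0` for the products of the source with the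
derivatives and the function. -/
structure FluxSystem (N κ R₀ : ℝ) where
  -- The last three functions are the x-derivatives of `p`, of `r` and of (β + γ - V(δ + Nα))/2.
  -- Naming them lets the divergence theorem be applied knowing only their continuity.
  (α β γ δ p q r σt σx σ0 px rx lx : ℝ → ℝ → ℝ)
  cα : Continuous fun z : ℝ × ℝ => α z.1 z.2
  cβ : Continuous fun z : ℝ × ℝ => β z.1 z.2
  cγ : Continuous fun z : ℝ × ℝ => γ z.1 z.2
  cδ : Continuous fun z : ℝ × ℝ => δ z.1 z.2
  cp : Continuous fun z : ℝ × ℝ => p z.1 z.2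
  cq : Continuous fun z : ℝ × ℝ => q z.1 z.2
  cr : Continuous fun z : ℝ × ℝ => r z.1 z.2
  cσt : Continuous fun z : ℝ × ℝ => σt z.1 z.2
  cσx : Continuous fun z : ℝ × ℝ => σx z.1 z.2
  cσ0 : Continuous fun z : ℝ × ℝ => σ0 z.1 z.2
  cpx : Continuous fun z : ℝ × ℝ => px z.1 z.2
  crx : Continuous fun z : ℝ × ℝ => rx z.1 z.2
  clx : Continuous fun z : ℝ × ℝ => lx z.1 z.2
  α_nonneg : ∀ t x, 0 ≤ α t x
  β_nonneg : ∀ t x, 0 ≤ β t x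
  γ_nonneg : ∀ t x, 0 ≤ γ t x
  δ_nonneg : ∀ t x, 0 ≤ δ t x
  p_le : ∀ t x, 2 * |p t x| ≤ β t x + γ t x
  q_le : ∀ t x, 2 * |q t x| ≤ α t x + β t x
  r_le : ∀ t x, 2 * |r t x| ≤ α t x + γ t x
  σt_le : ∀ t x, |σt t x| ≤ κ * (√(α t x) * √(β t x))
  σx_le : ∀ t x, 2 * |σx t x| ≤ κ * (α t x + γ t x)
  σ0_le : ∀ t x, |σ0 t x| ≤ κ * α t x
  σt_supp : ∀ t x, R₀ ≤ |x| → σt t x = 0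
  σx_supp : ∀ t x, R₀ ≤ |x| → σx t x = 0
  σ0_supp : ∀ t x, R₀ ≤ |x| → σ0 t x = 0
  α_x : ∀ t x, HasDerivAt (fun y => α t y) (2 * r t x) x
  -- The laws `e_t`, `p_t` and `q_t` come from multiplying the equation by ∂ₜu, ∂ₓu and u. In the
  -- second one the term with x V² is half of V' = -2xV².
  e_t : ∀ t x, HasDerivAt
    (fun s => (β s x + γ s x + potV x * (δ s x + N * α s x)) / 2) (px t x + σt t x) t
  p_x : ∀ t x, HasDerivAt (fun y => p t y) (px t x) x
  l_x : ∀ t x, HasDerivAt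
    (fun y => (β t y + γ t y - potV y * (δ t y + N * α t y)) / 2) (lx t x) x
  p_t : ∀ t x, HasDerivAt (fun s => p s x)
    (lx t x - x * potV x ^ 2 * (δ t x + N * α t x) + σx t x) t
  r_x : ∀ t x, HasDerivAt (fun y => r t y) (rx t x) x
  q_t : ∀ t x, HasDerivAt (fun s => q s x)
    (rx t x - γ t x - potV x * (δ t x + N * α t x) + β t x + σ0 t x) t

lemma one_add_sq_ne (x : ℝ) : x ^ 2 + 1 ≠ 0 := by positivity

lemma potV_pos (x : ℝ) : 0 < potV x := by unfold potV; positivity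

lemma potV_le_one (x : ℝ) : potV x ≤ 1 := by
  unfold potV; rw [div_le_one (by positivity)]; nlinarith [sq_nonneg x]

lemma continuous_potV : Continuous potV := by
  unfold potV
  exact continuous_const.div (by fun_prop) one_add_sq_ne

lemma hasDerivAt_potV (x : ℝ) : HasDerivAt potV (-2 * x * potV x ^ 2) x := by
  have h := ((hasDerivAt_pow 2 x).add_const 1).fun_inv (one_add_sq_ne x)
  have e : potV = fun y : ℝ => (y ^ 2 + 1)⁻¹ := by funext y; simp [potV]
  rw [e]
  refine h.congr_deriv ?_
  have := one_add_sq_ne x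
  field_simp
  norm_num
  ring

lemma two_mul_le_of_abs_le {a b c : ℝ} (hb : 0 ≤ b) (hc : 0 ≤ c) (h : |a| ≤ √b * √c) :
    2 * |a| ≤ b + c := by
  nlinarith [Real.sq_sqrt hb, Real.sq_sqrt hc, sq_nonneg (√b - √c)]

section Solution

variable {N κ : ℝ} {u : ℝ → ℝ → S2 → ℂ} {a : ℝ → S2 → ℝ}

/-- The source term. -/
def srcFun (a : ℝ → S2 → ℝ) (u : ℝ → ℝ → S2 → ℂ) (t x : ℝ) (θ : S2) : ℂ :=
  Complex.I * (a x θ : ℂ) * u t x θ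

lemma contFun_srcFun (ha : Continuous fun p : ℝ × S2 => a p.1 p.2) (hu : ContFun u) :
    ContFun (srcFun a u) := by
  have h1 : Continuous fun p : ℝ × ℝ × S2 => a p.2.1 p.2.2 :=
    ha.comp (by fun_prop : Continuous fun p : ℝ × ℝ × S2 => (p.2.1, p.2.2))
  exact (continuous_const.mul (Complex.continuous_ofReal.comp h1)).mul hu

/-- Smooth solutions of the wave equation with a source. -/
structure IsSolution (N : ℝ) (a : ℝ → S2 → ℝ) (u : ℝ → ℝ → S2 → ℂ) : Prop where
  smooth : SmoothFun u
  cont : Continuous fun p : ℝ × S2 => a p.1 p.2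
  eq : ∀ t x θ, dt (dt u) t x θ = dx (dx u) t x θ
    + (potV x : ℂ) * (lap u t x θ - (N : ℂ) * u t x θ) + srcFun a u t x θ

/-- Joint continuity of the spherical Laplacian is read off from the equation, solved for that term,
since V does not vanish. -/
lemma IsSolution.contFun_lap (h : IsSolution N a u) : ContFun (lap u) := by
  have hu := h.smooth
  have e : lap u = fun t x θ => ((x ^ 2 + 1 : ℝ) : ℂ) *
      (dt (dt u) t x θ - dx (dx u) t x θ - srcFun a u t x θ) + N * u t x θ := by
    funext t x θ
    rw [h.eq]
    have : ((x ^ 2 + 1 : ℝ) : ℂ) * (potV x : ℂ) = 1 := by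
      rw [← Complex.ofReal_mul, potV, mul_one_div_cancel (one_add_sq_ne x), Complex.ofReal_one]
    linear_combination (-(lap u t x θ) + N * u t x θ) * this
  rw [e]
  have c1 := hu.dt.dt.contFun
  have c2 := hu.dx.dx.contFun
  have c3 := contFun_srcFun h.cont hu.contFun
  have c4 := hu.contFun
  unfold ContFun at *
  fun_prop

lemma IsSolution.ip_dt_dt (h : IsSolution N a u) {B : ℝ → ℝ → S2 → ℂ} (hB : ContFun B) (t x : ℝ) :
    ip (dt (dt u)) B t x = ip (dx (dx u)) B t x + potV x * (ip (lap u) B t x - N * ip u B t x)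
      + ip (srcFun a u) B t x := by
  have hu := h.smooth
  have i1 := integrable_ip hu.dx.dx.contFun hB t x
  have i2 := integrable_ip h.contFun_lap hB t x
  have i3 := integrable_ip hu.contFun hB t x
  have i4 := integrable_ip (contFun_srcFun h.cont hu.contFun) hB t x
  have i5 : Integrable (fun θ => potV x * (inner ℝ (lap u t x θ) (B t x θ)
      - N * inner ℝ (u t x θ) (B t x θ))) sphereMeasure :=
    (i2.sub (i3.const_mul N)).const_mul (potV x)
  have i6 : Integrable (fun θ => inner ℝ (dx (dx u) t x θ) (B t x θ) + potV x *
      (inner ℝ (lap u t x θ) (B t x θ) - N * inner ℝ (u t x θ) (B t x θ))) sphereMeasure :=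
    i1.add i5
  simp only [ip]
  rw [← integral_const_mul N, ← integral_sub i2 (i3.const_mul N), ← integral_const_mul,
    ← integral_add i1 i5, ← integral_add i6 i4]
  refine integral_congr_ae (Eventually.of_forall fun θ => ?_)
  simp only [h.eq, inner_add_left]
  have e1 : (potV x : ℂ) * (lap u t x θ - (N : ℂ) * u t x θ)
      = potV x • (lap u t x θ - N • u t x θ) := by simp
  rw [e1, real_inner_smul_left, inner_sub_left, real_inner_smul_left]

lemma abs_ip_srcFun_le (h : IsSolution N a u) (hκ : 0 ≤ κ) (ha : ∀ x θ, |a x θ| ≤ κ)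
    {B : ℝ → ℝ → S2 → ℂ} (hB : ContFun B) (t x : ℝ) :
    |ip (srcFun a u) B t x| ≤ κ * (√(ip u u t x) * √(ip B B t x)) := by
  have hu := h.smooth.contFun
  have hG := contFun_srcFun h.cont hu
  have h1 := abs_ip_le hG hB t x
  have h2 : ip (srcFun a u) (srcFun a u) t x ≤ κ ^ 2 * ip u u t x := by
    rw [ip_self, ip_self, ← integral_const_mul]
    refine integral_mono (integrable_sphere ((hG.slice t x).norm.pow 2))
      ((integrable_sphere ((hu.slice t x).norm.pow 2)).const_mul _) fun θ => ?_
    simp only [srcFun, norm_mul, Complex.norm_I, one_mul, Complex.norm_real, Real.norm_eq_abs]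
    rw [mul_pow]
    have := pow_le_pow_left₀ (abs_nonneg _) (ha x θ) 2
    gcongr
  have h3 : √(ip (srcFun a u) (srcFun a u) t x) ≤ κ * √(ip u u t x) := by
    calc _ ≤ √(κ ^ 2 * ip u u t x) := Real.sqrt_le_sqrt h2
      _ = _ := by rw [Real.sqrt_mul (sq_nonneg κ), Real.sqrt_sq hκ]
  calc _ ≤ _ := h1
    _ ≤ (κ * √(ip u u t x)) * √(ip B B t x) := by gcongr
    _ = _ := by ring

lemma ip_srcFun_eq_zero {B : ℝ → ℝ → S2 → ℂ} {x : ℝ} (ha : ∀ θ, a x θ = 0) (t : ℝ) :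
    ip (srcFun a u) B t x = 0 := by
  simp [ip, srcFun, ha]

lemma dt_dx_eq (hu : SmoothFun u) : dt (dx u) = dx (dt u) := by
  funext t x θ; exact dt_dx_comm hu t x θ

/-- The balance laws of a solution. -/
def IsSolution.flux {R₀ : ℝ} (h : IsSolution N a u) (hκ : 0 ≤ κ) (ha : ∀ x θ, |a x θ| ≤ κ)
    (hs : ∀ x θ, R₀ ≤ |x| → a x θ = 0) : FluxSystem N κ R₀ where
  α := ip u u
  β := ip (dt u) (dt u)
  γ := ip (dx u) (dx u)
  δ := gradInt u
  p := ip (dt u) (dx u)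
  q := ip (dt u) u
  r := ip (dx u) u
  σt := ip (srcFun a u) (dt u)
  σx := ip (srcFun a u) (dx u)
  σ0 := ip (srcFun a u) u
  px t x := ip (dx (dt u)) (dx u) t x + ip (dt u) (dx (dx u)) t x
  rx t x := ip (dx (dx u)) u t x + ip (dx u) (dx u) t x
  lx t x := ip (dx (dt u)) (dt u) t x + ip (dx (dx u)) (dx u) t x
    + x * potV x ^ 2 * (gradInt u t x + N * ip u u t x)
    + potV x * (ip (lap u) (dx u) t x - N * ip u (dx u) t x)
  cα := continuous_ip h.smooth.contFun h.smooth.contFun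
  cβ := continuous_ip h.smooth.dt.contFun h.smooth.dt.contFun
  cγ := continuous_ip h.smooth.dx.contFun h.smooth.dx.contFun
  cδ := continuous_gradInt h.smooth
  cp := continuous_ip h.smooth.dt.contFun h.smooth.dx.contFun
  cq := continuous_ip h.smooth.dt.contFun h.smooth.contFun
  cr := continuous_ip h.smooth.dx.contFun h.smooth.contFun
  cσt := continuous_ip (contFun_srcFun h.cont h.smooth.contFun) h.smooth.dt.contFun
  cσx := continuous_ip (contFun_srcFun h.cont h.smooth.contFun) h.smooth.dx.contFun
  cσ0 := continuous_ip (contFun_srcFun h.cont h.smooth.contFun) h.smooth.contFun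
  cpx := (continuous_ip h.smooth.dt.dx.contFun h.smooth.dx.contFun).add
    (continuous_ip h.smooth.dt.contFun h.smooth.dx.dx.contFun)
  crx := (continuous_ip h.smooth.dx.dx.contFun h.smooth.contFun).add
    (continuous_ip h.smooth.dx.contFun h.smooth.dx.contFun)
  clx := by
    have c1 := continuous_ip h.smooth.dt.dx.contFun h.smooth.dt.contFun
    have c2 := continuous_ip h.smooth.dx.dx.contFun h.smooth.dx.contFun
    have c3 := continuous_gradInt h.smooth
    have c4 := continuous_ip h.smooth.contFun h.smooth.contFun
    have c5 := continuous_ip h.contFun_lap h.smooth.dx.contFun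
    have c6 := continuous_ip h.smooth.contFun h.smooth.dx.contFun
    have c7 : Continuous fun z : ℝ × ℝ => potV z.2 := continuous_potV.comp continuous_snd
    fun_prop
  α_nonneg := ip_self_nonneg u
  β_nonneg := ip_self_nonneg (dt u)
  γ_nonneg := ip_self_nonneg (dx u)
  δ_nonneg := gradInt_nonneg u
  p_le t x := two_mul_le_of_abs_le (ip_self_nonneg _ t x) (ip_self_nonneg _ t x)
    (abs_ip_le h.smooth.dt.contFun h.smooth.dx.contFun t x)
  q_le t x := by
    rw [add_comm]
    exact two_mul_le_of_abs_le (ip_self_nonneg _ t x) (ip_self_nonneg _ t x)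
      (abs_ip_le h.smooth.dt.contFun h.smooth.contFun t x)
  r_le t x := by
    rw [add_comm]
    exact two_mul_le_of_abs_le (ip_self_nonneg _ t x) (ip_self_nonneg _ t x)
      (abs_ip_le h.smooth.dx.contFun h.smooth.contFun t x)
  σt_le := abs_ip_srcFun_le h hκ ha h.smooth.dt.contFun
  σx_le t x := by
    have h1 := abs_ip_srcFun_le h hκ ha h.smooth.dx.contFun t x
    have h2 := Real.sq_sqrt (ip_self_nonneg u t x)
    have h3 := Real.sq_sqrt (ip_self_nonneg (dx u) t x)
    have h4 : 2 * (√(ip u u t x) * √(ip (dx u) (dx u) t x)) ≤ ip u u t x + ip (dx u) (dx u) t x := by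
      nlinarith [sq_nonneg (√(ip u u t x) - √(ip (dx u) (dx u) t x))]
    nlinarith [mul_le_mul_of_nonneg_left h4 hκ]
  σ0_le t x := by
    have h1 := abs_ip_srcFun_le h hκ ha h.smooth.contFun t x
    rwa [Real.mul_self_sqrt (ip_self_nonneg u t x)] at h1
  σt_supp t x hx := ip_srcFun_eq_zero (fun θ => hs x θ hx) t
  σx_supp t x hx := ip_srcFun_eq_zero (fun θ => hs x θ hx) t
  σ0_supp t x hx := ip_srcFun_eq_zero (fun θ => hs x θ hx) t
  α_x t x := (hasDerivAt_ip_x h.smooth h.smooth t x).congr_deriv (by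
    rw [ip_comm u (dx u)]; ring)
  e_t t x := by
    have hu := h.smooth
    refine (((((hasDerivAt_ip_t hu.dt hu.dt t x).fun_add (hasDerivAt_ip_t hu.dx hu.dx t x)).fun_add
      (((hasDerivAt_gradInt_t hu t x).fun_add ((hasDerivAt_ip_t hu hu t x).const_mul N)).const_mul
        (potV x)))).div_const 2).congr_deriv ?_
    rw [ip_comm (dt u) (dt (dt u)), ip_comm (dx u) (dt (dx u)), dt_dx_eq hu,
      h.ip_dt_dt hu.dt.contFun, ip_comm (dt u) u, ip_comm (dt u) (dx (dx u))]
    ring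
  p_x := hasDerivAt_ip_x h.smooth.dt h.smooth.dx
  l_x t x := by
    have hu := h.smooth
    refine (((((hasDerivAt_ip_x hu.dt hu.dt t x).fun_add (hasDerivAt_ip_x hu.dx hu.dx t x)).fun_sub
      ((hasDerivAt_potV x).fun_mul ((hasDerivAt_gradInt_x hu t x).fun_add
        ((hasDerivAt_ip_x hu hu t x).const_mul N))))).div_const 2).congr_deriv ?_
    rw [ip_comm (dt u) (dx (dt u)), ip_comm (dx u) (dx (dx u)), ip_comm (dx u) u]
    ring
  p_t t x := by
    have hu := h.smooth
    refine (hasDerivAt_ip_t hu.dt hu.dx t x).congr_deriv ?_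
    rw [h.ip_dt_dt hu.dx.contFun, dt_dx_eq hu, ip_comm (dt u) (dx (dt u))]
    ring
  r_x t x := hasDerivAt_ip_x h.smooth.dx h.smooth t x
  q_t t x := by
    have hu := h.smooth
    refine (hasDerivAt_ip_t hu.dt hu t x).congr_deriv ?_
    rw [h.ip_dt_dt hu.contFun, ip_lap_self hu]
    ring

end Solution

end TrappedWave

namespace TrappedWave

open Set Filter Topology

/-! ### Integrals over rectangles -/

/-- Joint continuity of a function of two real variables. -/
def Cont2 (S : ℝ → ℝ → ℝ) : Prop := Continuous fun z : ℝ × ℝ => S z.1 z.2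

/-- The integral over `[0, T] × [a, b]`. -/
def rectInt (T a b : ℝ) (S : ℝ → ℝ → ℝ) : ℝ := ∫ t in (0 : ℝ)..T, ∫ x in a..b, S t x

variable {S S₁ S₂ : ℝ → ℝ → ℝ} {T a b : ℝ}

lemma Cont2.slice_x (h : Cont2 S) (t : ℝ) : Continuous (S t) :=
  Continuous.comp (g := fun z : ℝ × ℝ => S z.1 z.2) h (by fun_prop : Continuous fun x : ℝ => (t, x))

lemma Cont2.slice_t (h : Cont2 S) (x : ℝ) : Continuous fun t => S t x :=
  Continuous.comp (g := fun z : ℝ × ℝ => S z.1 z.2) h (by fun_prop : Continuous fun t : ℝ => (t, x))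

lemma Cont2.swap (h : Cont2 S) : Continuous fun z : ℝ × ℝ => S z.2 z.1 :=
  Continuous.comp (g := fun z : ℝ × ℝ => S z.1 z.2) h
    (by fun_prop : Continuous fun z : ℝ × ℝ => (z.2, z.1))

lemma Cont2.continuous_integral (h : Cont2 S) (a b : ℝ) : Continuous fun t => ∫ x in a..b, S t x :=
  intervalIntegral.continuous_parametric_intervalIntegral_of_continuous' (f := S) h a b

lemma Cont2.intervalIntegrable_x (h : Cont2 S) (t a b : ℝ) :
    IntervalIntegrable (S t) volume a b := (h.slice_x t).intervalIntegrable a b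

lemma Cont2.intervalIntegrable_integral (h : Cont2 S) (a b c d : ℝ) :
    IntervalIntegrable (fun t => ∫ x in a..b, S t x) volume c d :=
  (h.continuous_integral a b).intervalIntegrable c d

lemma Cont2.of_x {f : ℝ → ℝ} (h : Continuous f) : Cont2 fun _ x => f x := by
  unfold Cont2; fun_prop

lemma Cont2.add (h₁ : Cont2 S₁) (h₂ : Cont2 S₂) : Cont2 fun t x => S₁ t x + S₂ t x :=
  Continuous.add h₁ h₂

lemma Cont2.sub (h₁ : Cont2 S₁) (h₂ : Cont2 S₂) : Cont2 fun t x => S₁ t x - S₂ t x :=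
  Continuous.sub h₁ h₂

lemma Cont2.mul (h₁ : Cont2 S₁) (h₂ : Cont2 S₂) : Cont2 fun t x => S₁ t x * S₂ t x :=
  Continuous.mul h₁ h₂

lemma Cont2.const_mul (h : Cont2 S) (c : ℝ) : Cont2 fun t x => c * S t x :=
  continuous_const.mul h

lemma Cont2.mul_x (h : Cont2 S) {f : ℝ → ℝ} (hf : Continuous f) : Cont2 fun t x => f x * S t x :=
  (Cont2.of_x hf).mul h

lemma Cont2.abs (h : Cont2 S) : Cont2 fun t x => |S t x| := Continuous.abs h

lemma rectInt_add (h₁ : Cont2 S₁) (h₂ : Cont2 S₂) :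
    rectInt T a b (fun t x => S₁ t x + S₂ t x) = rectInt T a b S₁ + rectInt T a b S₂ := by
  unfold rectInt
  rw [← intervalIntegral.integral_add (h₁.intervalIntegrable_integral a b 0 T)
    (h₂.intervalIntegrable_integral a b 0 T)]
  congr 1
  funext t
  exact intervalIntegral.integral_add (h₁.intervalIntegrable_x t a b) (h₂.intervalIntegrable_x t a b)

lemma rectInt_sub (h₁ : Cont2 S₁) (h₂ : Cont2 S₂) :
    rectInt T a b (fun t x => S₁ t x - S₂ t x) = rectInt T a b S₁ - rectInt T a b S₂ := by
  unfold rectInt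
  rw [← intervalIntegral.integral_sub (h₁.intervalIntegrable_integral a b 0 T)
    (h₂.intervalIntegrable_integral a b 0 T)]
  congr 1
  funext t
  exact intervalIntegral.integral_sub (h₁.intervalIntegrable_x t a b) (h₂.intervalIntegrable_x t a b)

lemma rectInt_const_mul (c : ℝ) :
    rectInt T a b (fun t x => c * S t x) = c * rectInt T a b S := by
  simp only [rectInt, intervalIntegral.integral_const_mul]

lemma rectInt_mono (hT : 0 ≤ T) (hab : a ≤ b) (h₁ : Cont2 S₁) (h₂ : Cont2 S₂)
    (h : ∀ t ∈ Icc 0 T, ∀ x ∈ Icc a b, S₁ t x ≤ S₂ t x) :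
    rectInt T a b S₁ ≤ rectInt T a b S₂ := by
  refine intervalIntegral.integral_mono_on hT (h₁.intervalIntegrable_integral a b 0 T)
    (h₂.intervalIntegrable_integral a b 0 T) fun t ht => ?_
  exact intervalIntegral.integral_mono_on hab (h₁.intervalIntegrable_x t a b)
    (h₂.intervalIntegrable_x t a b) fun x hx => h t ht x hx

lemma rectInt_nonneg (hT : 0 ≤ T) (hab : a ≤ b) (h : ∀ t x, 0 ≤ S t x) : 0 ≤ rectInt T a b S :=
  intervalIntegral.integral_nonneg hT fun t _ =>
    intervalIntegral.integral_nonneg hab fun x _ => h t x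

lemma integral_mono_interval {f : ℝ → ℝ} {a b c d : ℝ} (hca : c ≤ a) (hab : a ≤ b) (hbd : b ≤ d)
    (hf : Continuous f) (h : ∀ x, 0 ≤ f x) : ∫ x in a..b, f x ≤ ∫ x in c..d, f x :=
  intervalIntegral.integral_mono_interval hca hab hbd (Eventually.of_forall h)
    (hf.intervalIntegrable _ _)

lemma rectInt_mono_set {T' c d : ℝ} (hT : 0 ≤ T) (hT' : T ≤ T') (hca : c ≤ a) (hab : a ≤ b)
    (hbd : b ≤ d) (hS : Cont2 S) (h : ∀ t x, 0 ≤ S t x) : rectInt T a b S ≤ rectInt T' c d S := by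
  calc rectInt T a b S ≤ rectInt T c d S :=
        intervalIntegral.integral_mono_on hT (hS.intervalIntegrable_integral a b 0 T)
          (hS.intervalIntegrable_integral c d 0 T) fun t _ =>
            integral_mono_interval hca hab hbd (hS.slice_x t) (h t)
    _ ≤ _ := integral_mono_interval le_rfl hT hT' (hS.continuous_integral c d) fun t =>
        intervalIntegral.integral_nonneg (by linarith) fun x _ => h t x

lemma rectInt_swap (hS : Cont2 S) :
    rectInt T a b S = ∫ x in a..b, ∫ t in (0 : ℝ)..T, S t x := by
  refine intervalIntegral_intervalIntegral_swap (F := S) ?_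
  exact ((hS : Continuous S.uncurry).continuousOn.integrableOn_compact
    (isCompact_uIcc.prod isCompact_uIcc)).mono_set
    (prod_mono uIoc_subset_uIcc uIoc_subset_uIcc)

/-- The divergence theorem on a rectangle. -/
lemma rect_identity {F G Ft Gx : ℝ → ℝ → ℝ}
    (hF : ∀ t x, HasDerivAt (fun s => F s x) (Ft t x) t)
    (hG : ∀ t x, HasDerivAt (fun y => G t y) (Gx t x) x)
    (cF : Cont2 F) (cGx : Cont2 Gx) (cS : Cont2 S) (eq : ∀ t x, Ft t x = Gx t x + S t x) :
    (∫ x in a..b, F T x) - ∫ x in a..b, F 0 x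
      = (∫ t in (0 : ℝ)..T, (G t b - G t a)) + rectInt T a b S := by
  have cFt : Cont2 Ft := by
    have : Ft = fun t x => Gx t x + S t x := by funext t x; exact eq t x
    rw [this]; exact cGx.add cS
  have h1 : rectInt T a b Ft = rectInt T a b Gx + rectInt T a b S := by
    rw [← rectInt_add cGx cS]; congr 1; funext t x; exact eq t x
  have h2 : rectInt T a b Gx = ∫ t in (0 : ℝ)..T, (G t b - G t a) := by
    unfold rectInt
    congr 1
    funext t
    exact intervalIntegral.integral_eq_sub_of_hasDerivAt (fun x _ => hG t x)
      (cGx.intervalIntegrable_x t a b)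
  have h3 : rectInt T a b Ft = (∫ x in a..b, F T x) - ∫ x in a..b, F 0 x := by
    rw [rectInt_swap cFt, ← intervalIntegral.integral_sub (cF.intervalIntegrable_x T a b)
      (cF.intervalIntegrable_x 0 a b)]
    congr 1
    funext x
    exact intervalIntegral.integral_eq_sub_of_hasDerivAt (fun t _ => hF t x)
      ((cFt.slice_t x).intervalIntegrable 0 T)
  rw [← h3, h1, h2]

end TrappedWave

/-! ### Finite propagation speed and the energy inequality. -/

namespace TrappedWave

open Set Filter Topology

lemma integral_le_of_supp {f : ℝ → ℝ} (hf : Continuous f) (h0 : ∀ x, 0 ≤ f x) {R₀ R : ℝ}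
    (hR₀ : 0 ≤ R₀) (hR : 0 ≤ R) (hs : ∀ x, R₀ ≤ |x| → f x = 0) :
    ∫ x in -R..R, f x ≤ ∫ x in -R₀..R₀, f x := by
  rcases le_total R R₀ with h | h
  · exact integral_mono_interval (by linarith) (by linarith) h hf h0
  · have hi := fun a b => hf.intervalIntegrable (μ := volume) a b
    rw [← intervalIntegral.integral_add_adjacent_intervals (hi (-R) (-R₀)) (hi (-R₀) R),
      ← intervalIntegral.integral_add_adjacent_intervals (hi (-R₀) R₀) (hi R₀ R)]
    have z1 : ∫ x in -R..-R₀, f x = 0 := by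
      rw [intervalIntegral.integral_congr (g := fun _ => 0), intervalIntegral.integral_zero]
      intro x hx
      rw [uIcc_of_le (by linarith)] at hx
      exact hs x (by rw [abs_of_nonpos (by linarith [hx.2])]; linarith [hx.2])
    have z2 : ∫ x in R₀..R, f x = 0 := by
      rw [intervalIntegral.integral_congr (g := fun _ => 0), intervalIntegral.integral_zero]
      intro x hx
      rw [uIcc_of_le h] at hx
      exact hs x (by rw [abs_of_nonneg (by linarith [hx.1])]; exact hx.1)
    rw [z1, z2]; linarith

/-- A smooth version of the absolute value. -/
def jap (x : ℝ) : ℝ := √(x ^ 2 + 1)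

lemma jap_pos (x : ℝ) : 0 < jap x := Real.sqrt_pos.2 (by positivity)

lemma jap_sq (x : ℝ) : jap x ^ 2 = x ^ 2 + 1 := Real.sq_sqrt (by positivity)

lemma abs_le_jap (x : ℝ) : |x| ≤ jap x := by
  rw [← Real.sqrt_sq_eq_abs]; exact Real.sqrt_le_sqrt (by linarith)

lemma jap_le (x : ℝ) : jap x ≤ 1 + |x| := by
  refine Real.sqrt_le_iff.2 ⟨by positivity, ?_⟩
  nlinarith [sq_abs x, abs_nonneg x]

lemma continuous_jap : Continuous jap := by unfold jap; fun_prop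

lemma hasDerivAt_jap (x : ℝ) : HasDerivAt jap (x / jap x) x := by
  have h := ((hasDerivAt_pow 2 x).add_const 1).sqrt (one_add_sq_ne x)
  refine h.congr_deriv ?_
  have := (jap_pos x).ne'
  change _ / (2 * jap x) = _
  field_simp
  norm_num

lemma abs_div_jap_le (x : ℝ) : |x / jap x| ≤ 1 := by
  rw [abs_div, abs_of_pos (jap_pos x), div_le_one (jap_pos x)]
  exact abs_le_jap x

namespace FluxSystem

variable {N κ R₀ : ℝ} (Φ : FluxSystem N κ R₀)

/-- The weighted sum of the spherical gradient and the function. -/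
def D (t x : ℝ) : ℝ := Φ.δ t x + N * Φ.α t x

/-- The energy density. -/
def e (t x : ℝ) : ℝ := (Φ.β t x + Φ.γ t x + potV x * (Φ.δ t x + N * Φ.α t x)) / 2

lemma D_nonneg (hN : 0 ≤ N) (t x : ℝ) : 0 ≤ Φ.D t x :=
  add_nonneg (Φ.δ_nonneg t x) (mul_nonneg hN (Φ.α_nonneg t x))

lemma two_mul_e (t x : ℝ) : 2 * Φ.e t x = Φ.β t x + Φ.γ t x + potV x * Φ.D t x := by
  unfold e D; ring

lemma e_nonneg (hN : 0 ≤ N) (t x : ℝ) : 0 ≤ Φ.e t x := by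
  have := Φ.two_mul_e t x
  have := mul_nonneg (potV_pos x).le (Φ.D_nonneg hN t x)
  linarith [Φ.β_nonneg t x, Φ.γ_nonneg t x]

lemma cD : Cont2 Φ.D := by
  have := Φ.cδ; have := Φ.cα
  unfold Cont2 D; fun_prop

lemma ce : Cont2 Φ.e := by
  have := Φ.cδ; have := Φ.cα; have := Φ.cβ; have := Φ.cγ
  have c7 : Continuous fun z : ℝ × ℝ => potV z.2 := continuous_potV.comp continuous_snd
  unfold Cont2 e; fun_prop

/-- The amount of energy fed in by the source up to time `T`. -/
def work (T : ℝ) : ℝ := rectInt T (-R₀) R₀ (fun t x => |Φ.σt t x|)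

lemma work_nonneg {T : ℝ} (hR₀ : 0 ≤ R₀) (hT : 0 ≤ T) : 0 ≤ Φ.work T :=
  rectInt_nonneg hT (by linarith) fun _ _ => abs_nonneg _

lemma cσt_abs : Cont2 fun t x => |Φ.σt t x| := Cont2.abs Φ.cσt

lemma work_mono {T T' : ℝ} (hR₀ : 0 ≤ R₀) (hT : 0 ≤ T) (h : T ≤ T') : Φ.work T ≤ Φ.work T' :=
  rectInt_mono_set hT h le_rfl (by linarith) le_rfl Φ.cσt_abs fun _ _ => abs_nonneg _

/-- The energy inequality. -/
theorem energy_le (hN : 0 ≤ N) (hR₀ : 0 ≤ R₀) {E₀ : ℝ}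
    (hE : ∀ r, 0 ≤ r → ∫ x in -r..r, Φ.e 0 x ≤ E₀) {T r : ℝ} (hT : 0 ≤ T) (hr : 0 ≤ r) :
    ∫ x in -r..r, Φ.e T x ≤ E₀ + Φ.work T := by
  -- Since `jap x` is at most 1 + |x| and the transition is complete at argument 1, the margin 2
  -- makes the cutoff equal to one on [-r, r] at time T.
  set R := r + T + 2 with hR
  set h : ℝ → ℝ := Real.smoothTransition with hh
  have hcd : ContDiff ℝ 1 h := Real.smoothTransition.contDiff
  have hd : ∀ z, HasDerivAt h (deriv h z) z := fun z =>
    (hcd.differentiable (by simp) z).hasDerivAt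
  have hdc : Continuous (deriv h) := hcd.continuous_deriv le_rfl
  have hdn : ∀ z, 0 ≤ deriv h z := fun z => Real.smoothTransition.monotone.deriv_nonneg
  have hhc : Continuous h := hcd.continuous
  -- A smoothed backward light cone. The slope x / `jap x` is at most one in modulus and |p| ≤ e, so
  -- moving the cone inward only loses energy; the cutoff vanishes for |x| ≥ R, so there is no flux
  -- through the sides.
  set ψ : ℝ → ℝ → ℝ := fun t x => h (R - t - jap x) with hψ
  have hψt : ∀ t x, HasDerivAt (fun s => ψ s x) (-deriv h (R - t - jap x)) t := fun t x => by
    have h1 : HasDerivAt (fun s : ℝ => R - s - jap x) (-1) t :=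
      ((hasDerivAt_id t).const_sub R).sub_const _
    exact ((hd _).comp t h1).congr_deriv (by ring)
  have hψx : ∀ t x, HasDerivAt (fun y => ψ t y) (-(deriv h (R - t - jap x) * (x / jap x))) x :=
    fun t x => by
      have h1 : HasDerivAt (fun y : ℝ => R - t - jap y) (-(x / jap x)) x :=
        (hasDerivAt_jap x).const_sub _
      exact ((hd _).comp x h1).congr_deriv (by ring)
  have cjap : Continuous fun z : ℝ × ℝ => jap z.2 := continuous_jap.comp continuous_snd
  have carg : Continuous fun z : ℝ × ℝ => R - z.1 - jap z.2 := by fun_prop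
  have cψ : Cont2 ψ := hhc.comp carg
  have cψ' : Continuous fun z : ℝ × ℝ => deriv h (R - z.1 - jap z.2) := hdc.comp carg
  have cq : Continuous fun z : ℝ × ℝ => z.2 / jap z.2 :=
    continuous_snd.div cjap fun z => (jap_pos _).ne'
  have ce := Φ.ce
  have cp : Cont2 Φ.p := Φ.cp
  have cpx : Cont2 Φ.px := Φ.cpx
  have cσ : Cont2 Φ.σt := Φ.cσt
  have h0 := rect_identity (T := T) (a := -R) (b := R)
    (F := fun t x => ψ t x * Φ.e t x)
    (G := fun t x => ψ t x * Φ.p t x)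
    (S := fun t x => -deriv h (R - t - jap x) * (Φ.e t x - x / jap x * Φ.p t x)
      + ψ t x * Φ.σt t x)
    (fun t x => (hψt t x).fun_mul (Φ.e_t t x)) (fun t x => (hψx t x).fun_mul (Φ.p_x t x))
    (cψ.mul ce) (by unfold Cont2 at *; fun_prop) (by unfold Cont2 at *; fun_prop)
    (fun t x => by simp only [FluxSystem.e]; ring)
  have hψ0 : ∀ t, 0 ≤ t → ∀ x, R ≤ |x| → ψ t x = 0 := fun t ht x hx =>
    Real.smoothTransition.zero_of_nonpos (by have := abs_le_jap x; linarith)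
  have hRpos : 0 ≤ R := by positivity
  have hbd : ∫ t in (0 : ℝ)..T, (ψ t R * Φ.p t R - ψ t (-R) * Φ.p t (-R)) = 0 := by
    rw [intervalIntegral.integral_congr (g := fun _ => 0), intervalIntegral.integral_zero]
    intro t ht
    rw [uIcc_of_le hT] at ht
    simp [hψ0 t ht.1 R (le_abs_self R), hψ0 t ht.1 (-R) (by rw [abs_neg]; exact le_abs_self R)]
  rw [hbd, zero_add] at h0
  have hle1 : ∀ t x, ψ t x ≤ 1 := fun t x => Real.smoothTransition.le_one _
  have hnn : ∀ t x, 0 ≤ ψ t x := fun t x => Real.smoothTransition.nonneg _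
  have h1 : rectInt T (-R) R (fun t x => -deriv h (R - t - jap x) * (Φ.e t x - x / jap x * Φ.p t x)
      + ψ t x * Φ.σt t x) ≤ rectInt T (-R) R fun t x => |Φ.σt t x| := by
    refine rectInt_mono hT (by linarith) (by unfold Cont2 at *; fun_prop) Φ.cσt_abs
      fun t _ x _ => ?_
    have a1 : 0 ≤ Φ.e t x - x / jap x * Φ.p t x := by
      have b1 : x / jap x * Φ.p t x ≤ |Φ.p t x| := by
        refine (le_abs_self _).trans ?_
        rw [abs_mul]
        exact mul_le_of_le_one_left (abs_nonneg _) (abs_div_jap_le x)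
      have b2 := Φ.p_le t x
      have b3 := Φ.two_mul_e t x
      have b4 := mul_nonneg (potV_pos x).le (Φ.D_nonneg hN t x)
      linarith
    have a2 : ψ t x * Φ.σt t x ≤ |Φ.σt t x| := by
      refine (le_abs_self _).trans ?_
      rw [abs_mul, abs_of_nonneg (hnn t x)]
      exact mul_le_of_le_one_left (abs_nonneg _) (hle1 t x)
    nlinarith [mul_nonneg (hdn (R - t - jap x)) a1]
  have h2 : (rectInt T (-R) R fun t x => |Φ.σt t x|) ≤ Φ.work T :=
    intervalIntegral.integral_mono_on hT (Φ.cσt_abs.intervalIntegrable_integral _ _ 0 T)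
      (Φ.cσt_abs.intervalIntegrable_integral _ _ 0 T) fun t _ =>
      integral_le_of_supp (Φ.cσt_abs.slice_x t) (fun _ => abs_nonneg _) hR₀ hRpos
        fun x hx => by rw [Φ.σt_supp t x hx, abs_zero]
  have h3 : ∫ x in -R..R, ψ 0 x * Φ.e 0 x ≤ E₀ := by
    refine le_trans ?_ (hE R hRpos)
    refine intervalIntegral.integral_mono_on (by linarith) ((cψ.mul ce).intervalIntegrable_x 0 _ _)
      (ce.intervalIntegrable_x 0 _ _) fun x _ => ?_
    exact mul_le_of_le_one_left (Φ.e_nonneg hN 0 x) (hle1 0 x)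
  have h4 : ∫ x in -r..r, Φ.e T x ≤ ∫ x in -R..R, ψ T x * Φ.e T x := by
    calc _ = ∫ x in -r..r, ψ T x * Φ.e T x := by
          refine intervalIntegral.integral_congr fun x hx => ?_
          rw [uIcc_of_le (by linarith)] at hx
          have : ψ T x = 1 := Real.smoothTransition.one_of_one_le (by
            have := jap_le x
            have := abs_le.2 hx
            linarith)
          simp [this]
      _ ≤ _ := integral_mono_interval (by linarith) (by linarith) (by linarith)
          ((cψ.mul ce).slice_x T) fun x => mul_nonneg (hnn T x) (Φ.e_nonneg hN T x)
  linarith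

end FluxSystem

end TrappedWave

namespace TrappedWave

open Set Filter Topology

/-! ### Weights -/

/-- The decaying weight in the zeroth order terms. -/
def wgt (x : ℝ) : ℝ := 1 / (1 + |x| ^ 3)

lemma one_add_abs_cube_pos (x : ℝ) : 0 < 1 + |x| ^ 3 := by positivity

lemma wgt_pos (x : ℝ) : 0 < wgt x := by unfold wgt; positivity

lemma continuous_wgt : Continuous wgt :=
  continuous_const.div (by fun_prop) fun x => (one_add_abs_cube_pos x).ne'

lemma sq_mul_potV_le_one (x : ℝ) : x ^ 2 * potV x ≤ 1 := by
  unfold potV; rw [mul_one_div, div_le_one (by positivity)]; linarith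

lemma abs_mul_potV_le_one (x : ℝ) : |x| * potV x ≤ 1 := by
  unfold potV; rw [mul_one_div, div_le_one (by positivity)]
  nlinarith [sq_abs x, sq_nonneg (|x| - 1)]

lemma wgt_le (x : ℝ) : wgt x ≤ 2 * (potV x / (1 + |x|)) := by
  unfold wgt potV
  rw [div_div, mul_one_div, div_le_div_iff₀ (one_add_abs_cube_pos x) (by positivity),
    ← sq_abs x]
  have := abs_nonneg x
  nlinarith [mul_nonneg (sq_nonneg (1 - |x|)) (by linarith : 0 ≤ 1 + |x|)]

lemma abs_mul_potV_sq_le (x : ℝ) : |x| * potV x ^ 2 ≤ 2 * wgt x := by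
  unfold wgt potV
  rw [div_pow, one_pow, mul_one_div, mul_one_div,
    div_le_div_iff₀ (by positivity) (one_add_abs_cube_pos x), ← sq_abs x]
  nlinarith [sq_nonneg (|x| - 1), sq_nonneg (|x|), sq_nonneg (|x| ^ 2)]

lemma potV_sq_le (x : ℝ) : potV x ^ 2 ≤ 2 * wgt x := by
  unfold wgt potV
  rw [div_pow, one_pow, mul_one_div,
    div_le_div_iff₀ (by positivity) (one_add_abs_cube_pos x), ← sq_abs x]
  nlinarith [sq_nonneg (|x| ^ 2 - |x|), sq_nonneg (|x|), sq_nonneg (|x| ^ 2)]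

lemma abs_arctan_le_two (x : ℝ) : |Real.arctan x| ≤ 2 := by
  have h1 := Real.arctan_lt_pi_div_two x
  have h2 := Real.neg_pi_div_two_lt_arctan x
  have h3 := Real.pi_lt_four
  rw [abs_le]; constructor <;> linarith

/-- Both sides are even. For y ≥ 0 the difference arctan y - y/(1+y) starts at 0 and has derivative
1/(1+y²) - 1/(1+y)², which is nonnegative. -/
lemma sq_div_le_mul_arctan (x : ℝ) : x ^ 2 / (1 + |x|) ≤ x * Real.arctan x := by
  have key : ∀ y : ℝ, 0 ≤ y → y / (1 + y) ≤ Real.arctan y := by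
    intro y hy
    have hmono : MonotoneOn (fun y => Real.arctan y - y / (1 + y)) (Ici 0) := by
      refine monotoneOn_of_hasDerivWithinAt_nonneg (f' := fun y => 1 / (1 + y ^ 2) - 1 / (1 + y) ^ 2)
        (convex_Ici 0) ?_ ?_ ?_
      · refine Real.continuous_arctan.continuousOn.sub (continuousOn_id.div (by fun_prop) ?_)
        intro z hz
        have : (0 : ℝ) ≤ z := hz
        positivity
      · intro z hz
        rw [interior_Ici] at hz
        have hz' : (0 : ℝ) < z := hz
        have h2 := (hasDerivAt_id z).div ((hasDerivAt_id z).const_add 1)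
          (by simp only [id]; positivity)
        refine ((Real.hasDerivAt_arctan z).sub (h2.congr_deriv ?_)).hasDerivWithinAt
        simp
      · intro z hz
        rw [interior_Ici] at hz
        have hz' : (0 : ℝ) < z := hz
        rw [sub_nonneg]
        exact one_div_le_one_div_of_le (by positivity) (by nlinarith)
    have := hmono (mem_Ici.2 le_rfl) (mem_Ici.2 hy) hy
    simp at this
    linarith
  rcases le_total 0 x with h | h
  · rw [abs_of_nonneg h]
    have := mul_le_mul_of_nonneg_left (key x h) h
    calc _ = x * (x / (1 + x)) := by ring
      _ ≤ _ := this
  · rw [abs_of_nonpos h]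
    have := mul_le_mul_of_nonneg_left (key (-x) (by linarith)) (by linarith : 0 ≤ -x)
    rw [Real.arctan_neg] at this
    calc _ = -x * (-x / (1 + -x)) := by ring
      _ ≤ _ := this
      _ = _ := by ring

/-- Positivity of the zeroth order coefficients in the Morawetz identity. -/
lemma morawetz_coeff {N δ α : ℝ} (hN : 100 ≤ N) (hδ : 0 ≤ δ) (hα : 0 ≤ α) (x : ℝ) :
    1 / 4 * (x ^ 2 * potV x * wgt x * (δ + N * α) + wgt x * α)
      ≤ x * Real.arctan x * potV x ^ 2 * (δ + N * α)
        + (potV x ^ 2 / 2 - 2 * x ^ 2 * potV x ^ 3) * α := by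
  have hV := potV_pos x
  have hw := wgt_le x
  have hx := abs_nonneg x
  set P := potV x / (1 + |x|) with hP
  have hPp : 0 < P := by positivity
  have hD : 0 ≤ δ + N * α := by positivity
  have h1 : x ^ 2 * P * potV x ≤ x * Real.arctan x * potV x ^ 2 := by
    have := mul_le_mul_of_nonneg_right (sq_div_le_mul_arctan x) (sq_nonneg (potV x))
    calc _ = x ^ 2 / (1 + |x|) * potV x ^ 2 := by rw [hP]; ring
      _ ≤ _ := this
  have h2 : x ^ 2 * potV x * wgt x ≤ 2 * (x * Real.arctan x * potV x ^ 2) := by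
    have : x ^ 2 * potV x * wgt x ≤ x ^ 2 * potV x * (2 * P) := by gcongr
    nlinarith
  -- The bare coefficient of α becomes negative away from the origin. It is repaired with half of
  -- the angular term, whose part in α has the factor N/2 ≥ 50; the other half of that term pays for
  -- the weighted gradient on the left.
  have h3 : P / 2 ≤ 50 * (x ^ 2 * P * potV x) + (potV x ^ 2 / 2 - 2 * x ^ 2 * potV x ^ 3) := by
    have e1 : potV x = P * (1 + |x|) := by rw [hP]; field_simp
    have e2 : (1 + |x|) * potV x ≤ 2 := by
      have := potV_le_one x
      have := abs_mul_potV_le_one x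
      linarith
    have e3 : potV x * (x ^ 2 + 1) = 1 := by
      unfold potV; rw [one_div_mul_cancel (one_add_sq_ne x)]
    have e4 : potV x ≤ (1 + |x|) * potV x := by nlinarith
    have e5 : potV x ^ 2 = P * ((1 + |x|) * potV x) := by
      calc potV x ^ 2 = potV x * potV x := sq _
        _ = (P * (1 + |x|)) * potV x := by rw [← e1]
        _ = _ := by ring
    have e6 : x ^ 2 * potV x ^ 3 ≤ P * (2 * (x ^ 2 * potV x)) := by
      calc x ^ 2 * potV x ^ 3 = potV x ^ 2 * (x ^ 2 * potV x) := by ring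
        _ = P * ((1 + |x|) * potV x * (x ^ 2 * potV x)) := by rw [e5]; ring
        _ ≤ _ := by gcongr
    have e7 : P * potV x ≤ potV x ^ 2 := by rw [e5]; gcongr
    have e8 : P * (potV x * (x ^ 2 + 1)) = P := by rw [e3, mul_one]
    have e9 : 0 ≤ P * (x ^ 2 * potV x) := by positivity
    nlinarith
  set Q := x * Real.arctan x * potV x ^ 2 with hQ
  have h4 : 0 ≤ x ^ 2 * P * potV x := by positivity
  have h5 : wgt x * α ≤ 2 * P * α := by gcongr
  have h6 : x ^ 2 * potV x * wgt x * (δ + N * α) ≤ 2 * Q * (δ + N * α) := by gcongr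
  have h7 : 50 * (x ^ 2 * P * potV x) * α ≤ 1 / 2 * Q * (δ + N * α) := by
    have : 50 * Q * α ≤ 1 / 2 * Q * (δ + N * α) := by
      have hQ0 : 0 ≤ Q := h4.trans h1
      nlinarith [mul_nonneg hQ0 hδ, mul_nonneg (mul_nonneg hQ0 hα) (by linarith : 0 ≤ N - 100)]
    nlinarith [mul_le_mul_of_nonneg_right h1 hα]
  have h8 := mul_le_mul_of_nonneg_right h3 hα
  nlinarith

/-! ### Morawetz estimates. -/

namespace FluxSystem

variable {N κ R₀ : ℝ} (Φ : FluxSystem N κ R₀)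

/-- The density controlled by the first multiplier. -/
def m0 (t x : ℝ) : ℝ := potV x * Φ.γ t x + x ^ 2 * potV x * wgt x * Φ.D t x + wgt x * Φ.α t x

/-- The Morawetz density. -/
def m (t x : ℝ) : ℝ := Φ.m0 t x + x ^ 2 * potV x ^ 2 * Φ.β t x

lemma m0_nonneg (hN : 0 ≤ N) (t x : ℝ) : 0 ≤ Φ.m0 t x := by
  have := Φ.D_nonneg hN t x; have := Φ.γ_nonneg t x; have := Φ.α_nonneg t x
  have := potV_pos x; have := wgt_pos x
  unfold m0; positivity

lemma m_nonneg (hN : 0 ≤ N) (t x : ℝ) : 0 ≤ Φ.m t x := by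
  have := Φ.m0_nonneg hN t x; have := Φ.β_nonneg t x
  unfold m; positivity

lemma cm0 : Cont2 Φ.m0 := by
  have h1 := Φ.cD; have h2 := Φ.cα; have h3 := Φ.cγ
  have c1 : Continuous fun z : ℝ × ℝ => potV z.2 := continuous_potV.comp continuous_snd
  have c2 : Continuous fun z : ℝ × ℝ => wgt z.2 := continuous_wgt.comp continuous_snd
  unfold Cont2 m0 at *; fun_prop

lemma cm : Cont2 Φ.m := by
  have h1 := Φ.cm0; have h3 := Φ.cβ
  have c1 : Continuous fun z : ℝ × ℝ => potV z.2 := continuous_potV.comp continuous_snd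
  unfold Cont2 m at *; fun_prop

/-- The boundary flux through the lines `x = ± R`. -/
def bdry (T R : ℝ) : ℝ := ∫ t in (0 : ℝ)..T, (Φ.e t R + Φ.e t (-R))

/-- The size of the source terms. -/
def src (t x : ℝ) : ℝ := 2 * |Φ.σx t x| + |Φ.σ0 t x|

lemma csrc : Cont2 Φ.src := by
  have h1 := Φ.cσx; have h2 := Φ.cσ0
  unfold Cont2 src; fun_prop

/-- Averaging over R: the integral of the boundary flux in R is at most T times the energy bound, so
the flux cannot stay above η on a half-line. This replaces any pointwise decay at infinity. -/
lemma exists_bdry_le (hN : 0 ≤ N) {T S : ℝ} (hT : 0 ≤ T)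
    (hS : ∀ t ∈ Icc 0 T, ∀ r, 0 ≤ r → ∫ x in -r..r, Φ.e t x ≤ S) {η : ℝ} (hη : 0 < η) (R₁ : ℝ) :
    ∃ R, R₁ ≤ R ∧ 0 ≤ R ∧ Φ.bdry T R ≤ η := by
  by_contra! hcon
  set R₂ := max R₁ 0 with hR₂
  have hb : ∀ R, R₂ ≤ R → η < Φ.bdry T R := fun R hR =>
    hcon R ((le_max_left _ _).trans hR) ((le_max_right _ _).trans hR)
  have h0 : 0 ≤ R₂ := le_max_right _ _
  have ce := Φ.ce
  have ce2 : Cont2 fun t x => Φ.e t x + Φ.e t (-x) := by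
    have : Continuous fun z : ℝ × ℝ => Φ.e z.1 (-z.2) :=
      Continuous.comp (g := fun z : ℝ × ℝ => Φ.e z.1 z.2) ce
        (by fun_prop : Continuous fun z : ℝ × ℝ => (z.1, -z.2))
    exact Continuous.add ce this
  have hnn : ∀ t x, 0 ≤ Φ.e t x + Φ.e t (-x) := fun t x =>
    add_nonneg (Φ.e_nonneg hN t x) (Φ.e_nonneg hN t _)
  have cb : Continuous (Φ.bdry T) :=
    intervalIntegral.continuous_parametric_intervalIntegral_of_continuous'
      (f := fun x t => Φ.e t x + Φ.e t (-x)) ce2.swap 0 T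
  have hSnn : 0 ≤ S := by
    have := hS 0 ⟨le_rfl, hT⟩ 0 le_rfl
    simpa using this
  have h1 : ∀ ρ, R₂ ≤ ρ → η * (ρ - R₂) ≤ T * S := by
    intro ρ hρ
    calc η * (ρ - R₂) = ∫ _ in R₂..ρ, η := by
          rw [intervalIntegral.integral_const, smul_eq_mul, mul_comm]
      _ ≤ ∫ R in R₂..ρ, Φ.bdry T R := by
          refine intervalIntegral.integral_mono_on hρ (by simp)
            (cb.intervalIntegrable _ _) fun R hR => (hb R hR.1).le
      _ ≤ ∫ R in (0 : ℝ)..ρ, Φ.bdry T R :=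
          integral_mono_interval h0 hρ le_rfl cb fun R =>
            intervalIntegral.integral_nonneg hT fun t _ => hnn t R
      _ = rectInt T 0 ρ fun t x => Φ.e t x + Φ.e t (-x) := (rectInt_swap ce2).symm
      _ ≤ ∫ _ in (0 : ℝ)..T, S := by
          refine intervalIntegral.integral_mono_on hT (ce2.intervalIntegrable_integral _ _ _ _)
            (by simp) fun t ht => ?_
          refine le_trans (le_of_eq ?_) (hS t ht ρ (h0.trans hρ))
          have hi := fun a b => ce.intervalIntegrable_x t a b
          have hi2 : IntervalIntegrable (fun x => Φ.e t (-x)) volume 0 ρ :=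
            ((ce.slice_x t).comp continuous_neg).intervalIntegrable _ _
          rw [intervalIntegral.integral_add (hi _ _) hi2, intervalIntegral.integral_comp_neg,
            neg_zero, add_comm, intervalIntegral.integral_add_adjacent_intervals (hi _ _) (hi _ _)]
      _ = T * S := by simp
  have h2 := h1 (R₂ + (T * S + 1) / η) (by
    have : 0 ≤ (T * S + 1) / η := by positivity
    linarith)
  rw [add_sub_cancel_left, mul_div_cancel₀ _ hη.ne'] at h2
  linarith

lemma energy_dominates (hN : 100 ≤ N) (t x : ℝ) :
    Φ.β t x + Φ.γ t x + 100 * (potV x * Φ.α t x) ≤ 2 * Φ.e t x := by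
  have h1 := Φ.two_mul_e t x
  have h2 := Φ.δ_nonneg t x
  have h3 := Φ.α_nonneg t x
  have h4 : potV x * Φ.D t x = potV x * Φ.δ t x + N * (potV x * Φ.α t x) := by unfold D; ring
  have h5 : 0 ≤ potV x * Φ.δ t x := mul_nonneg (potV_pos x).le h2
  have h6 : 0 ≤ potV x * Φ.α t x := mul_nonneg (potV_pos x).le h3
  nlinarith

/-- The estimate from the multiplier `arctan x ∂ₓ`. -/
lemma rectInt_m0_le (hN : 100 ≤ N) {T R S : ℝ} (hT : 0 ≤ T) (hR : 0 ≤ R)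
    (hS : ∀ t ∈ Icc 0 T, ∀ r, 0 ≤ r → ∫ x in -r..r, Φ.e t x ≤ S) :
    rectInt T (-R) R Φ.m0 ≤ 4 * (6 * S + 3 * Φ.bdry T R + rectInt T (-R) R Φ.src) := by
  have hN0 : 0 ≤ N := by linarith
  set f := Real.arctan with hf
  have cV : Continuous fun z : ℝ × ℝ => potV z.2 := continuous_potV.comp continuous_snd
  have cf : Continuous fun z : ℝ × ℝ => f z.2 := Real.continuous_arctan.comp continuous_snd
  have hfd : ∀ x, HasDerivAt f (potV x) x := fun x =>
    (Real.hasDerivAt_arctan x).congr_deriv (by rw [potV, add_comm])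
  have cp := Φ.cp; have cq := Φ.cq; have cr := Φ.cr; have cD := Φ.cD; have cα := Φ.cα
  have cβ := Φ.cβ; have cγ := Φ.cγ; have clx := Φ.clx; have crx := Φ.crx; have cδ := Φ.cδ
  have cσx := Φ.cσx; have cσ0 := Φ.cσ0; have ce := Φ.ce
  have hVd := hasDerivAt_potV
  have hV2d : ∀ x, HasDerivAt (fun y => y * potV y ^ 2 / 2)
      (potV x ^ 2 / 2 - 2 * x ^ 2 * potV x ^ 3) x := fun x =>
    (((hasDerivAt_id x).fun_mul ((hVd x).fun_pow 2)).div_const 2).congr_deriv (by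
      simp only [id]; norm_num; ring)
  -- The multiplier is f∂ₓ + f'/2 with f = arctan, f' = V. The correction f'/2 cancels β and V(δ+Nα)
  -- in the bulk and leaves Vγ. The remaining term x V² r is half of x V² ∂ₓα; a further integration
  -- by parts produces the third term of `G` and the coefficient V²/2 - 2x²V³.
  let F : ℝ → ℝ → ℝ := fun t x => f x * Φ.p t x + potV x / 2 * Φ.q t x
  let G : ℝ → ℝ → ℝ := fun t x =>
    f x * ((Φ.β t x + Φ.γ t x - potV x * (Φ.δ t x + N * Φ.α t x)) / 2) + potV x / 2 * Φ.r t x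
      + x * potV x ^ 2 / 2 * Φ.α t x
  let I : ℝ → ℝ → ℝ := fun t x => potV x * Φ.γ t x
    + (x * f x * potV x ^ 2 * (Φ.δ t x + N * Φ.α t x)
    + (potV x ^ 2 / 2 - 2 * x ^ 2 * potV x ^ 3) * Φ.α t x)
  let Z : ℝ → ℝ → ℝ := fun t x => f x * Φ.σx t x + potV x / 2 * Φ.σ0 t x
  have cI : Cont2 I := by unfold Cont2 at *; simp only [I]; fun_prop
  have cZ : Cont2 Z := by unfold Cont2 at *; simp only [Z]; fun_prop
  have cF : Cont2 F := by unfold Cont2 at *; simp only [F]; fun_prop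
  have cG : Cont2 G := by unfold Cont2 at *; simp only [G]; fun_prop
  have h0 := rect_identity (T := T) (a := -R) (b := R) (F := F) (G := G)
    (S := fun t x => Z t x - I t x)
    (fun t x => ((Φ.p_t t x).const_mul (f x)).fun_add ((Φ.q_t t x).const_mul (potV x / 2)))
    (fun t x => ((((hfd x).fun_mul (Φ.l_x t x)).fun_add
      (((hVd x).div_const 2).fun_mul (Φ.r_x t x))).fun_add ((hV2d x).fun_mul (Φ.α_x t x))))
    cF (by unfold Cont2 at *; fun_prop) (cZ.sub cI)
    (fun t x => by simp only [Z, I]; ring)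
  rw [rectInt_sub cZ cI] at h0
  have hdom := Φ.energy_dominates hN
  have hVα : ∀ t x, 0 ≤ potV x * Φ.α t x := fun t x =>
    mul_nonneg (potV_pos x).le (Φ.α_nonneg t x)
  have hFle : ∀ t x, |F t x| ≤ 3 * Φ.e t x := by
    intro t x
    have b1 : |F t x| ≤ 2 * |Φ.p t x| + potV x / 2 * |Φ.q t x| := by
      refine (abs_add_le _ _).trans ?_
      rw [abs_mul, abs_mul, abs_of_pos (half_pos (potV_pos x))]
      have := abs_arctan_le_two x
      gcongr
    have b2 : potV x * (2 * |Φ.q t x|) ≤ potV x * (Φ.α t x + Φ.β t x) :=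
      mul_le_mul_of_nonneg_left (Φ.q_le t x) (potV_pos x).le
    have b3 : potV x * Φ.β t x ≤ Φ.β t x :=
      mul_le_of_le_one_left (Φ.β_nonneg t x) (potV_le_one x)
    nlinarith [hdom t x, Φ.p_le t x, hVα t x, Φ.γ_nonneg t x, Φ.β_nonneg t x]
  have hGle : ∀ t x, |G t x| ≤ 3 * Φ.e t x := by
    intro t x
    have hD := mul_nonneg (potV_pos x).le (Φ.D_nonneg hN0 t x)
    have he := Φ.two_mul_e t x
    have b0 : |(Φ.β t x + Φ.γ t x - potV x * (Φ.δ t x + N * Φ.α t x)) / 2| ≤ Φ.e t x := by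
      have := Φ.β_nonneg t x; have := Φ.γ_nonneg t x
      unfold D at hD he
      rw [abs_le]; constructor <;> linarith
    have b1 : |G t x| ≤ 2 * Φ.e t x + potV x / 2 * |Φ.r t x| + 1 / 2 * (potV x * Φ.α t x) := by
      refine (abs_add_le _ _).trans (add_le_add ((abs_add_le _ _).trans (add_le_add ?_ ?_)) ?_)
      · rw [abs_mul]
        have := abs_arctan_le_two x
        exact mul_le_mul this b0 (abs_nonneg _) (by norm_num)
      · rw [abs_mul, abs_of_pos (half_pos (potV_pos x))]
      · have e1 : x * potV x ^ 2 / 2 * Φ.α t x = (x * potV x) * (1 / 2 * (potV x * Φ.α t x)) := by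
          ring
        rw [e1, abs_mul, abs_mul, abs_of_pos (potV_pos x),
          abs_of_nonneg (mul_nonneg (by norm_num) (hVα t x))]
        exact mul_le_of_le_one_left (mul_nonneg (by norm_num) (hVα t x)) (abs_mul_potV_le_one x)
    have b2 : potV x * (2 * |Φ.r t x|) ≤ potV x * (Φ.α t x + Φ.γ t x) :=
      mul_le_mul_of_nonneg_left (Φ.r_le t x) (potV_pos x).le
    have b3 : potV x * Φ.γ t x ≤ Φ.γ t x :=
      mul_le_of_le_one_left (Φ.γ_nonneg t x) (potV_le_one x)
    nlinarith [hdom t x, hVα t x, Φ.γ_nonneg t x, Φ.β_nonneg t x]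
  have hFint : ∀ t ∈ Icc 0 T, |∫ x in -R..R, F t x| ≤ 3 * S := by
    intro t ht
    refine (intervalIntegral.abs_integral_le_integral_abs (by linarith)).trans ?_
    calc _ ≤ ∫ x in -R..R, 3 * Φ.e t x :=
          intervalIntegral.integral_mono_on (by linarith) (cF.abs.intervalIntegrable_x t _ _)
            ((ce.const_mul 3).intervalIntegrable_x t _ _) fun x _ => hFle t x
      _ = 3 * ∫ x in -R..R, Φ.e t x := intervalIntegral.integral_const_mul _ _
      _ ≤ _ := by linarith [hS t ht R hR]
  have hGint : |∫ t in (0 : ℝ)..T, (G t R - G t (-R))| ≤ 3 * Φ.bdry T R := by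
    refine (intervalIntegral.abs_integral_le_integral_abs hT).trans ?_
    rw [bdry, ← intervalIntegral.integral_const_mul]
    refine intervalIntegral.integral_mono_on hT
      (((cG.slice_t R).sub (cG.slice_t (-R))).abs.intervalIntegrable _ _)
      ((continuous_const.mul ((ce.slice_t R).add (ce.slice_t (-R)))).intervalIntegrable _ _)
      fun t _ => ?_
    have := abs_sub (G t R) (G t (-R))
    linarith [hGle t R, hGle t (-R)]
  have hZle : rectInt T (-R) R Z ≤ rectInt T (-R) R Φ.src := by
    refine rectInt_mono hT (by linarith) cZ Φ.csrc fun t _ x _ => ?_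
    have h1 : f x * Φ.σx t x ≤ 2 * |Φ.σx t x| := by
      refine (le_abs_self _).trans ?_
      rw [abs_mul]
      exact mul_le_mul_of_nonneg_right (abs_arctan_le_two x) (abs_nonneg _)
    have h2 : potV x / 2 * Φ.σ0 t x ≤ |Φ.σ0 t x| := by
      refine (le_abs_self _).trans ?_
      rw [abs_mul, abs_of_pos (half_pos (potV_pos x))]
      exact mul_le_of_le_one_left (abs_nonneg _) (by linarith [potV_le_one x])
    exact add_le_add h1 h2
  have hIge : rectInt T (-R) R Φ.m0 ≤ 4 * rectInt T (-R) R I := by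
    rw [← rectInt_const_mul]
    refine rectInt_mono hT (by linarith) Φ.cm0 (cI.const_mul 4) fun t _ x _ => ?_
    have := morawetz_coeff hN (Φ.δ_nonneg t x) (Φ.α_nonneg t x) x
    have hγ := mul_nonneg (potV_pos x).le (Φ.γ_nonneg t x)
    simp only [m0, I, D]
    linarith
  have hTm := hFint T ⟨hT, le_rfl⟩
  have h0m := hFint 0 ⟨le_rfl, hT⟩
  rw [abs_le] at hTm h0m hGint
  linarith

/-- The **Morawetz estimate** with boundary and source terms. -/
lemma rectInt_m_le (hN : 100 ≤ N) {T R S : ℝ} (hT : 0 ≤ T) (hR : 0 ≤ R)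
    (hS : ∀ t ∈ Icc 0 T, ∀ r, 0 ≤ r → ∫ x in -r..r, Φ.e t x ≤ S) :
    rectInt T (-R) R Φ.m ≤ 170 * S + 85 * Φ.bdry T R + 29 * rectInt T (-R) R Φ.src := by
  have hN0 : 0 ≤ N := by linarith
  have hm0 := Φ.rectInt_m0_le hN hT hR hS
  have cV : Continuous fun z : ℝ × ℝ => potV z.2 := continuous_potV.comp continuous_snd
  have cq := Φ.cq; have cr := Φ.cr; have cD := Φ.cD; have cα := Φ.cα
  have cβ := Φ.cβ; have cγ := Φ.cγ; have crx := Φ.crx; have cδ := Φ.cδ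
  have cσ0 := Φ.cσ0; have ce := Φ.ce
  have hVd := hasDerivAt_potV
  -- The multiplier g u compares gβ with gγ and gV(δ+Nα). The choice g = x²V² vanishes at the
  -- trapped set to the same order as the weight of the gradient in `m0`.
  let g : ℝ → ℝ := fun x => x ^ 2 * potV x ^ 2
  have hgd : ∀ x, HasDerivAt g (2 * x * potV x ^ 2 - 4 * x ^ 3 * potV x ^ 3) x := fun x =>
    ((hasDerivAt_pow 2 x).fun_mul ((hVd x).fun_pow 2)).congr_deriv (by norm_num; ring)
  have hg0 : ∀ x, 0 ≤ g x := fun x => by simp only [g]; positivity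
  have hgV : ∀ x, g x ≤ potV x := fun x => by
    have := mul_le_mul_of_nonneg_right (sq_mul_potV_le_one x) (potV_pos x).le
    simp only [g]; linarith
  let I : ℝ → ℝ → ℝ := fun t x => g x * Φ.β t x
  let Z : ℝ → ℝ → ℝ := fun t x => (2 * x * potV x ^ 2 - 4 * x ^ 3 * potV x ^ 3) * Φ.r t x
    + g x * (Φ.γ t x + potV x * (Φ.δ t x + N * Φ.α t x) - Φ.σ0 t x)
  have cI : Cont2 I := by unfold Cont2 at *; simp only [I, g]; fun_prop
  have cZ : Cont2 Z := by unfold Cont2 at *; simp only [Z, g]; fun_prop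
  have cF : Cont2 fun t x => g x * Φ.q t x := by unfold Cont2 at *; simp only [g]; fun_prop
  have cG : Cont2 fun t x => g x * Φ.r t x := by unfold Cont2 at *; simp only [g]; fun_prop
  have h0 := rect_identity (T := T) (a := -R) (b := R) (F := fun t x => g x * Φ.q t x)
    (G := fun t x => g x * Φ.r t x) (S := fun t x => I t x - Z t x)
    (fun t x => (Φ.q_t t x).const_mul (g x)) (fun t x => (hgd x).fun_mul (Φ.r_x t x))
    cF (by unfold Cont2 at *; simp only [g]; fun_prop) (cI.sub cZ)
    (fun t x => by simp only [Z, I]; ring)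
  rw [rectInt_sub cI cZ] at h0
  have hdom := Φ.energy_dominates hN
  have hVα : ∀ t x, 0 ≤ potV x * Φ.α t x := fun t x =>
    mul_nonneg (potV_pos x).le (Φ.α_nonneg t x)
  have hFle : ∀ t x, |g x * Φ.q t x| ≤ Φ.e t x := by
    intro t x
    rw [abs_mul, abs_of_nonneg (hg0 x)]
    have b0 : g x * |Φ.q t x| ≤ potV x * |Φ.q t x| :=
      mul_le_mul_of_nonneg_right (hgV x) (abs_nonneg _)
    have b2 : potV x * (2 * |Φ.q t x|) ≤ potV x * (Φ.α t x + Φ.β t x) :=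
      mul_le_mul_of_nonneg_left (Φ.q_le t x) (potV_pos x).le
    have b3 : potV x * Φ.β t x ≤ Φ.β t x :=
      mul_le_of_le_one_left (Φ.β_nonneg t x) (potV_le_one x)
    nlinarith [hdom t x, hVα t x, Φ.γ_nonneg t x, Φ.β_nonneg t x]
  have hGle : ∀ t x, |g x * Φ.r t x| ≤ Φ.e t x := by
    intro t x
    rw [abs_mul, abs_of_nonneg (hg0 x)]
    have b0 : g x * |Φ.r t x| ≤ potV x * |Φ.r t x| :=
      mul_le_mul_of_nonneg_right (hgV x) (abs_nonneg _)
    have b2 : potV x * (2 * |Φ.r t x|) ≤ potV x * (Φ.α t x + Φ.γ t x) :=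
      mul_le_mul_of_nonneg_left (Φ.r_le t x) (potV_pos x).le
    have b3 : potV x * Φ.γ t x ≤ Φ.γ t x :=
      mul_le_of_le_one_left (Φ.γ_nonneg t x) (potV_le_one x)
    nlinarith [hdom t x, hVα t x, Φ.γ_nonneg t x, Φ.β_nonneg t x]
  have hFint : ∀ t ∈ Icc 0 T, |∫ x in -R..R, g x * Φ.q t x| ≤ S := by
    intro t ht
    refine (intervalIntegral.abs_integral_le_integral_abs (by linarith)).trans ?_
    refine le_trans ?_ (hS t ht R hR)
    exact intervalIntegral.integral_mono_on (by linarith) (cF.abs.intervalIntegrable_x t _ _)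
      (ce.intervalIntegrable_x t _ _) fun x _ => hFle t x
  have hGint : |∫ t in (0 : ℝ)..T, (g R * Φ.r t R - g (-R) * Φ.r t (-R))| ≤ Φ.bdry T R := by
    refine (intervalIntegral.abs_integral_le_integral_abs hT).trans ?_
    refine intervalIntegral.integral_mono_on hT
      (((cG.slice_t R).sub (cG.slice_t (-R))).abs.intervalIntegrable _ _)
      (((ce.slice_t R).add (ce.slice_t (-R))).intervalIntegrable _ _)
      fun t _ => ?_
    have := abs_sub (g R * Φ.r t R) (g (-R) * Φ.r t (-R))
    linarith [hGle t R, hGle t (-R)]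
  have hZle : rectInt T (-R) R Z ≤ 6 * rectInt T (-R) R Φ.m0 + rectInt T (-R) R Φ.src := by
    rw [← rectInt_const_mul, ← rectInt_add (Φ.cm0.const_mul 6) Φ.csrc]
    refine rectInt_mono hT (by linarith) cZ ((Φ.cm0.const_mul 6).add Φ.csrc) fun t _ x _ => ?_
    have hV := potV_pos x
    have hr := Φ.r_le t x
    have hα := Φ.α_nonneg t x
    have hγ := Φ.γ_nonneg t x
    have hD := Φ.D_nonneg hN0 t x
    have b1 : |2 * x * potV x ^ 2 - 4 * x ^ 3 * potV x ^ 3| ≤ 6 * (|x| * potV x ^ 2) := by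
      have e1 : 2 * x * potV x ^ 2 - 4 * x ^ 3 * potV x ^ 3
          = x * potV x ^ 2 * (2 - 4 * (x ^ 2 * potV x)) := by ring
      rw [e1, abs_mul, abs_mul, abs_of_nonneg (sq_nonneg (potV x)), mul_comm 6]
      refine mul_le_mul_of_nonneg_left ?_ (by positivity)
      have := sq_mul_potV_le_one x
      have h2 : 0 ≤ x ^ 2 * potV x := by positivity
      rw [abs_le]; constructor <;> linarith
    have b2 : (2 * x * potV x ^ 2 - 4 * x ^ 3 * potV x ^ 3) * Φ.r t x
        ≤ 3 * (potV x * Φ.γ t x) + 6 * (wgt x * Φ.α t x) := by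
      refine (le_abs_self _).trans ?_
      rw [abs_mul]
      have c1 : |x| * potV x ^ 2 * Φ.α t x ≤ 2 * wgt x * Φ.α t x :=
        mul_le_mul_of_nonneg_right (abs_mul_potV_sq_le x) hα
      have c2 : |x| * potV x ^ 2 * Φ.γ t x ≤ potV x * Φ.γ t x := by
        have := mul_le_mul_of_nonneg_right (abs_mul_potV_le_one x) hV.le
        exact mul_le_mul_of_nonneg_right (by linarith) hγ
      have c3 : 0 ≤ |x| * potV x ^ 2 := by positivity
      calc _ ≤ 6 * (|x| * potV x ^ 2) * |Φ.r t x| := mul_le_mul_of_nonneg_right b1 (abs_nonneg _)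
        _ ≤ 3 * (|x| * potV x ^ 2) * (Φ.α t x + Φ.γ t x) := by nlinarith
        _ ≤ _ := by linarith
    have b3 : g x * Φ.γ t x ≤ potV x * Φ.γ t x := mul_le_mul_of_nonneg_right (hgV x) hγ
    have b4 : g x * (potV x * Φ.D t x) ≤ 2 * (x ^ 2 * potV x * wgt x * Φ.D t x) := by
      have c1 : x ^ 2 * potV x * Φ.D t x * potV x ^ 2 ≤ x ^ 2 * potV x * Φ.D t x * (2 * wgt x) :=
        mul_le_mul_of_nonneg_left (potV_sq_le x) (by positivity)
      simp only [g]; linarith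
    have b5 : -(g x * Φ.σ0 t x) ≤ |Φ.σ0 t x| := by
      refine (neg_le_abs _).trans ?_
      rw [abs_mul, abs_of_nonneg (hg0 x)]
      exact mul_le_of_le_one_left (abs_nonneg _) ((hgV x).trans (potV_le_one x))
    have b6 := abs_nonneg (Φ.σx t x)
    have b7 : 0 ≤ x ^ 2 * potV x * wgt x * Φ.D t x := by have := wgt_pos x; positivity
    have b8 : 0 ≤ potV x * Φ.γ t x := by positivity
    simp only [Z, m0, src]
    unfold D at *
    linarith
  -- The constants add up as 7·4·(6S + 3b + s) + 2S + b + s, with b the boundary flux and s the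
  -- source: one copy of `m0` from the definition of `m` and six from `hZle`.
  have hmI : rectInt T (-R) R Φ.m = rectInt T (-R) R Φ.m0 + rectInt T (-R) R I :=
    rectInt_add Φ.cm0 cI
  have hTm := hFint T ⟨hT, le_rfl⟩
  have h0m := hFint 0 ⟨le_rfl, hT⟩
  rw [abs_le] at hTm h0m hGint
  linarith

/-- A constant depending on the support of the source. -/
def supC (R₀ : ℝ) : ℝ := 2 * (1 + R₀ ^ 3) + (1 + R₀ ^ 2)

/-- On the support of the source V and `wgt` are bounded below, so `m` controls α and γ there. Only
these two enter, so the degeneracy of the weight of β does no harm. -/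
lemma src_le (hN : 0 ≤ N) (hκ : 0 ≤ κ) (hR₀ : 0 ≤ R₀) (t x : ℝ) :
    Φ.src t x ≤ κ * supC R₀ * Φ.m t x := by
  have hm := Φ.m_nonneg hN t x
  have hC : 0 ≤ supC R₀ := by unfold supC; positivity
  rcases le_total R₀ |x| with h | h
  · have : Φ.src t x = 0 := by simp [src, Φ.σx_supp t x h, Φ.σ0_supp t x h]
    rw [this]; positivity
  · have hα := Φ.α_nonneg t x
    have hγ := Φ.γ_nonneg t x
    have hV := potV_pos x
    have hw := wgt_pos x
    have a0 : 0 ≤ x ^ 2 * potV x * wgt x * Φ.D t x := by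
      have := Φ.D_nonneg hN t x; positivity
    have a1 : 0 ≤ x ^ 2 * potV x ^ 2 * Φ.β t x := by
      have := Φ.β_nonneg t x; positivity
    have b1 : 1 ≤ (1 + R₀ ^ 3) * wgt x := by
      unfold wgt
      rw [mul_one_div, le_div_iff₀ (one_add_abs_cube_pos x), one_mul]
      gcongr
    have b2 : 1 ≤ (1 + R₀ ^ 2) * potV x := by
      unfold potV
      rw [mul_one_div, le_div_iff₀ (by positivity), one_mul, ← sq_abs, add_comm]
      gcongr
    have b3 : Φ.α t x ≤ (1 + R₀ ^ 3) * (wgt x * Φ.α t x) := by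
      have := mul_le_mul_of_nonneg_right b1 hα; linarith
    have b4 : Φ.γ t x ≤ (1 + R₀ ^ 2) * (potV x * Φ.γ t x) := by
      have := mul_le_mul_of_nonneg_right b2 hγ; linarith
    have b5 : 0 ≤ wgt x * Φ.α t x := by positivity
    have b6 : 0 ≤ potV x * Φ.γ t x := by positivity
    have b7 : 2 * Φ.α t x + Φ.γ t x ≤ supC R₀ * Φ.m t x := by
      have c1 : wgt x * Φ.α t x ≤ Φ.m t x := by unfold m m0; linarith
      have c2 : potV x * Φ.γ t x ≤ Φ.m t x := by unfold m m0; linarith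
      have d1 := mul_le_mul_of_nonneg_left c1 (by positivity : 0 ≤ 1 + R₀ ^ 3)
      have d2 := mul_le_mul_of_nonneg_left c2 (by positivity : 0 ≤ 1 + R₀ ^ 2)
      unfold supC; linarith
    have b8 := mul_le_mul_of_nonneg_left b7 hκ
    have := Φ.σx_le t x
    have := Φ.σ0_le t x
    unfold src
    linarith

/-- The **Morawetz estimate** for small sources. -/
theorem rectInt_m_le_of_small (hN : 100 ≤ N) (hκ : 0 ≤ κ) (hR₀ : 0 ≤ R₀)
    (hsmall : 58 * (κ * supC R₀) ≤ 1) {T R S : ℝ} (hT : 0 ≤ T) (hR : 0 ≤ R)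
    (hS : ∀ t ∈ Icc 0 T, ∀ r, 0 ≤ r → ∫ x in -r..r, Φ.e t x ≤ S) :
    rectInt T (-R) R Φ.m ≤ 340 * S := by
  have hN0 : 0 ≤ N := by linarith
  refine le_of_forall_pos_le_add fun η hη => ?_
  -- By smallness the source costs at most half of the left-hand side. Absorbing it doubles 170 and
  -- 85, whence 340 and the choice η / 170.
  obtain ⟨R', hR', h0, hb⟩ := Φ.exists_bdry_le hN0 hT hS (η := η / 170) (by positivity) R
  have h1 := Φ.rectInt_m_le hN hT h0 hS
  have h2 : rectInt T (-R') R' Φ.src ≤ κ * supC R₀ * rectInt T (-R') R' Φ.m := by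
    rw [← rectInt_const_mul]
    exact rectInt_mono hT (by linarith) Φ.csrc (Φ.cm.const_mul _) fun t _ x _ =>
      Φ.src_le hN0 hκ hR₀ t x
  have h3 : 0 ≤ rectInt T (-R') R' Φ.m := rectInt_nonneg hT (by linarith) (Φ.m_nonneg hN0)
  have h4 : rectInt T (-R) R Φ.m ≤ rectInt T (-R') R' Φ.m :=
    rectInt_mono_set hT le_rfl (by linarith) (by linarith) hR' Φ.cm (Φ.m_nonneg hN0)
  nlinarith [mul_le_mul_of_nonneg_right hsmall h3]

end FluxSystem

end TrappedWave

namespace TrappedWave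

open Set Filter Topology

/-! ### Integrals over a fixed interval and its square -/

/-- The integral over `[-1/8, 1/8]`. -/
def jI (f : ℝ → ℝ) : ℝ := ∫ x in (-(1 / 8) : ℝ)..(1 / 8), f x

/-- The integral over the square of `[-1/8, 1/8]`. -/
def jJ (F : ℝ → ℝ → ℝ) : ℝ := jI fun x => jI fun y => F x y

section IntervalLemmas

variable {f g : ℝ → ℝ} {F G : ℝ → ℝ → ℝ}

lemma jI_add (hf : Continuous f) (hg : Continuous g) :
    jI (fun x => f x + g x) = jI f + jI g :=
  intervalIntegral.integral_add (hf.intervalIntegrable _ _) (hg.intervalIntegrable _ _)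

lemma jI_sub (hf : Continuous f) (hg : Continuous g) :
    jI (fun x => f x - g x) = jI f - jI g :=
  intervalIntegral.integral_sub (hf.intervalIntegrable _ _) (hg.intervalIntegrable _ _)

lemma jI_const_mul (c : ℝ) (f : ℝ → ℝ) : jI (fun x => c * f x) = c * jI f :=
  intervalIntegral.integral_const_mul _ _

lemma jI_mono (hf : Continuous f) (hg : Continuous g) (h : ∀ x, |x| ≤ 1 / 8 → f x ≤ g x) :
    jI f ≤ jI g :=
  intervalIntegral.integral_mono_on (by norm_num) (hf.intervalIntegrable _ _)
    (hg.intervalIntegrable _ _) fun x hx => h x (abs_le.2 hx)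

lemma jI_congr (h : ∀ x, |x| ≤ 1 / 8 → f x = g x) : jI f = jI g :=
  intervalIntegral.integral_congr fun x hx => h x (by
    rw [uIcc_of_le (by norm_num)] at hx; exact abs_le.2 hx)

lemma jI_nonneg (h : ∀ x, 0 ≤ f x) : 0 ≤ jI f :=
  intervalIntegral.integral_nonneg (by norm_num) fun x _ => h x

lemma abs_jI_le : |jI f| ≤ jI fun x => |f x| :=
  intervalIntegral.abs_integral_le_integral_abs (by norm_num)

lemma Cont2.jI {F : ℝ → ℝ → ℝ} (h : Cont2 F) : Continuous fun x => TrappedWave.jI fun y => F x y :=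
  h.continuous_integral _ _

lemma jJ_add (hF : Cont2 F) (hG : Cont2 G) :
    jJ (fun x y => F x y + G x y) = jJ F + jJ G := by
  unfold jJ
  rw [← jI_add hF.jI hG.jI]
  exact jI_congr fun x _ => jI_add (hF.slice_x x) (hG.slice_x x)

lemma jJ_sub (hF : Cont2 F) (hG : Cont2 G) :
    jJ (fun x y => F x y - G x y) = jJ F - jJ G := by
  unfold jJ
  rw [← jI_sub hF.jI hG.jI]
  exact jI_congr fun x _ => jI_sub (hF.slice_x x) (hG.slice_x x)

lemma jJ_const_mul (c : ℝ) (F : ℝ → ℝ → ℝ) : jJ (fun x y => c * F x y) = c * jJ F := by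
  simp only [jJ, jI_const_mul]

lemma jJ_mono (hF : Cont2 F) (hG : Cont2 G)
    (h : ∀ x y, |x| ≤ 1 / 8 → |y| ≤ 1 / 8 → F x y ≤ G x y) : jJ F ≤ jJ G :=
  jI_mono hF.jI hG.jI fun x hx => jI_mono (hF.slice_x x) (hG.slice_x x) fun y hy => h x y hx hy

lemma jJ_swap (hF : Cont2 F) : jJ F = jJ fun x y => F y x := by
  refine intervalIntegral_intervalIntegral_swap (F := F) ?_
  exact ((hF : Continuous F.uncurry).continuousOn.integrableOn_compact
    (isCompact_uIcc.prod isCompact_uIcc)).mono_set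
    (prod_mono uIoc_subset_uIcc uIoc_subset_uIcc)

lemma jJ_eq_zero (hF : Cont2 F) (h : ∀ x y, F y x = -F x y) : jJ F = 0 := by
  have h1 := jJ_swap hF
  have h2 : (jJ fun x y => F y x) = -jJ F := by
    have := jJ_const_mul (-1) F
    simp only [neg_one_mul] at this
    rw [← this]
    exact congrArg jJ (by funext x y; exact h x y)
  linarith

/-- The Cauchy-Schwarz inequality with a weight. -/
lemma sq_integral_mul_le {w h : ℝ → ℝ} {a b : ℝ} (hab : a ≤ b) (hw : Continuous w)
    (hh : Continuous h) (h0 : ∀ x, 0 ≤ w x) :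
    (∫ x in a..b, w x * h x) ^ 2 ≤ (∫ x in a..b, w x) * ∫ x in a..b, w x * h x ^ 2 := by
  have key : ∀ m : ℝ, 0 ≤ (∫ x in a..b, w x) * (m * m) + (-2 * ∫ x in a..b, w x * h x) * m
      + ∫ x in a..b, w x * h x ^ 2 := by
    intro m
    have e : (∫ x in a..b, w x * (m - h x) ^ 2) = (∫ x in a..b, w x) * (m * m)
        + (-2 * ∫ x in a..b, w x * h x) * m + ∫ x in a..b, w x * h x ^ 2 := by
      have i1 : IntervalIntegrable (fun x => w x * (m * m)) volume a b :=
        Continuous.intervalIntegrable (by fun_prop) _ _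
      have i2 : IntervalIntegrable (fun x => -2 * (w x * h x) * m) volume a b :=
        Continuous.intervalIntegrable (by fun_prop) _ _
      have i3 : IntervalIntegrable (fun x => w x * h x ^ 2) volume a b :=
        Continuous.intervalIntegrable (by fun_prop) _ _
      rw [← intervalIntegral.integral_mul_const, ← intervalIntegral.integral_const_mul,
        ← intervalIntegral.integral_mul_const, ← intervalIntegral.integral_add i1 i2,
        ← intervalIntegral.integral_add (i1.add i2) i3]
      exact intervalIntegral.integral_congr fun x _ => by ring
    rw [← e]
    exact intervalIntegral.integral_nonneg hab fun x _ => mul_nonneg (h0 x) (sq_nonneg _)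
  have := discrim_le_zero key
  unfold discrim at this
  nlinarith

/-- Translation bound for the difference quotient in mean square. -/
lemma integral_sq_translate_le {U U₁ : ℝ → ℝ} (hd : ∀ x, HasDerivAt U (U₁ x) x)
    (hc : Continuous U₁) (hs : ∀ x, 1 / 16 ≤ |x| → U₁ x = 0) {d : ℝ} (hd4 : |d| ≤ 1 / 4) :
    (jI fun y => (U (y + d) - U y) ^ 2) ≤ d ^ 2 * jI fun y => U₁ y ^ 2 := by
  have hU : Continuous U := continuous_iff_continuousAt.2 fun x => (hd x).continuousAt
  have c1 : Cont2 fun y τ => U₁ (y + τ * d) ^ 2 := by unfold Cont2; fun_prop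
  have h1 : ∀ y, (U (y + d) - U y) ^ 2 ≤ d ^ 2 * ∫ τ in (0 : ℝ)..1, U₁ (y + τ * d) ^ 2 := by
    intro y
    have e1 : ∫ τ in (0 : ℝ)..1, d * U₁ (y + τ * d) = U (y + d) - U y := by
      have := intervalIntegral.integral_eq_sub_of_hasDerivAt (a := 0) (b := 1)
        (f := fun τ => U (y + τ * d)) (f' := fun τ => d * U₁ (y + τ * d)) (fun τ _ => by
          have h2 : HasDerivAt (fun τ : ℝ => y + τ * d) d τ := by
            simpa using ((hasDerivAt_id τ).mul_const d).const_add y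
          exact ((hd _).comp τ h2).congr_deriv (by ring))
        (Continuous.intervalIntegrable (by fun_prop) _ _)
      simpa using this
    have e2 := sq_integral_mul_le (a := 0) (b := 1) (w := fun _ => 1)
      (h := fun τ => d * U₁ (y + τ * d)) (by norm_num) (by fun_prop) (by fun_prop) (fun _ => zero_le_one)
    simp only [one_mul, intervalIntegral.integral_const, sub_zero, smul_eq_mul, mul_one, mul_pow,
      intervalIntegral.integral_const_mul] at e2
    rw [← e1]
    simpa [intervalIntegral.integral_const_mul, mul_pow] using e2
  have cI : Continuous fun y => ∫ τ in (0 : ℝ)..1, U₁ (y + τ * d) ^ 2 := c1.continuous_integral 0 1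
  have h2 : (jI fun y => (U (y + d) - U y) ^ 2)
      ≤ d ^ 2 * jI fun y => ∫ τ in (0 : ℝ)..1, U₁ (y + τ * d) ^ 2 := by
    rw [← jI_const_mul]
    exact jI_mono (by fun_prop) (by fun_prop) fun y _ => h1 y
  refine h2.trans (mul_le_mul_of_nonneg_left ?_ (sq_nonneg d))
  have h3 : (jI fun y => ∫ τ in (0 : ℝ)..1, U₁ (y + τ * d) ^ 2)
      = ∫ τ in (0 : ℝ)..1, jI fun y => U₁ (y + τ * d) ^ 2 := (rectInt_swap (S := fun τ y =>
        U₁ (y + τ * d) ^ 2) c1.swap).symm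
  rw [h3]
  have h4 : ∀ τ ∈ Icc (0 : ℝ) 1, (jI fun y => U₁ (y + τ * d) ^ 2) ≤ jI fun y => U₁ y ^ 2 := by
    intro τ hτ
    have e1 : (jI fun y => U₁ (y + τ * d) ^ 2)
        = ∫ y in (-(1 / 8) + τ * d)..(1 / 8 + τ * d), U₁ y ^ 2 := by
      unfold jI
      exact intervalIntegral.integral_comp_add_right (fun y => U₁ y ^ 2) (τ * d)
    have e2 : |τ * d| ≤ 1 / 4 := by
      rw [abs_mul, abs_of_nonneg hτ.1]
      have := abs_nonneg d
      nlinarith [hτ.2]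
    rw [abs_le] at e2
    rw [e1]
    calc _ ≤ ∫ y in (-1 : ℝ)..1, U₁ y ^ 2 :=
          integral_mono_interval (by linarith) (by linarith) (by linarith) (by fun_prop)
            fun y => sq_nonneg _
      _ ≤ _ := integral_le_of_supp (by fun_prop) (fun y => sq_nonneg _) (by norm_num) (by norm_num)
          fun x hx => by rw [hs x (by linarith)]; norm_num
  calc _ ≤ ∫ _ in (0 : ℝ)..1, jI fun y => U₁ y ^ 2 := by
        refine intervalIntegral.integral_mono_on (by norm_num)
          ((Cont2.jI (F := fun τ y => U₁ (y + τ * d) ^ 2) c1.swap).intervalIntegrable _ _)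
          (by simp) h4
    _ = _ := by simp

end IntervalLemmas

/-! ### The geometry of the barrier top -/

/-- The derivative of `jap`. -/
def jap1 (x : ℝ) : ℝ := x / jap x

/-- The second derivative of `jap`. -/
def jap2 (x : ℝ) : ℝ := 1 / jap x ^ 3

lemma continuous_jap1 : Continuous jap1 :=
  continuous_id.div continuous_jap fun x => (jap_pos x).ne'

lemma continuous_jap2 : Continuous jap2 :=
  continuous_const.div (continuous_jap.pow 3) fun x => (pow_pos (jap_pos x) 3).ne'

lemma one_le_jap (x : ℝ) : 1 ≤ jap x := Real.one_le_sqrt.2 (by nlinarith [sq_nonneg x])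

lemma hasDerivAt_jap1 (x : ℝ) : HasDerivAt jap1 (jap2 x) x := by
  have h := (hasDerivAt_id x).fun_div (hasDerivAt_jap x) (jap_pos x).ne'
  refine h.congr_deriv ?_
  have := (jap_pos x).ne'
  have h2 := jap_sq x
  unfold jap2
  simp only [id]
  field_simp
  linarith

lemma hasDerivAt_jap2 (x : ℝ) : HasDerivAt jap2 (-3 * x / jap x ^ 5) x := by
  have h := ((hasDerivAt_jap x).fun_pow 3).fun_inv (pow_pos (jap_pos x) 3).ne'
  have e : jap2 = fun y => (jap y ^ 3)⁻¹ := by funext y; simp [jap2]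
  rw [e]
  refine h.congr_deriv ?_
  have := (jap_pos x).ne'
  field_simp
  norm_num
  ring

/-- The eikonal equation at the top of the barrier: up to the constant 1, the potential is minus the
square of the derivative of `jap`. This makes L·`jap` an exact phase. -/
lemma potV_eq (x : ℝ) : potV x = 1 - jap1 x ^ 2 := by
  have h := jap_sq x
  have := (jap_pos x).ne'
  unfold potV jap1
  rw [div_pow, h]
  have := one_add_sq_ne x
  field_simp
  ring

lemma jap2_le_one (x : ℝ) : jap2 x ≤ 1 := by
  unfold jap2
  rw [div_le_one (pow_pos (jap_pos x) 3)]
  exact one_le_pow₀ (one_le_jap x)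

lemma jap2_pos (x : ℝ) : 0 < jap2 x := one_div_pos.2 (pow_pos (jap_pos x) 3)

lemma le_jap2 {x : ℝ} (hx : |x| ≤ 1 / 8) : 97 / 100 ≤ jap2 x := by
  have h0 : x ^ 2 ≤ 1 / 64 := by rw [← sq_abs]; nlinarith [abs_nonneg x]
  have h1 := jap_sq x
  have h2 := one_le_jap x
  have h3 : jap x ≤ 1 + 1 / 128 := by nlinarith
  unfold jap2
  rw [le_div_iff₀ (pow_pos (jap_pos x) 3)]
  have : jap x ^ 3 ≤ (1 + 1 / 128) ^ 3 := pow_le_pow_left₀ (by linarith) h3 3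
  nlinarith

lemma abs_jap2_sub_le (x y : ℝ) : |jap2 y - jap2 x| ≤ 3 * |y - x| := by
  have h := Convex.norm_image_sub_le_of_norm_hasDerivWithin_le (f := jap2) (s := univ) (x := x)
    (y := y) (C := 3) (fun z _ => (hasDerivAt_jap2 z).hasDerivWithinAt) (fun z _ => ?_)
    convex_univ trivial trivial
  · simpa [Real.norm_eq_abs] using h
  · rw [Real.norm_eq_abs, abs_div, abs_mul, abs_of_pos (pow_pos (jap_pos z) 5),
      div_le_iff₀ (pow_pos (jap_pos z) 5)]
    have h1 : jap z ≤ jap z ^ 5 := le_self_pow₀ (one_le_jap z) (by norm_num)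
    have := abs_le_jap z
    norm_num
    linarith

lemma mul_jap1_sub_ge {x y : ℝ} (hx : |x| ≤ 1 / 8) (hy : |y| ≤ 1 / 8) :
    97 / 100 * (x - y) ^ 2 ≤ (x - y) * (jap1 x - jap1 y) := by
  have key : ∀ a b : ℝ, |a| ≤ 1 / 8 → |b| ≤ 1 / 8 → a ≤ b → 97 / 100 * (b - a) ≤ jap1 b - jap1 a := by
    intro a b ha hb hab
    have := (convex_Icc (-(1 / 8) : ℝ) (1 / 8)).mul_sub_le_image_sub_of_le_deriv (f := jap1)
      (C := 97 / 100) continuous_jap1.continuousOn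
      (fun z _ => (hasDerivAt_jap1 z).differentiableAt.differentiableWithinAt)
      (fun z hz => by
        rw [(hasDerivAt_jap1 z).deriv]
        have hz' : z ∈ Icc (-(1 / 8) : ℝ) (1 / 8) := interior_subset hz
        exact le_jap2 (abs_le.2 hz')) a (abs_le.1 ha) b (abs_le.1 hb) hab
    exact this
  rcases le_total x y with h | h
  · have := key x y hx hy h
    nlinarith
  · have := key y x hy hx h
    nlinarith

lemma abs_jap1_sub_le (x y : ℝ) : |jap1 x - jap1 y| ≤ |x - y| := by
  have h := Convex.norm_image_sub_le_of_norm_hasDerivWithin_le (f := jap1) (s := univ) (x := y)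
    (y := x) (C := 1) (fun z _ => (hasDerivAt_jap1 z).hasDerivWithinAt) (fun z _ => by
      rw [Real.norm_eq_abs, abs_of_pos (jap2_pos z)]; exact jap2_le_one z)
    convex_univ trivial trivial
  simpa [Real.norm_eq_abs] using h

lemma jap_sub_eq (x y : ℝ) : jap x - jap y = (x - y) * (x + y) / (jap x + jap y) := by
  have h1 := jap_sq x
  have h2 := jap_sq y
  have := jap_pos x
  have := jap_pos y
  rw [eq_div_iff (by positivity)]
  nlinarith

lemma abs_jap_sub_le (x y : ℝ) : |jap x - jap y| ≤ |x - y| * |x + y| / 2 := by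
  rw [jap_sub_eq, abs_div, abs_mul, abs_of_pos (add_pos (jap_pos x) (jap_pos y))]
  have := one_le_jap x
  have := one_le_jap y
  exact div_le_div_of_nonneg_left (by positivity) (by norm_num) (by linarith)

end TrappedWave

namespace TrappedWave

open Set Filter Topology

/-! ### The kernel -/

/-- The regularized square of the distance. -/
def qd (L d : ℝ) : ℝ := d ^ 2 + (L ^ 2)⁻¹

/-- The profile of the kernel. -/
def phi (L d : ℝ) : ℝ := √L * qd L d ^ (-(3 / 4) : ℝ)

/-- The derivative of `phi`. -/
def phi1 (L d : ℝ) : ℝ := -(3 / 2) * √L * (d * qd L d ^ (-(7 / 4) : ℝ))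

/-- The second derivative of `phi`. -/
def phi2 (L d : ℝ) : ℝ :=
  -(3 / 2) * √L * (qd L d ^ (-(7 / 4) : ℝ) - 7 / 2 * d ^ 2 * qd L d ^ (-(11 / 4) : ℝ))

variable {L : ℝ}

lemma qd_pos (hL : 0 < L) (d : ℝ) : 0 < qd L d := by unfold qd; positivity

lemma qd_neg (L d : ℝ) : qd L (-d) = qd L d := by simp [qd]

lemma phi_neg (L d : ℝ) : phi L (-d) = phi L d := by simp [phi, qd_neg]

lemma phi1_neg (L d : ℝ) : phi1 L (-d) = -phi1 L d := by simp [phi1, qd_neg]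

lemma phi2_neg (L d : ℝ) : phi2 L (-d) = phi2 L d := by simp [phi2, qd_neg]

lemma hasDerivAt_qd (L d : ℝ) : HasDerivAt (qd L) (2 * d) d :=
  ((hasDerivAt_pow 2 d).add_const _).congr_deriv (by norm_num)

lemma hasDerivAt_qd_rpow (hL : 0 < L) (p d : ℝ) :
    HasDerivAt (fun z => qd L z ^ p) (2 * d * p * qd L d ^ (p - 1)) d :=
  (hasDerivAt_qd L d).rpow_const (Or.inl (qd_pos hL d).ne')

lemma continuous_qd_rpow (hL : 0 < L) (p : ℝ) : Continuous fun z => qd L z ^ p :=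
  continuous_iff_continuousAt.2 fun d => (hasDerivAt_qd_rpow hL p d).continuousAt

lemma hasDerivAt_phi (hL : 0 < L) (d : ℝ) : HasDerivAt (phi L) (phi1 L d) d := by
  refine ((hasDerivAt_qd_rpow hL _ d).const_mul (√L)).congr_deriv ?_
  have e : (-(3 / 4) : ℝ) - 1 = -(7 / 4) := by norm_num
  unfold phi1
  rw [e]
  ring

lemma hasDerivAt_phi1 (hL : 0 < L) (d : ℝ) : HasDerivAt (phi1 L) (phi2 L d) d := by
  refine (((hasDerivAt_id d).fun_mul (hasDerivAt_qd_rpow hL (-(7 / 4)) d)).const_mul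
    (-(3 / 2) * √L)).congr_deriv ?_
  have e : (-(7 / 4) : ℝ) - 1 = -(11 / 4) := by norm_num
  unfold phi2
  simp only [id]
  rw [e]
  ring

lemma continuous_phi (hL : 0 < L) : Continuous (phi L) :=
  continuous_const.mul (continuous_qd_rpow hL _)

lemma continuous_phi1 (hL : 0 < L) : Continuous (phi1 L) :=
  continuous_const.mul (continuous_id.mul (continuous_qd_rpow hL _))

lemma continuous_phi2 (hL : 0 < L) : Continuous (phi2 L) :=
  continuous_const.mul ((continuous_qd_rpow hL _).sub
    ((by fun_prop : Continuous fun d : ℝ => 7 / 2 * d ^ 2).mul (continuous_qd_rpow hL _)))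

lemma phi_pos (hL : 0 < L) (d : ℝ) : 0 < phi L d :=
  mul_pos (Real.sqrt_pos.2 hL) (Real.rpow_pos_of_pos (qd_pos hL d) _)

/-- The phase of the kernel. -/
def phase (L x y : ℝ) : ℝ := L * (jap x - jap y)

/-- The antisymmetric kernel. -/
def ker (L x y : ℝ) : ℝ := phi L (x - y) * Real.sin (phase L x y)

/-- The first derivative of the kernel in the first variable. -/
def ker1 (L x y : ℝ) : ℝ :=
  phi1 L (x - y) * Real.sin (phase L x y)
    + phi L (x - y) * (L * jap1 x) * Real.cos (phase L x y)

/-- The second derivative of the kernel in the first variable. -/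
def ker2 (L x y : ℝ) : ℝ :=
  phi2 L (x - y) * Real.sin (phase L x y)
    + L * (2 * phi1 L (x - y) * jap1 x + phi L (x - y) * jap2 x) * Real.cos (phase L x y)
    - phi L (x - y) * (L * jap1 x) ^ 2 * Real.sin (phase L x y)

/-- The symmetric kernel of the commutator. -/
def kerB (L x y : ℝ) : ℝ :=
  -2 * phi1 L (x - y) * (jap1 x - jap1 y) - phi L (x - y) * (jap2 x + jap2 y)

lemma phase_swap (L x y : ℝ) : phase L y x = -phase L x y := by unfold phase; ring

lemma ker_swap (L x y : ℝ) : ker L y x = -ker L x y := by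
  unfold ker
  rw [phase_swap, Real.sin_neg, ← neg_sub x y, phi_neg]; ring

lemma kerB_swap (L x y : ℝ) : kerB L y x = kerB L x y := by
  unfold kerB
  rw [← neg_sub x y, phi_neg, phi1_neg]; ring

lemma hasDerivAt_phase (L x y : ℝ) : HasDerivAt (fun z => phase L z y) (L * jap1 x) x :=
  ((hasDerivAt_jap x).sub_const _).const_mul L

lemma hasDerivAt_phi_sub (hL : 0 < L) (x y : ℝ) :
    HasDerivAt (fun z => phi L (z - y)) (phi1 L (x - y)) x :=
  (hasDerivAt_phi hL (x - y)).comp_sub_const x y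

lemma hasDerivAt_phi1_sub (hL : 0 < L) (x y : ℝ) :
    HasDerivAt (fun z => phi1 L (z - y)) (phi2 L (x - y)) x :=
  (hasDerivAt_phi1 hL (x - y)).comp_sub_const x y

lemma hasDerivAt_ker (hL : 0 < L) (x y : ℝ) :
    HasDerivAt (fun z => ker L z y) (ker1 L x y) x :=
  ((hasDerivAt_phi_sub hL x y).fun_mul (hasDerivAt_phase L x y).sin).congr_deriv (by
    unfold ker1; ring)

lemma hasDerivAt_ker1 (hL : 0 < L) (x y : ℝ) :
    HasDerivAt (fun z => ker1 L z y) (ker2 L x y) x :=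
  (((hasDerivAt_phi1_sub hL x y).fun_mul (hasDerivAt_phase L x y).sin).fun_add
    (((hasDerivAt_phi_sub hL x y).fun_mul ((hasDerivAt_jap1 x).const_mul L)).fun_mul
      (hasDerivAt_phase L x y).cos)).congr_deriv (by unfold ker2; ring)

lemma cont2_phase (L : ℝ) : Cont2 (phase L) := by
  have := continuous_jap
  unfold Cont2 phase; fun_prop

lemma cont2_phi (hL : 0 < L) : Cont2 fun x y => phi L (x - y) :=
  (continuous_phi hL).comp (by fun_prop : Continuous fun z : ℝ × ℝ => z.1 - z.2)

lemma cont2_phi1 (hL : 0 < L) : Cont2 fun x y => phi1 L (x - y) :=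
  (continuous_phi1 hL).comp (by fun_prop : Continuous fun z : ℝ × ℝ => z.1 - z.2)

lemma cont2_phi2 (hL : 0 < L) : Cont2 fun x y => phi2 L (x - y) :=
  (continuous_phi2 hL).comp (by fun_prop : Continuous fun z : ℝ × ℝ => z.1 - z.2)

lemma cont2_ker (hL : 0 < L) : Cont2 (ker L) :=
  (cont2_phi hL).mul (Real.continuous_sin.comp (cont2_phase L))

lemma cont2_ker1 (hL : 0 < L) : Cont2 (ker1 L) := by
  have h1 := cont2_phi hL; have h2 := cont2_phi1 hL; have h3 := cont2_phase L
  have h4 := continuous_jap1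
  unfold Cont2 ker1 at *
  fun_prop

lemma cont2_ker2 (hL : 0 < L) : Cont2 (ker2 L) := by
  have h1 := cont2_phi hL; have h2 := cont2_phi1 hL; have h3 := cont2_phase L
  have h4 := continuous_jap1; have h5 := cont2_phi2 hL; have h6 := continuous_jap2
  unfold Cont2 ker2 at *
  fun_prop

lemma cont2_kerB (hL : 0 < L) : Cont2 (kerB L) := by
  have h1 := cont2_phi hL; have h2 := cont2_phi1 hL
  have h4 := continuous_jap1; have h6 := continuous_jap2
  unfold Cont2 kerB at *
  fun_prop

/-- Twice continuously differentiable functions supported near the origin. -/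
structure CutFun (U U₁ U₂ : ℝ → ℝ) : Prop where
  d1 : ∀ x, HasDerivAt U (U₁ x) x
  d2 : ∀ x, HasDerivAt U₁ (U₂ x) x
  c2 : Continuous U₂
  supp : ∀ x, 1 / 16 ≤ |x| → U x = 0
  supp1 : ∀ x, 1 / 16 ≤ |x| → U₁ x = 0

namespace CutFun

variable {U U₁ U₂ : ℝ → ℝ}

lemma c0 (h : CutFun U U₁ U₂) : Continuous U := continuous_iff_continuousAt.2 fun x => (h.d1 x).continuousAt

lemma c1 (h : CutFun U U₁ U₂) : Continuous U₁ := continuous_iff_continuousAt.2 fun x => (h.d2 x).continuousAt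

end CutFun

/-- The modulus squared of the difference of the modulated values. -/
def dfun (L : ℝ) (U : ℝ → ℝ) (x y : ℝ) : ℝ :=
  U x ^ 2 + U y ^ 2 - 2 * Real.cos (phase L x y) * (U x * U y)

lemma cont2_dfun (L : ℝ) {U : ℝ → ℝ} (hU : Continuous U) : Cont2 (dfun L U) := by
  have h3 := cont2_phase L
  unfold Cont2 dfun at *
  fun_prop

/-- The right-hand side is |e^(iLj(x))U(x) - e^(iLj(y))U(y)|², and the left-hand side is what
remains after minimizing it over U(x). -/
lemma dfun_ge (L : ℝ) (U : ℝ → ℝ) (x y : ℝ) :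
    Real.sin (phase L x y) ^ 2 * U y ^ 2 ≤ dfun L U x y := by
  unfold dfun
  have := Real.sin_sq_add_cos_sq (phase L x y)
  nlinarith [sq_nonneg (U x - Real.cos (phase L x y) * U y)]

lemma dfun_nonneg (L : ℝ) (U : ℝ → ℝ) (x y : ℝ) : 0 ≤ dfun L U x y :=
  le_trans (by positivity) (dfun_ge L U x y)

lemma dfun_le (L : ℝ) (U : ℝ → ℝ) (x y : ℝ) :
    dfun L U x y ≤ (U x - U y) ^ 2 + phase L x y ^ 2 / 2 * (U x ^ 2 + U y ^ 2) := by
  unfold dfun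
  have h1 := Real.one_sub_sq_div_two_le_cos (x := phase L x y)
  have h2 := Real.cos_le_one (phase L x y)
  have h3 : 2 * (U x * U y) ≤ U x ^ 2 + U y ^ 2 := by nlinarith [sq_nonneg (U x - U y)]
  have h4 := mul_le_mul_of_nonneg_left h3 (by linarith : 0 ≤ 1 - Real.cos (phase L x y))
  have h5 : 0 ≤ U x ^ 2 + U y ^ 2 := by positivity
  have h6 := mul_le_mul_of_nonneg_right h1 h5
  nlinarith

/-- The quadratic form of the commutator. -/
def comQ (L : ℝ) (U U₂ : ℝ → ℝ) : ℝ :=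
  jJ fun x y => (U₂ x + L ^ 2 * jap1 x ^ 2 * U x) * ker L x y * U y

/-- The commutator identity. -/
lemma comQ_eq (hL : 0 < L) {U U₁ U₂ : ℝ → ℝ} (h : CutFun U U₁ U₂) :
    4 * comQ L U U₂ = L * jJ (fun x y => kerB L x y * dfun L U x y)
      - 2 * L * jI (fun x => jI (fun y => kerB L x y) * U x ^ 2) := by
  have cU := h.c0; have cU1 := h.c1; have cU2 := h.c2
  have hk := cont2_ker hL; have hk1 := cont2_ker1 hL; have hk2 := cont2_ker2 hL
  have hB := cont2_kerB hL; have hph := cont2_phase L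
  have cj1 := continuous_jap1; have cj2 := continuous_jap2
  have hphi := cont2_phi hL; have hphi1 := cont2_phi1 hL; have hphi2 := cont2_phi2 hL
  have hd := cont2_dfun L cU
  have cF1 : Cont2 fun x y => (U₂ x + L ^ 2 * jap1 x ^ 2 * U x) * ker L x y * U y := by
    unfold Cont2 at *; fun_prop
  have cF2 : Cont2 fun x y => (ker2 L x y + L ^ 2 * jap1 x ^ 2 * ker L x y) * (U x * U y) := by
    unfold Cont2 at *; fun_prop
  have cF3 : Cont2 fun x y => phi2 L (x - y) * Real.sin (phase L x y) * (U x * U y) := by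
    unfold Cont2 at *; fun_prop
  have cF4 : Cont2 fun x y => L * (2 * phi1 L (x - y) * jap1 x + phi L (x - y) * jap2 x)
      * Real.cos (phase L x y) * (U x * U y) := by
    unfold Cont2 at *; fun_prop
  -- Two derivatives are moved from `U` to the kernel. The support of `U` lies well inside the
  -- interval, so there are no boundary terms.
  have e1 : comQ L U U₂ = jJ fun x y =>
      (ker2 L x y + L ^ 2 * jap1 x ^ 2 * ker L x y) * (U x * U y) := by
    rw [comQ, jJ_swap cF1, jJ_swap cF2]
    refine jI_congr fun y _ => ?_
    have cA : Continuous fun x => U₂ x * ker L x y - U x * ker2 L x y := by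
      have a1 := hk.slice_t y; have a2 := hk2.slice_t y
      fun_prop
    have ftc : jI (fun x => U₂ x * ker L x y - U x * ker2 L x y) = 0 := by
      have := intervalIntegral.integral_eq_sub_of_hasDerivAt (a := -(1 / 8)) (b := 1 / 8)
        (f := fun x => U₁ x * ker L x y - U x * ker1 L x y)
        (f' := fun x => U₂ x * ker L x y - U x * ker2 L x y)
        (fun x _ => (((h.d2 x).fun_mul (hasDerivAt_ker hL x y)).fun_sub
          ((h.d1 x).fun_mul (hasDerivAt_ker1 hL x y))).congr_deriv (by ring))
        (cA.intervalIntegrable _ _)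
      have z1 : 1 / 16 ≤ |(1 / 8 : ℝ)| := by rw [abs_of_pos] <;> norm_num
      have z2 : 1 / 16 ≤ |(-(1 / 8) : ℝ)| := by rw [abs_neg]; exact z1
      rw [h.supp _ z1, h.supp _ z2, h.supp1 _ z1, h.supp1 _ z2] at this
      simpa [jI] using this
    have cB : Continuous fun x => (ker2 L x y + L ^ 2 * jap1 x ^ 2 * ker L x y) * (U x * U y) :=
      cF2.slice_t y
    have := jI_add (cA.mul_const (U y)) cB
    have e : jI (fun x => (U₂ x * ker L x y - U x * ker2 L x y) * U y) = 0 := by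
      have := jI_const_mul (U y) (fun x => U₂ x * ker L x y - U x * ker2 L x y)
      rw [ftc, mul_zero] at this
      rw [← this]
      exact jI_congr fun x _ => mul_comm _ _
    rw [e, zero_add] at this
    rw [← this]
    exact jI_congr fun x _ => by ring
  -- The terms of order L² cancel by the eikonal equation, and the part with the second derivative
  -- of the profile is antisymmetric, hence integrates to zero against U(x)U(y).
  have e2 : comQ L U U₂ = jJ fun x y =>
      L * (2 * phi1 L (x - y) * jap1 x + phi L (x - y) * jap2 x)
      * Real.cos (phase L x y) * (U x * U y) := by
    have z : jJ (fun x y => phi2 L (x - y) * Real.sin (phase L x y) * (U x * U y)) = 0 :=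
      jJ_eq_zero cF3 fun x y => by
        rw [phase_swap, Real.sin_neg, ← neg_sub x y, phi2_neg]; ring
    have s := jJ_add cF3 cF4
    rw [z, zero_add] at s
    rw [e1, ← s]
    exact congrArg jJ (by funext x y; unfold ker2 ker; ring)
  have cF5 : Cont2 fun x y => kerB L x y * dfun L U x y := by unfold Cont2 at *; fun_prop
  have cF6 : Cont2 fun x y => kerB L x y * U x ^ 2 := by unfold Cont2 at *; fun_prop
  have cF7 : Cont2 fun x y => kerB L x y * U y ^ 2 := by unfold Cont2 at *; fun_prop
  -- Symmetrization in x and y: the cosine is even, and the sum of the two coefficients is minus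
  -- `kerB`.
  have e3 : 2 * comQ L U U₂ = jJ fun x y =>
      -L * kerB L x y * Real.cos (phase L x y) * (U x * U y) := by
    have s := jJ_add cF4 (G := fun x y => L * (2 * phi1 L (y - x) * jap1 y + phi L (y - x) * jap2 y)
      * Real.cos (phase L y x) * (U y * U x)) cF4.swap
    rw [← jJ_swap cF4, ← e2] at s
    rw [two_mul, ← s]
    refine congrArg jJ ?_
    funext x y
    rw [phase_swap, Real.cos_neg, ← neg_sub x y, phi_neg, phi1_neg]
    unfold kerB
    ring
  have e4 : jJ (fun x y => kerB L x y * U y ^ 2) = jJ fun x y => kerB L x y * U x ^ 2 := by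
    rw [jJ_swap cF7]
    exact congrArg jJ (by funext x y; rw [kerB_swap])
  have e5 : jJ (fun x y => kerB L x y * U x ^ 2)
      = jI (fun x => jI (fun y => kerB L x y) * U x ^ 2) := by
    unfold jJ
    refine jI_congr fun x _ => ?_
    rw [mul_comm, ← jI_const_mul]
    exact jI_congr fun y _ => mul_comm _ _
  -- The identity -2cos(phase)U(x)U(y) = `dfun` - U(x)² - U(y)² isolates the difference form and
  -- leaves only the marginals of the kernel.
  have e6 : 2 * (jJ fun x y => -L * kerB L x y * Real.cos (phase L x y) * (U x * U y))
      = L * jJ (fun x y => kerB L x y * dfun L U x y)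
        - L * (jJ (fun x y => kerB L x y * U x ^ 2) + jJ (fun x y => kerB L x y * U y ^ 2)) := by
    rw [← jJ_add cF6 cF7, ← jJ_const_mul, ← jJ_const_mul, ← jJ_const_mul,
      ← jJ_sub (cF5.const_mul L) ((cF6.add cF7).const_mul L)]
    refine congrArg jJ ?_
    funext x y
    unfold dfun
    ring
  rw [e4, e5] at e6
  linarith

end TrappedWave

/-! ### Size and sign of the kernels. -/

namespace TrappedWave

open Set Filter Topology

variable {L : ℝ}

/-- The total mass of the profile of the kernel. -/
def profMass : ℝ := ∫ z : ℝ, (1 + z ^ 2) ^ (-(3 / 4) : ℝ)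

lemma integrable_prof : Integrable fun z : ℝ => (1 + z ^ 2) ^ (-(3 / 4) : ℝ) := by
  have := integrable_rpow_neg_one_add_norm_sq (E := ℝ) (μ := volume) (r := 3 / 2) (by norm_num)
  refine this.congr (Eventually.of_forall fun z => ?_)
  simp only [Real.norm_eq_abs, sq_abs]
  norm_num

lemma profMass_nonneg : 0 ≤ profMass := integral_nonneg fun z => by positivity

lemma qd_eq (hL : 0 < L) (z : ℝ) : qd L z = (L ^ 2)⁻¹ * (1 + (L * z) ^ 2) := by
  unfold qd; field_simp; ring

/-- Rescaling by L reduces every profile to the fixed integrable function (1+z²)^(-3/4), so that all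
constants below are independent of L. -/
lemma qd_rpow_eq (hL : 0 < L) (z : ℝ) :
    qd L z ^ (-(3 / 4) : ℝ) = L * √L * (1 + (L * z) ^ 2) ^ (-(3 / 4) : ℝ) := by
  rw [qd_eq hL, Real.mul_rpow (by positivity) (by positivity)]
  congr 1
  rw [Real.inv_rpow (by positivity), ← Real.rpow_neg (by positivity), ← Real.rpow_natCast,
    ← Real.rpow_mul hL.le, Real.sqrt_eq_rpow]
  nth_rewrite 2 [← Real.rpow_one L]
  rw [← Real.rpow_add hL]
  norm_num

lemma integral_qd_le (hL : 0 < L) {a b : ℝ} (hab : a ≤ b) :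
    ∫ z in a..b, qd L z ^ (-(3 / 4) : ℝ) ≤ √L * profMass := by
  simp only [qd_rpow_eq hL]
  rw [intervalIntegral.integral_const_mul,
    intervalIntegral.integral_comp_mul_left (fun z : ℝ => (1 + z ^ 2) ^ (-(3 / 4) : ℝ)) hL.ne',
    smul_eq_mul]
  have h1 : ∫ z in L * a..L * b, (1 + z ^ 2) ^ (-(3 / 4) : ℝ) ≤ profMass := by
    rw [intervalIntegral.integral_of_le (by gcongr)]
    exact setIntegral_le_integral integrable_prof (Eventually.of_forall fun z => by positivity)
  calc _ = √L * ∫ z in L * a..L * b, (1 + z ^ 2) ^ (-(3 / 4) : ℝ) := by field_simp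
    _ ≤ _ := by gcongr

lemma jI_qd_le (hL : 0 < L) (x : ℝ) :
    (jI fun y => qd L (x - y) ^ (-(3 / 4) : ℝ)) ≤ √L * profMass := by
  unfold jI
  rw [intervalIntegral.integral_comp_sub_left (fun z => qd L z ^ (-(3 / 4) : ℝ)) x]
  exact integral_qd_le hL (by linarith)

lemma jI_phi_le (hL : 0 < L) (x : ℝ) : (jI fun y => phi L (x - y)) ≤ L * profMass := by
  unfold phi
  rw [jI_const_mul]
  have := mul_le_mul_of_nonneg_left (jI_qd_le hL x) (Real.sqrt_nonneg L)
  have h2 := Real.mul_self_sqrt hL.le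
  calc _ ≤ √L * (√L * profMass) := this
    _ = _ := by rw [← mul_assoc, h2]

lemma abs_le_qd_rpow (hL : 0 < L) (d : ℝ) : |d| ≤ qd L d ^ (1 / 2 : ℝ) := by
  rw [← Real.sqrt_eq_rpow, ← Real.sqrt_sq_eq_abs]
  refine Real.sqrt_le_sqrt ?_
  unfold qd
  have : 0 ≤ (L ^ 2)⁻¹ := by positivity
  linarith

lemma sq_le_qd (L d : ℝ) : d ^ 2 ≤ qd L d := by
  unfold qd
  have : 0 ≤ (L ^ 2)⁻¹ := by positivity
  linarith

lemma qd_rpow_mul (hL : 0 < L) (d p q : ℝ) : qd L d ^ p * qd L d ^ q = qd L d ^ (p + q) :=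
  (Real.rpow_add (qd_pos hL d) p q).symm

lemma qd_rpow_mul_self (hL : 0 < L) (d p : ℝ) : qd L d ^ p * qd L d = qd L d ^ (p + 1) := by
  rw [Real.rpow_add_one (qd_pos hL d).ne']

lemma phi_mul_abs_le (hL : 0 < L) (d : ℝ) : phi L d * |d| ≤ √L * qd L d ^ (-(1 / 4) : ℝ) := by
  have h := abs_le_qd_rpow hL d
  have h0 : 0 ≤ phi L d := (phi_pos hL d).le
  calc _ ≤ phi L d * qd L d ^ (1 / 2 : ℝ) := by gcongr
    _ = √L * (qd L d ^ (-(3 / 4) : ℝ) * qd L d ^ (1 / 2 : ℝ)) := by unfold phi; ring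
    _ = _ := by rw [qd_rpow_mul hL]; norm_num

lemma qd_rpow_quarter_le (hL : 1 ≤ L) {d : ℝ} (hd : |d| ≤ 1) : qd L d ^ (1 / 4 : ℝ) ≤ 2 := by
  have h1 : qd L d ≤ 16 := by
    unfold qd
    have : (L ^ 2)⁻¹ ≤ 1 := inv_le_one_of_one_le₀ (one_le_pow₀ hL)
    have : d ^ 2 ≤ 1 := by rw [← sq_abs]; exact pow_le_one₀ (abs_nonneg _) hd
    linarith
  calc qd L d ^ (1 / 4 : ℝ) ≤ (16 : ℝ) ^ (1 / 4 : ℝ) :=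
        Real.rpow_le_rpow (qd_pos (by linarith) d).le h1 (by norm_num)
    _ = ((2 : ℝ) ^ (4 : ℕ)) ^ (1 / 4 : ℝ) := by norm_num
    _ = 2 := by rw [← Real.rpow_natCast, ← Real.rpow_mul (by norm_num)]; norm_num

/-- The integrand is at most twice the derivative of z q^(-1/4), with q the regularized square of z,
and that primitive is bounded by q^(1/4) ≤ 2 in modulus, whatever L is. -/
lemma jI_qd_neg_quarter_le (hL : 1 ≤ L) {x : ℝ} (hx : |x| ≤ 1 / 8) :
    (jI fun y => qd L (x - y) ^ (-(1 / 4) : ℝ)) ≤ 8 := by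
  have hL0 : 0 < L := by linarith
  have hF : ∀ d, HasDerivAt (fun z => z * qd L z ^ (-(1 / 4) : ℝ))
      (qd L d ^ (-(1 / 4) : ℝ) - 1 / 2 * d ^ 2 * qd L d ^ (-(5 / 4) : ℝ)) d := fun d =>
    ((hasDerivAt_id d).fun_mul (hasDerivAt_qd_rpow hL0 (-(1 / 4)) d)).congr_deriv (by
      have e : (-(1 / 4) : ℝ) - 1 = -(5 / 4) := by norm_num
      simp only [id]
      rw [e]; ring)
  have hle : ∀ d, qd L d ^ (-(1 / 4) : ℝ)
      ≤ 2 * (qd L d ^ (-(1 / 4) : ℝ) - 1 / 2 * d ^ 2 * qd L d ^ (-(5 / 4) : ℝ)) := by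
    intro d
    have h1 : d ^ 2 * qd L d ^ (-(5 / 4) : ℝ) ≤ qd L d ^ (-(1 / 4) : ℝ) := by
      have h2 := mul_le_mul_of_nonneg_right (sq_le_qd L d)
        (Real.rpow_nonneg (qd_pos hL0 d).le (-(5 / 4)))
      rw [mul_comm (qd L d), qd_rpow_mul_self hL0] at h2
      norm_num at h2 ⊢
      exact h2
    linarith
  have cF' : Continuous fun d => qd L d ^ (-(1 / 4) : ℝ)
      - 1 / 2 * d ^ 2 * qd L d ^ (-(5 / 4) : ℝ) := by
    have := continuous_qd_rpow hL0 (-(1 / 4)); have := continuous_qd_rpow hL0 (-(5 / 4))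
    fun_prop
  have hb : ∀ d, |d| ≤ 1 → |d * qd L d ^ (-(1 / 4) : ℝ)| ≤ 2 := by
    intro d hd
    have h0 := Real.rpow_nonneg (qd_pos hL0 d).le (-(1 / 4))
    rw [abs_mul, abs_of_nonneg h0]
    calc _ ≤ qd L d ^ (1 / 2 : ℝ) * qd L d ^ (-(1 / 4) : ℝ) :=
          mul_le_mul_of_nonneg_right (abs_le_qd_rpow hL0 d) h0
      _ = qd L d ^ (1 / 4 : ℝ) := by rw [qd_rpow_mul hL0]; norm_num
      _ ≤ 2 := qd_rpow_quarter_le hL hd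
  rw [abs_le] at hx
  unfold jI
  rw [intervalIntegral.integral_comp_sub_left (fun z => qd L z ^ (-(1 / 4) : ℝ)) x]
  calc _ ≤ ∫ d in (x - 1 / 8)..(x - -(1 / 8)),
        2 * (qd L d ^ (-(1 / 4) : ℝ) - 1 / 2 * d ^ 2 * qd L d ^ (-(5 / 4) : ℝ)) :=
        intervalIntegral.integral_mono_on (by linarith)
          ((continuous_qd_rpow hL0 _).intervalIntegrable _ _)
          ((continuous_const.mul cF').intervalIntegrable _ _) fun d _ => hle d
    _ = 2 * ((x - -(1 / 8)) * qd L (x - -(1 / 8)) ^ (-(1 / 4) : ℝ)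
        - (x - 1 / 8) * qd L (x - 1 / 8) ^ (-(1 / 4) : ℝ)) := by
        rw [intervalIntegral.integral_const_mul,
          intervalIntegral.integral_eq_sub_of_hasDerivAt (fun d _ => hF d)
            (cF'.intervalIntegrable _ _)]
    _ ≤ 8 := by
        have h1 := hb (x - -(1 / 8)) (by rw [abs_le]; constructor <;> linarith)
        have h2 := hb (x - 1 / 8) (by rw [abs_le]; constructor <;> linarith)
        rw [abs_le] at h1 h2
        linarith

/-- The marginal of the commutator kernel is small. -/
lemma abs_jI_kerB_le (hL : 1 ≤ L) {x : ℝ} (hx : |x| ≤ 1 / 16) :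
    |jI fun y => kerB L x y| ≤ 40 * √L := by
  have hL0 : 0 < L := by linarith
  have hg : ∀ y, HasDerivAt (fun z => phi L (x - z) * (jap1 x - jap1 z))
      (-phi1 L (x - y) * (jap1 x - jap1 y) + phi L (x - y) * -jap2 y) y := fun y =>
    ((hasDerivAt_phi hL0 (x - y)).comp_const_sub x y).fun_mul ((hasDerivAt_jap1 y).const_sub _)
  have c1 : Continuous fun y => phi L (x - y) := (cont2_phi hL0).slice_x x
  have c2 : Continuous fun y => phi1 L (x - y) := (cont2_phi1 hL0).slice_x x
  have c3 := continuous_jap1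
  have c4 := continuous_jap2
  have cg : Continuous fun y => -phi1 L (x - y) * (jap1 x - jap1 y) + phi L (x - y) * -jap2 y := by
    fun_prop
  -- The kernel is twice the y-derivative of φ(x-y)(`jap1` x - `jap1` y), up to a term with the
  -- difference of the second derivatives, which gains a factor |x-y|.
  have e1 : (jI fun y => kerB L x y) = 2 * (jI fun y => -phi1 L (x - y) * (jap1 x - jap1 y)
      + phi L (x - y) * -jap2 y) + jI fun y => phi L (x - y) * (jap2 y - jap2 x) := by
    rw [← jI_const_mul, ← jI_add (by fun_prop) (by fun_prop)]
    exact jI_congr fun y _ => by unfold kerB; ring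
  have e2 : (jI fun y => -phi1 L (x - y) * (jap1 x - jap1 y) + phi L (x - y) * -jap2 y)
      = phi L (x - 1 / 8) * (jap1 x - jap1 (1 / 8))
        - phi L (x - -(1 / 8)) * (jap1 x - jap1 (-(1 / 8))) :=
    intervalIntegral.integral_eq_sub_of_hasDerivAt (fun y _ => hg y) (cg.intervalIntegrable _ _)
  have hx' := abs_le.1 hx
  -- The endpoints are at distance at least 1/16 from x, and 4 = (1/256)^(-1/4). The final constant
  -- is 40 = 2·(4+4) + 24.
  have hbd : ∀ z, 1 / 16 ≤ |x - z| → |phi L (x - z) * (jap1 x - jap1 z)| ≤ 4 * √L := by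
    intro z hz
    have hp := phi_pos hL0 (x - z)
    rw [abs_mul, abs_of_pos hp]
    calc _ ≤ phi L (x - z) * |x - z| :=
          mul_le_mul_of_nonneg_left (abs_jap1_sub_le x z) hp.le
      _ ≤ √L * qd L (x - z) ^ (-(1 / 4) : ℝ) := phi_mul_abs_le hL0 _
      _ ≤ √L * 4 := by
          refine mul_le_mul_of_nonneg_left ?_ (Real.sqrt_nonneg _)
          have h1 : 1 / 256 ≤ qd L (x - z) := by
            refine le_trans ?_ (sq_le_qd L _)
            rw [← sq_abs]; nlinarith
          calc qd L (x - z) ^ (-(1 / 4) : ℝ) ≤ (1 / 256 : ℝ) ^ (-(1 / 4) : ℝ) :=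
                Real.rpow_le_rpow_of_nonpos (by norm_num) h1 (by norm_num)
            _ = ((4 : ℝ) ^ (-4 : ℤ)) ^ (-(1 / 4) : ℝ) := by norm_num
            _ = 4 := by rw [← Real.rpow_intCast, ← Real.rpow_mul (by norm_num)]; norm_num
      _ = _ := mul_comm _ _
  have h1 := hbd (1 / 8) (by rw [abs_sub_comm, le_abs]; left; linarith)
  have h2 := hbd (-(1 / 8)) (by rw [le_abs]; left; linarith)
  have h3 : |jI fun y => phi L (x - y) * (jap2 y - jap2 x)| ≤ 24 * √L := by
    refine abs_jI_le.trans ?_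
    calc _ ≤ jI fun y => 3 * √L * qd L (x - y) ^ (-(1 / 4) : ℝ) := by
          have cq : Continuous fun y => qd L (x - y) ^ (-(1 / 4) : ℝ) :=
            (continuous_qd_rpow hL0 _).comp (by fun_prop : Continuous fun y : ℝ => x - y)
          refine jI_mono (by fun_prop) (by fun_prop) fun y _ => ?_
          have hp := phi_pos hL0 (x - y)
          rw [abs_mul, abs_of_pos hp]
          have a1 := abs_jap2_sub_le x y
          have a2 := phi_mul_abs_le hL0 (x - y)
          rw [abs_sub_comm] at a1
          rw [abs_sub_comm y x] at a1
          rw [abs_sub_comm]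
          nlinarith [mul_le_mul_of_nonneg_left a1 hp.le]
      _ = 3 * √L * jI fun y => qd L (x - y) ^ (-(1 / 4) : ℝ) := jI_const_mul _ _
      _ ≤ 3 * √L * 8 := by
          gcongr
          exact jI_qd_neg_quarter_le hL (hx.trans (by norm_num))
      _ = _ := by ring
  rw [e1, e2]
  rw [abs_le] at h1 h2 h3 ⊢
  constructor <;> linarith

/-- Since φ behaves like |d|^(-3/2), the term -2φ'(`jap1` x - `jap1` y) is about 3φ, and it beats
φ(`jap2` x + `jap2` y) ≤ 2φ because `jap1` has slope at least 0.97 on the interval. The subtracted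
term is the price of the regularization at scale 1/L. -/
lemma kerB_ge (hL : 0 < L) {x y : ℝ} (hx : |x| ≤ 1 / 8) (hy : |y| ≤ 1 / 8) :
    1 / 4 * phi L (x - y) - 9 / 4 * (√L * (L ^ 2)⁻¹) * qd L (x - y) ^ (-(7 / 4) : ℝ)
      ≤ kerB L x y := by
  set d := x - y with hd
  have hq : 0 < qd L d ^ (-(7 / 4) : ℝ) := Real.rpow_pos_of_pos (qd_pos hL d) _
  have e1 : phi L d = √L * (qd L d ^ (-(7 / 4) : ℝ) * qd L d) := by
    rw [qd_rpow_mul_self hL]; unfold phi; norm_num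
  have h1 := mul_jap1_sub_ge hx hy
  rw [← hd] at h1
  have h2 := jap2_le_one x
  have h3 := jap2_le_one y
  have e2 : kerB L x y = √L * qd L d ^ (-(7 / 4) : ℝ)
      * (3 * (d * (jap1 x - jap1 y)) - qd L d * (jap2 x + jap2 y)) := by
    unfold kerB
    rw [← hd, e1]; unfold phi1; ring
  rw [e2, e1]
  have h4 : qd L d * (jap2 x + jap2 y) ≤ qd L d * 2 :=
    mul_le_mul_of_nonneg_left (by linarith) (qd_pos hL d).le
  have h5 : 1 / 4 * qd L d - 9 / 4 * (L ^ 2)⁻¹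
      ≤ 3 * (d * (jap1 x - jap1 y)) - qd L d * (jap2 x + jap2 y) := by
    have : qd L d = d ^ 2 + (L ^ 2)⁻¹ := rfl
    have : 0 ≤ d ^ 2 := sq_nonneg d
    linarith
  have h6 := mul_le_mul_of_nonneg_left h5 (mul_nonneg (Real.sqrt_nonneg L) hq.le)
  linarith

end TrappedWave

/-! ### Coercivity of the commutator. -/

namespace TrappedWave

open Set Filter Topology

variable {L : ℝ} {U U₁ U₂ : ℝ → ℝ}

lemma qd_seven_mul_sq_le (hL : 0 < L) (d : ℝ) :
    qd L d ^ (-(7 / 4) : ℝ) * d ^ 2 ≤ qd L d ^ (-(3 / 4) : ℝ) := by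
  have h := mul_le_mul_of_nonneg_left (sq_le_qd L d)
    (Real.rpow_nonneg (qd_pos hL d).le (-(7 / 4)))
  rw [qd_rpow_mul_self hL] at h
  norm_num at h ⊢
  exact h

lemma qd_three_mul_sq_le (hL : 1 ≤ L) {d : ℝ} (hd : |d| ≤ 1) :
    qd L d ^ (-(3 / 4) : ℝ) * d ^ 2 ≤ 2 := by
  have hL0 : 0 < L := by linarith
  have h := mul_le_mul_of_nonneg_left (sq_le_qd L d)
    (Real.rpow_nonneg (qd_pos hL0 d).le (-(3 / 4)))
  rw [qd_rpow_mul_self hL0] at h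
  refine h.trans (le_trans (le_of_eq ?_) (qd_rpow_quarter_le hL hd))
  norm_num

lemma cont2_qd (hL : 0 < L) (p : ℝ) : Cont2 fun x y => qd L (x - y) ^ p :=
  (continuous_qd_rpow hL p).comp (by fun_prop : Continuous fun z : ℝ × ℝ => z.1 - z.2)

lemma jI_weight (f : ℝ → ℝ) (F : ℝ → ℝ → ℝ) :
    (jJ fun x y => F x y * f x) = jI fun x => jI (fun y => F x y) * f x := by
  unfold jJ
  refine jI_congr fun x _ => ?_
  rw [mul_comm, ← jI_const_mul]
  exact jI_congr fun y _ => mul_comm _ _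

/-- The part of the error with differences of values. -/
lemma jJ_diff_le (hL : 0 < L) (h : CutFun U U₁ U₂) :
    (jJ fun x y => qd L (x - y) ^ (-(7 / 4) : ℝ) * (U x - U y) ^ 2)
      ≤ √L * profMass * jI fun y => U₁ y ^ 2 := by
  have cU := h.c0; have cU1 := h.c1
  set κ : ℝ → ℝ := fun d => qd L d ^ (-(7 / 4) : ℝ) with hκ
  have cκ : Continuous κ := continuous_qd_rpow hL _
  have hκ0 : ∀ d, 0 ≤ κ d := fun d => Real.rpow_nonneg (qd_pos hL d).le _
  have hκs : ∀ d, κ (-d) = κ d := fun d => by simp [hκ, qd_neg]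
  have cF : Cont2 fun x d => κ d * (U (x + d) - U x) ^ 2 := by unfold Cont2; fun_prop
  -- In the variable d = y - x, with |d| ≤ 1/4 for points of the interval, the form becomes a
  -- superposition of translation differences, each bounded by d² times the Dirichlet integral.
  have h1 : (jJ fun x y => κ (x - y) * (U x - U y) ^ 2)
      ≤ jI fun x => ∫ d in (-(1 / 4) : ℝ)..(1 / 4), κ d * (U (x + d) - U x) ^ 2 := by
    have c0 : Cont2 fun x y => κ (x - y) * (U x - U y) ^ 2 := by unfold Cont2; fun_prop
    refine jI_mono c0.jI (cF.continuous_integral _ _) fun x hx => ?_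
    have e : (jI fun y => κ (x - y) * (U x - U y) ^ 2)
        = ∫ d in (-(1 / 8) - x)..(1 / 8 - x), κ d * (U (x + d) - U x) ^ 2 := by
      unfold jI
      rw [← intervalIntegral.integral_comp_sub_right
        (fun d => κ d * (U (x + d) - U x) ^ 2) x]
      refine intervalIntegral.integral_congr fun y _ => ?_
      rw [← neg_sub y x, hκs, add_sub_cancel]
      ring
    rw [abs_le] at hx
    rw [e]
    exact integral_mono_interval (by linarith) (by linarith) (by linarith) (cF.slice_x x)
      fun d => mul_nonneg (hκ0 d) (sq_nonneg _)
  have h2 : (jI fun x => ∫ d in (-(1 / 4) : ℝ)..(1 / 4), κ d * (U (x + d) - U x) ^ 2)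
      = ∫ d in (-(1 / 4) : ℝ)..(1 / 4), jI fun x => κ d * (U (x + d) - U x) ^ 2 := by
    refine intervalIntegral_intervalIntegral_swap (F := fun x d => κ d * (U (x + d) - U x) ^ 2) ?_
    exact (Continuous.continuousOn (f := Function.uncurry fun x d => κ d * (U (x + d) - U x) ^ 2)
      cF |>.integrableOn_compact (isCompact_uIcc.prod isCompact_uIcc)).mono_set
      (prod_mono uIoc_subset_uIcc uIoc_subset_uIcc)
  have hI0 : 0 ≤ jI fun y => U₁ y ^ 2 := jI_nonneg fun _ => sq_nonneg _
  have h3 : ∫ d in (-(1 / 4) : ℝ)..(1 / 4), (jI fun x => κ d * (U (x + d) - U x) ^ 2)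
      ≤ ∫ d in (-(1 / 4) : ℝ)..(1 / 4), qd L d ^ (-(3 / 4) : ℝ) * jI fun y => U₁ y ^ 2 := by
    refine intervalIntegral.integral_mono_on (by norm_num)
      ((Cont2.jI (F := fun d x => κ d * (U (x + d) - U x) ^ 2) cF.swap).intervalIntegrable _ _)
      (((continuous_qd_rpow hL _).mul continuous_const).intervalIntegrable _ _) fun d hd => ?_
    rw [jI_const_mul]
    calc _ ≤ κ d * (d ^ 2 * jI fun y => U₁ y ^ 2) :=
          mul_le_mul_of_nonneg_left (integral_sq_translate_le h.d1 cU1 h.supp1 (abs_le.2 hd)) (hκ0 d)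
      _ = κ d * d ^ 2 * jI fun y => U₁ y ^ 2 := by ring
      _ ≤ _ := mul_le_mul_of_nonneg_right (qd_seven_mul_sq_le hL d) hI0
  rw [intervalIntegral.integral_mul_const] at h3
  have h4 := mul_le_mul_of_nonneg_right
    (integral_qd_le hL (by norm_num : (-(1 / 4) : ℝ) ≤ 1 / 4)) hI0
  linarith

/-- The error term in the commutator estimate. -/
lemma jJ_err_le (hL : 1 ≤ L) (h : CutFun U U₁ U₂) :
    L * (√L * (L ^ 2)⁻¹) * (jJ fun x y => qd L (x - y) ^ (-(7 / 4) : ℝ) * dfun L U x y)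
      ≤ profMass * (jI fun y => U₁ y ^ 2) + 2 * profMass * (jI fun x => L ^ 2 * x ^ 2 * U x ^ 2)
        + 1 / 2 * (L * √L) * jI fun x => U x ^ 2 := by
  have hL0 : 0 < L := by linarith
  have cU := h.c0
  have cq7 := cont2_qd hL0 (-(7 / 4))
  have cq3 := cont2_qd hL0 (-(3 / 4))
  have cd := cont2_dfun L cU
  have cph := cont2_phase L
  have hq7 : ∀ d, 0 ≤ qd L d ^ (-(7 / 4) : ℝ) := fun d => Real.rpow_nonneg (qd_pos hL0 d).le _
  have cA : Cont2 fun x y => qd L (x - y) ^ (-(7 / 4) : ℝ) * (U x - U y) ^ 2 := by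
    unfold Cont2 at *; fun_prop
  have cB : Cont2 fun x y => qd L (x - y) ^ (-(7 / 4) : ℝ) * (phase L x y ^ 2 / 2) * U x ^ 2 := by
    unfold Cont2 at *; fun_prop
  have cB' : Cont2 fun x y => qd L (x - y) ^ (-(7 / 4) : ℝ) * (phase L x y ^ 2 / 2) * U y ^ 2 := by
    unfold Cont2 at *; fun_prop
  have e1 : (jJ fun x y => qd L (x - y) ^ (-(7 / 4) : ℝ) * (phase L x y ^ 2 / 2) * U y ^ 2)
      = jJ fun x y => qd L (x - y) ^ (-(7 / 4) : ℝ) * (phase L x y ^ 2 / 2) * U x ^ 2 := by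
    rw [jJ_swap cB']
    refine congrArg jJ ?_
    funext x y
    rw [phase_swap, ← neg_sub x y, qd_neg, neg_sq]
  have e2 : (jJ fun x y => qd L (x - y) ^ (-(7 / 4) : ℝ) * dfun L U x y)
      ≤ (jJ fun x y => qd L (x - y) ^ (-(7 / 4) : ℝ) * (U x - U y) ^ 2)
        + 2 * jJ fun x y => qd L (x - y) ^ (-(7 / 4) : ℝ) * (phase L x y ^ 2 / 2) * U x ^ 2 := by
    have s1 := jJ_add cB cB'
    have s2 := jJ_add cA (cB.add cB')
    rw [s1, e1] at s2
    rw [two_mul, ← s2]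
    refine jJ_mono (cq7.mul cd) (cA.add (cB.add cB')) fun x y _ _ => ?_
    have := mul_le_mul_of_nonneg_left (dfun_le L U x y) (hq7 (x - y))
    linarith
  have cC : Cont2 fun x y => qd L (x - y) ^ (-(3 / 4) : ℝ) * (L ^ 2 * x ^ 2 * U x ^ 2) := by
    unfold Cont2 at *; fun_prop
  have cD : Cont2 fun x _ => L ^ 2 * U x ^ 2 := by unfold Cont2; fun_prop
  have e3 : (jJ fun x y => qd L (x - y) ^ (-(7 / 4) : ℝ) * (phase L x y ^ 2 / 2) * U x ^ 2)
      ≤ √L * profMass * (jI fun x => L ^ 2 * x ^ 2 * U x ^ 2)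
        + L ^ 2 * (1 / 4 * jI fun x => U x ^ 2) := by
    calc _ ≤ jJ fun x y => qd L (x - y) ^ (-(3 / 4) : ℝ) * (L ^ 2 * x ^ 2 * U x ^ 2)
          + L ^ 2 * U x ^ 2 := by
          refine jJ_mono cB (cC.add cD) fun x y hx hy => ?_
          set d := x - y with hd
          have hd1 : |d| ≤ 1 := by
            rw [abs_le] at hx hy ⊢
            constructor <;> linarith
          have a1 : phase L x y ^ 2 ≤ L ^ 2 * (d ^ 2 * (x + y) ^ 2 / 4) := by
            have b := abs_jap_sub_le x y
            have b2 := pow_le_pow_left₀ (abs_nonneg _) b 2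
            rw [sq_abs, div_pow, mul_pow, sq_abs, sq_abs] at b2
            unfold phase
            rw [mul_pow]
            refine mul_le_mul_of_nonneg_left ?_ (sq_nonneg L)
            rw [hd]
            linarith
          -- Writing x + y = 2x - d splits the phase into a part of size L|d||x|, which ends in the
          -- term with L²x²U², and a part of size L d², which contributes only order L^(3/2) in the
          -- end.
          have a2 : (x + y) ^ 2 ≤ 8 * x ^ 2 + 2 * d ^ 2 := by
            rw [hd]; nlinarith [sq_nonneg (2 * x + (x - y))]
          have a3 := qd_seven_mul_sq_le hL0 d
          have a4 := qd_three_mul_sq_le hL hd1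
          have h7 := hq7 d
          have h3 : 0 ≤ qd L d ^ (-(3 / 4) : ℝ) := Real.rpow_nonneg (qd_pos hL0 d).le _
          calc qd L d ^ (-(7 / 4) : ℝ) * (phase L x y ^ 2 / 2) * U x ^ 2
              ≤ qd L d ^ (-(7 / 4) : ℝ) * (L ^ 2 * (d ^ 2 * (8 * x ^ 2 + 2 * d ^ 2) / 4) / 2)
                * U x ^ 2 := by
                gcongr
                refine a1.trans ?_
                gcongr
            _ = (qd L d ^ (-(7 / 4) : ℝ) * d ^ 2) * (L ^ 2 * (x ^ 2 + d ^ 2 / 4) * U x ^ 2) := by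
                ring
            _ ≤ qd L d ^ (-(3 / 4) : ℝ) * (L ^ 2 * (x ^ 2 + d ^ 2 / 4) * U x ^ 2) := by
                gcongr
            _ = qd L d ^ (-(3 / 4) : ℝ) * (L ^ 2 * x ^ 2 * U x ^ 2)
                + (qd L d ^ (-(3 / 4) : ℝ) * d ^ 2) * (L ^ 2 * U x ^ 2 / 4) := by ring
            _ ≤ qd L d ^ (-(3 / 4) : ℝ) * (L ^ 2 * x ^ 2 * U x ^ 2)
                + 2 * (L ^ 2 * U x ^ 2 / 4) := by gcongr
            _ ≤ _ := by
                have : 0 ≤ L ^ 2 * U x ^ 2 := by positivity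
                linarith
      _ = (jI fun x => (jI fun y => qd L (x - y) ^ (-(3 / 4) : ℝ)) * (L ^ 2 * x ^ 2 * U x ^ 2))
          + L ^ 2 * (1 / 4 * jI fun x => U x ^ 2) := by
          rw [jJ_add cC cD, jI_weight]
          congr 1
          unfold jJ
          have : ∀ x, (jI fun _ => L ^ 2 * U x ^ 2) = L ^ 2 * (1 / 4 * U x ^ 2) := by
            intro x; unfold jI; rw [intervalIntegral.integral_const, smul_eq_mul]; ring
          simp only [this, jI_const_mul]
      _ ≤ _ := by
          gcongr
          rw [← jI_const_mul]
          refine jI_mono (cq3.jI.mul (by fun_prop)) (by fun_prop) fun x _ => ?_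
          exact mul_le_mul_of_nonneg_right (jI_qd_le hL0 x) (by positivity)
  have e4 := jJ_diff_le hL0 h
  have hs : L * (√L * (L ^ 2)⁻¹) * √L = 1 := by
    have := Real.mul_self_sqrt hL0.le
    calc _ = L * (√L * √L) * (L ^ 2)⁻¹ := by ring
      _ = _ := by rw [this]; field_simp
  have hs2 : L * (√L * (L ^ 2)⁻¹) * L ^ 2 = L * √L := by field_simp
  have hs0 : 0 ≤ L * (√L * (L ^ 2)⁻¹) := by positivity
  have e5 := mul_le_mul_of_nonneg_left (e2.trans (add_le_add e4
    (mul_le_mul_of_nonneg_left e3 (by norm_num : (0 : ℝ) ≤ 2)))) hs0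
  refine e5.trans (le_of_eq ?_)
  linear_combination (profMass * (jI fun y => U₁ y ^ 2)
    + 2 * profMass * (jI fun x => L ^ 2 * x ^ 2 * U x ^ 2)) * hs
    + (1 / 2 * jI fun x => U x ^ 2) * hs2

/-- The length scale in the lower bound. -/
def scl (L y : ℝ) : ℝ := √(y ^ 2 + 1 / L)

/-- The weight in the refined estimate. -/
def rho1 (L y : ℝ) : ℝ := √(scl L y)

lemma scl_sq (hL : 0 < L) (y : ℝ) : scl L y ^ 2 = y ^ 2 + 1 / L := Real.sq_sqrt (by positivity)

lemma scl_pos (hL : 0 < L) (y : ℝ) : 0 < scl L y := Real.sqrt_pos.2 (by positivity)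

lemma rho1_pos (hL : 0 < L) (y : ℝ) : 0 < rho1 L y := Real.sqrt_pos.2 (scl_pos hL y)

lemma continuous_scl (L : ℝ) : Continuous (scl L) := by unfold scl; fun_prop

lemma continuous_rho1 (L : ℝ) : Continuous (rho1 L) := by
  have := continuous_scl L
  unfold rho1; fun_prop

lemma abs_le_scl (hL : 0 < L) (y : ℝ) : |y| ≤ scl L y := by
  rw [← Real.sqrt_sq_eq_abs]
  exact Real.sqrt_le_sqrt (by have : 0 < 1 / L := by positivity
                              linarith)

lemma abs_add_add_of_mul_nonneg {y d : ℝ} (h : 0 ≤ y * d) : |y + d + y| = 2 * |y| + |d| := by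
  have h1 : |2 * y + d| = |2 * y| + |d| := abs_add_eq_add_abs_iff _ _ |>.2 (by
    rcases mul_nonneg_iff.1 h with ⟨h1, h2⟩ | ⟨h1, h2⟩
    · exact Or.inl ⟨by linarith, h2⟩
    · exact Or.inr ⟨by linarith, h2⟩)
  rw [abs_mul, abs_two] at h1
  rw [← h1]; congr 1; ring

lemma sq_le_sin_sq_of_abs_mem {z : ℝ} (hz : |z| ≤ 5 / 8) (hz' : 1 / 34 ≤ |z|) :
    (1 / 68 : ℝ) ^ 2 ≤ Real.sin z ^ 2 := by
  have h0 : 0 ≤ Real.sin |z| := Real.sin_nonneg_of_nonneg_of_le_pi (abs_nonneg z)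
    (by linarith [Real.pi_gt_three])
  have h1 : |Real.sin z| = Real.sin |z| := by
    rcases abs_choice z with h | h
    · rw [h] at h0 ⊢; exact abs_of_nonneg h0
    · rw [h] at h0 ⊢
      rw [Real.sin_neg] at h0 ⊢
      exact abs_of_nonpos (by linarith)
  have h2 : |z| / 2 ≤ Real.sin |z| := by
    have h3 := Real.mul_le_sin (abs_nonneg z) (by linarith [Real.pi_gt_three])
    have h4 : 1 / 2 ≤ 2 / Real.pi := by
      rw [div_le_div_iff₀ (by norm_num) Real.pi_pos]; linarith [Real.pi_le_four]
    nlinarith [abs_nonneg z]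
  rw [← sq_abs (Real.sin z), h1]
  exact pow_le_pow_left₀ (by norm_num) (by linarith) 2

lemma phi_ge (hL : 0 < L) {a d : ℝ} (ha0 : 0 < a) (hd2 : |d| ≤ 2 * a) (h2 : 1 / L ≤ 4 * a) :
    1 / 20 * (√L * (1 / a * √(1 / a))) ≤ phi L d := by
  have hq : qd L d ≤ 20 * a ^ 2 := by
    unfold qd
    have h1 : d ^ 2 ≤ 4 * a ^ 2 := by
      calc d ^ 2 = |d| ^ 2 := (sq_abs d).symm
        _ ≤ (2 * a) ^ 2 := pow_le_pow_left₀ (abs_nonneg d) hd2 2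
        _ = _ := by ring
    have h3 : (L ^ 2)⁻¹ ≤ 16 * a ^ 2 := by
      have h4 : (L ^ 2)⁻¹ = (1 / L) ^ 2 := by rw [one_div, inv_pow]
      rw [h4]
      calc (1 / L) ^ 2 ≤ (4 * a) ^ 2 := pow_le_pow_left₀ (by positivity) h2 2
        _ = _ := by ring
    linarith
  have h1 : (20 * a ^ 2) ^ (-(3 / 4) : ℝ) ≤ qd L d ^ (-(3 / 4) : ℝ) :=
    Real.rpow_le_rpow_of_nonpos (qd_pos hL d) hq (by norm_num)
  have h2 : (20 * a ^ 2) ^ (-(3 / 4) : ℝ) = (20 : ℝ) ^ (-(3 / 4) : ℝ) * (1 / a * √(1 / a)) := by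
    rw [Real.mul_rpow (by norm_num) (by positivity)]
    congr 1
    rw [one_div, Real.sqrt_eq_rpow, Real.inv_rpow ha0.le, ← mul_inv, ← Real.rpow_one_add' ha0.le
      (by norm_num), ← Real.rpow_neg ha0.le, ← Real.rpow_natCast, ← Real.rpow_mul ha0.le]
    norm_num
  have h3 : (1 / 20 : ℝ) ≤ (20 : ℝ) ^ (-(3 / 4) : ℝ) := by
    calc (1 / 20 : ℝ) = (20 : ℝ) ^ (-1 : ℝ) := by rw [Real.rpow_neg_one]; norm_num
      _ ≤ _ := Real.rpow_le_rpow_of_exponent_le (by norm_num) (by norm_num)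
  unfold phi
  calc _ = √L * (1 / 20 * (1 / a * √(1 / a))) := by ring
    _ ≤ √L * ((20 : ℝ) ^ (-(3 / 4) : ℝ) * (1 / a * √(1 / a))) := by gcongr
    _ ≤ _ := by rw [← h2]; gcongr

/-- Lower bound of the kernel at the scale adapted to the point. -/
lemma phi_sin_ge (hL : 256 ≤ L) {y d a : ℝ} (hy : |y| ≤ 1 / 16) (ha : a = 1 / (4 * L * scl L y))
    (hyd : 0 ≤ y * d) (hd1 : a ≤ |d|) (hd2 : |d| ≤ 2 * a) :
    1 / 46240 * (L * rho1 L y) ≤ a * (phi L d * Real.sin (phase L (y + d) y) ^ 2) := by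
  have hL0 : 0 < L := by linarith
  set ρ := scl L y with hρ
  have hρ0 : 0 < ρ := scl_pos hL0 y
  have ha0 : 0 < a := by rw [ha]; positivity
  -- The scale a is the distance over which the phase, whose derivative near y is of size at most
  -- about Lρ, turns by a moderate angle.
  have haρ : 4 * L * ρ * a = 1 := by rw [ha]; field_simp
  have hρ2 : ρ ^ 2 = y ^ 2 + 1 / L := scl_sq hL0 y
  have hLρ : 1 ≤ L * ρ ^ 2 := by
    rw [hρ2, mul_add, mul_one_div_cancel hL0.ne']
    have : 0 ≤ L * y ^ 2 := by positivity
    linarith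
  have hyρ : |y| ≤ ρ := abs_le_scl hL0 y
  have haρ4 : a ≤ ρ / 4 := by
    have : a * (L * ρ ^ 2) = ρ / 4 := by
      calc a * (L * ρ ^ 2) = (4 * L * ρ * a) * ρ / 4 := by ring
        _ = _ := by rw [haρ]; ring
    nlinarith
  have hρ1 : ρ ≤ 1 / 8 := by
    have h1 : 1 / L ≤ 1 / 256 := one_div_le_one_div_of_le (by norm_num) hL
    have h2 : y ^ 2 ≤ 1 / 256 := by rw [← sq_abs]; nlinarith [abs_nonneg y]
    nlinarith
  have hphase : |phase L (y + d) y| = L * (|d| * (2 * |y| + |d|)) / (jap (y + d) + jap y) := by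
    unfold phase
    rw [jap_sub_eq, abs_mul, abs_of_pos hL0, abs_div,
      abs_of_pos (add_pos (jap_pos (y + d)) (jap_pos y)), mul_div_assoc]
    congr 2
    rw [abs_mul]
    have e1 : y + d - y = d := by ring
    have e2 := abs_add_add_of_mul_nonneg hyd
    rw [e1, e2]
  have hy0 := abs_nonneg y
  have hd0 : 0 < |d| := by linarith
  have hnum_hi : L * (|d| * (2 * |y| + |d|)) ≤ 5 / 4 := by
    calc L * (|d| * (2 * |y| + |d|)) ≤ L * (2 * a * (2 * ρ + 2 * (ρ / 4))) := by
          gcongr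
          linarith
      _ = 5 / 4 * (4 * L * ρ * a) := by ring
      _ = 5 / 4 := by rw [haρ, mul_one]
  have hnum_lo : 1 / 16 ≤ L * (|d| * (2 * |y| + |d|)) := by
    -- As ρ² = y² + 1/L and ρa = 1/(4L), one of |y| and a is always comparable with ρ: near the
    -- origin it is the quadratic part of the phase that makes it turn.
    have h1 : ρ / 4 ≤ 2 * |y| + a := by
      have h2 : ρ * a = 1 / (4 * L) := by rw [ha]; field_simp
      have h3 : ρ * (ρ / 4) ≤ ρ * (2 * |y| + a) := by
        rw [mul_add, h2]
        have h4 : 1 / (4 * L) = 1 / L / 4 := by field_simp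
        have h5 : |y| * |y| ≤ ρ * |y| := mul_le_mul_of_nonneg_right hyρ hy0
        have h6 : |y| * |y| = y ^ 2 := by rw [← sq, sq_abs]
        rw [h4]
        nlinarith
      exact le_of_mul_le_mul_left h3 hρ0
    calc (1 / 16 : ℝ) = 1 / 16 * (4 * L * ρ * a) := by rw [haρ, mul_one]
      _ = L * (a * (ρ / 4)) := by ring
      _ ≤ L * (|d| * (2 * |y| + |d|)) := by
          gcongr
          exact h1.trans (by linarith)
  have hj1 := one_le_jap (y + d)
  have hj2 := one_le_jap y
  have hyd1 : |y + d| ≤ 1 / 8 := (abs_add_le y d).trans (by linarith)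
  have hjle : ∀ z, |z| ≤ 1 / 8 → jap z ≤ 17 / 16 := by
    intro z hz
    have h1 := jap_sq z
    have h2 : z ^ 2 ≤ 1 / 64 := by rw [← sq_abs]; nlinarith [abs_nonneg z]
    have := one_le_jap z
    nlinarith
  have hj3 := hjle _ hyd1
  have hj4 := hjle y (by linarith)
  have hph1 : |phase L (y + d) y| ≤ 5 / 8 := by
    rw [hphase, div_le_iff₀ (by linarith)]; linarith
  have hph2 : 1 / 34 ≤ |phase L (y + d) y| := by
    rw [hphase, le_div_iff₀ (by linarith)]; linarith
  have hsin : (1 / 68 : ℝ) ^ 2 ≤ Real.sin (phase L (y + d) y) ^ 2 :=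
    sq_le_sin_sq_of_abs_mem hph1 hph2
  have hphi : 1 / 20 * (√L * (1 / a * √(1 / a))) ≤ phi L d := by
    refine phi_ge hL0 ha0 hd2 ?_
    rw [ha, div_le_iff₀ hL0]
    have : 4 * (1 / (4 * L * ρ)) * L = 1 / ρ := by field_simp
    rw [this, le_div_iff₀ hρ0]; linarith
  -- The profile at distance a has size √L a^(-3/2), so a times it is √L a^(-1/2) = 2L√ρ up to a
  -- constant. The final constant is 46240 = 10·68², from 2/20 and the lower bound 1/68 for the
  -- sine.
  have hsqrt : √(1 / a) = 2 * √L * rho1 L y := by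
    have : 1 / a = 2 ^ 2 * (L * ρ) := by rw [ha]; field_simp; norm_num
    rw [this, Real.sqrt_mul (by norm_num), Real.sqrt_sq (by norm_num), Real.sqrt_mul hL0.le, mul_assoc]
    rfl
  have hLL := Real.mul_self_sqrt hL0.le
  have hr := rho1_pos hL0 y
  calc 1 / 46240 * (L * rho1 L y) = a * (1 / 20 * (√L * (1 / a * √(1 / a))) * (1 / 68) ^ 2) := by
        rw [hsqrt]
        have : a * (1 / a) = 1 := mul_one_div_cancel ha0.ne'
        linear_combination (-(1 / 46240 * rho1 L y)) * hLL
          - (1 / 46240 * rho1 L y * (√L * √L)) * this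
    _ ≤ _ := by
        have := (phi_pos hL0 d).le
        gcongr

/-- Coercivity of the difference form. -/
lemma jI_phi_dfun_ge (hL : 256 ≤ L) (hU : Continuous U) {y : ℝ} (hy : |y| ≤ 1 / 16) :
    1 / 46240 * (L * rho1 L y) * U y ^ 2 ≤ jI fun x => phi L (x - y) * dfun L U x y := by
  have hL0 : 0 < L := by linarith
  obtain ⟨a, ha⟩ : ∃ a, a = 1 / (4 * L * scl L y) := ⟨_, rfl⟩
  have hρ0 : 0 < scl L y := scl_pos hL0 y
  have ha0 : 0 < a := by rw [ha]; positivity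
  have ha1 : 2 * a ≤ 1 / 16 := by
    have h1 : 1 ≤ L * scl L y ^ 2 := by
      rw [scl_sq hL0, mul_add, mul_one_div_cancel hL0.ne']
      have : 0 ≤ L * y ^ 2 := by positivity
      linarith
    have h2 : 16 ≤ L * scl L y := by
      have h3 : 256 * 1 ≤ L * (L * scl L y ^ 2) := mul_le_mul hL h1 (by norm_num) hL0.le
      have h4 : 0 < L * scl L y := by positivity
      nlinarith
    have h3 : a * (L * scl L y) = 1 / 4 := by rw [ha]; field_simp
    nlinarith
  have cG : Continuous fun x => phi L (x - y) * dfun L U x y :=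
    ((cont2_phi hL0).mul (cont2_dfun L hU)).slice_t y
  have hG : ∀ x, 0 ≤ phi L (x - y) * dfun L U x y := fun x =>
    mul_nonneg (phi_pos hL0 _).le (dfun_nonneg L U x y)
  have hpt : ∀ x, 0 ≤ y * (x - y) → a ≤ |x - y| → |x - y| ≤ 2 * a →
      1 / a * (1 / 46240 * (L * rho1 L y) * U y ^ 2) ≤ phi L (x - y) * dfun L U x y := by
    intro x h1 h2 h3
    have h4 := phi_sin_ge hL hy ha h1 h2 h3
    have e : y + (x - y) = x := by ring
    rw [e] at h4
    have h5 := mul_le_mul_of_nonneg_left (dfun_ge L U x y) (phi_pos hL0 (x - y)).le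
    refine le_trans ?_ h5
    rw [one_div, inv_mul_le_iff₀ ha0]
    have h6 := mul_le_mul_of_nonneg_right h4 (sq_nonneg (U y))
    linarith
  have hint : ∀ b c : ℝ, -(1 / 8) ≤ b → c ≤ 1 / 8 → c - b = a →
      (∀ x ∈ Icc b c, 1 / a * (1 / 46240 * (L * rho1 L y) * U y ^ 2)
        ≤ phi L (x - y) * dfun L U x y) →
      1 / 46240 * (L * rho1 L y) * U y ^ 2 ≤ jI fun x => phi L (x - y) * dfun L U x y := by
    intro b c hb hc hbc hx
    have hbc' : b ≤ c := by linarith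
    calc _ = ∫ _ in b..c, 1 / a * (1 / 46240 * (L * rho1 L y) * U y ^ 2) := by
          rw [intervalIntegral.integral_const, hbc, smul_eq_mul]
          field_simp
      _ ≤ ∫ x in b..c, phi L (x - y) * dfun L U x y :=
          intervalIntegral.integral_mono_on hbc' (by simp) (cG.intervalIntegrable _ _) hx
      _ ≤ _ := integral_mono_interval hb hbc' hc cG hG
  rw [abs_le] at hy
  -- Only points x beyond y, away from the origin, at distance between a and 2a are used; there |x +
  -- y| cannot cancel, so the phase difference is bounded below.
  rcases le_total 0 y with h | h
  · refine hint (y + a) (y + 2 * a) (by linarith) (by linarith) (by ring) fun x hx => ?_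
    have h1 : 0 ≤ x - y := by linarith [hx.1]
    refine hpt x (mul_nonneg h h1) ?_ ?_
    · rw [abs_of_nonneg h1]; linarith [hx.1]
    · rw [abs_of_nonneg h1]; linarith [hx.2]
  · refine hint (y - 2 * a) (y - a) (by linarith) (by linarith) (by ring) fun x hx => ?_
    have h1 : x - y ≤ 0 := by linarith [hx.2]
    refine hpt x (mul_nonneg_of_nonpos_of_nonpos h h1) ?_ ?_
    · rw [abs_of_nonpos h1]; linarith [hx.2]
    · rw [abs_of_nonpos h1]; linarith [hx.1]

/-- The difference form. -/
def diffForm (L : ℝ) (U : ℝ → ℝ) : ℝ := L * jJ fun x y => phi L (x - y) * dfun L U x y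

/-- A form of the uncertainty principle: the modulated function e^(iLj)U cannot have a small
seminorm of order 1/4 where its phase oscillates, and the faster the oscillation, the larger the
gain. -/
lemma diffForm_ge (hL : 256 ≤ L) (h : CutFun U U₁ U₂) :
    1 / 46240 * (L ^ 2 * jI fun y => rho1 L y * U y ^ 2) ≤ diffForm L U := by
  have hL0 : 0 < L := by linarith
  have cU := h.c0
  have cF : Cont2 fun x y => phi L (x - y) * dfun L U x y := (cont2_phi hL0).mul (cont2_dfun L cU)
  have cr := continuous_rho1 L
  unfold diffForm
  rw [jJ_swap cF]
  have : (jI fun y => 1 / 46240 * (L * rho1 L y) * U y ^ 2)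
      ≤ jJ fun y x => phi L (x - y) * dfun L U x y := by
    refine jI_mono (by fun_prop) (Cont2.jI (F := fun y x => phi L (x - y) * dfun L U x y) cF.swap)
      fun y _ => ?_
    rcases le_total |y| (1 / 16) with hy | hy
    · exact jI_phi_dfun_ge hL cU hy
    · rw [h.supp y hy]
      simp only [ne_eq, OfNat.ofNat_ne_zero, not_false_eq_true, zero_pow, mul_zero]
      exact jI_nonneg fun x => mul_nonneg (phi_pos hL0 _).le (dfun_nonneg L U x y)
  have e : (jI fun y => 1 / 46240 * (L * rho1 L y) * U y ^ 2)
      = 1 / 46240 * L * jI fun y => rho1 L y * U y ^ 2 := by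
    rw [← jI_const_mul]; exact jI_congr fun y _ => by ring
  rw [e] at this
  calc _ = L * (1 / 46240 * L * jI fun y => rho1 L y * U y ^ 2) := by ring
    _ ≤ _ := mul_le_mul_of_nonneg_left this hL0.le

/-- The integral operator. -/
def opA (L : ℝ) (U : ℝ → ℝ) (x : ℝ) : ℝ := jI fun y => ker L x y * U y

lemma continuous_opA (hL : 0 < L) (hU : Continuous U) : Continuous (opA L U) :=
  Cont2.jI (F := fun x y => ker L x y * U y) (by
    have := cont2_ker hL
    unfold Cont2 at *; fun_prop)

lemma sq_opA_le (hL : 0 < L) (hU : Continuous U) (x : ℝ) :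
    opA L U x ^ 2 ≤ L * profMass
      * jI fun y => phi L (x - y) * (Real.sin (phase L x y) ^ 2 * U y ^ 2) := by
  have c1 : Continuous fun y => phi L (x - y) := (cont2_phi hL).slice_x x
  have c2 : Continuous fun y => phase L x y := (cont2_phase L).slice_x x
  have h := sq_integral_mul_le (a := -(1 / 8)) (b := 1 / 8) (by norm_num) c1
    (h := fun y => Real.sin (phase L x y) * U y) (by fun_prop) fun y => (phi_pos hL _).le
  have e1 : opA L U x = jI fun y => phi L (x - y) * (Real.sin (phase L x y) * U y) :=
    jI_congr fun y _ => by unfold ker; ring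
  simp only [mul_pow] at h
  rw [e1]
  refine h.trans (mul_le_mul_of_nonneg_right (jI_phi_le hL x) (jI_nonneg fun y => ?_))
  have := phi_pos hL (x - y)
  positivity

/-- The factor sin² U(y)² left by Cauchy-Schwarz is dominated by the difference form. The commutator
thus controls `opA L U` itself, which pays for pairing it with the source. -/
lemma jI_sq_opA_le_diffForm (hL : 0 < L) (hU : Continuous U) :
    (jI fun x => opA L U x ^ 2) ≤ profMass * diffForm L U := by
  have cF : Cont2 fun x y => phi L (x - y) * dfun L U x y := (cont2_phi hL).mul (cont2_dfun L hU)
  have cA := continuous_opA hL hU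
  have c2 := cont2_phase L
  have c3 := cont2_phi hL
  have cG : Cont2 fun x y => phi L (x - y) * (Real.sin (phase L x y) ^ 2 * U y ^ 2) := by
    unfold Cont2 at *; fun_prop
  calc _ ≤ jI fun x => L * profMass * jI fun y => phi L (x - y) * dfun L U x y := by
        refine jI_mono (by fun_prop) (continuous_const.mul cF.jI) fun x _ => ?_
        refine (sq_opA_le hL hU x).trans ?_
        refine mul_le_mul_of_nonneg_left ?_ (mul_nonneg hL.le profMass_nonneg)
        exact jI_mono (cG.slice_x x) (cF.slice_x x) fun y _ =>
          mul_le_mul_of_nonneg_left (dfun_ge L U x y) (phi_pos hL _).le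
    _ = _ := by rw [jI_const_mul, diffForm]; unfold jJ; ring

/-- Schur's test. The operator has norm of order L, so its pairing with w_t is bounded by the energy
of the mode. -/
lemma jI_sq_opA_le (hL : 0 < L) (hU : Continuous U) :
    (jI fun x => opA L U x ^ 2) ≤ (L * profMass) ^ 2 * jI fun y => U y ^ 2 := by
  have cA := continuous_opA hL hU
  have c2 := cont2_phase L
  have c3 := cont2_phi hL
  have cG : Cont2 fun x y => phi L (x - y) * (Real.sin (phase L x y) ^ 2 * U y ^ 2) := by
    unfold Cont2 at *; fun_prop
  have cH : Cont2 fun x y => phi L (x - y) * U y ^ 2 := by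
    unfold Cont2 at *; fun_prop
  have hP := profMass_nonneg
  calc _ ≤ jI fun x => L * profMass * jI fun y => phi L (x - y) * U y ^ 2 := by
        refine jI_mono (by fun_prop) (continuous_const.mul cH.jI) fun x _ => ?_
        refine (sq_opA_le hL hU x).trans ?_
        refine mul_le_mul_of_nonneg_left ?_ (mul_nonneg hL.le profMass_nonneg)
        refine jI_mono (cG.slice_x x) (cH.slice_x x) fun y _ => ?_
        refine mul_le_mul_of_nonneg_left ?_ (phi_pos hL _).le
        exact mul_le_of_le_one_left (sq_nonneg _) (Real.sin_sq_le_one _)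
    _ = L * profMass * jJ fun x y => phi L (x - y) * U y ^ 2 := by rw [jI_const_mul]; rfl
    _ = L * profMass * jI fun y => (jI fun x => phi L (x - y)) * U y ^ 2 := by
        rw [jJ_swap cH, jI_weight (fun y => U y ^ 2) (fun y x => phi L (x - y))]
    _ ≤ L * profMass * jI fun y => (L * profMass) * U y ^ 2 := by
        gcongr
        refine jI_mono ((Cont2.jI (F := fun y x => phi L (x - y)) c3.swap).mul (by fun_prop))
          (by fun_prop) fun y _ => ?_
        refine mul_le_mul_of_nonneg_right ?_ (sq_nonneg _)
        have e : (jI fun x => phi L (x - y)) = jI fun x => phi L (y - x) :=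
          jI_congr fun x _ => by rw [← neg_sub, phi_neg]
        rw [e]
        exact jI_phi_le hL y
    _ = _ := by rw [jI_const_mul]; ring

/-- The threshold for the spectral parameter. -/
def freqMin : ℝ := 10 ^ 32

/-- **Coercivity** of the commutator. -/
lemma comQ_ge (hL : freqMin ≤ L) (h : CutFun U U₁ U₂) :
    1 / 8 * diffForm L U + 1 / 10 ^ 6 * (L ^ 2 * jI fun y => rho1 L y * U y ^ 2)
      ≤ 4 * comQ L U U₂ + 5 * profMass * ((jI fun y => U₁ y ^ 2)
        + jI fun x => L ^ 2 * x ^ 2 * U x ^ 2) := by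
  unfold freqMin at hL
  have hL1 : 1 ≤ L := by linarith
  have hL0 : 0 < L := by linarith
  have hL256 : 256 ≤ L := by linarith
  have cU := h.c0
  have cF : Cont2 fun x y => phi L (x - y) * dfun L U x y := (cont2_phi hL0).mul (cont2_dfun L cU)
  have cG : Cont2 fun x y => qd L (x - y) ^ (-(7 / 4) : ℝ) * dfun L U x y :=
    (cont2_qd hL0 _).mul (cont2_dfun L cU)
  have cB := (cont2_kerB hL0).mul (cont2_dfun L cU)
  have cB1 := (cont2_kerB hL0).jI
  have e0 := comQ_eq hL0 h
  have e1 : 1 / 4 * (jJ fun x y => phi L (x - y) * dfun L U x y)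
      - 9 / 4 * (√L * (L ^ 2)⁻¹) * (jJ fun x y => qd L (x - y) ^ (-(7 / 4) : ℝ) * dfun L U x y)
      ≤ jJ fun x y => kerB L x y * dfun L U x y := by
    rw [← jJ_const_mul, ← jJ_const_mul, ← jJ_sub (cF.const_mul _) (cG.const_mul _)]
    refine jJ_mono ((cF.const_mul _).sub (cG.const_mul _)) cB fun x y hx hy => ?_
    have := mul_le_mul_of_nonneg_right (kerB_ge hL0 hx hy) (dfun_nonneg L U x y)
    linarith
  have e2 : (jI fun x => jI (fun y => kerB L x y) * U x ^ 2) ≤ 40 * √L * jI fun x => U x ^ 2 := by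
    rw [← jI_const_mul]
    refine jI_mono (cB1.mul (by fun_prop)) (by fun_prop) fun x _ => ?_
    rcases le_total |x| (1 / 16) with hx | hx
    · exact mul_le_mul_of_nonneg_right ((le_abs_self _).trans (abs_jI_kerB_le hL1 hx)) (sq_nonneg _)
    · rw [h.supp x hx]; simp
  have e3 := jJ_err_le hL1 h
  have e4 := diffForm_ge hL256 h
  -- Since `rho1` is at least L^(-1/4), the gain exceeds L^(3/2) by the factor L^(1/4), which is at
  -- least 10^8 once L ≥ 10^32. This is what absorbs the marginals and the regularization error.
  have e5 : 10 ^ 8 * (L * √L * jI fun x => U x ^ 2) ≤ L ^ 2 * jI fun y => rho1 L y * U y ^ 2 := by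
    have cr := continuous_rho1 L
    have hk : 10 ^ 8 ≤ √(√L) := by
      refine Real.le_sqrt_of_sq_le (Real.le_sqrt_of_sq_le ?_)
      norm_num at hL ⊢; linarith
    have hrho : ∀ y, 10 ^ 8 * √L ≤ L * rho1 L y := by
      intro y
      have h1 : 1 / √L ≤ scl L y := by
        have : 1 / √L = √(1 / L) := by rw [Real.sqrt_div zero_le_one, Real.sqrt_one]
        rw [this]
        exact Real.sqrt_le_sqrt (by nlinarith [sq_nonneg y])
      have h2 : 1 / √(√L) ≤ rho1 L y := by
        have : 1 / √(√L) = √(1 / √L) := by rw [Real.sqrt_div zero_le_one, Real.sqrt_one]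
        rw [this]
        exact Real.sqrt_le_sqrt h1
      have hs : 0 < √(√L) := by positivity
      have h3 : √(√L) * √(√L) = √L := Real.mul_self_sqrt (Real.sqrt_nonneg L)
      have h4 : √L * √L = L := Real.mul_self_sqrt hL0.le
      calc 10 ^ 8 * √L ≤ √(√L) * √L := by gcongr
        _ = L * (1 / √(√L)) := by
            rw [mul_one_div, eq_div_iff hs.ne']
            calc √(√L) * √L * √(√L) = (√(√L) * √(√L)) * √L := by ring
              _ = L := by rw [h3, h4]
        _ ≤ _ := by gcongr
    rw [← jI_const_mul, ← jI_const_mul, ← jI_const_mul]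
    refine jI_mono (by fun_prop) (by fun_prop) fun y _ => ?_
    have := mul_le_mul_of_nonneg_right (hrho y) (mul_nonneg hL0.le (sq_nonneg (U y)))
    linarith
  have hU0 : 0 ≤ jI fun x => U x ^ 2 := jI_nonneg fun x => sq_nonneg _
  have hX : 0 ≤ jI fun x => L ^ 2 * x ^ 2 * U x ^ 2 := jI_nonneg fun x => by positivity
  have hG : 0 ≤ jI fun y => U₁ y ^ 2 := jI_nonneg fun x => sq_nonneg _
  have hP := profMass_nonneg
  have e6 := mul_le_mul_of_nonneg_left e1 hL0.le
  have e7 := mul_le_mul_of_nonneg_left e2 (by linarith : 0 ≤ 2 * L)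
  have hPG := mul_nonneg hP hG
  have hPX := mul_nonneg hP hX
  have hLU : 0 ≤ L * √L * jI fun x => U x ^ 2 := by positivity
  have e8 : diffForm L U = L * jJ fun x y => phi L (x - y) * dfun L U x y := rfl
  linarith

end TrappedWave

namespace TrappedWave

open Set Filter Topology

/-! ### The refined estimate for a single frequency -/

/-- Differentiation under the integral from joint continuity alone, through Fubini and the
fundamental theorem of calculus, as the divergence theorem with zero flux. -/
lemma hasDerivAt_jI {F F' : ℝ → ℝ → ℝ} (hF : ∀ t x, HasDerivAt (fun s => F s x) (F' t x) t)
    (cF : Cont2 F) (cF' : Cont2 F') (t : ℝ) :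
    HasDerivAt (fun s => jI (F s)) (jI (F' t)) t := by
  have h : (fun s => jI (F s)) = fun s => jI (F 0) + ∫ r in (0 : ℝ)..s, jI (F' r) := by
    funext s
    have := rect_identity (T := s) (a := -(1 / 8)) (b := 1 / 8) (G := fun _ _ => 0)
      (Gx := fun _ _ => 0) hF (fun t x => hasDerivAt_const x 0) cF (Cont2.of_x continuous_const) cF'
      (fun t x => (zero_add _).symm)
    simp only [sub_self, intervalIntegral.integral_zero, zero_add] at this
    have e : rectInt s (-(1 / 8)) (1 / 8) F' = ∫ r in (0 : ℝ)..s, jI (F' r) := rfl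
    rw [← e, ← this]
    unfold jI
    ring
  rw [h]
  exact (cF'.jI.integral_hasStrictDerivAt 0 t).hasDerivAt.const_add _

/-- A solution of the one-dimensional wave equation `w_tt = w_xx - L² V w + g`. -/
structure Mode (L : ℝ) (w wt wx wxx g : ℝ → ℝ → ℝ) : Prop where
  dt0 : ∀ t x, HasDerivAt (fun s => w s x) (wt t x) t
  dt1 : ∀ t x, HasDerivAt (fun s => wt s x) (wxx t x - L ^ 2 * potV x * w t x + g t x) t
  dx0 : ∀ t x, HasDerivAt (fun y => w t y) (wx t x) x
  dx1 : ∀ t x, HasDerivAt (fun y => wx t y) (wxx t x) x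
  c0 : Cont2 w
  ct : Cont2 wt
  cx : Cont2 wx
  cxx : Cont2 wxx
  cg : Cont2 g

lemma cont2_opA {L : ℝ} (hL : 0 < L) {U : ℝ → ℝ → ℝ} (hU : Cont2 U) :
    Cont2 fun t x => opA L (U t) x := by
  have hk : Continuous (Function.uncurry (ker L)) := cont2_ker hL
  have hU' : Continuous (Function.uncurry U) := hU
  have key : Continuous (Function.uncurry fun (z : ℝ × ℝ) y =>
      Function.uncurry (ker L) (z.2, y) * Function.uncurry U (z.1, y)) := by
    unfold Function.uncurry at *
    exact (hk.comp (by fun_prop : Continuous fun p : (ℝ × ℝ) × ℝ => (p.1.2, p.2))).mul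
      (hU'.comp (by fun_prop : Continuous fun p : (ℝ × ℝ) × ℝ => (p.1.1, p.2)))
  exact intervalIntegral.continuous_parametric_intervalIntegral_of_continuous' key _ _

lemma hasDerivAt_opA {L : ℝ} (hL : 0 < L) {U Ut : ℝ → ℝ → ℝ}
    (h : ∀ t x, HasDerivAt (fun s => U s x) (Ut t x) t) (hU : Cont2 U) (hUt : Cont2 Ut) (t x : ℝ) :
    HasDerivAt (fun s => opA L (U s) x) (opA L (Ut t) x) t := by
  have hk := (cont2_ker hL).slice_x x
  exact hasDerivAt_jI (F := fun s y => ker L x y * U s y) (F' := fun s y => ker L x y * Ut s y)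
    (fun t y => (h t y).const_mul _) (hU.mul_x hk) (hUt.mul_x hk) t

lemma jI_mul_opA_self {L : ℝ} (hL : 0 < L) {U : ℝ → ℝ} (hU : Continuous U) :
    (jI fun x => U x * opA L U x) = 0 := by
  have hk := cont2_ker hL
  have e : (jI fun x => U x * opA L U x) = jJ fun x y => U x * (ker L x y * U y) :=
    jI_congr fun x _ => (jI_const_mul _ _).symm
  rw [e]
  refine jJ_eq_zero (by unfold Cont2 at *; fun_prop) fun x y => ?_
  rw [ker_swap]; ring

namespace Mode

variable {L : ℝ} {w wt wx wxx g : ℝ → ℝ → ℝ}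

/-- The boundary terms. -/
def bdry (L : ℝ) (w wt : ℝ → ℝ → ℝ) (t : ℝ) : ℝ :=
  jI fun x => wt t x ^ 2 + L ^ 2 * w t x ^ 2

/-- Differentiate the pairing of w_t with Aw. Antisymmetry of A kills the pairing of w_t with A w_t
and also the constant part L² of the potential, so only -`jap1`² is left of V. -/
lemma comQ_identity (hL : 0 < L) (h : Mode L w wt wx wxx g) (T : ℝ) :
    (∫ t in (0 : ℝ)..T, comQ L (w t) (wxx t))
      = (jI fun x => wt T x * opA L (w T) x) - (jI fun x => wt 0 x * opA L (w 0) x)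
        - rectInt T (-(1 / 8)) (1 / 8) fun t x => g t x * opA L (w t) x := by
  have c0 := h.c0; have ct := h.ct; have cx := h.cx; have cxx := h.cxx; have cg := h.cg
  have cj := Cont2.of_x continuous_jap1; have cV := Cont2.of_x continuous_potV
  have cA := cont2_opA hL c0; have cAt := cont2_opA hL ct
  have hk := cont2_ker hL
  have cM : Cont2 fun t x => (wxx t x + L ^ 2 * jap1 x ^ 2 * w t x) * opA L (w t) x := by
    unfold Cont2 at *; fun_prop
  have cR : Cont2 fun t x => g t x * opA L (w t) x := by unfold Cont2 at *; fun_prop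
  have cW : Cont2 fun t x => w t x * opA L (w t) x := by unfold Cont2 at *; fun_prop
  have cWt : Cont2 fun t x => wt t x * opA L (wt t) x := by unfold Cont2 at *; fun_prop
  have d := fun t => hasDerivAt_jI (F := fun t x => wt t x * opA L (w t) x)
    (F' := fun t x => (wxx t x - L ^ 2 * potV x * w t x + g t x) * opA L (w t) x
      + wt t x * opA L (wt t) x)
    (fun t x => (h.dt1 t x).mul (hasDerivAt_opA hL h.dt0 c0 ct t x))
    (by unfold Cont2 at *; fun_prop) (by unfold Cont2 at *; fun_prop) t
  have e : ∀ t, (jI fun x => (wxx t x - L ^ 2 * potV x * w t x + g t x) * opA L (w t) x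
      + wt t x * opA L (wt t) x)
      = comQ L (w t) (wxx t) + jI fun x => g t x * opA L (w t) x := by
    intro t
    have e1 : comQ L (w t) (wxx t)
        = jI fun x => (wxx t x + L ^ 2 * jap1 x ^ 2 * w t x) * opA L (w t) x := by
      refine jI_congr fun x _ => ?_
      rw [opA, ← jI_const_mul]
      exact jI_congr fun y _ => by ring
    have z1 := jI_mul_opA_self hL (ct.slice_x t)
    have z2 := jI_mul_opA_self hL (c0.slice_x t)
    have s1 := jI_add (cM.slice_x t) (cR.slice_x t)
    have s2 := jI_add ((cM.add cR).slice_x t) (cWt.slice_x t)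
    have s3 := jI_sub (((cM.add cR).add cWt).slice_x t) ((cW.const_mul (L ^ 2)).slice_x t)
    rw [jI_const_mul, z2, s2, s1, z1, ← e1] at s3
    rw [mul_zero, sub_zero, add_zero] at s3
    rw [← s3]
    refine jI_congr fun x _ => ?_
    rw [potV_eq]; ring
  have cQ : Continuous fun t => comQ L (w t) (wxx t) := by
    have : (fun t => comQ L (w t) (wxx t))
        = fun t => jI fun x => (wxx t x + L ^ 2 * jap1 x ^ 2 * w t x) * opA L (w t) x := by
      funext t
      refine jI_congr fun x _ => ?_
      rw [opA, ← jI_const_mul]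
      exact jI_congr fun y _ => by ring
    rw [this]; exact cM.jI
  have f := intervalIntegral.integral_eq_sub_of_hasDerivAt (a := 0) (b := T)
    (fun t _ => (d t).congr_deriv (e t)) ((cQ.add cR.jI).intervalIntegrable _ _)
  rw [intervalIntegral.integral_add (cQ.intervalIntegrable _ _) (cR.jI.intervalIntegrable _ _)] at f
  have e3 : rectInt T (-(1 / 8)) (1 / 8) (fun t x => g t x * opA L (w t) x)
      = ∫ t in (0 : ℝ)..T, jI fun x => g t x * opA L (w t) x := rfl
  rw [e3]; linarith

lemma abs_jI_wt_opA_le (hL : 0 < L) (h : Mode L w wt wx wxx g) (t : ℝ) :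
    |jI fun x => wt t x * opA L (w t) x| ≤ (profMass + 1) ^ 2 / 2 * bdry L w wt t := by
  have c0 := h.c0.slice_x t; have ct := h.ct.slice_x t
  have cA := continuous_opA hL c0
  have hP := profMass_nonneg
  have i1 : 0 ≤ jI fun x => wt t x ^ 2 := jI_nonneg fun x => sq_nonneg _
  have i2 : 0 ≤ jI fun x => w t x ^ 2 := jI_nonneg fun x => sq_nonneg _
  have e : bdry L w wt t = (jI fun x => wt t x ^ 2) + L ^ 2 * jI fun x => w t x ^ 2 := by
    rw [bdry, ← jI_const_mul, ← jI_add (by fun_prop) (by fun_prop)]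
  have h1 := jI_sq_opA_le hL c0
  calc _ ≤ jI fun x => |wt t x * opA L (w t) x| := abs_jI_le
    _ ≤ jI fun x => 1 / 2 * wt t x ^ 2 + 1 / 2 * opA L (w t) x ^ 2 := by
        refine jI_mono (by fun_prop) (by fun_prop) fun x _ => ?_
        rw [abs_mul, ← sq_abs (wt t x), ← sq_abs (opA L (w t) x)]
        nlinarith [sq_nonneg (|wt t x| - |opA L (w t) x|)]
    _ = 1 / 2 * (jI fun x => wt t x ^ 2) + 1 / 2 * jI fun x => opA L (w t) x ^ 2 := by
        rw [jI_add (by fun_prop) (by fun_prop), jI_const_mul, jI_const_mul]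
    _ ≤ _ := by
        rw [e]
        have hq : 1 ≤ (profMass + 1) ^ 2 := by nlinarith
        have hr : profMass ^ 2 ≤ (profMass + 1) ^ 2 := by nlinarith
        have := mul_le_mul_of_nonneg_right hq i1
        have := mul_le_mul_of_nonneg_right hr (mul_nonneg (sq_nonneg L) i2)
        nlinarith

/-- Control of the solution with the weight `ρ₁`. -/
lemma rectInt_rho_le (hL : freqMin ≤ L) (h : Mode L w wt wx wxx g)
    (s0 : ∀ t x, 1 / 16 ≤ |x| → w t x = 0) (s1 : ∀ t x, 1 / 16 ≤ |x| → wx t x = 0)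
    {T : ℝ} (hT : 0 ≤ T) :
    rectInt T (-(1 / 8)) (1 / 8) (fun t x => L ^ 2 * (rho1 L x * w t x ^ 2))
      ≤ 10 ^ 6 * (32 * (profMass + 1) ^ 2) * (bdry L w wt 0 + bdry L w wt T
        + rectInt T (-(1 / 8)) (1 / 8) fun t x => wx t x ^ 2 + L ^ 2 * x ^ 2 * w t x ^ 2
          + g t x ^ 2) := by
  have hL0 : 0 < L := lt_of_lt_of_le (by unfold freqMin; norm_num) hL
  have hL256 : 256 ≤ L := le_trans (by unfold freqMin; norm_num) hL
  have c0 := h.c0; have ct := h.ct; have cx := h.cx; have cxx := h.cxx; have cg := h.cg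
  have cA := cont2_opA hL0 c0
  have cr := Cont2.of_x (continuous_rho1 L)
  have cX : Cont2 fun t x => L ^ 2 * x ^ 2 * w t x ^ 2 := by unfold Cont2 at *; fun_prop
  have cB : Cont2 fun t x => wx t x ^ 2 := by unfold Cont2 at *; fun_prop
  have cG : Cont2 fun t x => g t x ^ 2 := by unfold Cont2 at *; fun_prop
  have cA2 : Cont2 fun t x => opA L (w t) x ^ 2 := by unfold Cont2 at *; fun_prop
  have cR : Cont2 fun t x => g t x * opA L (w t) x := by unfold Cont2 at *; fun_prop
  have cM : Cont2 fun t x => (wxx t x + L ^ 2 * jap1 x ^ 2 * w t x) * opA L (w t) x := by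
    have := Cont2.of_x continuous_jap1
    unfold Cont2 at *; fun_prop
  have crw : Cont2 fun t x => L ^ 2 * (rho1 L x * w t x ^ 2) := by unfold Cont2 at *; fun_prop
  have hP := profMass_nonneg
  have eQ : ∀ t, comQ L (w t) (wxx t)
      = jI fun x => (wxx t x + L ^ 2 * jap1 x ^ 2 * w t x) * opA L (w t) x := by
    intro t
    refine jI_congr fun x _ => ?_
    rw [opA, ← jI_const_mul]
    exact jI_congr fun y _ => by ring
  have hcut : ∀ t, CutFun (w t) (wx t) (wxx t) := fun t =>
    ⟨h.dx0 t, h.dx1 t, cxx.slice_x t, s0 t, s1 t⟩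
  -- This η makes η‖Aw‖² at most the share 1/8 of the difference form, so that much of ‖Aw‖² is
  -- available to absorb the pairing with g.
  set η : ℝ := 1 / (8 * (profMass + 1)) with hη
  have hη0 : 0 < η := by positivity
  have hηP : η * profMass ≤ 1 / 8 := by
    rw [hη, div_mul_eq_mul_div, div_le_div_iff₀ (by positivity) (by norm_num)]; linarith
  -- the pointwise in time inequality
  have key : ∀ t, 1 / 10 ^ 6 * (jI fun x => L ^ 2 * (rho1 L x * w t x ^ 2))
      + η * (jI fun x => opA L (w t) x ^ 2)
      ≤ 4 * comQ L (w t) (wxx t) + 5 * profMass * jI fun x => wx t x ^ 2 + L ^ 2 * x ^ 2 * w t x ^ 2 := by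
    intro t
    have k1 := comQ_ge hL (hcut t)
    have k2 := jI_sq_opA_le_diffForm hL0 (c0.slice_x t)
    have k3 := jI_add (cB.slice_x t) (cX.slice_x t)
    have k4 : 0 ≤ diffForm L (w t) := le_trans (by
      have : 0 ≤ jI fun y => rho1 L y * w t y ^ 2 := jI_nonneg fun y =>
        mul_nonneg (rho1_pos hL0 y).le (sq_nonneg _)
      positivity) (diffForm_ge hL256 (hcut t))
    have k5 := mul_le_mul_of_nonneg_left k2 hη0.le
    have k6 := mul_le_mul_of_nonneg_right hηP k4
    rw [jI_const_mul, k3]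
    linarith
  have int1 : 1 / 10 ^ 6 * rectInt T (-(1 / 8)) (1 / 8) (fun t x => L ^ 2 * (rho1 L x * w t x ^ 2))
      + η * rectInt T (-(1 / 8)) (1 / 8) (fun t x => opA L (w t) x ^ 2)
      ≤ 4 * (∫ t in (0 : ℝ)..T, comQ L (w t) (wxx t)) + 5 * profMass *
        rectInt T (-(1 / 8)) (1 / 8) fun t x => wx t x ^ 2 + L ^ 2 * x ^ 2 * w t x ^ 2 := by
    have cQ : Continuous fun t => comQ L (w t) (wxx t) := by
      rw [funext eQ]; exact cM.jI
    have cBX := (cB.add cX).jI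
    have cA2' := cA2.jI
    have crw' := crw.jI
    have i1 : IntervalIntegrable (fun t => 1 / 10 ^ 6 *
        jI fun x => L ^ 2 * (rho1 L x * w t x ^ 2)) volume 0 T :=
      (continuous_const.mul crw').intervalIntegrable _ _
    have i2 : IntervalIntegrable (fun t => η * jI fun x => opA L (w t) x ^ 2) volume 0 T :=
      (continuous_const.mul cA2').intervalIntegrable _ _
    have i3 : IntervalIntegrable (fun t => 4 * comQ L (w t) (wxx t)) volume 0 T :=
      (continuous_const.mul cQ).intervalIntegrable _ _
    have i4 : IntervalIntegrable (fun t => 5 * profMass *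
        jI fun x => wx t x ^ 2 + L ^ 2 * x ^ 2 * w t x ^ 2) volume 0 T :=
      (continuous_const.mul cBX).intervalIntegrable _ _
    have := intervalIntegral.integral_mono_on hT (i1.add i2) (i3.add i4) fun t _ => key t
    rw [intervalIntegral.integral_add i1 i2, intervalIntegral.integral_add i3 i4] at this
    simp only [intervalIntegral.integral_const_mul] at this
    exact this
  have int2 : -4 * rectInt T (-(1 / 8)) (1 / 8) (fun t x => g t x * opA L (w t) x)
      ≤ η * rectInt T (-(1 / 8)) (1 / 8) (fun t x => opA L (w t) x ^ 2)
        + 4 / η * rectInt T (-(1 / 8)) (1 / 8) fun t x => g t x ^ 2 := by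
    rw [← rectInt_const_mul, ← rectInt_const_mul, ← rectInt_const_mul,
      ← rectInt_add (cA2.const_mul _) (cG.const_mul _)]
    refine rectInt_mono hT (by norm_num) (cR.const_mul _) ((cA2.const_mul _).add (cG.const_mul _))
      fun t _ x _ => ?_
    have : 0 ≤ η * (opA L (w t) x + 2 / η * g t x) ^ 2 := by positivity
    have e : η * (opA L (w t) x + 2 / η * g t x) ^ 2
        = η * opA L (w t) x ^ 2 + 4 * (g t x * opA L (w t) x) + 4 / η * g t x ^ 2 := by
      field_simp; ring
    linarith
  have id := comQ_identity hL0 h T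
  have b0 := (abs_le.1 (h.abs_jI_wt_opA_le hL0 0)).1
  have bT := (abs_le.1 (h.abs_jI_wt_opA_le hL0 T)).2
  have hB0 : ∀ t, 0 ≤ bdry L w wt t := fun t => jI_nonneg fun x => by positivity
  have n1 : 0 ≤ rectInt T (-(1 / 8)) (1 / 8) fun t x => wx t x ^ 2 + L ^ 2 * x ^ 2 * w t x ^ 2 :=
    rectInt_nonneg hT (by norm_num) fun t x => by positivity
  have n2 : 0 ≤ rectInt T (-(1 / 8)) (1 / 8) fun t x => g t x ^ 2 :=
    rectInt_nonneg hT (by norm_num) fun t x => by positivity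
  have sp := rectInt_add (T := T) (a := -(1 / 8)) (b := 1 / 8) (cB.add cX) cG
  rw [sp]
  have h4η : 4 / η = 32 * (profMass + 1) := by rw [hη]; field_simp; norm_num
  rw [h4η] at int2
  have q1 : (profMass + 1) ≤ (profMass + 1) ^ 2 := by nlinarith
  have q2 := mul_le_mul_of_nonneg_right q1 n2
  have q3 : 5 * profMass ≤ 32 * (profMass + 1) ^ 2 := by nlinarith
  have q4 := mul_le_mul_of_nonneg_right q3 n1
  have q5 := mul_nonneg (sq_nonneg (profMass + 1)) (hB0 0)
  have q6 := mul_nonneg (sq_nonneg (profMass + 1)) (hB0 T)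
  linarith

end Mode

end TrappedWave

/-! ### From the weighted function to its time derivative. -/

namespace TrappedWave

open Set Filter Topology

/-- The derivative of `rho1`. -/
def rho1' (L y : ℝ) : ℝ := y / (2 * rho1 L y * scl L y)

section Rho

variable {L : ℝ}

lemma hasDerivAt_scl (hL : 0 < L) (y : ℝ) : HasDerivAt (scl L) (y / scl L y) y := by
  have h : HasDerivAt (fun y : ℝ => y ^ 2 + 1 / L) (2 * y) y := by
    simpa using (hasDerivAt_pow 2 y).add_const (1 / L)
  refine (h.sqrt (by positivity)).congr_deriv ?_
  rw [mul_div_mul_left _ _ two_ne_zero]; rfl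

lemma hasDerivAt_rho1 (hL : 0 < L) (y : ℝ) : HasDerivAt (rho1 L) (rho1' L y) y := by
  refine ((hasDerivAt_scl hL y).sqrt (scl_pos hL y).ne').congr_deriv ?_
  have := scl_pos hL y; have := rho1_pos hL y
  unfold rho1'
  change _ / (2 * rho1 L y) = _
  field_simp

lemma continuous_rho1' (hL : 0 < L) : Continuous (rho1' L) := by
  have h1 := continuous_rho1 L; have h2 := continuous_scl L
  unfold rho1'
  exact continuous_id.div (by fun_prop) fun y => by
    have := scl_pos hL y; have := rho1_pos hL y
    positivity

lemma rho1_sq (hL : 0 < L) (y : ℝ) : rho1 L y ^ 2 = scl L y := Real.sq_sqrt (scl_pos hL y).le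

lemma sqrt_abs_le_rho1 (hL : 0 < L) (y : ℝ) : √|y| ≤ rho1 L y := Real.sqrt_le_sqrt (abs_le_scl hL y)

lemma rho1_le_one (hL : 4 ≤ L) {y : ℝ} (hy : |y| ≤ 1 / 8) : rho1 L y ≤ 1 := by
  refine Real.sqrt_le_one.2 (Real.sqrt_le_one.2 ?_)
  have h1 : 1 / L ≤ 1 / 4 := one_div_le_one_div_of_le (by norm_num) hL
  have h2 : y ^ 2 ≤ (1 / 8) ^ 2 := by rw [← sq_abs]; exact pow_le_pow_left₀ (abs_nonneg y) hy 2
  linarith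

/-- The derivative of the weight is at most 1/(2`rho1`), and L²`rho1`³ ≥ 1 on this interval, so
differentiating the weight costs no more than the term already controlled. -/
lemma sq_rho1'_le (hL : 4 ≤ L) {y : ℝ} (hy : |y| ≤ 1 / 8) : rho1' L y ^ 2 ≤ L ^ 2 * rho1 L y := by
  have hL0 : 0 < L := by linarith
  have hs := scl_pos hL0 y; have hr := rho1_pos hL0 y
  have h1 := rho1_le_one hL hy
  have hy2 : y ^ 2 ≤ scl L y ^ 2 := by rw [scl_sq hL0]; have : 0 < 1 / L := by positivity
                                       linarith
  have h4 : 1 ≤ L * rho1 L y ^ 4 := by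
    have : rho1 L y ^ 4 = y ^ 2 + 1 / L := by rw [← scl_sq hL0, ← rho1_sq hL0]; ring
    rw [this, mul_add, mul_one_div_cancel hL0.ne']
    have : 0 ≤ L * y ^ 2 := by positivity
    linarith
  have h3 : rho1 L y ^ 4 ≤ rho1 L y ^ 3 := by
    have := mul_le_mul_of_nonneg_left h1 (pow_pos hr 3).le
    calc rho1 L y ^ 4 = rho1 L y ^ 3 * rho1 L y := by ring
      _ ≤ _ := by linarith
  have h5 : 1 ≤ L ^ 2 * rho1 L y ^ 3 := by
    calc 1 ≤ L * rho1 L y ^ 4 := h4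
      _ ≤ L ^ 2 * rho1 L y ^ 3 := by
        gcongr
        nlinarith
  unfold rho1'
  rw [div_pow, div_le_iff₀ (by positivity)]
  calc y ^ 2 ≤ scl L y ^ 2 * 1 := by linarith
    _ ≤ scl L y ^ 2 * (4 * (L ^ 2 * rho1 L y ^ 3)) := by gcongr; linarith
    _ = _ := by ring

end Rho

namespace Mode

variable {L : ℝ} {w wt wx wxx g : ℝ → ℝ → ℝ}

lemma bdry_nonneg (L : ℝ) (w wt : ℝ → ℝ → ℝ) (t : ℝ) : 0 ≤ bdry L w wt t :=
  jI_nonneg fun x => by positivity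

/-- Equipartition: the multiplier `rho1` w compares the weighted w_t² with the weighted L²w², up to
w_x, g and the derivative of the weight. -/
lemma rho_identity (hL : 0 < L) (h : Mode L w wt wx wxx g)
    (s0 : ∀ t x, 1 / 16 ≤ |x| → w t x = 0) (T : ℝ) :
    (jI fun x => rho1 L x * w T x * wt T x) - (jI fun x => rho1 L x * w 0 x * wt 0 x)
      = rectInt T (-(1 / 8)) (1 / 8) fun t x => rho1 L x * wt t x ^ 2 - rho1 L x * wx t x ^ 2
        - rho1' L x * w t x * wx t x - L ^ 2 * (potV x * rho1 L x * w t x ^ 2)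
        + rho1 L x * w t x * g t x := by
  have c0 := h.c0; have ct := h.ct; have cx := h.cx; have cxx := h.cxx; have cg := h.cg
  have cr := Cont2.of_x (continuous_rho1 L); have cV := Cont2.of_x continuous_potV
  have cr' := Cont2.of_x (continuous_rho1' hL)
  have hz : ∀ t, w t (1 / 8) = 0 := fun t => s0 t _ (by rw [abs_of_pos] <;> norm_num)
  have hz' : ∀ t, w t (-(1 / 8)) = 0 := fun t => s0 t _ (by rw [abs_neg, abs_of_pos] <;> norm_num)
  have := rect_identity (T := T) (a := -(1 / 8)) (b := 1 / 8)
    (F := fun t x => rho1 L x * w t x * wt t x)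
    (Ft := fun t x => rho1 L x * wt t x * wt t x
      + rho1 L x * w t x * (wxx t x - L ^ 2 * potV x * w t x + g t x))
    (G := fun t x => rho1 L x * w t x * wx t x)
    (Gx := fun t x => (rho1' L x * w t x + rho1 L x * wx t x) * wx t x
      + rho1 L x * w t x * wxx t x)
    (S := fun t x => rho1 L x * wt t x ^ 2 - rho1 L x * wx t x ^ 2
        - rho1' L x * w t x * wx t x - L ^ 2 * (potV x * rho1 L x * w t x ^ 2)
        + rho1 L x * w t x * g t x)
    (fun t x => ((h.dt0 t x).const_mul _).mul (h.dt1 t x))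
    (fun t x => ((hasDerivAt_rho1 hL x).mul (h.dx0 t x)).mul (h.dx1 t x))
    (by unfold Cont2 at *; fun_prop) (by unfold Cont2 at *; fun_prop)
    (by unfold Cont2 at *; fun_prop) (fun t x => by ring)
  simp only [hz, hz', mul_zero, zero_mul, sub_zero, intervalIntegral.integral_zero,
    zero_add] at this
  exact this

lemma abs_jI_rho_le (hL : freqMin ≤ L) (h : Mode L w wt wx wxx g) (t : ℝ) :
    |jI fun x => rho1 L x * w t x * wt t x| ≤ bdry L w wt t := by
  have hL4 : 4 ≤ L := le_trans (by unfold freqMin; norm_num) hL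
  have c0 := h.c0.slice_x t; have ct := h.ct.slice_x t
  have cr := continuous_rho1 L
  refine abs_jI_le.trans ?_
  refine jI_mono (by fun_prop) (by fun_prop) fun x hx => ?_
  have h1 := rho1_le_one hL4 hx
  have h0 := rho1_pos (by linarith : 0 < L) x
  rw [abs_mul, abs_mul, abs_of_pos h0, ← sq_abs (wt t x), ← sq_abs (w t x)]
  have h2 : rho1 L x * |w t x| * |wt t x| ≤ 1 * |w t x| * |wt t x| := by gcongr
  have h3 : 1 * |w t x| ^ 2 ≤ L ^ 2 * |w t x| ^ 2 := by
    gcongr; nlinarith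
  nlinarith [sq_nonneg (|wt t x| - |w t x|), sq_nonneg (|wt t x|), sq_nonneg (|w t x|)]

/-- The constant in the refined estimate for a compactly supported mode. -/
def cutConst : ℝ := 4 + 2 * (10 ^ 6 * (32 * (profMass + 1) ^ 2))

lemma cutConst_pos : 0 < cutConst := by unfold cutConst; positivity

lemma rectInt_rho_wt_le (hL : freqMin ≤ L) (h : Mode L w wt wx wxx g)
    (s0 : ∀ t x, 1 / 16 ≤ |x| → w t x = 0) (s1 : ∀ t x, 1 / 16 ≤ |x| → wx t x = 0)
    {T : ℝ} (hT : 0 ≤ T) :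
    rectInt T (-(1 / 8)) (1 / 8) (fun t x => rho1 L x * wt t x ^ 2)
      ≤ cutConst * (bdry L w wt 0 + bdry L w wt T
        + rectInt T (-(1 / 8)) (1 / 8) fun t x => wx t x ^ 2 + L ^ 2 * x ^ 2 * w t x ^ 2
          + g t x ^ 2) := by
  have hL4 : 4 ≤ L := le_trans (by unfold freqMin; norm_num) hL
  have hL0 : 0 < L := by linarith
  have c0 := h.c0; have ct := h.ct; have cx := h.cx; have cxx := h.cxx; have cg := h.cg
  have cr := Cont2.of_x (continuous_rho1 L); have cV := Cont2.of_x continuous_potV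
  have cr' := Cont2.of_x (continuous_rho1' hL0)
  have k1 := h.rho_identity hL0 s0 T
  have k2 := h.rectInt_rho_le hL s0 s1 hT
  have b0 := (abs_le.1 (h.abs_jI_rho_le hL 0)).1
  have bT := (abs_le.1 (h.abs_jI_rho_le hL T)).2
  have cE : Cont2 fun t x => wx t x ^ 2 + L ^ 2 * x ^ 2 * w t x ^ 2 + g t x ^ 2 := by
    unfold Cont2 at *; fun_prop
  have cD : Cont2 fun t x => L ^ 2 * (rho1 L x * w t x ^ 2) := by unfold Cont2 at *; fun_prop
  have cF : Cont2 fun t x => rho1 L x * wt t x ^ 2 := by unfold Cont2 at *; fun_prop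
  have cS : Cont2 fun t x => rho1 L x * wt t x ^ 2 - rho1 L x * wx t x ^ 2
        - rho1' L x * w t x * wx t x - L ^ 2 * (potV x * rho1 L x * w t x ^ 2)
        + rho1 L x * w t x * g t x := by unfold Cont2 at *; fun_prop
  -- Young's inequality on every other term of the identity. The weighted L²w² is spent three times,
  -- with coefficients 1/2, 1 and 1/2, whence the last factor 2.
  have k3 : rectInt T (-(1 / 8)) (1 / 8) (fun t x => rho1 L x * wt t x ^ 2)
      ≤ (rectInt T (-(1 / 8)) (1 / 8) fun t x => rho1 L x * wt t x ^ 2 - rho1 L x * wx t x ^ 2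
        - rho1' L x * w t x * wx t x - L ^ 2 * (potV x * rho1 L x * w t x ^ 2)
        + rho1 L x * w t x * g t x)
        + 2 * rectInt T (-(1 / 8)) (1 / 8) (fun t x => wx t x ^ 2
          + L ^ 2 * x ^ 2 * w t x ^ 2 + g t x ^ 2)
        + 2 * rectInt T (-(1 / 8)) (1 / 8) fun t x => L ^ 2 * (rho1 L x * w t x ^ 2) := by
    rw [← rectInt_const_mul, ← rectInt_const_mul, ← rectInt_add cS (cE.const_mul _),
      ← rectInt_add (cS.add (cE.const_mul _)) (cD.const_mul _)]
    refine rectInt_mono hT (by norm_num) cF ((cS.add (cE.const_mul _)).add (cD.const_mul _))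
      fun t _ x hx => ?_
    have hx' : |x| ≤ 1 / 8 := abs_le.2 hx
    have h1 := rho1_le_one hL4 hx'
    have h0 := rho1_pos hL0 x
    have hr := sq_rho1'_le hL4 hx'
    have p1 : rho1 L x * wx t x ^ 2 ≤ wx t x ^ 2 := mul_le_of_le_one_left (sq_nonneg _) h1
    have p2 : rho1' L x * w t x * wx t x ≤ 1 / 2 * (L ^ 2 * (rho1 L x * w t x ^ 2))
        + 1 / 2 * wx t x ^ 2 := by
      have := mul_le_mul_of_nonneg_right hr (sq_nonneg (w t x))
      nlinarith [sq_nonneg (rho1' L x * w t x - wx t x)]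
    have hw : 0 ≤ rho1 L x * w t x ^ 2 := by positivity
    have p3 : L ^ 2 * (potV x * rho1 L x * w t x ^ 2) ≤ L ^ 2 * (rho1 L x * w t x ^ 2) := by
      rw [mul_assoc (potV x)]
      exact mul_le_mul_of_nonneg_left (mul_le_of_le_one_left hw (potV_le_one x)) (sq_nonneg L)
    have p4 : -(rho1 L x * w t x * g t x) ≤ 1 / 2 * (L ^ 2 * (rho1 L x * w t x ^ 2))
        + 1 / 2 * g t x ^ 2 := by
      have q1 : (rho1 L x * w t x) ^ 2 ≤ rho1 L x * w t x ^ 2 := by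
        calc (rho1 L x * w t x) ^ 2 = rho1 L x * (rho1 L x * w t x ^ 2) := by ring
          _ ≤ _ := mul_le_of_le_one_left hw h1
      have q2 : rho1 L x * w t x ^ 2 ≤ L ^ 2 * (rho1 L x * w t x ^ 2) :=
        le_mul_of_one_le_left hw (by nlinarith)
      nlinarith [sq_nonneg (rho1 L x * w t x + g t x)]
    have p5 : 0 ≤ L ^ 2 * x ^ 2 * w t x ^ 2 := by positivity
    have p6 := sq_nonneg (wx t x); have p7 := sq_nonneg (g t x)
    linarith
  have n0 := bdry_nonneg L w wt 0; have n1 := bdry_nonneg L w wt T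
  unfold cutConst
  have n2 : 0 ≤ rectInt T (-(1 / 8)) (1 / 8) (fun t x => wx t x ^ 2
          + L ^ 2 * x ^ 2 * w t x ^ 2 + g t x ^ 2) :=
    rectInt_nonneg hT (by norm_num) fun t x => by positivity
  linarith

end Mode

/-! ### Localization -/

/-- A bump function equal to one on `[-1/32, 1/32]`, supported in `[-1/16, 1/16]`. -/
def cutBump : ContDiffBump (0 : ℝ) := ⟨1 / 32, 1 / 16, by norm_num, by norm_num⟩

/-- The cut-off. -/
def cutF (x : ℝ) : ℝ := cutBump x

lemma contDiff_cutF : ContDiff ℝ ∞ cutF := cutBump.contDiff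

lemma cutF_nonneg (x : ℝ) : 0 ≤ cutF x := cutBump.nonneg

lemma cutF_le_one (x : ℝ) : cutF x ≤ 1 := cutBump.le_one

lemma cutF_eq_one {x : ℝ} (hx : |x| ≤ 1 / 32) : cutF x = 1 :=
  cutBump.one_of_mem_closedBall (by simpa [cutBump] using hx)

lemma cutF_eq_zero {x : ℝ} (hx : 1 / 16 ≤ |x|) : cutF x = 0 :=
  cutBump.zero_of_le_dist (by simpa [cutBump] using hx)

lemma hasDerivAt_cutF (x : ℝ) : HasDerivAt cutF (deriv cutF x) x :=
  (contDiff_cutF.differentiable (by simp) x).hasDerivAt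

lemma hasDerivAt_deriv_cutF (x : ℝ) : HasDerivAt (deriv cutF) (deriv (deriv cutF) x) x :=
  ((contDiff_infty_iff_deriv.1 contDiff_cutF).2.differentiable (by simp) x).hasDerivAt

lemma continuous_deriv_cutF : Continuous (deriv cutF) :=
  (contDiff_infty_iff_deriv.1 contDiff_cutF).2.continuous

lemma continuous_deriv_deriv_cutF : Continuous (deriv (deriv cutF)) :=
  (contDiff_infty_iff_deriv.1 (contDiff_infty_iff_deriv.1 contDiff_cutF).2).2.continuous

/-- A zero of the nonnegative cutoff is a minimum; this covers the edge |x| = 1/16 as well. -/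
lemma deriv_cutF_eq_zero {x : ℝ} (hx : 1 / 16 ≤ |x|) : deriv cutF x = 0 := by
  have hm : IsLocalMin cutF x := Eventually.of_forall fun y => by
    rw [cutF_eq_zero hx]; exact cutF_nonneg y
  exact hm.deriv_eq_zero

lemma exists_cutF_bound : ∃ K : ℝ, 1 ≤ K ∧ ∀ x, |x| ≤ 1 / 8 →
    deriv cutF x ^ 2 ≤ K ∧ deriv (deriv cutF) x ^ 2 ≤ K := by
  have h1 := continuous_deriv_cutF; have h2 := continuous_deriv_deriv_cutF
  obtain ⟨K, hK⟩ := (isCompact_Icc (a := (-(1 / 8) : ℝ)) (b := 1 / 8)).exists_bound_of_continuousOn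
    (f := fun x => deriv cutF x ^ 2 + deriv (deriv cutF) x ^ 2) (by fun_prop)
  refine ⟨max 1 K, le_max_left _ _, fun x hx => ?_⟩
  have h := (le_abs_self _).trans (hK x (abs_le.1 hx))
  have := sq_nonneg (deriv cutF x); have := sq_nonneg (deriv (deriv cutF) x)
  have := le_max_right 1 K
  constructor <;> linarith

/-- The refined estimate for a single frequency. -/
lemma exists_mode_bound : ∃ K : ℝ, 0 < K ∧ ∀ {L : ℝ} {w wt wx wxx g : ℝ → ℝ → ℝ},
    freqMin ≤ L → Mode L w wt wx wxx g → ∀ {T : ℝ}, 0 ≤ T →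
    rectInt T (-(1 / 32)) (1 / 32) (fun t x => √|x| * wt t x ^ 2)
      ≤ K * (Mode.bdry L w wt 0 + Mode.bdry L w wt T
        + rectInt T (-(1 / 8)) (1 / 8) fun t x => wx t x ^ 2 + w t x ^ 2
          + L ^ 2 * x ^ 2 * w t x ^ 2 + g t x ^ 2) := by
  obtain ⟨K, hK1, hK⟩ := exists_cutF_bound
  refine ⟨Mode.cutConst * (14 * K), mul_pos Mode.cutConst_pos (by linarith),
    fun {L w wt wx wxx g} hL h {T} hT => ?_⟩
  have hL0 : 0 < L := lt_of_lt_of_le (by unfold freqMin; norm_num) hL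
  have c0 := h.c0; have ct := h.ct; have cx := h.cx; have cxx := h.cxx; have cg := h.cg
  have q0 := Cont2.of_x contDiff_cutF.continuous
  have q1 := Cont2.of_x continuous_deriv_cutF
  have q2 := Cont2.of_x continuous_deriv_deriv_cutF
  -- The cut-off function solves the same equation. The commutator terms 2χ'w_x + χ''w join the
  -- source, and they involve only quantities that the Morawetz estimate controls without
  -- degeneracy.
  have hc : Mode L (fun t x => cutF x * w t x) (fun t x => cutF x * wt t x)
      (fun t x => deriv cutF x * w t x + cutF x * wx t x)
      (fun t x => deriv (deriv cutF) x * w t x + deriv cutF x * wx t x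
        + (deriv cutF x * wx t x + cutF x * wxx t x))
      (fun t x => cutF x * g t x - 2 * (deriv cutF x * wx t x) - deriv (deriv cutF) x * w t x) :=
    { dt0 := fun t x => (h.dt0 t x).const_mul _
      dt1 := fun t x => ((h.dt1 t x).const_mul _).congr_deriv (by ring)
      dx0 := fun t x => (hasDerivAt_cutF x).fun_mul (h.dx0 t x)
      dx1 := fun t x => ((hasDerivAt_deriv_cutF x).fun_mul (h.dx0 t x)).fun_add
        ((hasDerivAt_cutF x).fun_mul (h.dx1 t x))
      c0 := by unfold Cont2 at *; fun_prop
      ct := by unfold Cont2 at *; fun_prop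
      cx := by unfold Cont2 at *; fun_prop
      cxx := by unfold Cont2 at *; fun_prop
      cg := by unfold Cont2 at *; fun_prop }
  have main := hc.rectInt_rho_wt_le hL
    (fun t x hx => by simp only [cutF_eq_zero hx, zero_mul])
    (fun t x hx => by simp only [cutF_eq_zero hx, deriv_cutF_eq_zero hx, zero_mul, add_zero]) hT
  have cr := Cont2.of_x (continuous_rho1 L)
  have l1 : rectInt T (-(1 / 32)) (1 / 32) (fun t x => √|x| * wt t x ^ 2)
      ≤ rectInt T (-(1 / 8)) (1 / 8) (fun t x => rho1 L x * (cutF x * wt t x) ^ 2) := by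
    have cA : Cont2 fun t x => rho1 L x * (cutF x * wt t x) ^ 2 := by
      unfold Cont2 at *; fun_prop
    have cB : Cont2 fun t x => √|x| * wt t x ^ 2 := by
      unfold Cont2 at *; fun_prop
    refine (rectInt_mono hT (by norm_num) cB cA fun t _ x hx => ?_).trans
      (rectInt_mono_set hT le_rfl (by norm_num) (by norm_num) (by norm_num) cA fun t x =>
        mul_nonneg (rho1_pos hL0 x).le (sq_nonneg _))
    rw [cutF_eq_one (abs_le.2 hx), one_mul]
    exact mul_le_mul_of_nonneg_right (sqrt_abs_le_rho1 hL0 x) (sq_nonneg _)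
  have l2 : ∀ t, Mode.bdry L (fun t x => cutF x * w t x) (fun t x => cutF x * wt t x) t
      ≤ Mode.bdry L w wt t := by
    intro t
    have a0 := c0.slice_x t; have a1 := ct.slice_x t
    have a2 := contDiff_cutF.continuous
    refine jI_mono (by fun_prop) (by fun_prop) fun x _ => ?_
    have h1 : cutF x ^ 2 ≤ 1 := pow_le_one₀ (cutF_nonneg x) (cutF_le_one x)
    rw [mul_pow, mul_pow]
    have e1 := mul_le_of_le_one_left (sq_nonneg (wt t x)) h1
    have e2 := mul_le_mul_of_nonneg_left (mul_le_of_le_one_left (sq_nonneg (w t x)) h1)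
      (sq_nonneg L)
    linarith
  have l3 : rectInt T (-(1 / 8)) (1 / 8) (fun t x =>
        (deriv cutF x * w t x + cutF x * wx t x) ^ 2 + L ^ 2 * x ^ 2 * (cutF x * w t x) ^ 2
        + (cutF x * g t x - 2 * (deriv cutF x * wx t x) - deriv (deriv cutF) x * w t x) ^ 2)
      ≤ 14 * K * rectInt T (-(1 / 8)) (1 / 8) (fun t x => wx t x ^ 2 + w t x ^ 2
          + L ^ 2 * x ^ 2 * w t x ^ 2 + g t x ^ 2) := by
    have cA : Cont2 fun t x => wx t x ^ 2 + w t x ^ 2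
          + L ^ 2 * x ^ 2 * w t x ^ 2 + g t x ^ 2 := by unfold Cont2 at *; fun_prop
    rw [← rectInt_const_mul]
    refine rectInt_mono hT (by norm_num) (by unfold Cont2 at *; fun_prop) (cA.const_mul _)
      fun t _ x hx => ?_
    obtain ⟨b1, b2⟩ := hK x (abs_le.2 hx)
    have h1 : cutF x ^ 2 ≤ 1 := pow_le_one₀ (cutF_nonneg x) (cutF_le_one x)
    have e1 : (deriv cutF x * w t x + cutF x * wx t x) ^ 2
        ≤ 2 * (K * w t x ^ 2) + 2 * (K * wx t x ^ 2) := by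
      have := mul_le_mul_of_nonneg_right b1 (sq_nonneg (w t x))
      have := mul_le_mul_of_nonneg_right (h1.trans hK1) (sq_nonneg (wx t x))
      nlinarith [sq_nonneg (deriv cutF x * w t x - cutF x * wx t x)]
    have e2 : (cutF x * g t x - 2 * (deriv cutF x * wx t x) - deriv (deriv cutF) x * w t x) ^ 2
        ≤ 3 * (K * g t x ^ 2) + 12 * (K * wx t x ^ 2) + 3 * (K * w t x ^ 2) := by
      have := mul_le_mul_of_nonneg_right (h1.trans hK1) (sq_nonneg (g t x))
      have := mul_le_mul_of_nonneg_right b1 (sq_nonneg (wx t x))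
      have := mul_le_mul_of_nonneg_right b2 (sq_nonneg (w t x))
      nlinarith [sq_nonneg (cutF x * g t x + 2 * (deriv cutF x * wx t x)),
        sq_nonneg (cutF x * g t x + deriv (deriv cutF) x * w t x),
        sq_nonneg (2 * (deriv cutF x * wx t x) - deriv (deriv cutF) x * w t x)]
    have e3 : L ^ 2 * x ^ 2 * (cutF x * w t x) ^ 2 ≤ K * (L ^ 2 * x ^ 2 * w t x ^ 2) := by
      have := mul_le_mul_of_nonneg_right (h1.trans hK1)
        (by positivity : 0 ≤ L ^ 2 * x ^ 2 * w t x ^ 2)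
      linarith
    have e4 : 0 ≤ K * w t x ^ 2 := by positivity
    have e5 : 0 ≤ K * g t x ^ 2 := by positivity
    have e6 : 0 ≤ K * (L ^ 2 * x ^ 2 * w t x ^ 2) := by positivity
    linarith
  have n0 := Mode.bdry_nonneg L w wt 0; have n1 := Mode.bdry_nonneg L w wt T
  rw [mul_assoc]
  refine l1.trans (main.trans (mul_le_mul_of_nonneg_left ?_ Mode.cutConst_pos.le))
  have := l2 0; have := l2 T
  have := mul_le_mul_of_nonneg_right hK1 n0
  have := mul_le_mul_of_nonneg_right hK1 n1
  linarith

end TrappedWave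

namespace TrappedWave

open Set Filter Topology ComplexConjugate

/-! ### Expansion in spherical harmonics -/

/-- The coefficient along `Y` of a function on `ℝ × ℝ × S²`. -/
def cf (Y : S2 → ℂ) (A : ℝ → ℝ → S2 → ℂ) (t x : ℝ) : ℂ := coeff Y (A t x)

section Coefficients

variable {Y : S2 → ℂ} {A u : ℝ → ℝ → S2 → ℂ} {N : ℝ} {a : ℝ → S2 → ℝ}

lemma continuous_cf (hY : Continuous Y) (hA : ContFun A) :
    Continuous fun z : ℝ × ℝ => cf Y A z.1 z.2 := by
  refine continuous_integral_sphere (φ := fun p : ℝ × ℝ => fun θ => conj (Y θ) * A p.1 p.2 θ) ?_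
  exact ((Complex.continuous_conj.comp hY).comp continuous_snd).mul hA.assoc

lemma hasDerivAt_cf_t (hY : Continuous Y) (hA : SmoothFun A) (t x : ℝ) :
    HasDerivAt (fun s => cf Y A s x) (cf Y (dt A) t x) t :=
  hasDerivAt_integral_sphere (φ := fun s θ => conj (Y θ) * A s x θ)
    (φ' := fun s θ => conj (Y θ) * dt A s x θ)
    (fun s => by have := hA.contFun.slice s x; fun_prop)
    (by have := hA.dt.contFun.slice_t x; fun_prop)
    (fun s θ => (hA.hasDerivAt_dt s x θ).const_mul _) t

lemma hasDerivAt_cf_x (hY : Continuous Y) (hA : SmoothFun A) (t x : ℝ) :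
    HasDerivAt (fun s => cf Y A t s) (cf Y (dx A) t x) x :=
  hasDerivAt_integral_sphere (φ := fun s θ => conj (Y θ) * A t s θ)
    (φ' := fun s θ => conj (Y θ) * dx A t s θ)
    (fun s => by have := hA.contFun.slice t s; fun_prop)
    (by have := hA.dx.contFun.slice_x t; fun_prop)
    (fun s θ => (hA.hasDerivAt_dx t s θ).const_mul _) x

lemma IsSolution.cf_dt_dt (h : IsSolution N a u) {m : ℕ} {Y : Fin m → S2 → ℂ} {l : Fin m → ℝ}
    (hY : IsEigenFamily Y l) (k : Fin m) (t x : ℝ) :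
    cf (Y k) (dt (dt u)) t x = cf (Y k) (dx (dx u)) t x
      - ((l k + N) * potV x : ℝ) • cf (Y k) u t x + cf (Y k) (srcFun a u) t x := by
  have hu := h.smooth
  have hc := hY.cont k
  have a1 := hu.dx.dx.contFun.slice t x
  have a2 := h.contFun_lap.slice t x
  have a3 := hu.contFun.slice t x
  have a4 := (contFun_srcFun h.cont hu.contFun).slice t x
  have i1 : Integrable (fun θ => conj (Y k θ) * dx (dx u) t x θ) sphereMeasure :=
    integrable_sphere (by fun_prop)
  have i2 : Integrable (fun θ => (potV x : ℂ) * (conj (Y k θ) * lap u t x θ)) sphereMeasure :=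
    integrable_sphere (by fun_prop)
  have i3 : Integrable (fun θ => (potV x * N : ℂ) * (conj (Y k θ) * u t x θ)) sphereMeasure :=
    integrable_sphere (by fun_prop)
  have i4 : Integrable (fun θ => conj (Y k θ) * srcFun a u t x θ) sphereMeasure :=
    integrable_sphere (by fun_prop)
  have i12 : Integrable (fun θ => conj (Y k θ) * dx (dx u) t x θ
      + (potV x : ℂ) * (conj (Y k θ) * lap u t x θ)) sphereMeasure := i1.add i2
  have i123 : Integrable (fun θ => conj (Y k θ) * dx (dx u) t x θ
      + (potV x : ℂ) * (conj (Y k θ) * lap u t x θ)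
      - (potV x * N : ℂ) * (conj (Y k θ) * u t x θ)) sphereMeasure := i12.sub i3
  have e1 : cf (Y k) (lap u) t x = -(l k : ℂ) * cf (Y k) u t x :=
    hY.coeff_laplacian (hu.smoothSph t x) k
  have e2 : cf (Y k) (dt (dt u)) t x = cf (Y k) (dx (dx u)) t x
      + (potV x : ℂ) * cf (Y k) (lap u) t x - (potV x * N : ℂ) * cf (Y k) u t x
      + cf (Y k) (srcFun a u) t x := by
    simp only [cf, coeff]
    rw [← integral_const_mul, ← integral_const_mul, ← integral_add i1 i2,
      ← integral_sub i12 i3, ← integral_add i123 i4]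
    refine integral_congr_ae (Eventually.of_forall fun θ => ?_)
    simp only [h.eq]
    ring
  rw [e2, e1, Complex.real_smul]
  push_cast
  ring

/-- P will be the real or the imaginary part. The factor i in the source mixes them, and so do the
other harmonics through W, but this coupling sits entirely in g, which is only estimated in mean
square. -/
lemma IsSolution.mode (h : IsSolution N a u) {m : ℕ} {Y : Fin m → S2 → ℂ} {l : Fin m → ℝ}
    (hY : IsEigenFamily Y l) (k : Fin m) {L : ℝ} (hL : L ^ 2 = l k + N) (P : ℂ →L[ℝ] ℝ) :
    Mode L (fun t x => P (cf (Y k) u t x)) (fun t x => P (cf (Y k) (dt u) t x))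
      (fun t x => P (cf (Y k) (dx u) t x)) (fun t x => P (cf (Y k) (dx (dx u)) t x))
      (fun t x => P (cf (Y k) (srcFun a u) t x)) := by
  have hu := h.smooth
  have hc := hY.cont k
  exact
  { dt0 := fun t x => P.hasFDerivAt.comp_hasDerivAt t (hasDerivAt_cf_t hc hu t x)
    dt1 := fun t x => (P.hasFDerivAt.comp_hasDerivAt t (hasDerivAt_cf_t hc hu.dt t x)).congr_deriv (by
      rw [h.cf_dt_dt hY, map_add, map_sub, map_smul, smul_eq_mul, hL])
    dx0 := fun t x => P.hasFDerivAt.comp_hasDerivAt x (hasDerivAt_cf_x hc hu t x)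
    dx1 := fun t x => P.hasFDerivAt.comp_hasDerivAt x (hasDerivAt_cf_x hc hu.dx t x)
    c0 := P.continuous.comp (continuous_cf hc hu.contFun)
    ct := P.continuous.comp (continuous_cf hc hu.dt.contFun)
    cx := P.continuous.comp (continuous_cf hc hu.dx.contFun)
    cxx := P.continuous.comp (continuous_cf hc hu.dx.dx.contFun)
    cg := P.continuous.comp (continuous_cf hc (contFun_srcFun h.cont hu.contFun)) }

end Coefficients

lemma norm_sq_eq_re_add_im (z : ℂ) :
    ‖z‖ ^ 2 = Complex.reCLM z ^ 2 + Complex.imCLM z ^ 2 := by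
  rw [Complex.sq_norm, Complex.normSq_apply]
  simp [sq]

lemma rectInt_sum {m : ℕ} {S : Fin m → ℝ → ℝ → ℝ} (h : ∀ k, Cont2 (S k)) (T a b : ℝ) :
    rectInt T a b (fun t x => ∑ k, S k t x) = ∑ k, rectInt T a b (S k) := by
  unfold rectInt
  rw [← intervalIntegral.integral_finsetSum fun k _ => (h k).intervalIntegrable_integral a b 0 T]
  congr 1
  funext t
  exact intervalIntegral.integral_finsetSum fun k _ => (h k).intervalIntegrable_x t a b

lemma jI_sum {m : ℕ} {f : Fin m → ℝ → ℝ} (h : ∀ k, Continuous (f k)) :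
    jI (fun x => ∑ k, f k x) = ∑ k, jI (f k) :=
  intervalIntegral.integral_finsetSum fun k _ => (h k).intervalIntegrable _ _

/-- The constant of the refined estimate for a single frequency. -/
def modeConst : ℝ := exists_mode_bound.choose

lemma modeConst_pos : 0 < modeConst := exists_mode_bound.choose_spec.1

section Sum

variable {N : ℝ} {a : ℝ → S2 → ℝ} {u : ℝ → ℝ → S2 → ℂ}

/-- The boundary terms for a complex mode. -/
def cbdry (L : ℝ) (Y : S2 → ℂ) (u : ℝ → ℝ → S2 → ℂ) (t : ℝ) : ℝ :=
  jI fun x => ‖cf Y (dt u) t x‖ ^ 2 + L ^ 2 * ‖cf Y u t x‖ ^ 2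

lemma IsSolution.rectInt_cf_le (h : IsSolution N a u) {m : ℕ} {Y : Fin m → S2 → ℂ} {l : Fin m → ℝ}
    (hY : IsEigenFamily Y l) (k : Fin m) {L : ℝ} (hL : L ^ 2 = l k + N) (hL' : freqMin ≤ L)
    {T : ℝ} (hT : 0 ≤ T) :
    rectInt T (-(1 / 32)) (1 / 32) (fun t x => √|x| * ‖cf (Y k) (dt u) t x‖ ^ 2)
      ≤ modeConst * (cbdry L (Y k) u 0 + cbdry L (Y k) u T
        + rectInt T (-(1 / 8)) (1 / 8) fun t x => ‖cf (Y k) (dx u) t x‖ ^ 2 + ‖cf (Y k) u t x‖ ^ 2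
          + L ^ 2 * x ^ 2 * ‖cf (Y k) u t x‖ ^ 2 + ‖cf (Y k) (srcFun a u) t x‖ ^ 2) := by
  have m1 := h.mode hY k hL Complex.reCLM
  have m2 := h.mode hY k hL Complex.imCLM
  have b1 := exists_mode_bound.choose_spec.2 hL' m1 hT
  have b2 := exists_mode_bound.choose_spec.2 hL' m2 hT
  have c1 := m1.c0; have c2 := m1.ct; have c3 := m1.cx; have c4 := m1.cg
  have d1 := m2.c0; have d2 := m2.ct; have d3 := m2.cx; have d4 := m2.cg
  have hb : ∀ t, cbdry L (Y k) u t = Mode.bdry L (fun t x => Complex.reCLM (cf (Y k) u t x))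
      (fun t x => Complex.reCLM (cf (Y k) (dt u) t x)) t
      + Mode.bdry L (fun t x => Complex.imCLM (cf (Y k) u t x))
      (fun t x => Complex.imCLM (cf (Y k) (dt u) t x)) t := by
    intro t
    have a1 := c1.slice_x t; have a2 := c2.slice_x t
    have a3 := d1.slice_x t; have a4 := d2.slice_x t
    unfold cbdry Mode.bdry
    rw [← jI_add (by fun_prop) (by fun_prop)]
    refine jI_congr fun x _ => ?_
    rw [norm_sq_eq_re_add_im, norm_sq_eq_re_add_im]; ring
  have l1 := rectInt_add (T := T) (a := -(1 / 32)) (b := 1 / 32)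
    (S₁ := fun t x => √|x| * Complex.reCLM (cf (Y k) (dt u) t x) ^ 2)
    (S₂ := fun t x => √|x| * Complex.imCLM (cf (Y k) (dt u) t x) ^ 2)
    (by unfold Cont2 at *; fun_prop) (by unfold Cont2 at *; fun_prop)
  have l2 := rectInt_add (T := T) (a := -(1 / 8)) (b := 1 / 8)
    (S₁ := fun t x => Complex.reCLM (cf (Y k) (dx u) t x) ^ 2 + Complex.reCLM (cf (Y k) u t x) ^ 2
      + L ^ 2 * x ^ 2 * Complex.reCLM (cf (Y k) u t x) ^ 2
      + Complex.reCLM (cf (Y k) (srcFun a u) t x) ^ 2)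
    (S₂ := fun t x => Complex.imCLM (cf (Y k) (dx u) t x) ^ 2 + Complex.imCLM (cf (Y k) u t x) ^ 2
      + L ^ 2 * x ^ 2 * Complex.imCLM (cf (Y k) u t x) ^ 2
      + Complex.imCLM (cf (Y k) (srcFun a u) t x) ^ 2)
    (by unfold Cont2 at *; fun_prop) (by unfold Cont2 at *; fun_prop)
  have e1 : (fun t x => √|x| * ‖cf (Y k) (dt u) t x‖ ^ 2)
      = fun t x => √|x| * Complex.reCLM (cf (Y k) (dt u) t x) ^ 2
        + √|x| * Complex.imCLM (cf (Y k) (dt u) t x) ^ 2 := by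
    funext t x; rw [norm_sq_eq_re_add_im]; ring
  have e2 : (fun t x => ‖cf (Y k) (dx u) t x‖ ^ 2 + ‖cf (Y k) u t x‖ ^ 2
          + L ^ 2 * x ^ 2 * ‖cf (Y k) u t x‖ ^ 2 + ‖cf (Y k) (srcFun a u) t x‖ ^ 2)
      = fun t x => (Complex.reCLM (cf (Y k) (dx u) t x) ^ 2 + Complex.reCLM (cf (Y k) u t x) ^ 2
      + L ^ 2 * x ^ 2 * Complex.reCLM (cf (Y k) u t x) ^ 2
      + Complex.reCLM (cf (Y k) (srcFun a u) t x) ^ 2)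
      + (Complex.imCLM (cf (Y k) (dx u) t x) ^ 2 + Complex.imCLM (cf (Y k) u t x) ^ 2
      + L ^ 2 * x ^ 2 * Complex.imCLM (cf (Y k) u t x) ^ 2
      + Complex.imCLM (cf (Y k) (srcFun a u) t x) ^ 2) := by
    funext t x; simp only [norm_sq_eq_re_add_im]; ring
  rw [e1, e2, l1, l2, hb, hb]
  unfold modeConst
  linarith

/-- The refined estimate for the projection to finitely many harmonics. -/
lemma IsSolution.rectInt_sum_cf_le (h : IsSolution N a u) (hN : freqMin ^ 2 ≤ N)
    (ha : ∀ x θ, |a x θ| ≤ 1) {m : ℕ} {Y : Fin m → S2 → ℂ} {l : Fin m → ℝ}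
    (hY : IsEigenFamily Y l) {T : ℝ} (hT : 0 ≤ T) :
    rectInt T (-(1 / 32)) (1 / 32) (fun t x => √|x| * ∑ k, ‖cf (Y k) (dt u) t x‖ ^ 2)
      ≤ modeConst * ((jI fun x => ip (dt u) (dt u) 0 x + (gradInt u 0 x + N * ip u u 0 x))
        + (jI fun x => ip (dt u) (dt u) T x + (gradInt u T x + N * ip u u T x))
        + rectInt T (-(1 / 8)) (1 / 8) fun t x => ip (dx u) (dx u) t x + 2 * ip u u t x
          + x ^ 2 * (gradInt u t x + N * ip u u t x)) := by
  have hu := h.smooth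
  have hs := contFun_srcFun h.cont hu.contFun
  have hf0 : 0 ≤ freqMin := by unfold freqMin; norm_num
  have hLk : ∀ k, (√(l k + N)) ^ 2 = l k + N := fun k =>
    Real.sq_sqrt (by have := hY.eigenvalue_nonneg k; nlinarith [sq_nonneg freqMin])
  -- Eigenvalues are nonnegative, so a large N puts every harmonic above the threshold, including
  -- the constants; no separate low-frequency argument is needed.
  have hLk' : ∀ k, freqMin ≤ √(l k + N) := fun k =>
    Real.le_sqrt_of_sq_le (by have := hY.eigenvalue_nonneg k; linarith)
  have b := Finset.sum_le_sum fun k (_ : k ∈ Finset.univ) =>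
    h.rectInt_cf_le hY k (hLk k) (hLk' k) hT
  have n0 : ∀ k, Continuous fun z : ℝ × ℝ => cf (Y k) u z.1 z.2 := fun k =>
    continuous_cf (hY.cont k) hu.contFun
  have nt : ∀ k, Continuous fun z : ℝ × ℝ => cf (Y k) (dt u) z.1 z.2 := fun k =>
    continuous_cf (hY.cont k) hu.dt.contFun
  have nx : ∀ k, Continuous fun z : ℝ × ℝ => cf (Y k) (dx u) z.1 z.2 := fun k =>
    continuous_cf (hY.cont k) hu.dx.contFun
  have ns : ∀ k, Continuous fun z : ℝ × ℝ => cf (Y k) (srcFun a u) z.1 z.2 := fun k =>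
    continuous_cf (hY.cont k) hs
  have cα := continuous_ip hu.contFun hu.contFun
  have cβ := continuous_ip hu.dt.contFun hu.dt.contFun
  have cγ := continuous_ip hu.dx.contFun hu.dx.contFun
  have cδ := continuous_gradInt hu
  have B0 : ∀ t x, ∑ k, ‖cf (Y k) u t x‖ ^ 2 ≤ ip u u t x := fun t x => by
    rw [ip_self]; exact hY.sum_sq_coeff_le (hu.contFun.slice t x)
  have Bt : ∀ t x, ∑ k, ‖cf (Y k) (dt u) t x‖ ^ 2 ≤ ip (dt u) (dt u) t x := fun t x => by
    rw [ip_self]; exact hY.sum_sq_coeff_le (hu.dt.contFun.slice t x)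
  have Bx : ∀ t x, ∑ k, ‖cf (Y k) (dx u) t x‖ ^ 2 ≤ ip (dx u) (dx u) t x := fun t x => by
    rw [ip_self]; exact hY.sum_sq_coeff_le (hu.dx.contFun.slice t x)
  have Bs : ∀ t x, ∑ k, ‖cf (Y k) (srcFun a u) t x‖ ^ 2 ≤ ip u u t x := fun t x => by
    refine (hY.sum_sq_coeff_le (hs.slice t x)).trans ?_
    rw [ip_self]
    have c1 := hs.slice t x
    have c2 := hu.contFun.slice t x
    refine integral_mono (integrable_sphere (by fun_prop)) (integrable_sphere (by fun_prop))
      fun θ => ?_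
    simp only [srcFun, norm_mul, Complex.norm_I, one_mul, Complex.norm_real, Real.norm_eq_abs]
    exact pow_le_pow_left₀ (by positivity) (mul_le_of_le_one_left (norm_nonneg _) (ha x θ)) 2
  have BL : ∀ t x, ∑ k, √(l k + N) ^ 2 * ‖cf (Y k) u t x‖ ^ 2 ≤ gradInt u t x + N * ip u u t x := by
    intro t x
    simp only [hLk, add_mul, Finset.sum_add_distrib, ← Finset.mul_sum]
    have hN0 : 0 ≤ N := (sq_nonneg _).trans hN
    exact add_le_add (hY.sum_eigenvalue_mul_sq_coeff_le (hu.smoothSph t x))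
      (mul_le_mul_of_nonneg_left (B0 t x) hN0)
  have e1 : rectInt T (-(1 / 32)) (1 / 32) (fun t x => √|x| * ∑ k, ‖cf (Y k) (dt u) t x‖ ^ 2)
      = ∑ k, rectInt T (-(1 / 32)) (1 / 32) fun t x => √|x| * ‖cf (Y k) (dt u) t x‖ ^ 2 := by
    simp only [Finset.mul_sum]
    exact rectInt_sum (fun k => by have := nt k; unfold Cont2; fun_prop) _ _ _
  rw [e1]
  refine b.trans ?_
  rw [← Finset.mul_sum]
  refine mul_le_mul_of_nonneg_left ?_ modeConst_pos.le
  rw [Finset.sum_add_distrib, Finset.sum_add_distrib]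
  have hbd : ∀ t, ∑ k, cbdry (√(l k + N)) (Y k) u t
      ≤ jI fun x => ip (dt u) (dt u) t x + (gradInt u t x + N * ip u u t x) := by
    intro t
    have s0 : ∀ k, Continuous fun x => cf (Y k) u t x := fun k => (n0 k).comp (by fun_prop : Continuous fun x : ℝ => (t, x))
    have st : ∀ k, Continuous fun x => cf (Y k) (dt u) t x := fun k => (nt k).comp (by fun_prop : Continuous fun x : ℝ => (t, x))
    have sα := Cont2.slice_x (S := ip u u) cα t
    have sβ := Cont2.slice_x (S := ip (dt u) (dt u)) cβ t
    have sδ := Cont2.slice_x (S := gradInt u) cδ t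
    unfold cbdry
    rw [← jI_sum fun k => by have := s0 k; have := st k; fun_prop]
    refine jI_mono (continuous_finsetSum _ fun k _ => by have := s0 k; have := st k; fun_prop)
      (by fun_prop) fun x _ => ?_
    rw [Finset.sum_add_distrib]
    exact add_le_add (Bt t x) (BL t x)
  refine add_le_add (add_le_add (hbd 0) (hbd T)) ?_
  rw [← rectInt_sum fun k => by
    have := n0 k; have := nx k; have := ns k; unfold Cont2; fun_prop]
  refine rectInt_mono hT (by norm_num) (continuous_finsetSum _ fun k _ => by
    have := n0 k; have := nx k; have := ns k; fun_prop)
    (by unfold Cont2; fun_prop) fun t _ x _ => ?_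
  simp only [Finset.sum_add_distrib]
  have e2 : ∑ k, √(l k + N) ^ 2 * x ^ 2 * ‖cf (Y k) u t x‖ ^ 2
      = x ^ 2 * ∑ k, √(l k + N) ^ 2 * ‖cf (Y k) u t x‖ ^ 2 := by
    rw [Finset.mul_sum]; exact Finset.sum_congr rfl fun k _ => by ring
  rw [e2]
  have := mul_le_mul_of_nonneg_left (BL t x) (sq_nonneg x)
  have := B0 t x; have := Bx t x; have := Bs t x
  linarith

lemma tendsto_rectInt {S : ℕ → ℝ → ℝ → ℝ} {S' : ℝ → ℝ → ℝ} (h : ∀ n, Cont2 (S n)) (h' : Cont2 S')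
    (h0 : ∀ n t x, 0 ≤ S n t x) (hle : ∀ n t x, S n t x ≤ S' t x)
    (ht : ∀ t x, Tendsto (fun n => S n t x) atTop (𝓝 (S' t x))) {T a b : ℝ} (hab : a ≤ b) :
    Tendsto (fun n => rectInt T a b (S n)) atTop (𝓝 (rectInt T a b S')) := by
  refine intervalIntegral.tendsto_integral_filter_of_dominated_convergence
    (fun t => ∫ x in a..b, S' t x)
    (Eventually.of_forall fun n => ((h n).continuous_integral a b).aestronglyMeasurable)
    (Eventually.of_forall fun n => Eventually.of_forall fun t _ => ?_)
    (h'.intervalIntegrable_integral a b 0 T) (Eventually.of_forall fun t _ => ?_)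
  · rw [Real.norm_of_nonneg (intervalIntegral.integral_nonneg hab fun x _ => h0 n t x)]
    exact intervalIntegral.integral_mono_on hab ((h n).intervalIntegrable_x t a b)
      (h'.intervalIntegrable_x t a b) fun x _ => hle n t x
  · refine intervalIntegral.tendsto_integral_filter_of_dominated_convergence (S' t)
      (Eventually.of_forall fun n => ((h n).slice_x t).aestronglyMeasurable)
      (Eventually.of_forall fun n => Eventually.of_forall fun x _ => ?_)
      (h'.intervalIntegrable_x t a b) (Eventually.of_forall fun x _ => ht t x)
    rw [Real.norm_of_nonneg (h0 n t x)]
    exact hle n t x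

/-- The refined estimate near the trapped set. -/
theorem IsSolution.rectInt_sqrt_abs_le (h : IsSolution N a u) (hN : freqMin ^ 2 ≤ N)
    (ha : ∀ x θ, |a x θ| ≤ 1) {T : ℝ} (hT : 0 ≤ T) :
    rectInt T (-(1 / 32)) (1 / 32) (fun t x => √|x| * ip (dt u) (dt u) t x)
      ≤ modeConst * ((jI fun x => ip (dt u) (dt u) 0 x + (gradInt u 0 x + N * ip u u 0 x))
        + (jI fun x => ip (dt u) (dt u) T x + (gradInt u T x + N * ip u u T x))
        + rectInt T (-(1 / 8)) (1 / 8) fun t x => ip (dx u) (dx u) t x + 2 * ip u u t x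
          + x ^ 2 * (gradInt u t x + N * ip u u t x)) := by
  have hu := h.smooth
  -- The right-hand side does not depend on the projection, by Bessel's inequalities; completeness
  -- is used only to pass to the limit on the left, by dominated convergence.
  refine le_of_tendsto' (tendsto_rectInt
    (S := fun n t x => √|x| * ∑ k, ‖cf (harm n k) (dt u) t x‖ ^ 2)
    (fun n => ?_) ?_ (fun n t x => by positivity) (fun n t x => ?_) (fun t x => ?_) (by norm_num))
    fun n => h.rectInt_sum_cf_le hN ha (isEigenFamily_harm n) hT
  · have := fun k => continuous_cf ((isEigenFamily_harm n).cont k) hu.dt.contFun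
    unfold Cont2
    refine Continuous.mul (by fun_prop) (continuous_finsetSum _ fun k _ => ?_)
    have := this k
    fun_prop
  · have cβ := continuous_ip hu.dt.contFun hu.dt.contFun
    unfold Cont2; fun_prop
  · rw [ip_self]
    exact mul_le_mul_of_nonneg_left
      ((isEigenFamily_harm n).sum_sq_coeff_le (hu.dt.contFun.slice t x)) (Real.sqrt_nonneg _)
  · rw [ip_self]
    exact (tendsto_sum_sq_coeff_harm (hu.dt.contFun.slice t x)).const_mul _

end Sum

end TrappedWave

namespace TrappedWave

open Set Filter Topology

/-! ### Closing the estimates -/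

lemma rectInt_adjacent {S : ℝ → ℝ → ℝ} (hS : Cont2 S) (T a b c : ℝ) :
    rectInt T a b S + rectInt T b c S = rectInt T a c S := by
  unfold rectInt
  rw [← intervalIntegral.integral_add (hS.intervalIntegrable_integral a b 0 T)
    (hS.intervalIntegrable_integral b c 0 T)]
  congr 1
  funext t
  exact intervalIntegral.integral_add_adjacent_intervals (hS.intervalIntegrable_x t a b)
    (hS.intervalIntegrable_x t b c)

/-- Integrability of |x|^(-1/2), with a regularization that keeps the integrand continuous; the
bound is uniform in η, so η can later tend to 0. -/
lemma integral_inv_sqrt_add_le {η : ℝ} (h0 : 0 < η) (h1 : η ≤ 1) :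
    ∫ x in (-(1 / 32) : ℝ)..(1 / 32), 1 / √(|x| + η) ≤ 8 := by
  have c : Continuous fun x : ℝ => 1 / √(|x| + η) :=
    continuous_const.div (by fun_prop) fun x => (Real.sqrt_pos.2 (by positivity)).ne'
  have e1 : ∫ x in (0 : ℝ)..(1 / 32), 1 / √(|x| + η) = 2 * √(1 / 32 + η) - 2 * √(0 + η) := by
    have e : ∫ x in (0 : ℝ)..(1 / 32), 1 / √(|x| + η) = ∫ x in (0 : ℝ)..(1 / 32), 1 / √(x + η) :=
      intervalIntegral.integral_congr fun x hx => by
        rw [uIcc_of_le (by norm_num)] at hx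
        simp only [abs_of_nonneg hx.1]
    rw [e]
    have hx0 : ∀ x ∈ uIcc (0 : ℝ) (1 / 32), 0 < x + η := fun x hx => by
      rw [uIcc_of_le (by norm_num)] at hx
      linarith [hx.1]
    refine intervalIntegral.integral_eq_sub_of_hasDerivAt (f := fun x => 2 * √(x + η))
      (fun x hx => ?_) (ContinuousOn.intervalIntegrable ?_)
    · refine ((((hasDerivAt_id x).add_const η).sqrt (hx0 x hx).ne').const_mul 2).congr_deriv ?_
      have := (Real.sqrt_pos.2 (hx0 x hx)).ne'
      simp only [id]
      field_simp
    · exact continuousOn_const.div (by fun_prop) fun x hx => (Real.sqrt_pos.2 (hx0 x hx)).ne'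
  have e2 : ∫ x in (-(1 / 32) : ℝ)..0, 1 / √(|x| + η) = ∫ x in (0 : ℝ)..(1 / 32), 1 / √(|x| + η) := by
    have := intervalIntegral.integral_comp_neg (a := 0) (b := 1 / 32)
      (fun x : ℝ => 1 / √(|x| + η))
    simp only [abs_neg, neg_zero] at this
    rw [← this]
  rw [← intervalIntegral.integral_add_adjacent_intervals (c.intervalIntegrable _ 0)
    (c.intervalIntegrable 0 _), e2, e1]
  have h2 : √(1 / 32 + η) ≤ 2 := Real.sqrt_le_iff.2 ⟨by norm_num, by linarith⟩
  have h3 := Real.sqrt_nonneg (0 + η)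
  linarith

lemma sqrt_add_le_add_sqrt {a b : ℝ} (ha : 0 ≤ a) (hb : 0 ≤ b) : √(a + b) ≤ √a + √b := by
  have := Real.sqrt_nonneg a; have := Real.sqrt_nonneg b
  refine Real.sqrt_le_iff.2 ⟨by positivity, ?_⟩
  nlinarith [Real.sq_sqrt ha, Real.sq_sqrt hb, mul_nonneg (Real.sqrt_nonneg a) (Real.sqrt_nonneg b)]

lemma half_le_wgt {x : ℝ} (hx : |x| ≤ 1 / 8) : 1 / 2 ≤ wgt x := by
  unfold wgt
  have h := pow_le_pow_left₀ (abs_nonneg x) hx 3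
  exact one_div_le_one_div_of_le (one_add_abs_cube_pos x) (by linarith)

lemma half_le_potV {x : ℝ} (hx : |x| ≤ 1 / 8) : 1 / 2 ≤ potV x := by
  unfold potV
  have h := pow_le_pow_left₀ (abs_nonneg x) hx 2
  rw [sq_abs] at h
  exact one_div_le_one_div_of_le (by positivity) (by linarith)

/-- Away from the trapped set the Morawetz weight of β is nondegenerate. The constant is 4·32². -/
lemma wgt_le_of_le_abs {x : ℝ} (hx : 1 / 32 ≤ |x|) : wgt x ≤ 4096 * (x ^ 2 * potV x ^ 2) := by
  have e : 4096 * (x ^ 2 * potV x ^ 2) = 4096 * |x| ^ 2 / (|x| ^ 2 + 1) ^ 2 := by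
    unfold potV; rw [sq_abs]; field_simp
  rw [e, wgt, div_le_div_iff₀ (one_add_abs_cube_pos x) (by positivity)]
  set y := |x|
  have h2 : (1 / 32) ^ 2 ≤ y ^ 2 := pow_le_pow_left₀ (by norm_num) hx 2
  rcases le_total y 1 with h | h
  · have h4 : y ^ 2 ≤ 1 := pow_le_one₀ (by linarith) h
    have h5 : (y ^ 2 + 1) ^ 2 ≤ 4 := by nlinarith
    have h6 : 0 ≤ y ^ 2 * y ^ 3 := by positivity
    nlinarith
  · have h3 : y ^ 4 ≤ y ^ 5 := pow_le_pow_right₀ h (by norm_num)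
    have h4 : y ^ 2 ≤ y ^ 4 := pow_le_pow_right₀ h (by norm_num)
    have h5 : 1 ≤ y ^ 4 := one_le_pow₀ h
    nlinarith [sq_nonneg y]

namespace FluxSystem

variable {N κ R₀ : ℝ} (Φ : FluxSystem N κ R₀)

/-- The estimate for the time derivative near the trapped set. -/
def TrapBound (K₀ : ℝ) : Prop := ∀ T : ℝ, 0 ≤ T →
  rectInt T (-(1 / 32)) (1 / 32) (fun t x => √|x| * Φ.β t x)
    ≤ K₀ * ((jI fun x => Φ.β 0 x + Φ.D 0 x) + (jI fun x => Φ.β T x + Φ.D T x)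
      + rectInt T (-(1 / 8)) (1 / 8) fun t x => Φ.γ t x + 2 * Φ.α t x + x ^ 2 * Φ.D t x)

lemma jI_le_energy (hN : 0 ≤ N) (t : ℝ) :
    (jI fun x => Φ.β t x + Φ.D t x) ≤ 4 * ∫ x in (-(1 / 8) : ℝ)..(1 / 8), Φ.e t x := by
  have cβ := Cont2.slice_x (S := Φ.β) Φ.cβ t
  have cD := Φ.cD.slice_x t
  have ce := Φ.ce.slice_x t
  have h : (jI fun x => Φ.β t x + Φ.D t x) ≤ jI fun x => 4 * Φ.e t x := by
    refine jI_mono (by fun_prop) (by fun_prop) fun x hx => ?_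
    have h1 := Φ.two_mul_e t x
    have h2 := mul_le_mul_of_nonneg_right (half_le_potV hx) (Φ.D_nonneg hN t x)
    linarith [Φ.β_nonneg t x, Φ.γ_nonneg t x]
  rwa [jI_const_mul] at h

lemma le_four_mul_m (hN : 0 ≤ N) {x : ℝ} (hx : |x| ≤ 1 / 8) (t : ℝ) :
    Φ.γ t x + 2 * Φ.α t x + x ^ 2 * Φ.D t x ≤ 4 * Φ.m t x := by
  have h1 := mul_le_mul_of_nonneg_right (half_le_potV hx) (Φ.γ_nonneg t x)
  have h2 := mul_le_mul_of_nonneg_right (half_le_wgt hx) (Φ.α_nonneg t x)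
  have h3 : 1 / 4 ≤ potV x * wgt x := by
    have := half_le_potV hx; have := half_le_wgt hx
    nlinarith
  have h4 := mul_le_mul_of_nonneg_right h3 (mul_nonneg (sq_nonneg x) (Φ.D_nonneg hN t x))
  have h5 : 0 ≤ x ^ 2 * potV x ^ 2 * Φ.β t x := by have := Φ.β_nonneg t x; positivity
  have := Φ.γ_nonneg t x
  have e : x ^ 2 * potV x * wgt x * Φ.D t x = potV x * wgt x * (x ^ 2 * Φ.D t x) := by ring
  unfold m m0
  rw [e]
  linarith

/-- A one-dimensional Sobolev inequality: ∂ₓα = 2r is at most α + γ in modulus, and α at a point is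
compared with its mean over an interval of length 1/4. -/
lemma alpha_le (t : ℝ) {x : ℝ} (hx : |x| ≤ 1 / 8) :
    Φ.α t x ≤ 5 * jI fun y => Φ.α t y + Φ.γ t y := by
  have cα := Cont2.slice_x (S := Φ.α) Φ.cα t
  have cγ := Cont2.slice_x (S := Φ.γ) Φ.cγ t
  have cr := Cont2.slice_x (S := Φ.r) Φ.cr t
  set A := jI fun y => Φ.α t y + Φ.γ t y with hA
  have h1 : ∀ y, |y| ≤ 1 / 8 → Φ.α t x ≤ Φ.α t y + A := by
    intro y hy
    have ftc := intervalIntegral.integral_eq_sub_of_hasDerivAt (a := y) (b := x)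
      (fun z _ => Φ.α_x t z) ((continuous_const.mul cr).intervalIntegrable _ _)
    have h2 : |∫ z in y..x, 2 * Φ.r t z| ≤ A := by
      rw [← Real.norm_eq_abs]
      refine intervalIntegral.norm_integral_le_abs_integral_norm.trans ?_
      simp only [Real.norm_eq_abs]
      have c1 : Continuous fun z => |2 * Φ.r t z| := by fun_prop
      have key : ∀ a b : ℝ, -(1 / 8) ≤ a → a ≤ b → b ≤ 1 / 8 → ∫ z in a..b, |2 * Φ.r t z| ≤ A := by
        intro a b ha hab hb
        refine (integral_mono_interval ha hab hb c1 fun z => abs_nonneg _).trans ?_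
        refine jI_mono c1 (by fun_prop) fun z _ => ?_
        rw [abs_mul, abs_two]
        exact Φ.r_le t z
      rw [abs_le] at hx hy
      rcases le_total y x with h | h
      · rw [abs_of_nonneg (intervalIntegral.integral_nonneg h fun z _ => abs_nonneg _)]
        exact key y x hy.1 h hx.2
      · rw [intervalIntegral.integral_symm, abs_neg,
          abs_of_nonneg (intervalIntegral.integral_nonneg h fun z _ => abs_nonneg _)]
        exact key x y hx.1 h hy.2
    linarith [(abs_le.1 h2).2]
  have h2 : (jI fun _ => Φ.α t x) ≤ jI fun y => Φ.α t y + A :=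
    jI_mono continuous_const (by fun_prop) h1
  have h3 : (jI fun _ => Φ.α t x) = 1 / 4 * Φ.α t x := by
    unfold jI; rw [intervalIntegral.integral_const, smul_eq_mul]; norm_num
  have h4 : (jI fun y => Φ.α t y + A) = (jI fun y => Φ.α t y) + 1 / 4 * A := by
    rw [jI_add cα continuous_const]
    congr 1
    unfold jI; rw [intervalIntegral.integral_const, smul_eq_mul]; norm_num
  have h5 : (jI fun y => Φ.α t y) ≤ A :=
    jI_mono cα (by fun_prop) fun y _ => by linarith [Φ.γ_nonneg t y]
  rw [h3, h4] at h2
  linarith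

/-- The product of the `L²` norms of the function and of its time derivative. -/
def w (t x : ℝ) : ℝ := √(Φ.α t x) * √(Φ.β t x)

lemma w_nonneg (t x : ℝ) : 0 ≤ Φ.w t x := by unfold w; positivity

lemma cw : Cont2 Φ.w := by
  have := Φ.cα; have := Φ.cβ
  unfold Cont2 w; fun_prop

lemma two_mul_w_le {s : ℝ} (hs : 0 < s) (t x : ℝ) :
    2 * Φ.w t x ≤ 1 / s * Φ.α t x + s * Φ.β t x := by
  have h1 := Real.sq_sqrt (Φ.α_nonneg t x)
  have h2 := Real.sq_sqrt (Φ.β_nonneg t x)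
  have h3 : 0 ≤ 1 / s * (√(Φ.α t x) - s * √(Φ.β t x)) ^ 2 := by positivity
  have h4 : 1 / s * (√(Φ.α t x) - s * √(Φ.β t x)) ^ 2
      = 1 / s * √(Φ.α t x) ^ 2 - 2 * (√(Φ.α t x) * √(Φ.β t x)) + s * √(Φ.β t x) ^ 2 := by
    field_simp; ring
  rw [h4, h1, h2] at h3
  unfold w
  linarith

/-- The product near the trapped set. -/
lemma rectInt_w_near_le (hN : 0 ≤ N) {K₀ : ℝ} (hK₀ : 0 ≤ K₀) (hTB : Φ.TrapBound K₀) {T S M : ℝ}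
    (hT : 0 ≤ T) (hS : ∀ t ∈ Icc 0 T, ∫ x in (-(1 / 8) : ℝ)..(1 / 8), Φ.e t x ≤ S)
    (hM : rectInt T (-(1 / 8)) (1 / 8) Φ.m ≤ M) :
    rectInt T (-(1 / 32)) (1 / 32) Φ.w ≤ K₀ * (4 * S + 2 * M) + 80 * M := by
  have cα := Φ.cα; have cβ := Φ.cβ; have cγ := Φ.cγ
  have cD : Continuous fun z : ℝ × ℝ => Φ.D z.1 z.2 := Φ.cD
  have cm := Φ.cm
  have hnear : rectInt T (-(1 / 32)) (1 / 32) (fun t x => √|x| * Φ.β t x)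
      ≤ K₀ * (8 * S + 4 * M) := by
    refine (hTB T hT).trans (mul_le_mul_of_nonneg_left ?_ hK₀)
    have h0 := Φ.jI_le_energy hN 0
    have h1 := Φ.jI_le_energy hN T
    have h2 := hS 0 ⟨le_rfl, hT⟩
    have h3 := hS T ⟨hT, le_rfl⟩
    have h4 : rectInt T (-(1 / 8)) (1 / 8) (fun t x => Φ.γ t x + 2 * Φ.α t x + x ^ 2 * Φ.D t x)
        ≤ rectInt T (-(1 / 8)) (1 / 8) fun t x => 4 * Φ.m t x :=
      rectInt_mono hT (by norm_num) (by unfold Cont2; fun_prop) (cm.const_mul 4)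
        fun t _ x hx => Φ.le_four_mul_m hN (abs_le.2 hx) t
    rw [rectInt_const_mul] at h4
    linarith
  have hαγ : (∫ t in (0 : ℝ)..T, jI fun y => Φ.α t y + Φ.γ t y) ≤ 4 * M := by
    have h4 : rectInt T (-(1 / 8)) (1 / 8) (fun t x => Φ.α t x + Φ.γ t x)
        ≤ rectInt T (-(1 / 8)) (1 / 8) fun t x => 4 * Φ.m t x :=
      rectInt_mono hT (by norm_num) (by unfold Cont2; fun_prop) (cm.const_mul 4)
        fun t _ x hx => by
          have h1 := Φ.le_four_mul_m hN (abs_le.2 hx) t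
          have h2 := mul_nonneg (sq_nonneg x) (Φ.D_nonneg hN t x)
          linarith [Φ.α_nonneg t x]
    rw [rectInt_const_mul] at h4
    exact h4.trans (by linarith)
  set B := rectInt T (-(1 / 32)) (1 / 32) Φ.β with hB
  have hB0 : 0 ≤ B := rectInt_nonneg hT (by norm_num) Φ.β_nonneg
  -- The product is split with the weight √(|x|+η). Its inverse is integrable, so the supremum of α
  -- in x can be taken out; the excess √η times the integral of β vanishes as η → 0, because that
  -- integral over a bounded box is finite.
  have key : ∀ η : ℝ, 0 < η → η ≤ 1 → 2 * rectInt T (-(1 / 32)) (1 / 32) Φ.w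
      ≤ 160 * M + (K₀ * (8 * S + 4 * M) + √η * B) := by
    intro η h0 h1
    have hs : ∀ x : ℝ, 0 < √(|x| + η) := fun x => Real.sqrt_pos.2 (by positivity)
    have c1 : Continuous fun x : ℝ => 1 / √(|x| + η) :=
      continuous_const.div (by fun_prop) fun x => (hs x).ne'
    have c2 : Cont2 fun t x => 1 / √(|x| + η) * Φ.α t x := Cont2.mul_x cα c1
    have c3 : Cont2 fun t x => √|x| * Φ.β t x := by unfold Cont2; fun_prop
    have c4 : Cont2 fun t x => √η * Φ.β t x := by unfold Cont2; fun_prop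
    have b1 : rectInt T (-(1 / 32)) (1 / 32) (fun t x => 2 * Φ.w t x)
        ≤ rectInt T (-(1 / 32)) (1 / 32) fun t x => 1 / √(|x| + η) * Φ.α t x
          + (√|x| * Φ.β t x + √η * Φ.β t x) := by
      refine rectInt_mono hT (by norm_num) (Φ.cw.const_mul 2) (c2.add (c3.add c4))
        fun t _ x _ => ?_
      refine (Φ.two_mul_w_le (hs x) t x).trans ?_
      have := mul_le_mul_of_nonneg_right (sqrt_add_le_add_sqrt (abs_nonneg x) h0.le)
        (Φ.β_nonneg t x)
      linarith
    rw [rectInt_const_mul, rectInt_add c2 (c3.add c4), rectInt_add c3 c4, rectInt_const_mul] at b1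
    have b2 : rectInt T (-(1 / 32)) (1 / 32) (fun t x => 1 / √(|x| + η) * Φ.α t x)
        ≤ ∫ t in (0 : ℝ)..T, 40 * jI fun y => Φ.α t y + Φ.γ t y := by
      have cI : Continuous fun t => jI fun y => Φ.α t y + Φ.γ t y :=
        Cont2.jI (F := fun t y => Φ.α t y + Φ.γ t y) (by unfold Cont2; fun_prop)
      refine intervalIntegral.integral_mono_on hT (c2.intervalIntegrable_integral _ _ _ _)
        ((continuous_const.mul cI).intervalIntegrable _ _) fun t _ => ?_
      set A := jI fun y => Φ.α t y + Φ.γ t y with hA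
      have hA0 : 0 ≤ A := jI_nonneg fun y => add_nonneg (Φ.α_nonneg t y) (Φ.γ_nonneg t y)
      calc (∫ x in (-(1 / 32) : ℝ)..(1 / 32), 1 / √(|x| + η) * Φ.α t x)
          ≤ ∫ x in (-(1 / 32) : ℝ)..(1 / 32), 1 / √(|x| + η) * (5 * A) := by
            refine intervalIntegral.integral_mono_on (by norm_num) (c2.intervalIntegrable_x _ _ _)
              ((c1.mul continuous_const).intervalIntegrable _ _) fun x hx => ?_
            refine mul_le_mul_of_nonneg_left (Φ.alpha_le t ?_) (by have := hs x; positivity)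
            have := abs_le.2 hx
            linarith
        _ = (∫ x in (-(1 / 32) : ℝ)..(1 / 32), 1 / √(|x| + η)) * (5 * A) :=
            intervalIntegral.integral_mul_const _ _
        _ ≤ 8 * (5 * A) := by gcongr; exact integral_inv_sqrt_add_le h0 h1
        _ = 40 * A := by ring
    rw [intervalIntegral.integral_const_mul] at b2
    linarith
  have lim : Tendsto (fun η : ℝ => 160 * M + (K₀ * (8 * S + 4 * M) + √η * B)) (𝓝[>] 0)
      (𝓝 (160 * M + (K₀ * (8 * S + 4 * M) + √0 * B))) := by
    have : Continuous fun η : ℝ => 160 * M + (K₀ * (8 * S + 4 * M) + √η * B) := by fun_prop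
    exact this.continuousAt.tendsto.mono_left nhdsWithin_le_nhds
  have hev : ∀ᶠ η : ℝ in 𝓝[>] 0, 2 * rectInt T (-(1 / 32)) (1 / 32) Φ.w
      ≤ 160 * M + (K₀ * (8 * S + 4 * M) + √η * B) := by
    filter_upwards [Ioc_mem_nhdsGT (zero_lt_one' ℝ)] with η hη
    exact key η hη.1 hη.2
  have := ge_of_tendsto lim hev
  rw [Real.sqrt_zero, zero_mul] at this
  linarith

/-- The constant in the estimate of the product. -/
def prodConst (K₀ : ℝ) : ℝ := K₀ * 684 + 27200 + 2 * (2100 * 340)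

/-- The product with the decaying weight. -/
lemma rectInt_wgt_w_le (hN : 100 ≤ N) (hκ : 0 ≤ κ) (hR₀ : 0 ≤ R₀)
    (hsmall : 58 * (κ * supC R₀) ≤ 1) {K₀ : ℝ} (hK₀ : 0 ≤ K₀) (hTB : Φ.TrapBound K₀) {T R S : ℝ}
    (hT : 0 ≤ T) (hR : 0 ≤ R)
    (hS : ∀ t ∈ Icc 0 T, ∀ r, 0 ≤ r → ∫ x in -r..r, Φ.e t x ≤ S) :
    rectInt T (-R) R (fun t x => wgt x * Φ.w t x) ≤ prodConst K₀ * S := by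
  have hN0 : 0 ≤ N := by linarith
  have cF : Cont2 fun t x => wgt x * Φ.w t x := Φ.cw.mul_x continuous_wgt
  have hF0 : ∀ t x, 0 ≤ wgt x * Φ.w t x := fun t x => mul_nonneg (wgt_pos x).le (Φ.w_nonneg t x)
  have hm := fun r (hr : 0 ≤ r) => Φ.rectInt_m_le_of_small hN hκ hR₀ hsmall (R := r) hT hr hS
  -- The box is enlarged so that ±1/32 lie inside it even for small R.
  set R' := R + 1 with hR'
  have b0 : rectInt T (-R) R (fun t x => wgt x * Φ.w t x)
      ≤ rectInt T (-R') R' fun t x => wgt x * Φ.w t x :=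
    rectInt_mono_set hT le_rfl (by linarith) (by linarith) (by linarith) cF hF0
  have s1 := rectInt_adjacent cF T (-R') (-(1 / 32)) (1 / 32)
  have s2 := rectInt_adjacent cF T (-R') (1 / 32) R'
  have near : rectInt T (-(1 / 32)) (1 / 32) (fun t x => wgt x * Φ.w t x)
      ≤ K₀ * (4 * S + 2 * (340 * S)) + 80 * (340 * S) := by
    refine le_trans (rectInt_mono hT (by norm_num) cF Φ.cw fun t _ x _ => ?_)
      (Φ.rectInt_w_near_le hN0 hK₀ hTB hT (fun t ht => hS t ht (1 / 8) (by norm_num))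
        (hm (1 / 8) (by norm_num)))
    refine mul_le_of_le_one_left (Φ.w_nonneg t x) ?_
    unfold wgt
    rw [div_le_one (one_add_abs_cube_pos x)]
    have : 0 ≤ |x| ^ 3 := by positivity
    linarith
  -- At distance at least 1/32 from the trapped set the product is controlled by `m` directly; 2100
  -- exceeds 1/2 + 4096/2.
  have far : ∀ a b : ℝ, a ≤ b → -R' ≤ a → b ≤ R' → (∀ x ∈ Icc a b, 1 / 32 ≤ |x|) →
      rectInt T a b (fun t x => wgt x * Φ.w t x) ≤ 2100 * (340 * S) := by
    intro a b hab ha hb hx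
    have h1 : rectInt T a b (fun t x => wgt x * Φ.w t x)
        ≤ rectInt T a b fun t x => 2100 * Φ.m t x := by
      refine rectInt_mono hT hab cF (Φ.cm.const_mul _) fun t _ x hxx => ?_
      have h2 := Φ.two_mul_w_le one_pos t x
      have h3 := mul_le_mul_of_nonneg_right (wgt_le_of_le_abs (hx x hxx)) (Φ.β_nonneg t x)
      have h4 := mul_le_mul_of_nonneg_left h2 (wgt_pos x).le
      have h5 := Φ.γ_nonneg t x; have h6 := Φ.α_nonneg t x; have h7 := Φ.β_nonneg t x
      have h8 := Φ.D_nonneg hN0 t x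
      have hV := (potV_pos x).le; have hW := (wgt_pos x).le
      have h9 : 0 ≤ potV x * Φ.γ t x := by positivity
      have h10 : 0 ≤ x ^ 2 * potV x * wgt x * Φ.D t x := by positivity
      have h11 : 0 ≤ wgt x * Φ.α t x := by positivity
      have h12 : 0 ≤ x ^ 2 * potV x ^ 2 * Φ.β t x := by positivity
      unfold m m0
      linarith
    rw [rectInt_const_mul] at h1
    have h2 : rectInt T a b Φ.m ≤ rectInt T (-R') R' Φ.m :=
      rectInt_mono_set hT le_rfl ha hab hb Φ.cm (Φ.m_nonneg hN0)
    have h3 := hm R' (by linarith)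
    linarith
  have f1 := far (-R') (-(1 / 32)) (by linarith) le_rfl (by linarith) fun x hx => by
    rw [abs_of_nonpos (by linarith [hx.2])]; linarith [hx.2]
  have f2 := far (1 / 32) R' (by linarith) (by linarith) le_rfl fun x hx =>
    hx.1.trans (le_abs_self x)
  unfold prodConst
  linarith

/-- On the support of the source the decaying weight is bounded below, so the unweighted product is
controlled by the weighted one. -/
lemma work_le {T : ℝ} (hT : 0 ≤ T) (hκ : 0 ≤ κ) (hR₀ : 0 ≤ R₀) :
    Φ.work T ≤ κ * (1 + R₀ ^ 3) * rectInt T (-R₀) R₀ fun t x => wgt x * Φ.w t x := by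
  rw [← rectInt_const_mul]
  refine rectInt_mono hT (by linarith) Φ.cσt_abs ((Φ.cw.mul_x continuous_wgt).const_mul _)
    fun t _ x hx => (Φ.σt_le t x).trans ?_
  have h1 : |x| ^ 3 ≤ R₀ ^ 3 := pow_le_pow_left₀ (abs_nonneg x) (abs_le.2 hx) 3
  have h2 : 1 ≤ (1 + R₀ ^ 3) * wgt x := by
    unfold wgt
    rw [mul_one_div, one_le_div (one_add_abs_cube_pos x)]
    linarith
  have h3 := Φ.w_nonneg t x
  calc κ * (√(Φ.α t x) * √(Φ.β t x)) = κ * (1 * Φ.w t x) := by rw [one_mul]; rfl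
    _ ≤ κ * (((1 + R₀ ^ 3) * wgt x) * Φ.w t x) := by gcongr
    _ = _ := by ring

/-- The uniform bounds, for small sources. -/
theorem uniform_bounds (hN : 100 ≤ N) (hκ : 0 ≤ κ) (hR₀ : 0 ≤ R₀)
    (hsmall : 58 * (κ * supC R₀) ≤ 1) {K₀ : ℝ} (hK₀ : 0 ≤ K₀) (hTB : Φ.TrapBound K₀)
    (hsmall' : 2 * (κ * (1 + R₀ ^ 3) * prodConst K₀) ≤ 1) {E₀ : ℝ}
    (hE : ∀ r, 0 ≤ r → ∫ x in -r..r, Φ.e 0 x ≤ E₀) {T R : ℝ} (hT : 0 ≤ T) (hR : 0 ≤ R) :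
    (∫ x in -R..R, Φ.e T x) ≤ 2 * E₀ ∧ rectInt T (-R) R Φ.m ≤ 680 * E₀ ∧
      rectInt T (-R) R (fun t x => wgt x * Φ.w t x) ≤ prodConst K₀ * (2 * E₀) := by
  have hN0 : 0 ≤ N := by linarith
  -- One bound for all earlier times, since the work is nondecreasing. It is the input S of every
  -- estimate on [0, T].
  have hS : ∀ t ∈ Icc 0 T, ∀ r, 0 ≤ r → ∫ x in -r..r, Φ.e t x ≤ E₀ + Φ.work T :=
    fun t ht r hr => (Φ.energy_le hN0 hR₀ hE ht.1 hr).trans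
      (by have := Φ.work_mono hR₀ ht.1 ht.2; linarith)
  have h1 := Φ.work_le hT hκ hR₀
  have h2 := Φ.rectInt_wgt_w_le hN hκ hR₀ hsmall hK₀ hTB hT hR₀ hS
  have hc : 0 ≤ κ * (1 + R₀ ^ 3) := by positivity
  have hE0 : 0 ≤ E₀ := by
    have := hE 0 le_rfl
    simpa using this
  have h0 : 0 ≤ E₀ + Φ.work T := add_nonneg hE0 (Φ.work_nonneg hR₀ hT)
  -- The work is at most half of E₀ plus the work. It is an integral over a compact box, hence a
  -- finite number that can be subtracted, and no continuity argument in time is needed.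
  have h3 : Φ.work T ≤ E₀ := by
    have h4 := mul_le_mul_of_nonneg_left h2 hc
    have h5 := mul_le_mul_of_nonneg_right hsmall' h0
    linarith
  have hS' : ∀ t ∈ Icc 0 T, ∀ r, 0 ≤ r → ∫ x in -r..r, Φ.e t x ≤ 2 * E₀ :=
    fun t ht r hr => (hS t ht r hr).trans (by linarith)
  refine ⟨hS' T ⟨hT, le_rfl⟩ R hR, ?_,
    Φ.rectInt_wgt_w_le hN hκ hR₀ hsmall hK₀ hTB hT hR hS'⟩
  have := Φ.rectInt_m_le_of_small hN hκ hR₀ hsmall hT hR hS'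
  linarith

end FluxSystem

lemma IsSolution.trapBound {N κ R₀ : ℝ} {a : ℝ → S2 → ℝ} {u : ℝ → ℝ → S2 → ℂ}
    (h : IsSolution N a u) (hN : freqMin ^ 2 ≤ N) (hκ : 0 ≤ κ) (hκ1 : κ ≤ 1)
    (ha : ∀ x θ, |a x θ| ≤ κ) (hs : ∀ x θ, R₀ ≤ |x| → a x θ = 0) :
    (h.flux hκ ha hs).TrapBound modeConst := fun _ hT =>
  h.rectInt_sqrt_abs_le hN (fun x θ => (ha x θ).trans hκ1) hT

end TrappedWave

namespace TrappedWave

open Set Filter Topology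

/-! ### Exhaustion by boxes -/

section Exhaustion

variable {f : ℝ → ℝ} {G : ℝ → ℝ → ℝ}

lemma lintegral_Icc_ofReal (hf : Continuous f) (h0 : ∀ x, 0 ≤ f x) {r : ℝ} (hr : 0 ≤ r) :
    ∫⁻ x in Icc (-r) r, ENNReal.ofReal (f x) = ENNReal.ofReal (∫ x in -r..r, f x) := by
  rw [intervalIntegral.integral_of_le (by linarith), ← integral_Icc_eq_integral_Ioc,
    ofReal_integral_eq_lintegral_ofReal hf.continuousOn.integrableOn_Icc
      (Eventually.of_forall h0)]

lemma tendsto_ofReal_integral (hf : Continuous f) (h0 : ∀ x, 0 ≤ f x) :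
    Tendsto (fun n : ℕ => ENNReal.ofReal (∫ x in -(n : ℝ)..n, f x)) atTop
      (𝓝 (∫⁻ x, ENNReal.ofReal (f x))) := by
  have h := (aecover_Icc (μ := (volume : Measure ℝ)) (l := atTop) (a := fun n : ℕ => -(n : ℝ))
    (b := fun n : ℕ => (n : ℝ)) (tendsto_neg_atTop_atBot.comp tendsto_natCast_atTop_atTop)
    tendsto_natCast_atTop_atTop).lintegral_tendsto_of_nat
    (f := fun x => ENNReal.ofReal (f x)) (by fun_prop)
  simpa only [lintegral_Icc_ofReal hf h0 (Nat.cast_nonneg _)] using h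

lemma lintegral_le_of_integral_le (hf : Continuous f) (h0 : ∀ x, 0 ≤ f x) {B : ℝ}
    (h : ∀ r, 0 ≤ r → ∫ x in -r..r, f x ≤ B) : ∫⁻ x, ENNReal.ofReal (f x) ≤ ENNReal.ofReal B :=
  le_of_tendsto' (tendsto_ofReal_integral hf h0) fun n =>
    ENNReal.ofReal_le_ofReal (h n (Nat.cast_nonneg n))

lemma integral_le_of_lintegral_lt_top (hf : Continuous f) (h0 : ∀ x, 0 ≤ f x)
    (h : ∫⁻ x, ENNReal.ofReal (f x) < ⊤) {r : ℝ} (hr : 0 ≤ r) :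
    ∫ x in -r..r, f x ≤ (∫⁻ x, ENNReal.ofReal (f x)).toReal := by
  rw [← ENNReal.ofReal_le_iff_le_toReal h.ne, ← lintegral_Icc_ofReal hf h0 hr]
  exact setLIntegral_le_lintegral _ _

lemma lintegral_lintegral_le (hG : Cont2 G) (h0 : ∀ t x, 0 ≤ G t x) {B : ℝ}
    (h : ∀ T R, 0 ≤ T → 0 ≤ R → ∫ t in -T..T, ∫ x in -R..R, G t x ≤ B) :
    ∫⁻ t, ∫⁻ x, ENNReal.ofReal (G t x) ≤ ENNReal.ofReal B := by
  have c := fun n : ℕ => hG.continuous_integral (-(n : ℝ)) n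
  have p : ∀ (n : ℕ) t, 0 ≤ ∫ x in -(n : ℝ)..n, G t x := fun n t =>
    intervalIntegral.integral_nonneg (by have : (0 : ℝ) ≤ n := Nat.cast_nonneg n
                                         linarith) fun x _ => h0 t x
  have lim := lintegral_tendsto_of_tendsto_of_monotone (μ := (volume : Measure ℝ))
    (f := fun (n : ℕ) t => ENNReal.ofReal (∫ x in -(n : ℝ)..n, G t x))
    (F := fun t => ∫⁻ x, ENNReal.ofReal (G t x))
    (fun n => (c n).measurable.ennreal_ofReal.aemeasurable)
    (Eventually.of_forall fun t m n hmn => ENNReal.ofReal_le_ofReal (by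
      have h1 : (m : ℝ) ≤ n := Nat.cast_le.2 hmn
      have h2 : (0 : ℝ) ≤ m := Nat.cast_nonneg m
      exact integral_mono_interval (by linarith) (by linarith) h1 (hG.slice_x t) (h0 t)))
    (Eventually.of_forall fun t => tendsto_ofReal_integral (hG.slice_x t) (h0 t))
  exact le_of_tendsto' lim fun n => lintegral_le_of_integral_le (c n) (p n) fun r hr =>
    h r n hr (Nat.cast_nonneg n)

lemma lintegral_lintegral_le_of_rectInt (hG : Cont2 G) (h0 : ∀ t x, 0 ≤ G t x) {B₁ B₂ : ℝ}
    (h₁ : ∀ T R, 0 ≤ T → 0 ≤ R → rectInt T (-R) R G ≤ B₁)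
    (h₂ : ∀ T R, 0 ≤ T → 0 ≤ R → rectInt T (-R) R (fun t x => G (-t) x) ≤ B₂) :
    ∫⁻ t, ∫⁻ x, ENNReal.ofReal (G t x) ≤ ENNReal.ofReal (B₁ + B₂) := by
  refine lintegral_lintegral_le hG h0 fun T R hT hR => ?_
  have c := hG.continuous_integral (-R) R
  rw [← intervalIntegral.integral_add_adjacent_intervals (c.intervalIntegrable (-T) 0)
    (c.intervalIntegrable 0 T)]
  have e := intervalIntegral.integral_comp_neg (a := 0) (b := T) fun t => ∫ x in -R..R, G t x
  rw [neg_zero] at e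
  rw [← e, add_comm]
  exact add_le_add (h₁ T R hT hR) (h₂ T R hT hR)

end Exhaustion

/-! ### Integrals over the sphere of the densities -/

lemma lintegral_sphere_ofReal {g : S2 → ℝ} (hg : Continuous g) (h0 : ∀ θ, 0 ≤ g θ) :
    ∫⁻ θ, ENNReal.ofReal (g θ) ∂sphereMeasure = ENNReal.ofReal (∫ θ, g θ ∂sphereMeasure) :=
  (ofReal_integral_eq_lintegral_ofReal (integrable_sphere hg) (Eventually.of_forall h0)).symm

lemma sphereGradSq_nonneg (f : S2 → ℂ) (θ : S2) : 0 ≤ sphereGradSq f θ :=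
  Finset.sum_nonneg fun i _ => by positivity

lemma SmoothSph.continuous_sphereGradSq {f : S2 → ℂ} (hf : SmoothSph f) :
    Continuous (sphereGradSq f) := by
  have : sphereGradSq f = fun θ => ∑ i, ‖gradComp i f θ‖ ^ 2 := by
    funext θ; rw [sphereGradSq_eq]
  rw [this]
  exact continuous_finsetSum _ fun i _ => (hf.continuous_gradComp i).norm.pow 2

section Densities

variable {u : ℝ → ℝ → S2 → ℂ} {N : ℝ}

/-- The energy density, integrated over the sphere. -/
def energyDens (N : ℝ) (u : ℝ → ℝ → S2 → ℂ) (t x : ℝ) : ℝ :=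
  (ip (dt u) (dt u) t x + ip (dx u) (dx u) t x
    + potV x * (gradInt u t x + N * ip u u t x)) / 2

/-- The Morawetz density, integrated over the sphere. -/
def morawetzDens (u : ℝ → ℝ → S2 → ℂ) (t x : ℝ) : ℝ :=
  potV x * ip (dx u) (dx u) t x
    + x ^ 2 * potV x * (wgt x * gradInt u t x + potV x * ip (dt u) (dt u) t x)
    + wgt x * ip u u t x

/-- The modulus. -/
def modulus (A : ℝ → ℝ → S2 → ℂ) (t x : ℝ) (θ : S2) : ℂ := (‖A t x θ‖ : ℂ)

/-- The density in the refined estimate, integrated over the sphere. -/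
def refinedDens (u : ℝ → ℝ → S2 → ℂ) (t x : ℝ) : ℝ :=
  wgt x * ip (modulus u) (modulus (dt u)) t x

lemma ContFun.modulus {A : ℝ → ℝ → S2 → ℂ} (h : ContFun A) : ContFun (modulus A) :=
  Complex.continuous_ofReal.comp (Continuous.norm h)

lemma ip_modulus_self (A : ℝ → ℝ → S2 → ℂ) (t x : ℝ) : ip (modulus A) (modulus A) t x = ip A A t x := by
  rw [ip_self, ip_self]; simp [modulus]

lemma ip_modulus (A B : ℝ → ℝ → S2 → ℂ) (t x : ℝ) :
    ip (modulus A) (modulus B) t x = ∫ θ, ‖A t x θ‖ * ‖B t x θ‖ ∂sphereMeasure := by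
  unfold ip modulus
  refine integral_congr_ae (Eventually.of_forall fun θ => ?_)
  simp [Complex.inner, mul_comm]

lemma energy_eq (hu : SmoothFun u) (hN : 0 ≤ N) (t : ℝ) :
    energy N u t = ∫⁻ x, ENNReal.ofReal (energyDens N u t x) := by
  have hhalf : (1 / 2 : ℝ≥0∞) = ENNReal.ofReal (1 / 2) := by
    rw [ENNReal.ofReal_div_of_pos two_pos]; simp
  unfold energy
  rw [← lintegral_const_mul' _ _ (by simp)]
  refine lintegral_congr fun x => ?_
  have c1 := hu.dt.contFun.slice t x
  have c2 := hu.dx.contFun.slice t x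
  have c3 := hu.contFun.slice t x
  have c4 := (hu.smoothSph t x).continuous_sphereGradSq
  have hV := (potV_pos x).le
  rw [lintegral_sphere_ofReal (by fun_prop) fun θ => by
      have := sphereGradSq_nonneg (u t x) θ
      positivity, hhalf, ← ENNReal.ofReal_mul (by norm_num)]
  congr 1
  have i1 : Integrable (fun θ => ‖dt u t x θ‖ ^ 2) sphereMeasure := integrable_sphere (by fun_prop)
  have i2 : Integrable (fun θ => ‖dx u t x θ‖ ^ 2) sphereMeasure := integrable_sphere (by fun_prop)
  have i3 : Integrable (fun θ => sphereGradSq (u t x) θ) sphereMeasure := integrable_sphere c4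
  have i4 : Integrable (fun θ => N * ‖u t x θ‖ ^ 2) sphereMeasure := integrable_sphere (by fun_prop)
  have i12 : Integrable (fun θ => ‖dt u t x θ‖ ^ 2 + ‖dx u t x θ‖ ^ 2) sphereMeasure := i1.add i2
  have i34 : Integrable (fun θ => potV x * (sphereGradSq (u t x) θ + N * ‖u t x θ‖ ^ 2))
    sphereMeasure := (i3.add i4).const_mul _
  rw [integral_add i12 i34, integral_add i1 i2, integral_const_mul, integral_add i3 i4,
    integral_const_mul, energyDens, ip_self, ip_self, ip_self, gradInt]
  ring

lemma morawetzIntegral_eq (hu : SmoothFun u) :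
    morawetzIntegral u = ∫⁻ t, ∫⁻ x, ENNReal.ofReal (morawetzDens u t x) := by
  unfold morawetzIntegral
  refine lintegral_congr fun t => lintegral_congr fun x => ?_
  have c1 := hu.dt.contFun.slice t x
  have c2 := hu.dx.contFun.slice t x
  have c3 := hu.contFun.slice t x
  have c4 := (hu.smoothSph t x).continuous_sphereGradSq
  rw [lintegral_sphere_ofReal (by fun_prop) fun θ => by
      have := sphereGradSq_nonneg (u t x) θ
      positivity]
  congr 1
  have i1 : Integrable (fun θ => ‖dt u t x θ‖ ^ 2) sphereMeasure := integrable_sphere (by fun_prop)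
  have i2 : Integrable (fun θ => ‖dx u t x θ‖ ^ 2) sphereMeasure := integrable_sphere (by fun_prop)
  have i3 : Integrable (fun θ => sphereGradSq (u t x) θ) sphereMeasure := integrable_sphere c4
  have i4 : Integrable (fun θ => ‖u t x θ‖ ^ 2) sphereMeasure := integrable_sphere (by fun_prop)
  have i13 : Integrable (fun θ => sphereGradSq (u t x) θ / (1 + |x| ^ 3)
    + ‖dt u t x θ‖ ^ 2 / (x ^ 2 + 1)) sphereMeasure := (i3.div_const _).add (i1.div_const _)
  have i2' : Integrable (fun θ => ‖dx u t x θ‖ ^ 2 / (x ^ 2 + 1)) sphereMeasure := i2.div_const _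
  have i123 : Integrable (fun θ => ‖dx u t x θ‖ ^ 2 / (x ^ 2 + 1) + x ^ 2 / (1 + x ^ 2) *
    (sphereGradSq (u t x) θ / (1 + |x| ^ 3) + ‖dt u t x θ‖ ^ 2 / (x ^ 2 + 1))) sphereMeasure :=
    i2'.add (i13.const_mul _)
  rw [integral_add i123 (i4.div_const _), integral_add i2' (i13.const_mul _), integral_const_mul,
    integral_add (i3.div_const _) (i1.div_const _), integral_div, integral_div, integral_div,
    integral_div, morawetzDens, ip_self, ip_self, ip_self, gradInt, potV, wgt, add_comm 1 (x ^ 2)]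
  ring

lemma refinedIntegral_eq (hu : SmoothFun u) :
    refinedIntegral u = ∫⁻ t, ∫⁻ x, ENNReal.ofReal (refinedDens u t x) := by
  unfold refinedIntegral
  refine lintegral_congr fun t => lintegral_congr fun x => ?_
  have c1 := hu.dt.contFun.slice t x
  have c3 := hu.contFun.slice t x
  rw [lintegral_sphere_ofReal (by fun_prop) fun θ => by positivity]
  congr 1
  rw [integral_div, refinedDens, ip_modulus, wgt]
  ring

lemma cont2_morawetzDens (hu : SmoothFun u) : Cont2 (morawetzDens u) := by
  have h1 := continuous_ip hu.contFun hu.contFun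
  have h2 := continuous_ip hu.dt.contFun hu.dt.contFun
  have h3 := continuous_ip hu.dx.contFun hu.dx.contFun
  have h4 := continuous_gradInt hu
  have h5 := continuous_potV.comp (continuous_snd (X := ℝ) (Y := ℝ))
  have h6 := continuous_wgt.comp (continuous_snd (X := ℝ) (Y := ℝ))
  simp only [Function.comp_def] at h5 h6
  unfold Cont2 morawetzDens; fun_prop

lemma morawetzDens_nonneg (u : ℝ → ℝ → S2 → ℂ) (t x : ℝ) : 0 ≤ morawetzDens u t x := by
  have h1 := ip_self_nonneg u t x; have h2 := ip_self_nonneg (dt u) t x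
  have h3 := ip_self_nonneg (dx u) t x; have h4 := gradInt_nonneg u t x
  have hV := (potV_pos x).le; have hW := (wgt_pos x).le
  unfold morawetzDens; positivity

lemma cont2_refinedDens (hu : SmoothFun u) : Cont2 (refinedDens u) :=
  Cont2.mul_x (S := ip (modulus u) (modulus (dt u)))
    (continuous_ip hu.contFun.modulus hu.dt.contFun.modulus) continuous_wgt

lemma refinedDens_nonneg (u : ℝ → ℝ → S2 → ℂ) (t x : ℝ) : 0 ≤ refinedDens u t x := by
  unfold refinedDens
  rw [ip_modulus]
  exact mul_nonneg (wgt_pos x).le (integral_nonneg fun θ => by positivity)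

end Densities

/-! ### Time reflection -/

/-- The time reflection of a function. -/
def reflect (u : ℝ → ℝ → S2 → ℂ) (t : ℝ) : ℝ → S2 → ℂ := u (-t)

section Reflection

variable {u : ℝ → ℝ → S2 → ℂ} {N ε : ℝ} {W : ℝ × S2 → ℝ} {u₀ u₁ : ℝ → S2 → ℂ}

lemma dt_reflect (u : ℝ → ℝ → S2 → ℂ) (t x : ℝ) (θ : S2) : dt (reflect u) t x θ = -dt u (-t) x θ :=
  deriv_comp_neg (fun s => u s x θ) t

lemma dx_reflect (u : ℝ → ℝ → S2 → ℂ) (t x : ℝ) (θ : S2) : dx (reflect u) t x θ = dx u (-t) x θ := rfl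

lemma dt_dt_reflect (u : ℝ → ℝ → S2 → ℂ) (t x : ℝ) (θ : S2) :
    dt (dt (reflect u)) t x θ = dt (dt u) (-t) x θ := by
  have e : dt (reflect u) = fun s y η => -(dt u (-s) y η) := by
    funext s y η; exact dt_reflect u s y η
  rw [e]
  have h : deriv (fun s => -(dt u (-s) x θ)) t = -deriv (fun s => dt u (-s) x θ) t :=
    deriv.fun_neg
  refine h.trans ?_
  rw [deriv_comp_neg (fun s => dt u s x θ) t, neg_neg]
  rfl

/-- The equation contains only the second time derivative and its coefficients do not depend on
time, so reflection changes only the sign of the initial velocity. -/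
lemma IsCauchySolution.reflect (h : IsCauchySolution N ε W u₀ u₁ u) :
    IsCauchySolution N ε W u₀ (fun x θ => -u₁ x θ) (reflect u) where
  smooth := by
    have h1 : ContMDiff (𝓘(ℝ, ℝ).prod (𝓘(ℝ, ℝ).prod (𝓡 2))) (𝓘(ℝ, ℝ).prod (𝓘(ℝ, ℝ).prod (𝓡 2))) ∞
        (fun p : ℝ × ℝ × S2 => (-p.1, p.2)) :=
      (contDiff_neg.contMDiff.comp contMDiff_fst).prodMk contMDiff_snd
    exact h.smooth.comp h1
  equation t x θ := by
    have := h.equation (-t) x θ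
    unfold waveOp at *
    rw [dt_dt_reflect]
    exact this
  init x θ := by
    rw [← h.init]; simp [TrappedWave.reflect]
  init_dt x θ := by
    rw [dt_reflect, neg_zero, h.init_dt]

lemma energy_reflect (N : ℝ) (u : ℝ → ℝ → S2 → ℂ) (t : ℝ) :
    energy N (reflect u) t = energy N u (-t) := by
  simp only [energy, dt_reflect, dx_reflect, norm_neg, TrappedWave.reflect]

lemma morawetzDens_reflect (u : ℝ → ℝ → S2 → ℂ) (t x : ℝ) :
    morawetzDens (reflect u) t x = morawetzDens u (-t) x := by
  simp only [morawetzDens, ip_self, gradInt, dt_reflect, dx_reflect, norm_neg, TrappedWave.reflect]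

lemma refinedDens_reflect (u : ℝ → ℝ → S2 → ℂ) (t x : ℝ) :
    refinedDens (reflect u) t x = refinedDens u (-t) x := by
  simp only [refinedDens, ip_modulus, dt_reflect, norm_neg, TrappedWave.reflect]

lemma IsCauchySolution.isSolution (h : IsCauchySolution N ε W u₀ u₁ u) (hW : Continuous W) :
    IsSolution N (fun x θ => ε * W (x, θ)) u where
  smooth := smoothFun_of_contMDiff h.smooth
  cont := continuous_const.mul hW
  eq t x θ := by
    have := h.equation t x θ
    unfold waveOp at this
    unfold srcFun lap
    push_cast
    linear_combination -this

end Reflection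

/-! ### Forward estimates -/

/-- The bounds for positive times. -/
lemma IsCauchySolution.forward_bounds {N ε R₀ : ℝ} {W : ℝ × S2 → ℝ} {u₀ u₁ : ℝ → S2 → ℂ}
    {u : ℝ → ℝ → S2 → ℂ} (h : IsCauchySolution N ε W u₀ u₁ u) (hN : freqMin ^ 2 ≤ N)
    (hW : Continuous W) (hW1 : ∀ p, |W p| ≤ 1) (hR₀ : 0 ≤ R₀)
    (hs : ∀ x θ, R₀ ≤ |x| → W (x, θ) = 0) (hε : 0 ≤ ε) (hε1 : ε ≤ 1)
    (hsmall : 58 * (ε * FluxSystem.supC R₀) ≤ 1)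
    (hsmall' : 2 * (ε * (1 + R₀ ^ 3) * FluxSystem.prodConst modeConst) ≤ 1)
    (hE : energy N u 0 < ⊤) :
    (∀ t, 0 ≤ t → energy N u t ≤ ENNReal.ofReal (2 * (energy N u 0).toReal)) ∧
    (∀ T R, 0 ≤ T → 0 ≤ R → rectInt T (-R) R (morawetzDens u) ≤ 680 * (energy N u 0).toReal) ∧
    (∀ T R, 0 ≤ T → 0 ≤ R → rectInt T (-R) R (refinedDens u)
      ≤ FluxSystem.prodConst modeConst * (2 * (energy N u 0).toReal)) := by
  have hsol := h.isSolution hW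
  have hu := hsol.smooth
  have hN100 : 100 ≤ N := le_trans (by unfold freqMin; norm_num) hN
  have hN0 : 0 ≤ N := by linarith
  have ha : ∀ x θ, |ε * W (x, θ)| ≤ ε := fun x θ => by
    rw [abs_mul, abs_of_nonneg hε]; exact mul_le_of_le_one_right hε (hW1 _)
  have hsa : ∀ x θ, R₀ ≤ |x| → ε * W (x, θ) = 0 := fun x θ hx => by rw [hs x θ hx, mul_zero]
  let Φ := hsol.flux hε ha hsa
  have hTB : Φ.TrapBound modeConst := hsol.trapBound hN hε hε1 ha hsa
  have ce : ∀ t, Continuous (Φ.e t) := fun t => Φ.ce.slice_x t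
  have he : ∀ t x, 0 ≤ Φ.e t x := Φ.e_nonneg hN0
  have hen : ∀ t, energy N u t = ∫⁻ x, ENNReal.ofReal (Φ.e t x) := energy_eq hu hN0
  have hE0 : ∀ r, 0 ≤ r → ∫ x in -r..r, Φ.e 0 x ≤ (energy N u 0).toReal := fun r hr => by
    rw [hen] at hE ⊢
    exact integral_le_of_lintegral_lt_top (ce 0) (he 0) hE hr
  have key := fun {T R : ℝ} (hT : 0 ≤ T) (hR : 0 ≤ R) =>
    Φ.uniform_bounds hN100 hε hR₀ hsmall modeConst_pos.le hTB hsmall' hE0 hT hR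
  refine ⟨fun t ht => ?_, fun T R hT hR => ?_, fun T R hT hR => ?_⟩
  · rw [hen t]
    exact lintegral_le_of_integral_le (ce t) (he t) fun r hr => (key ht hr).1
  · refine (rectInt_mono hT (by linarith) (cont2_morawetzDens hu) Φ.cm fun t _ x _ => ?_).trans
      (key hT hR).2.1
    have hV := (potV_pos x).le; have hw := (wgt_pos x).le
    have h1 : 0 ≤ x ^ 2 * potV x * wgt x * (N * ip u u t x) := by
      have := ip_self_nonneg u t x
      positivity
    change morawetzDens u t x ≤ potV x * ip (dx u) (dx u) t x
      + x ^ 2 * potV x * wgt x * (gradInt u t x + N * ip u u t x) + wgt x * ip u u t x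
      + x ^ 2 * potV x ^ 2 * ip (dt u) (dt u) t x
    unfold morawetzDens
    linarith
  · refine (rectInt_mono hT (by linarith) (cont2_refinedDens hu)
      (Φ.cw.mul_x continuous_wgt) fun t _ x _ => ?_).trans (key hT hR).2.2
    refine mul_le_mul_of_nonneg_left ?_ (wgt_pos x).le
    -- Cauchy-Schwarz on the sphere is applied to the moduli, since the refined integral contains
    -- |u||∂ₜu| pointwise and not the real product.
    have h1 := (le_abs_self _).trans (abs_ip_le hu.contFun.modulus hu.dt.contFun.modulus t x)
    rwa [ip_modulus_self, ip_modulus_self] at h1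

lemma exists_support_bound {W : ℝ × S2 → ℝ} (hW : HasCompactSupport W) :
    ∃ R₀ : ℝ, 0 ≤ R₀ ∧ ∀ x θ, R₀ ≤ |x| → W (x, θ) = 0 := by
  obtain ⟨r, hr⟩ := (hW.isCompact.image continuous_fst).isBounded.exists_norm_le
  -- The bound r on the support is not strict; the added 1 makes W vanish also where |x| equals the
  -- chosen radius.
  refine ⟨max r 0 + 1, by positivity, fun x θ hx => ?_⟩
  by_contra hne
  have h1 := hr x ⟨(x, θ), subset_tsupport W hne, rfl⟩
  rw [Real.norm_eq_abs] at h1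
  have := le_max_left r 0
  linarith

end TrappedWave

end

/-! ### Conclusion from the forward and backward bounds. -/

open TrappedWave in
theorem theorem1 :
    ∃ N₀ : ℝ, 0 < N₀ ∧ ∀ N : ℝ, N₀ ≤ N →
      ∀ W : ℝ × TrappedWave.S2 → ℝ,
        ContMDiff (𝓘(ℝ, ℝ).prod (𝓡 2)) 𝓘(ℝ, ℝ) ∞ W →
        HasCompactSupport W →
        (∀ p, |W p| ≤ 1) →
        (∀ θ, W (0, θ) ≠ 0) →
        ∃ ε₀ : ℝ, 0 < ε₀ ∧ ∃ C : ℝ≥0, 0 < C ∧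
          ∀ ε : ℝ, 0 < ε → ε < ε₀ →
            ∀ (u₀ u₁ : ℝ → TrappedWave.S2 → ℂ) (u : ℝ → ℝ → TrappedWave.S2 → ℂ),
              TrappedWave.IsCauchySolution N ε W u₀ u₁ u →
              TrappedWave.energy N u 0 < (⊤ : ℝ≥0∞) →
                (∀ t : ℝ, TrappedWave.energy N u t ≤ C * TrappedWave.energy N u 0) ∧
                TrappedWave.morawetzIntegral u ≤ C * TrappedWave.energy N u 0 ∧
                TrappedWave.refinedIntegral u ≤ C * TrappedWave.energy N u 0 := by
  refine ⟨freqMin ^ 2, by unfold freqMin; norm_num, fun N hN W hWs hWc hW1 _ => ?_⟩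
  obtain ⟨R₀, hR₀, hs⟩ := exists_support_bound hWc
  have hK := modeConst_pos
  have hP : 0 < FluxSystem.prodConst modeConst := by unfold FluxSystem.prodConst; positivity
  have hsC : 0 < FluxSystem.supC R₀ := by unfold FluxSystem.supC; positivity
  -- The three summands encode the three smallness conditions on ε, so ε < 1 / D yields all of them
  -- at once.
  set D : ℝ := 1 + 58 * FluxSystem.supC R₀
    + 2 * ((1 + R₀ ^ 3) * FluxSystem.prodConst modeConst) with hD
  have hq : 0 < (1 + R₀ ^ 3) * FluxSystem.prodConst modeConst := by positivity
  have hD0 : 0 < D := by positivity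
  -- Each time direction contributes 680 to the Morawetz integral and twice `prodConst` to the
  -- refined one; the energy itself needs only the factor 2.
  set c : ℝ := 1360 + 4 * FluxSystem.prodConst modeConst with hc
  have hc0 : 0 < c := by positivity
  refine ⟨1 / D, by positivity, c.toNNReal, Real.toNNReal_pos.2 hc0, fun ε hε hε' u₀ u₁ u h hE => ?_⟩
  have hεD : ε * D < 1 := by rwa [lt_div_iff₀ hD0] at hε'
  have e1 : 0 < ε * (58 * FluxSystem.supC R₀) := by positivity
  have e2 : 0 < ε * (2 * ((1 + R₀ ^ 3) * FluxSystem.prodConst modeConst)) := by positivity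
  have e3 : ε * D = ε + ε * (58 * FluxSystem.supC R₀)
    + ε * (2 * ((1 + R₀ ^ 3) * FluxSystem.prodConst modeConst)) := by rw [hD]; ring
  have hW := hWs.continuous
  have hu := (h.isSolution hW).smooth
  have hE0 : energy N (reflect u) 0 = energy N u 0 := by rw [energy_reflect, neg_zero]
  obtain ⟨f1, f2, f3⟩ := h.forward_bounds hN hW hW1 hR₀ hs hε.le (by linarith) (by linarith)
    (by linarith) hE
  obtain ⟨b1, b2, b3⟩ := h.reflect.forward_bounds hN hW hW1 hR₀ hs hε.le (by linarith)
    (by linarith) (by linarith) (by rwa [hE0])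
  rw [hE0] at b1 b2 b3
  have hEr : 0 ≤ (energy N u 0).toReal := ENNReal.toReal_nonneg
  have hPE := mul_nonneg hP.le hEr
  have fin : ∀ B : ℝ, B ≤ c * (energy N u 0).toReal →
      ENNReal.ofReal B ≤ (c.toNNReal : ℝ≥0∞) * energy N u 0 := by
    intro B hB
    refine (ENNReal.ofReal_le_ofReal hB).trans (le_of_eq ?_)
    rw [ENNReal.ofReal_mul hc0.le, ENNReal.ofReal_toReal hE.ne, ENNReal.ofReal]
  refine ⟨fun t => ?_, ?_, ?_⟩
  · rcases le_total 0 t with ht | ht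
    · exact (f1 t ht).trans (fin _ (by rw [hc]; linarith))
    · have := b1 (-t) (by linarith)
      rw [energy_reflect, neg_neg] at this
      exact this.trans (fin _ (by rw [hc]; linarith))
  · rw [morawetzIntegral_eq hu]
    refine (lintegral_lintegral_le_of_rectInt (cont2_morawetzDens hu) (morawetzDens_nonneg u)
      (B₂ := 680 * (energy N u 0).toReal) f2
      fun T R hT hR => ?_).trans (fin _ (by rw [hc]; linarith))
    have e : (fun t x => morawetzDens u (-t) x) = morawetzDens (reflect u) := by
      funext t x; rw [morawetzDens_reflect]
    rw [e]
    exact b2 T R hT hR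
  · rw [refinedIntegral_eq hu]
    refine (lintegral_lintegral_le_of_rectInt (cont2_refinedDens hu) (refinedDens_nonneg u)
      (B₂ := FluxSystem.prodConst modeConst * (2 * (energy N u 0).toReal)) f3
      fun T R hT hR => ?_).trans (fin _ (by rw [hc]; linarith))
    have e : (fun t x => refinedDens u (-t) x) = refinedDens (reflect u) := by
      funext t x; rw [refinedDens_reflect]
    rw [e]
    exact b3 T R hT hR
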